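/- **Setting.** There are $d$ divisible goods, one unit of each; bundles are $x\in[0,1]^d$. A buyer with utility $U$, facing prices $p\in\mathbb R_+^d$ and budget $B\ge 0$, buys a cheapest one among the bundles that maximize $U$ subject to $\langle p,x\rangle\le B$, remaining ties being broken by some rule; this bundle is $\mathcal B_U(p,B)$. Let $\mathbf L$ prescribe, for every good $j$, a number $1\le n_j\le\kappa$ of segments and lengths $l_{jk}>0$ ($1\le k<n_j$) of all but the last segment, the last one being unbounded. $\mathcal H^{\mathbf L}_{splc}$ is the class of utilities $U_{\mathbf A}(x)=\sum_j\sum_{k\le n_j}a_{jk}x_{jk}$, where $x_{jk}$ is the part of $x_j$ in segment $k$ of good $j$ and the slopes satisfy $a_{jk}\ge0$ and $a_{j1}>\dots>a_{jn_j}$. A learner receives a sample $(p_i,B_i,\mathcal B_U(p_i,B_i))_{i\le m}$, where the $(p_i,B_i)$ are drawn i.i.d. from a distribution $P$ on $\mathbb R_+^d\times\mathbb R_+$, and outputs a utility $V$; its error is $\Pr_{(p,B)\sim P}[U(\mathcal B_U(p,B))\ne U(\mathcal B_V(p,B))]$. Its sample complexity $m(\epsilon,\delta)$ is the least $m$ such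 that for every sample size $\ge m$, every $P$ and every $U\in\mathcal H^{\mathbf L}_{splc}$ such that $P$-almost surely the bundle to be bought is not tied (there is only one cheapest optimal bundle), the error is at most $\epsilon$ with probability at least $1-\delta$. **Theorem.** There are an absolute constant $C$ and learners $\mathcal A_{d,\kappa,\mathbf L}$, with outputs in $\mathcal H^{\mathbf L}_{splc}$, such that 1. for all $d,\kappa,\mathbf L$, every tie-breaking rule, and all $0<\epsilon\le\frac12$, $0<\delta<1$, the sample complexity of $\mathcal A_{d,\kappa,\mathbf L}$ is at most $\Big\lceil C\,\frac{\kappa d\log(1/\epsilon)+\log(1/\delta)}{\epsilon}\Big\rceil$; 2. the learners are efficient: one program of a random access machine with the field operations and comparisons computes them all from $d,\kappa,\mathbf L$ and the sample; on real data with unit costs its time is polynomial in $d+\kappa+m$, where $m$ is the sample size, and on rational data, with every operation charged the bit lengths of the numbers involved, its time is polynomial in the bit length of the input. Moreover, for all $d,\kappa,\mathbf L$: 3. the demand functions of $\mathcal H^{\mathbf L}_{splc}$ form a $\kappa d$-dimensional linear class: there is $\Psi:(\mathbb R_+^d\times\mathbb R_+)\times[0,1]^d\to\mathbb R^{\kappa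 d}$ such that every $U\in\mathcal H^{\mathbf L}_{splc}$ has some $w\in\mathbb R^{\kappa d}$ for which, at all $(p,B)$, every optimal bundle lies in $\operatorname{argmax}_{x\in[0,1]^d}\langle w,\Psi((p,B),x)\rangle$, and, unless $U$ vanishes identically on $[0,1]^d$, this argmax consists of optimal bundles only; 4. second best admissible bundles are computable in time $O(d)$. Here, if $\sum_jp_j\le B$ then only the all-ones bundle is admissible; otherwise $x\in[0,1]^d$ is admissible if $\langle p,x\rangle=B$ and for all but at most one good $j$ the amount $x_j$ is $1$ or equals $\sum_{g\le h}l_{jg}$ for some $0\le h<n_j$. One program with the following property exists. Suppose that all prices are positive, $B\ge 0$, $x^*$ is an optimal bundle for $U_{\mathbf A}$ at $(p,B)$ that is admissible, and there is another admissible bundle. Given $p$, $B$, $\mathbf A$, $\mathbf L$, and $x^*$ together with its allocation $(x^*_{jk})$ to the segments and the number of segments bought of each good, the program outputs, after at most $c\,d$ unit-cost steps ($c$ an absolute constant), an admissible bundle $y\neq x^*$ with $U_{\mathbf A}(z)\le U_{\mathbf A}(y)$ for all admissible $z\ne x^*$. -/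

import Mathlib

open MeasureTheory

/-! ## Markets, demand and SPLC utilities -/

/-- Bundles of `d` divisible goods, one unit of each: the cube `[0,1]^d`. -/
def unitCube (d : ℕ) : Set (Fin d → ℝ) := {x | ∀ j, 0 ≤ x j ∧ x j ≤ 1}

/-- The bundles that are affordable at prices `p` and budget `B`. -/
def budgetSet {d : ℕ} (p : Fin d → ℝ) (B : ℝ) : Set (Fin d → ℝ) :=
  {x | x ∈ unitCube d ∧ p ⬝ᵥ x ≤ B}

/-- The affordable bundles of maximal utility. -/
def optimalBundles {d : ℕ} (U : (Fin d → ℝ) → ℝ) (p : Fin d → ℝ) (B : ℝ) : Set (Fin d → ℝ) :=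
  {x | x ∈ budgetSet p B ∧ ∀ y ∈ budgetSet p B, U y ≤ U x}

/-- The cheapest optimal bundles, among which the buyer chooses. -/
def cheapestBundles {d : ℕ} (U : (Fin d → ℝ) → ℝ) (p : Fin d → ℝ) (B : ℝ) : Set (Fin d → ℝ) :=
  {x | x ∈ optimalBundles U p B ∧ ∀ y ∈ optimalBundles U p B, p ⬝ᵥ x ≤ p ⬝ᵥ y}

/-- A demand rule: it assigns to every utility function its demand function, which picks one of the
cheapest optimal bundles. Different rules are different ways of breaking the remaining ties. -/
structure DemandRule (d : ℕ) where
  demand : ((Fin d → ℝ) → ℝ) → (Fin d → ℝ) → ℝ → (Fin d → ℝ)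
  demand_mem : ∀ U p B, (cheapestBundles U p B).Nonempty → demand U p B ∈ cheapestBundles U p B

/-- Numbers and lengths of the segments of `d` separable utilities with at most `κ` segments each.
Good `j` has the segments `k < num j`; segment `k` has length `len j k` if `k + 1 < num j`, and the
last segment, `k + 1 = num j`, is unbounded. The other entries of `len` are not used. -/
structure Segments (K : Type) (d κ : ℕ) where
  num : Fin d → ℕ
  len : Fin d → Fin κ → K

/-- Every good has between one and `κ` segments, and bounded segments have positive length. -/
def Segments.Valid {K : Type} [Field K] [LinearOrder K] {d κ : ℕ} (L : Segments K d κ) : Prop :=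
  (∀ j, 1 ≤ L.num j ∧ L.num j ≤ κ) ∧
    ∀ (j : Fin d) (k : Fin κ), (k : ℕ) + 1 < L.num j → 0 < L.len j k

/-- The left end point of segment `k` of good `j`. -/
def Segments.start {d κ : ℕ} (L : Segments ℝ d κ) (j : Fin d) (k : Fin κ) : ℝ :=
  ∑ g ∈ Finset.univ.filter (fun g : Fin κ => g < k), L.len j g

/-- The part of the amount `t` of good `j` that lies in segment `k`. -/
noncomputable def Segments.alloc {d κ : ℕ} (L : Segments ℝ d κ) (j : Fin d) (k : Fin κ)
    (t : ℝ) : ℝ :=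
  if (k : ℕ) + 1 < L.num j then max 0 (min (t - L.start j k) (L.len j k))
  else if (k : ℕ) + 1 = L.num j then max 0 (t - L.start j k)
  else 0

/-- Matrices of slopes: non-negative, and strictly decreasing along the segments of a good. -/
def IsSlopes {d κ : ℕ} (L : Segments ℝ d κ) (A : Fin d → Fin κ → ℝ) : Prop :=
  (∀ j k, 0 ≤ A j k) ∧
    ∀ (j : Fin d) (k k' : Fin κ), k < k' → (k' : ℕ) < L.num j → A j k' < A j k

/-- The SPLC utility function with segments `L` and slopes `A`. -/
noncomputable def splcUtility {d κ : ℕ} (L : Segments ℝ d κ) (A : Fin d → Fin κ → ℝ)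
    (x : Fin d → ℝ) : ℝ :=
  ∑ j, ∑ k, A j k * L.alloc j k (x j)

/-- The class of all SPLC utility functions with the given segments. -/
def splcClass {d κ : ℕ} (L : Segments ℝ d κ) : Set ((Fin d → ℝ) → ℝ) :=
  {U | ∃ A, IsSlopes L A ∧ U = splcUtility L A}

/-! ## Learning from revealed preferences -/

/-- One observation: prices, a budget, and the bundle that was bought. -/
structure Obs (K : Type) (d : ℕ) where
  price : Fin d → K
  budget : K
  bundle : Fin d → K

/-- A learner maps a finite sample to a matrix of slopes. -/
abbrev Learner (d κ : ℕ) : Type := (n : ℕ) → (Fin n → Obs ℝ d) → Fin d → Fin κ → ℝ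

/-- The observation of a buyer with utility `U` at prices and budget `z`. -/
def observe {d : ℕ} (β : DemandRule d) (U : (Fin d → ℝ) → ℝ) (z : (Fin d → ℝ) × ℝ) : Obs ℝ d :=
  ⟨z.1, z.2, β.demand U z.1 z.2⟩

/-- The probability that the bundle predicted by the utility function `V` does not have the value,
under the true utility `U`, of the bundle that is bought. -/
noncomputable def predictionError {d : ℕ} (β : DemandRule d) (P : Measure ((Fin d → ℝ) × ℝ))
    (U V : (Fin d → ℝ) → ℝ) : ENNReal :=
  P {z | U (β.demand U z.1 z.2) ≠ U (β.demand V z.1 z.2)}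

/-- Samples of size at least `m` suffice for the learner `𝒜` to reach error `ε` with confidence
`1 - δ`, for every distribution of non-negative prices and budgets and every target utility in
the class for which, almost surely, the bundle to be bought is not tied. -/
def SampleSizeSuffices {d κ : ℕ} (L : Segments ℝ d κ) (β : DemandRule d) (𝒜 : Learner d κ)
    (ε δ : ℝ) (m : ℕ) : Prop :=
  ∀ n : ℕ, m ≤ n → ∀ P : Measure ((Fin d → ℝ) × ℝ), IsProbabilityMeasure P →
    (∀ᵐ z ∂P, (∀ j, 0 ≤ z.1 j) ∧ 0 ≤ z.2) →
    ∀ U ∈ splcClass L, (∀ᵐ z ∂P, (cheapestBundles U z.1 z.2).Subsingleton) →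
      Measure.pi (fun _ : Fin n => P)
          {Z | ENNReal.ofReal ε <
            predictionError β P U (splcUtility L (𝒜 n (fun i => observe β U (Z i))))}
        ≤ ENNReal.ofReal δ

/-- The sample complexity of a learner: the least sufficient sample size. -/
noncomputable def sampleComplexity {d κ : ℕ} (L : Segments ℝ d κ) (β : DemandRule d)
    (𝒜 : Learner d κ) (ε δ : ℝ) : ℕ∞ :=
  ⨅ (m : ℕ) (_ : SampleSizeSuffices L β 𝒜 ε δ m), (m : ℕ∞)

/-! ## Linear classes -/

/-- The label space is the unit cube; this is the set of labels of maximal score. -/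
def scoreArgmax {d D : ℕ} (w : Fin D → ℝ) (ψ : (Fin d → ℝ) → (Fin D → ℝ)) : Set (Fin d → ℝ) :=
  {x | x ∈ unitCube d ∧ ∀ y ∈ unitCube d, w ⬝ᵥ ψ y ≤ w ⬝ᵥ ψ x}

/-- The demand functions of `H` form a `D`-dimensional linear class: there is an encoding `Ψ` into
`ℝ^D` such that every member of `H` has a weight vector for which optimal bundles have maximal
score. So that this is not satisfied by a constant `Ψ`, conversely only optimal bundles have maximal
score, unless the utility vanishes identically; in particular the label of maximal score is unique
wherever the optimal bundle is. -/
def IsLinearDemandClass {d : ℕ} (D : ℕ) (H : Set ((Fin d → ℝ) → ℝ)) : Prop :=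
  ∃ Ψ : (Fin d → ℝ) × ℝ → (Fin d → ℝ) → (Fin D → ℝ), ∀ U ∈ H, ∃ w : Fin D → ℝ,
    ∀ (p : Fin d → ℝ) (B : ℝ), (∀ j, 0 ≤ p j) → 0 ≤ B →
      optimalBundles U p B ⊆ scoreArgmax w (Ψ (p, B)) ∧
      ((∃ z ∈ unitCube d, U z ≠ 0) → scoreArgmax w (Ψ (p, B)) ⊆ optimalBundles U p B)

/-! ## Admissible bundles -/

/-- The amount `t` of good `j` is an end point of segments, within the unit supply. -/
def IsBreakpoint {d κ : ℕ} (L : Segments ℝ d κ) (j : Fin d) (t : ℝ) : Prop :=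
  t = 1 ∨ ∃ k : Fin κ, (k : ℕ) < L.num j ∧ t = L.start j k

/-- A bundle is admissible if it costs exactly the budget and buys at most one good up to an
amount that is not a breakpoint; if everything is affordable then only buying everything is. -/
def IsAdmissible {d κ : ℕ} (L : Segments ℝ d κ) (p : Fin d → ℝ) (B : ℝ) (x : Fin d → ℝ) : Prop :=
  (∑ j, p j ≤ B ∧ x = 1) ∨
    (B < ∑ j, p j ∧ x ∈ unitCube d ∧ p ⬝ᵥ x = B ∧ {j | ¬ IsBreakpoint L j (x j)}.ncard ≤ 1)

/-- `y` has the largest utility among the admissible bundles other than `x`. -/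
def IsSecondBest {d κ : ℕ} (L : Segments ℝ d κ) (A : Fin d → Fin κ → ℝ) (p : Fin d → ℝ) (B : ℝ)
    (x y : Fin d → ℝ) : Prop :=
  IsAdmissible L p B y ∧ y ≠ x ∧
    ∀ z, IsAdmissible L p B z → z ≠ x → splcUtility L A z ≤ splcUtility L A y

/-- The number of segments of good `j` of which something is bought in the bundle `x`. -/
noncomputable def Segments.bought {d κ : ℕ} (L : Segments ℝ d κ) (x : Fin d → ℝ) (j : Fin d) : ℕ :=
  {k : Fin κ | (k : ℕ) < L.num j ∧ L.start j k < x j}.ncard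

/-! ## A random access machine over an ordered field, with running times -/

/-- Memory: two-dimensional arrays of natural numbers and of field elements. A cell is addressed by
the number of its array, a row and a column. -/
structure Mem (K : Type) where
  nat : ℕ → ℕ → ℕ → ℕ
  num : ℕ → ℕ → ℕ → K

/-- Expressions for natural numbers (counters and addresses). -/
inductive NExp : Type
  | const (n : ℕ)
  | read (a : ℕ) (i j : NExp)
  | add (e f : NExp)
  | sub (e f : NExp)

/-- Expressions for field elements. -/
inductive RExp : Type
  | zero
  | one
  | read (a : ℕ) (i j : NExp)
  | add (e f : RExp)
  | sub (e f : RExp)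
  | mul (e f : RExp)
  | div (e f : RExp)

/-- Tests. -/
inductive Test : Type
  | nle (e f : NExp)
  | rle (e f : RExp)
  | neg (b : Test)
  | conj (b c : Test)

/-- Programs. A program is a finite text; it does not depend on the input. -/
inductive Prog : Type
  | skip
  | setNat (a : ℕ) (i j : NExp) (e : NExp)
  | setNum (a : ℕ) (i j : NExp) (e : RExp)
  | seq (c c' : Prog)
  | ite (b : Test) (c c' : Prog)
  | loop (b : Test) (c : Prog)

/-- What is charged, in addition to one unit for each operation, for the numbers that occur. -/
structure CostModel (K : Type) where
  nat : ℕ → ℕ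
  num : K → ℕ

/-- Unit cost: every operation, on numbers of any size, takes one step. -/
def unitCost (K : Type) : CostModel K := ⟨fun _ => 0, fun _ => 0⟩

/-- The bit length of a rational number. -/
def ratBits (q : ℚ) : ℕ := Nat.size q.num.natAbs + Nat.size q.den

/-- Bit cost: every operation is charged the bit length of its operands and of its result. -/
def bitCost : CostModel ℚ := ⟨Nat.size, ratBits⟩

section Semantics

variable {K : Type} [Field K] [LinearOrder K]

def NExp.eval (s : Mem K) : NExp → ℕ
  | .const n => n
  | .read a i j => s.nat a (i.eval s) (j.eval s)
  | .add e f => e.eval s + f.eval s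
  | .sub e f => e.eval s - f.eval s

def RExp.eval (s : Mem K) : RExp → K
  | .zero => 0
  | .one => 1
  | .read a i j => s.num a (i.eval s) (j.eval s)
  | .add e f => e.eval s + f.eval s
  | .sub e f => e.eval s - f.eval s
  | .mul e f => e.eval s * f.eval s
  | .div e f => e.eval s / f.eval s

def Test.eval (s : Mem K) : Test → Prop
  | .nle e f => e.eval s ≤ f.eval s
  | .rle e f => e.eval s ≤ f.eval s
  | .neg b => ¬ b.eval s
  | .conj b c => b.eval s ∧ c.eval s

/-- Every node of an expression costs one unit plus the charge for its value; the charge for the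
operands is part of the cost of the subexpressions. -/
def NExp.cost (c : CostModel K) (s : Mem K) : NExp → ℕ
  | .const n => 1 + c.nat n
  | .read a i j => 1 + c.nat ((NExp.read a i j).eval s) + i.cost c s + j.cost c s
  | .add e f => 1 + c.nat ((NExp.add e f).eval s) + e.cost c s + f.cost c s
  | .sub e f => 1 + c.nat ((NExp.sub e f).eval s) + e.cost c s + f.cost c s

def RExp.cost (c : CostModel K) (s : Mem K) : RExp → ℕ
  | .zero => 1 + c.num 0
  | .one => 1 + c.num 1
  | .read a i j => 1 + c.num ((RExp.read a i j).eval s) + i.cost c s + j.cost c s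
  | .add e f => 1 + c.num ((RExp.add e f).eval s) + e.cost c s + f.cost c s
  | .sub e f => 1 + c.num ((RExp.sub e f).eval s) + e.cost c s + f.cost c s
  | .mul e f => 1 + c.num ((RExp.mul e f).eval s) + e.cost c s + f.cost c s
  | .div e f => 1 + c.num ((RExp.div e f).eval s) + e.cost c s + f.cost c s

def Test.cost (c : CostModel K) (s : Mem K) : Test → ℕ
  | .nle e f => 1 + e.cost c s + f.cost c s
  | .rle e f => 1 + e.cost c s + f.cost c s
  | .neg b => 1 + b.cost c s
  | .conj b b' => 1 + b.cost c s + b'.cost c s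

/-- The memory `s` after the cell `(i, j)` of the array `a` of natural numbers is set to `v`. -/
def Mem.writeNat (s : Mem K) (a i j v : ℕ) : Mem K :=
  ⟨fun a' i' j' => if a' = a ∧ i' = i ∧ j' = j then v else s.nat a' i' j', s.num⟩

/-- The memory `s` after the cell `(i, j)` of the array `a` of field elements is set to `v`. -/
def Mem.writeNum (s : Mem K) (a i j : ℕ) (v : K) : Mem K :=
  ⟨s.nat, fun a' i' j' => if a' = a ∧ i' = i ∧ j' = j then v else s.num a' i' j'⟩

/-- `Exec c q s s' t`: the program `q`, started on the memory `s`, halts with the memory `s'`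
after time `t`. -/
inductive Exec (c : CostModel K) : Prog → Mem K → Mem K → ℕ → Prop
  | skip (s : Mem K) : Exec c .skip s s 1
  | setNat (a : ℕ) (i j e : NExp) (s : Mem K) :
      Exec c (.setNat a i j e) s (s.writeNat a (i.eval s) (j.eval s) (e.eval s))
        (1 + i.cost c s + j.cost c s + e.cost c s)
  | setNum (a : ℕ) (i j : NExp) (e : RExp) (s : Mem K) :
      Exec c (.setNum a i j e) s (s.writeNum a (i.eval s) (j.eval s) (e.eval s))
        (1 + i.cost c s + j.cost c s + e.cost c s)
  | seq {q q' : Prog} {s s' s'' : Mem K} {t t' : ℕ} :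
      Exec c q s s' t → Exec c q' s' s'' t' → Exec c (.seq q q') s s'' (1 + t + t')
  | iteTrue {b : Test} {q q' : Prog} {s s' : Mem K} {t : ℕ} :
      b.eval s → Exec c q s s' t → Exec c (.ite b q q') s s' (1 + b.cost c s + t)
  | iteFalse {b : Test} {q q' : Prog} {s s' : Mem K} {t : ℕ} :
      ¬ b.eval s → Exec c q' s s' t → Exec c (.ite b q q') s s' (1 + b.cost c s + t)
  | loopDone {b : Test} {q : Prog} {s : Mem K} :
      ¬ b.eval s → Exec c (.loop b q) s s (1 + b.cost c s)
  | loopStep {b : Test} {q : Prog} {s s' s'' : Mem K} {t t' : ℕ} :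
      b.eval s → Exec c q s s' t → Exec c (.loop b q) s' s'' t' →
      Exec c (.loop b q) s s'' (1 + b.cost c s + t + t')

/-- A vector as a row that is filled up with zeros. -/
def padVec {R : Type} [Zero R] {n : ℕ} (v : Fin n → R) (i : ℕ) : R :=
  if h : i < n then v ⟨i, h⟩ else 0

/-- A matrix as an array that is filled up with zeros. -/
def padMat {R : Type} [Zero R] {m n : ℕ} (M : Fin m → Fin n → R) (i j : ℕ) : R :=
  if h : i < m then padVec (M ⟨i, h⟩) j else 0

/-- The input of a learning program: the dimensions `d`, `κ`, the size `n` of the sample, the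
segments, and the sample. -/
def learnInput {d κ n : ℕ} (L : Segments K d κ) (S : Fin n → Obs K d) : Mem K where
  nat a i j := match a, i with
    | 0, 0 => if j = 0 then d else if j = 1 then κ else if j = 2 then n else 0
    | 1, 0 => padVec L.num j
    | _, _ => 0
  num a i j := match a with
    | 0 => padMat L.len i j
    | 1 => padMat (fun r => (S r).price) i j
    | 2 => if j = 0 then padVec (fun r => (S r).budget) i else 0
    | 3 => padMat (fun r => (S r).bundle) i j
    | _ => 0

end Semantics

/-- The output of a learning program: the entries of the field array with number four. -/
def learnOutput {K : Type} (d κ : ℕ) (s : Mem K) : Fin d → Fin κ → K :=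
  fun j k => s.num 4 j k

def Segments.toReal {d κ : ℕ} (L : Segments ℚ d κ) : Segments ℝ d κ :=
  ⟨L.num, fun j k => (L.len j k : ℝ)⟩

noncomputable def Obs.toReal {d : ℕ} (o : Obs ℚ d) : Obs ℝ d :=
  ⟨fun j => (o.price j : ℝ), (o.budget : ℝ), fun j => (o.bundle j : ℝ)⟩

/-- The bit length of a rational input of a learning program. -/
def learnInputBits {d κ n : ℕ} (L : Segments ℚ d κ) (S : Fin n → Obs ℚ d) : ℕ :=
  d + κ + n + ∑ j, ∑ k, ratBits (L.len j k) +
    ∑ i, (∑ j, ratBits ((S i).price j) + ratBits ((S i).budget) + ∑ j, ratBits ((S i).bundle j))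

/-- The learners `𝒜 d κ L` are computed in polynomial time by one program, that gets the
dimensions, the segments and the sample as its input: at unit cost per operation on real data, the
time is polynomial in the dimensions and the sample size, and on rational data the bit cost is
polynomial in the bit length of the input. -/
def IsPolyTimeLearner (𝒜 : (d κ : ℕ) → Segments ℝ d κ → Learner d κ) : Prop :=
  ∃ (prog : Prog) (q : Polynomial ℕ),
    (∀ (d κ : ℕ) (L : Segments ℝ d κ), L.Valid → ∀ (n : ℕ) (S : Fin n → Obs ℝ d),
      ∃ (s : Mem ℝ) (t : ℕ), Exec (unitCost ℝ) prog (learnInput L S) s t ∧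
        t ≤ q.eval (d + κ + n) ∧ learnOutput d κ s = 𝒜 d κ L n S) ∧
    (∀ (d κ : ℕ) (L : Segments ℚ d κ), L.Valid → ∀ (n : ℕ) (S : Fin n → Obs ℚ d),
      ∃ (s : Mem ℚ) (t : ℕ), Exec bitCost prog (learnInput L S) s t ∧
        t ≤ q.eval (learnInputBits L S) ∧
        ∀ j k, ((learnOutput d κ s j k : ℚ) : ℝ) = 𝒜 d κ L.toReal n (fun i => (S i).toReal) j k)

/-- The input of a program for the second best bundle: the dimensions, the segments, prices,
budget, slopes, and the bundle `x` together with its allocation to the segments and, for every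
good, the number of segments bought. -/
noncomputable def secondBestInput {d κ : ℕ} (L : Segments ℝ d κ) (A : Fin d → Fin κ → ℝ)
    (p : Fin d → ℝ) (B : ℝ) (x : Fin d → ℝ) : Mem ℝ where
  nat a i j := match a, i with
    | 0, 0 => if j = 0 then d else if j = 1 then κ else 0
    | 1, 0 => padVec L.num j
    | 2, 0 => padVec (L.bought x) j
    | _, _ => 0
  num a i j := match a with
    | 0 => padMat L.len i j
    | 1 => if i = 0 then padVec p j else 0
    | 2 => if i = 0 ∧ j = 0 then B else 0
    | 3 => if i = 0 then padVec x j else 0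
    | 4 => padMat A i j
    | 5 => padMat (fun j' k => L.alloc j' k (x j')) i j
    | _ => 0

/-- The output of a program for the second best bundle: the first row of the field array with
number six. -/
def secondBestOutput (d : ℕ) (s : Mem ℝ) : Fin d → ℝ := fun j => s.num 6 0 j

/-- A single program finds, from an optimal bundle that is admissible, a second best admissible
bundle, whenever there is a further admissible bundle, in time `O(d)` at unit cost. The constant
does not depend on `κ` either. -/
def SecondBestInLinearTime : Prop :=
  ∃ (prog : Prog) (c : ℕ), ∀ (d κ : ℕ) (L : Segments ℝ d κ), L.Valid →
    ∀ A : Fin d → Fin κ → ℝ, IsSlopes L A →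
    ∀ (p : Fin d → ℝ) (B : ℝ), (∀ j, 0 < p j) → 0 ≤ B →
    ∀ x : Fin d → ℝ, x ∈ optimalBundles (splcUtility L A) p B → IsAdmissible L p B x →
    (∃ y, IsAdmissible L p B y ∧ y ≠ x) →
      ∃ (s : Mem ℝ) (t : ℕ), Exec (unitCost ℝ) prog (secondBestInput L A p B x) s t ∧
        t ≤ c * d ∧ IsSecondBest L A p B x (secondBestOutput d s)

/-! The learner is a sample compression scheme whose reconstruction step is the least solution of a
system of inequalities between slopes.

Local structure: at an amount of good `j`, segment `lo` carries the left derivative of the utility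
and segment `hi` the right derivative. By concavity, a bundle is the only cheapest optimal one
exactly if strict first order conditions hold: free goods are bought completely, the last segment
bought of each good has positive slope, nothing more is wanted if money is left, and the last
segment bought of a good yields strictly more per unit of money than the next segment of any other
good. This is `Fits`; the two directions are `fits_of_unique` and `Fits.cheapestBundles_eq`. Hence
an untied observation amounts to finitely many homogeneous strict inequalities `a f > w * a g`,
together with slopes that are known to be zero or known to be positive. Predicting with slopes that
fit an observation is free of error there.

The fitted slopes: every segment that is not known to be worthless starts with slope one, and values
are raised only as far as the inequalities force them. In order to handle strictness, values are
pairs in lexicographic order, whose second component counts strict inequalities; a small unit `η`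
turns the pairs into slopes that satisfy the inequalities strictly (`slopeOf_edge`,
`IsFit.realizes`). In the least solution every value is either a start value or forced by a single
inequality, and a solution with this property is unique (`IsTightSolution.le`, `IsFit.unique`). One
observation for each segment of slope zero, one for each forced value and one for `η`, thus `2κd +
1` observations, therefore determine the output (`IsFit.exists_compression`).

Generalization: slopes reconstructed from a fixed set of positions with error above `ε` agree with
all the other observations only with small probability (`pi_compression_le`). A union bound over the
sets of positions, estimated in `choose_mul_pow_le` without a factor `log n`, gives the sample
complexity. The demand rule need not be measurable, but almost surely it agrees with a Borel
function (`exists_measurable_demand`).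

Running time: the least solution is found by relaxation in the manner of Bellman and Ford. If a
strict solution exists, `m + 1` rounds suffice for `m` inequalities, whatever the numbers are
(`act_rounds_le`). Each relaxation multiplies by one ratio of prices, and `ratHeight` is subadditive
under all field operations, so bit lengths grow additively and remain polynomial. Programs are
verified by the triples `Triple`, which bound memory and time together.

Linear class: the encoding lists the allocation of a bundle to the segments, and is constantly `-1`
on bundles that cannot be afforded.

Second best bundles: money is moved from the last segment bought of one good to the next segment of
another good, until one of them reaches a breakpoint. Some swap of this kind loses at most as much
as any given other admissible bundle (`exists_validSwap`), and only swaps that involve one of three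
distinguished goods have to be examined (`exists_validSwap_of_mem`), so linearly many. -/

set_option linter.unusedSectionVars false

/-! ## Verification of programs -/

section Machine

variable {K : Type} [Field K] [LinearOrder K]

/-- A cost model whose charges are dominated by subadditive size functions. -/
structure Tame (c : CostModel K) (g : ℕ → ℕ) (h : K → ℕ) : Prop where
  nat_le : ∀ n, c.nat n ≤ g n
  num_le : ∀ a, c.num a ≤ 2 * h a
  g_le : ∀ n, g n ≤ n
  g_add : ∀ m n, g (m + n) ≤ g m + g n
  g_sub : ∀ m n, g (m - n) ≤ g m
  h_zero : h 0 ≤ 2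
  h_one : h 1 ≤ 2
  h_add : ∀ a b, h (a + b) ≤ h a + h b
  h_sub : ∀ a b, h (a - b) ≤ h a + h b
  h_mul : ∀ a b, h (a * b) ≤ h a + h b
  h_div : ∀ a b, h (a / b) ≤ h a + h b

/-- All cells of the memory have size at most `G`. -/
def Bdd (g : ℕ → ℕ) (h : K → ℕ) (G : ℕ) (s : Mem K) : Prop :=
  (∀ a i j, g (s.nat a i j) ≤ G) ∧ ∀ a i j, h (s.num a i j) ≤ G

/-- If all cells have size at most `G`, then the value of an expression has size at most `sz * (G +
1)` and its evaluation costs at most `wt * (G + 1)`. Both factors depend on the text of the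
expression only. -/
def NExp.sz : NExp → ℕ
  | .const n => n + 1
  | .read _ _ _ => 1
  | .add e f => e.sz + f.sz
  | .sub e _ => e.sz

def NExp.wt : NExp → ℕ
  | .const n => 1 + n
  | .read _ i j => 1 + i.wt + j.wt
  | .add e f => 1 + (e.sz + f.sz) + e.wt + f.wt
  | .sub e f => 1 + e.sz + e.wt + f.wt

def RExp.sz : RExp → ℕ
  | .zero => 2
  | .one => 2
  | .read _ _ _ => 1
  | .add e f => e.sz + f.sz
  | .sub e f => e.sz + f.sz
  | .mul e f => e.sz + f.sz
  | .div e f => e.sz + f.sz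

def RExp.wt : RExp → ℕ
  | .zero => 5
  | .one => 5
  | .read _ i j => 2 + i.wt + j.wt
  | .add e f => 1 + 2 * (e.sz + f.sz) + e.wt + f.wt
  | .sub e f => 1 + 2 * (e.sz + f.sz) + e.wt + f.wt
  | .mul e f => 1 + 2 * (e.sz + f.sz) + e.wt + f.wt
  | .div e f => 1 + 2 * (e.sz + f.sz) + e.wt + f.wt

def Test.wt : Test → ℕ
  | .nle e f => 1 + e.wt + f.wt
  | .rle e f => 1 + e.wt + f.wt
  | .neg b => 1 + b.wt
  | .conj b c => 1 + b.wt + c.wt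

/-- A loop is counted as a single pass. The number of passes enters through the factor `T` of
`Triple`. -/
def Prog.wt : Prog → ℕ
  | .skip => 1
  | .setNat _ i j e => 1 + i.wt + j.wt + e.wt
  | .setNum _ i j e => 1 + i.wt + j.wt + e.wt
  | .seq c c' => 1 + c.wt + c'.wt
  | .ite b c c' => 1 + b.wt + c.wt + c'.wt
  | .loop b c => 2 + b.wt + c.wt

section Costs

variable {c : CostModel K} {g : ℕ → ℕ} {h : K → ℕ} {G : ℕ} {s : Mem K}

theorem NExp.size_eval_le (hc : Tame c g h) (hs : Bdd g h G s) (e : NExp) :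
    g (e.eval s) ≤ e.sz * (G + 1) := by
  induction e with
  | const n => exact (hc.g_le n).trans (by simp only [NExp.sz]; nlinarith)
  | read a i j => exact (hs.1 _ _ _).trans (by simp [NExp.sz])
  | add e f he hf => exact (hc.g_add _ _).trans (by simp only [NExp.sz]; nlinarith)
  | sub e f he hf => exact (hc.g_sub _ _).trans (by simpa only [NExp.sz] using he)

theorem NExp.cost_le (hc : Tame c g h) (hs : Bdd g h G s) (e : NExp) :
    e.cost c s ≤ e.wt * (G + 1) := by
  have key : ∀ e : NExp, c.nat (e.eval s) ≤ e.sz * (G + 1) := fun e =>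
    (hc.nat_le _).trans (e.size_eval_le hc hs)
  induction e with
  | const n =>
    have := (hc.nat_le n).trans (hc.g_le n)
    simp only [NExp.cost, NExp.wt]; nlinarith
  | read a i j hi hj =>
    have := (hc.nat_le _).trans (hs.1 a (i.eval s) (j.eval s))
    simp only [NExp.cost, NExp.wt, NExp.eval]; nlinarith
  | add e f he hf =>
    have := key (.add e f)
    simp only [NExp.cost, NExp.wt, NExp.sz] at *; nlinarith
  | sub e f he hf =>
    have := key (.sub e f)
    simp only [NExp.cost, NExp.wt, NExp.sz] at *; nlinarith

theorem RExp.size_eval_le (hc : Tame c g h) (hs : Bdd g h G s) (e : RExp) :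
    h (e.eval s) ≤ e.sz * (G + 1) := by
  induction e with
  | zero => exact hc.h_zero.trans (by simp only [RExp.sz]; nlinarith)
  | one => exact hc.h_one.trans (by simp only [RExp.sz]; nlinarith)
  | read a i j => exact (hs.2 _ _ _).trans (by simp [RExp.sz])
  | add e f he hf => exact (hc.h_add _ _).trans (by simp only [RExp.sz]; nlinarith)
  | sub e f he hf => exact (hc.h_sub _ _).trans (by simp only [RExp.sz]; nlinarith)
  | mul e f he hf => exact (hc.h_mul _ _).trans (by simp only [RExp.sz]; nlinarith)
  | div e f he hf => exact (hc.h_div _ _).trans (by simp only [RExp.sz]; nlinarith)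

theorem RExp.cost_le (hc : Tame c g h) (hs : Bdd g h G s) (e : RExp) :
    e.cost c s ≤ e.wt * (G + 1) := by
  have key : ∀ e : RExp, c.num (e.eval s) ≤ 2 * (e.sz * (G + 1)) := fun e =>
    (hc.num_le _).trans (Nat.mul_le_mul_left _ (e.size_eval_le hc hs))
  induction e with
  | zero =>
    have := hc.num_le 0
    have := hc.h_zero
    simp only [RExp.cost, RExp.wt]; nlinarith
  | one =>
    have := hc.num_le 1
    have := hc.h_one
    simp only [RExp.cost, RExp.wt]; nlinarith
  | read a i j =>
    have := (hc.num_le (s.num a (i.eval s) (j.eval s)))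
    have := (hs.2 a (i.eval s) (j.eval s))
    have := i.cost_le hc hs
    have := j.cost_le hc hs
    simp only [RExp.cost, RExp.wt, RExp.eval]; nlinarith
  | add e f he hf =>
    have := key (.add e f)
    simp only [RExp.cost, RExp.wt, RExp.sz] at *; nlinarith
  | sub e f he hf =>
    have := key (.sub e f)
    simp only [RExp.cost, RExp.wt, RExp.sz] at *; nlinarith
  | mul e f he hf =>
    have := key (.mul e f)
    simp only [RExp.cost, RExp.wt, RExp.sz] at *; nlinarith
  | div e f he hf =>
    have := key (.div e f)
    simp only [RExp.cost, RExp.wt, RExp.sz] at *; nlinarith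

theorem Test.cost_le (hc : Tame c g h) (hs : Bdd g h G s) (b : Test) :
    b.cost c s ≤ b.wt * (G + 1) := by
  induction b with
  | nle e f =>
    have := e.cost_le hc hs
    have := f.cost_le hc hs
    simp only [Test.cost, Test.wt]; nlinarith
  | rle e f =>
    have := e.cost_le hc hs
    have := f.cost_le hc hs
    simp only [Test.cost, Test.wt]; nlinarith
  | neg b hb => simp only [Test.cost, Test.wt]; nlinarith
  | conj b b' hb hb' => simp only [Test.cost, Test.wt]; nlinarith

theorem Bdd.writeNat (hs : Bdd g h G s) {a i j v : ℕ} (hv : g v ≤ G) :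
    Bdd g h G (s.writeNat a i j v) := by
  refine ⟨fun a' i' j' => ?_, hs.2⟩
  simp only [Mem.writeNat]
  split_ifs
  exacts [hv, hs.1 _ _ _]

theorem Bdd.writeNum (hs : Bdd g h G s) {a i j : ℕ} {v : K} (hv : h v ≤ G) :
    Bdd g h G (s.writeNum a i j v) := by
  refine ⟨hs.1, fun a' i' j' => ?_⟩
  simp only [Mem.writeNum]
  split_ifs
  exacts [hv, hs.2 _ _ _]

end Costs

/-- The effect of a program without loops. -/
noncomputable def Prog.res : Prog → Mem K → Mem K
  | .skip, s => s
  | .setNat a i j e, s => s.writeNat a (i.eval s) (j.eval s) (e.eval s)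
  | .setNum a i j e, s => s.writeNum a (i.eval s) (j.eval s) (e.eval s)
  | .seq c c', s => c'.res (c.res s)
  | .ite b c c', s => by classical exact if b.eval s then c.res s else c'.res s
  | .loop _ _, s => s

def Prog.Straight : Prog → Prop
  | .skip => True
  | .setNat _ _ _ _ => True
  | .setNum _ _ _ _ => True
  | .seq c c' => c.Straight ∧ c'.Straight
  | .ite _ c c' => c.Straight ∧ c'.Straight
  | .loop _ _ => False

/-- All values written by a program without loops have size at most `G`. -/
def Prog.Safe (g : ℕ → ℕ) (h : K → ℕ) (G : ℕ) : Prog → Mem K → Prop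
  | .skip, _ => True
  | .setNat _ _ _ e, s => g (e.eval s) ≤ G
  | .setNum _ _ _ e, s => h (e.eval s) ≤ G
  | .seq c c', s => c.Safe g h G s ∧ c'.Safe g h G (c.res s)
  | .ite b c c', s => (b.eval s → c.Safe g h G s) ∧ (¬ b.eval s → c'.Safe g h G s)
  | .loop _ _, _ => True

/-- Total correctness with a bound on memory sizes and on time. -/
def Triple (c : CostModel K) (g : ℕ → ℕ) (h : K → ℕ) (G : ℕ) (P : Mem K → Prop) (q : Prog)
    (Q : Mem K → Prop) (T : ℕ) : Prop :=
  ∀ s, Bdd g h G s → P s →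
    ∃ s' t, Exec c q s s' t ∧ Bdd g h G s' ∧ Q s' ∧ t ≤ T * (q.wt * (G + 1))

def NExp.cell (a : ℕ) : NExp := .read a (.const 0) (.const 0)

/-- Repeat `q` with the counter in cell `(0, 0)` of array `a` running from zero to `n`. -/
def Prog.forLoop (a : ℕ) (n : NExp) (q : Prog) : Prog :=
  .seq (.setNat a (.const 0) (.const 0) (.const 0))
    (.loop (.neg (.nle n (.cell a)))
      (.seq q (.setNat a (.const 0) (.const 0) (.add (.cell a) (.const 1)))))

section Rules

variable {c : CostModel K} {g : ℕ → ℕ} {h : K → ℕ} {G : ℕ} {P P' Q Q' R : Mem K → Prop}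

theorem Prog.exec_of_straight (hc : Tame c g h) (q : Prog) (hq : q.Straight) (s : Mem K)
    (hs : Bdd g h G s) (hsafe : q.Safe g h G s) :
    ∃ t, Exec c q s (q.res s) t ∧ Bdd g h G (q.res s) ∧ t ≤ q.wt * (G + 1) := by
  induction q generalizing s with
  | skip => exact ⟨1, .skip s, hs, by simp [Prog.wt]⟩
  | setNat a i j e =>
    refine ⟨_, .setNat a i j e s, hs.writeNat hsafe, ?_⟩
    have := i.cost_le hc hs
    have := j.cost_le hc hs
    have := e.cost_le hc hs
    simp only [Prog.wt]; nlinarith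
  | setNum a i j e =>
    refine ⟨_, .setNum a i j e s, hs.writeNum hsafe, ?_⟩
    have := i.cost_le hc hs
    have := j.cost_le hc hs
    have := e.cost_le hc hs
    simp only [Prog.wt]; nlinarith
  | seq q q' h1 h2 =>
    obtain ⟨t, ht, hb, hle⟩ := h1 hq.1 s hs hsafe.1
    obtain ⟨t', ht', hb', hle'⟩ := h2 hq.2 _ hb hsafe.2
    refine ⟨_, .seq ht ht', hb', ?_⟩
    simp only [Prog.wt]; nlinarith
  | ite b q q' h1 h2 =>
    have hbc := b.cost_le hc hs
    by_cases hb : b.eval s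
    · obtain ⟨t, ht, hb', hle⟩ := h1 hq.1 s hs (hsafe.1 hb)
      have e : (Prog.ite b q q').res s = q.res s := by simp [Prog.res, hb]
      rw [e]
      refine ⟨_, .iteTrue hb ht, hb', ?_⟩
      simp only [Prog.wt]; nlinarith [Nat.zero_le (q'.wt * (G + 1))]
    · obtain ⟨t, ht, hb', hle⟩ := h2 hq.2 s hs (hsafe.2 hb)
      have e : (Prog.ite b q q').res s = q'.res s := by simp [Prog.res, hb]
      rw [e]
      refine ⟨_, .iteFalse hb ht, hb', ?_⟩
      simp only [Prog.wt]; nlinarith [Nat.zero_le (q.wt * (G + 1))]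
  | loop b q _ => exact hq.elim

theorem Triple.straight (hc : Tame c g h) {q : Prog} (hq : q.Straight)
    (hP : ∀ s, Bdd g h G s → P s → q.Safe g h G s ∧ Q (q.res s)) : Triple c g h G P q Q 1 := by
  intro s hs hp
  obtain ⟨h1, h2⟩ := hP s hs hp
  obtain ⟨t, ht, hb, hle⟩ := q.exec_of_straight hc hq s hs h1
  exact ⟨_, t, ht, hb, h2, by simpa using hle⟩

theorem Triple.seq {q q' : Prog} {T T' : ℕ} (h1 : Triple c g h G P q Q T)
    (h2 : Triple c g h G Q q' R T') : Triple c g h G P (.seq q q') R (T + T' + 1) := by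
  intro s hs hp
  obtain ⟨s', t, ht, hb, hq, hle⟩ := h1 s hs hp
  obtain ⟨s'', t', ht', hb', hq', hle'⟩ := h2 s' hb hq
  refine ⟨s'', _, .seq ht ht', hb', hq', ?_⟩
  simp only [Prog.wt]
  nlinarith [Nat.zero_le (T * (q'.wt * (G + 1))), Nat.zero_le (T' * (q.wt * (G + 1))),
    Nat.zero_le (q.wt * (G + 1)), Nat.zero_le (q'.wt * (G + 1)), Nat.zero_le (T * (G + 1)),
    Nat.zero_le (T' * (G + 1))]

theorem Triple.mono {q : Prog} {T T' : ℕ} (h1 : Triple c g h G P q Q T)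
    (hP : ∀ s, P' s → P s) (hQ : ∀ s, Q s → Q' s) (hT : T ≤ T') :
    Triple c g h G P' q Q' T' := by
  intro s hs hp
  obtain ⟨s', t, ht, hb, hq, hle⟩ := h1 s hs (hP s hp)
  exact ⟨s', t, ht, hb, hQ _ hq, hle.trans (Nat.mul_le_mul_right _ hT)⟩

/-- The bound `n` is evaluated anew before each pass, so the invariant has to fix its value. The
invariant must also survive writes to the counter, and the body has to leave the counter as it was.
-/
theorem Triple.forLoop (hc : Tame c g h) {a : ℕ} {n : NExp} {q : Prog} {T N : ℕ}
    (I : ℕ → Mem K → Prop) (hG : ∀ i ≤ N, g i ≤ G)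
    (hstab : ∀ i v s, I i s → I i (s.writeNat a 0 0 v))
    (hb : ∀ i s, I i s → n.eval s = N)
    (hbody : ∀ i < N, Triple c g h G (fun s => I i s ∧ s.nat a 0 0 = i) q
      (fun s => I (i + 1) s ∧ s.nat a 0 0 = i) T) :
    Triple c g h G (I 0) (.forLoop a n q) (I N) (N * (T + 1) + 2) := by
  set b : Test := .neg (.nle n (.cell a)) with hbdef
  set set1 : Prog := .setNat a (.const 0) (.const 0) (.add (.cell a) (.const 1)) with hset
  have hbe : ∀ i s, I i s → s.nat a 0 0 = i → (b.eval s ↔ i < N) := by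
    intro i s hi hs
    simp [b, Test.eval, NExp.cell, NExp.eval, hs, hb i s hi]
  have key : ∀ k i, i + k = N → ∀ s, Bdd g h G s → I i s → s.nat a 0 0 = i →
      ∃ s' t, Exec c (.loop b (.seq q set1)) s s' t ∧ Bdd g h G s' ∧ I N s' ∧
        t ≤ (k * (T + 1) + 1) * ((Prog.loop b (.seq q set1)).wt * (G + 1)) := by
    intro k
    induction k with
    | zero =>
      intro i hi s hs hI hsi
      have hbc := b.cost_le hc hs
      obtain rfl : i = N := by omega
      refine ⟨s, _, .loopDone ?_, hs, hI, ?_⟩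
      · rw [hbe i s hI hsi]; omega
      · simp only [Prog.wt]; nlinarith [Nat.zero_le (q.wt * (G + 1)), Nat.zero_le (set1.wt * (G + 1))]
    | succ k ih =>
      intro i hi s hs hI hsi
      have hbc := b.cost_le hc hs
      obtain ⟨s1, t1, ht1, hb1, ⟨hI1, hc1⟩, hle1⟩ := hbody i (by omega) s hs ⟨hI, hsi⟩
      have hstr : set1.Straight := trivial
      obtain ⟨t2, ht2, hb2, hle2⟩ := set1.exec_of_straight hc hstr s1 hb1 (by
        simp only [hset, Prog.Safe, NExp.cell, NExp.eval, hc1]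
        exact hG _ (by omega))
      have e : set1.res s1 = s1.writeNat a 0 0 (i + 1) := by
        simp [hset, Prog.res, NExp.cell, NExp.eval, hc1]
      rw [e] at ht2 hb2
      obtain ⟨s3, t3, ht3, hb3, hI3, hle3⟩ := ih (i + 1) (by omega) _ hb2 (hstab _ _ _ hI1)
        (by simp [Mem.writeNat])
      refine ⟨s3, _, .loopStep ((hbe i s hI hsi).2 (by omega)) (.seq ht1 ht2) ht3, hb3, hI3, ?_⟩
      set w := (Prog.loop b (.seq q set1)).wt with hw
      have hw' : w = 3 + b.wt + q.wt + set1.wt := by simp only [hw, Prog.wt]; ring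
      have h4 : T * (q.wt * (G + 1)) ≤ T * (w * (G + 1)) :=
        Nat.mul_le_mul_left _ (Nat.mul_le_mul_right _ (by omega))
      -- Apart from the body, a pass costs one test, one increment and two units of control; this
      -- accounts for the `+ 1` in `T + 1`.
      have h5 : 1 + b.wt * (G + 1) + 1 + set1.wt * (G + 1) ≤ w * (G + 1) := by
        rw [hw']; nlinarith [Nat.zero_le (q.wt * (G + 1))]
      nlinarith
  intro s hs hP
  have hs' : Bdd g h G (s.writeNat a 0 0 0) := hs.writeNat (hG 0 (Nat.zero_le _))
  obtain ⟨s', t, ht, hb', hI', hle⟩ := key N 0 (by simp) _ hs' (hstab _ _ _ hP)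
    (by simp [Mem.writeNat])
  refine ⟨s', _, .seq (.setNat a (.const 0) (.const 0) (.const 0) s) ht, hb', hI', ?_⟩
  have h1 := (NExp.const 0).cost_le hc hs
  have h2 : (Prog.forLoop a n q).wt = 1 + (1 + (NExp.const 0).wt + (NExp.const 0).wt +
    (NExp.const 0).wt) + (Prog.loop b (.seq q set1)).wt := rfl
  rw [h2]
  set w := (Prog.loop b (.seq q set1)).wt
  nlinarith [Nat.zero_le ((N * (T + 1)) * (G + 1)), Nat.zero_le ((N * (T + 1)) * ((NExp.const 0).wt * (G + 1))), Nat.zero_le ((NExp.const 0).wt * (G + 1)), Nat.zero_le (w * (G + 1))]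

/-- The program does not write to the array `a` of natural numbers. -/
def Prog.KeepsNat (a : ℕ) : Prog → Prop
  | .skip => True
  | .setNat b _ _ _ => a ≠ b
  | .setNum _ _ _ _ => True
  | .seq c c' => c.KeepsNat a ∧ c'.KeepsNat a
  | .ite _ c c' => c.KeepsNat a ∧ c'.KeepsNat a
  | .loop _ c => c.KeepsNat a

/-- The program does not write to the array `a` of field elements. -/
def Prog.KeepsNum (a : ℕ) : Prog → Prop
  | .skip => True
  | .setNat _ _ _ _ => True
  | .setNum b _ _ _ => a ≠ b
  | .seq c c' => c.KeepsNum a ∧ c'.KeepsNum a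
  | .ite _ c c' => c.KeepsNum a ∧ c'.KeepsNum a
  | .loop _ c => c.KeepsNum a

theorem Exec.nat_eq {q : Prog} {s s' : Mem K} {t a : ℕ} (he : Exec c q s s' t)
    (hq : q.KeepsNat a) : s'.nat a = s.nat a := by
  induction he with
  | skip => rfl
  | setNat b i j e s =>
    have h : a ≠ b := hq
    simp [Mem.writeNat, h]
  | setNum => rfl
  | seq _ _ h1 h2 => exact (h2 hq.2).trans (h1 hq.1)
  | iteTrue _ _ h1 => exact h1 hq.1
  | iteFalse _ _ h1 => exact h1 hq.2
  | loopDone => rfl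
  | loopStep _ _ _ h1 h2 => exact (h2 hq).trans (h1 hq)

theorem Exec.num_eq {q : Prog} {s s' : Mem K} {t a : ℕ} (he : Exec c q s s' t)
    (hq : q.KeepsNum a) : s'.num a = s.num a := by
  induction he with
  | skip => rfl
  | setNat => rfl
  | setNum b i j e s =>
    have h : a ≠ b := hq
    simp [Mem.writeNum, h]
  | seq _ _ h1 h2 => exact (h2 hq.2).trans (h1 hq.1)
  | iteTrue _ _ h1 => exact h1 hq.1
  | iteFalse _ _ h1 => exact h1 hq.2
  | loopDone => rfl
  | loopStep _ _ _ h1 h2 => exact (h2 hq).trans (h1 hq)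

theorem Triple.frameNat {q : Prog} {T : ℕ} (ht : Triple c g h G P q Q T) {a : ℕ}
    (hq : q.KeepsNat a) (F : (ℕ → ℕ → ℕ) → Prop) :
    Triple c g h G (fun s => P s ∧ F (s.nat a)) q (fun s => Q s ∧ F (s.nat a)) T := by
  rintro s hs ⟨hp, hf⟩
  obtain ⟨s', t, h1, h2, h3, h4⟩ := ht s hs hp
  exact ⟨s', t, h1, h2, ⟨h3, by rwa [h1.nat_eq hq]⟩, h4⟩

end Rules

/-! ## Programs as functions -/

/-- The effect of a program in which every loop is cut off after `n` iterations. -/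
noncomputable def Prog.den (n : ℕ) : Prog → Mem K → Mem K
  | .skip, s => s
  | .setNat a i j e, s => s.writeNat a (i.eval s) (j.eval s) (e.eval s)
  | .setNum a i j e, s => s.writeNum a (i.eval s) (j.eval s) (e.eval s)
  | .seq c c', s => c'.den n (c.den n s)
  | .ite b c c', s => by classical exact if b.eval s then c.den n s else c'.den n s
  | .loop b c, s => by classical exact (fun s => if b.eval s then c.den n s else s)^[n] s

/-- The running time bounds the number of passes through every loop, so cutting loops off after `n ≥
t` passes changes nothing; surplus passes are idle because the test fails. -/
theorem Exec.den_eq {c : CostModel K} {q : Prog} {s s' : Mem K} {t : ℕ} (he : Exec c q s s' t) :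
    ∀ n, t ≤ n → q.den n s = s' := by
  classical
  -- For an outermost loop the number `m` of passes is separated from the cutoff `n` inside its
  -- body; otherwise peeling off one pass would change both.
  have key : ∀ n, t ≤ n → q.den n s = s' ∧ ∀ b q0, q = .loop b q0 → ∀ m, t ≤ m →
      (fun s => if b.eval s then q0.den n s else s)^[m] s = s' := by
    induction he with
    | skip s => exact fun n _ => ⟨rfl, by simp⟩
    | setNat a i j e s => exact fun n _ => ⟨rfl, by simp⟩
    | setNum a i j e s => exact fun n _ => ⟨rfl, by simp⟩
    | seq h1 h2 ih1 ih2 =>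
      intro n hn
      refine ⟨?_, by simp⟩
      simp only [Prog.den, (ih1 n (by omega)).1, (ih2 n (by omega)).1]
    | iteTrue hb h1 ih =>
      intro n hn
      refine ⟨?_, by simp⟩
      simp only [Prog.den, hb, if_true, (ih n (by omega)).1]
    | iteFalse hb h1 ih =>
      intro n hn
      refine ⟨?_, by simp⟩
      simp only [Prog.den, hb, if_false, (ih n (by omega)).1]
    | @loopDone b q s hb =>
      intro n hn
      have : ∀ m, (fun s => if b.eval s then q.den n s else s)^[m] s = s := fun m =>
        Function.iterate_fixed (by simp [hb]) m
      refine ⟨?_, ?_⟩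
      · simpa only [Prog.den] using this n
      · rintro b' q' ⟨rfl, rfl⟩ m _
        exact this m
    | @loopStep b q s s' s'' t t' hb h1 h2 ih1 ih2 =>
      intro n hn
      have : ∀ m, 1 + b.cost c s + t + t' ≤ m →
          (fun s => if b.eval s then q.den n s else s)^[m] s = s'' := by
        intro m hm
        obtain ⟨m, rfl⟩ : ∃ m', m = m' + 1 := ⟨m - 1, by omega⟩
        rw [Function.iterate_succ_apply]
        simp only [hb, if_true, (ih1 n (by omega)).1]
        exact (ih2 n (by omega)).2 b q rfl m (by omega)
      refine ⟨?_, ?_⟩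
      · simpa only [Prog.den] using this n hn
      · rintro b' q' ⟨rfl, rfl⟩ m hm
        exact this m hm
  exact fun n hn => (key n hn).1

theorem Exec.unique {c c' : CostModel K} {q : Prog} {s s' s'' : Mem K} {t t' : ℕ}
    (h1 : Exec c q s s' t) (h2 : Exec c' q s s'' t') : s' = s'' :=
  (h1.den_eq (max t t') (le_max_left _ _)).symm.trans (h2.den_eq _ (le_max_right _ _))

end Machine

/-! ### Measurability of the effect of a program -/

section Measurability

variable {Y : Type*} [MeasurableSpace Y]

/-- A memory that depends measurably on a parameter. -/
def MeasurableMem (σ : Y → Mem ℝ) : Prop :=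
  (∀ a i j, Measurable fun y => (σ y).nat a i j) ∧ ∀ a i j, Measurable fun y => (σ y).num a i j

theorem measurable_comp_nat_nat {β : Type*} [MeasurableSpace β] {f : Y → ℕ → ℕ → β} {i j : Y → ℕ}
    (hf : ∀ i j, Measurable fun y => f y i j) (hi : Measurable i) (hj : Measurable j) :
    Measurable fun y => f y (i y) (j y) := by
  have : Measurable fun z : Y × (ℕ × ℕ) => f z.1 z.2.1 z.2.2 :=
    measurable_from_prod_countable_left fun x => hf x.1 x.2
  exact this.comp (measurable_id.prodMk (hi.prodMk hj))

theorem MeasurableMem.nexp {σ : Y → Mem ℝ} (hσ : MeasurableMem σ) (e : NExp) :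
    Measurable fun y => e.eval (σ y) := by
  induction e with
  | const n => exact measurable_const
  | read a i j hi hj => exact measurable_comp_nat_nat (hσ.1 a) hi hj
  | add e f he hf => exact he.add hf
  | sub e f he hf => exact he.sub hf

theorem MeasurableMem.rexp {σ : Y → Mem ℝ} (hσ : MeasurableMem σ) (e : RExp) :
    Measurable fun y => e.eval (σ y) := by
  induction e with
  | zero => exact measurable_const
  | one => exact measurable_const
  | read a i j => exact measurable_comp_nat_nat (hσ.2 a) (hσ.nexp i) (hσ.nexp j)
  | add e f he hf => exact he.add hf
  | sub e f he hf => exact he.sub hf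
  | mul e f he hf => exact he.mul hf
  | div e f he hf => exact he.div hf

theorem MeasurableMem.test {σ : Y → Mem ℝ} (hσ : MeasurableMem σ) (b : Test) :
    MeasurableSet {y | b.eval (σ y)} := by
  induction b with
  | nle e f => exact measurableSet_le (hσ.nexp e) (hσ.nexp f)
  | rle e f => exact measurableSet_le (hσ.rexp e) (hσ.rexp f)
  | neg b hb => exact hb.compl
  | conj b c hb hc => exact hb.inter hc

theorem MeasurableMem.ite {σ τ : Y → Mem ℝ} (hσ : MeasurableMem σ) (hτ : MeasurableMem τ)
    {p : Y → Prop} [DecidablePred p] (hp : MeasurableSet {y | p y}) :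
    MeasurableMem fun y => if p y then σ y else τ y := by
  refine ⟨fun a i j => ?_, fun a i j => ?_⟩
  · simpa only [apply_ite (fun s : Mem ℝ => s.nat a i j)] using
      Measurable.ite hp (hσ.1 a i j) (hτ.1 a i j)
  · simpa only [apply_ite (fun s : Mem ℝ => s.num a i j)] using
      Measurable.ite hp (hσ.2 a i j) (hτ.2 a i j)

theorem measurableSet_eq_nat {f : Y → ℕ} (hf : Measurable f) (n : ℕ) :
    MeasurableSet {y | n = f y} := by
  have : {y | n = f y} = f ⁻¹' {n} := by ext y; simp [eq_comm]
  rw [this]; exact hf (measurableSet_singleton n)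

/-- A program with its loops cut off is a finite composition of writes of measurable values and case
distinctions by measurable tests. This is what a definition of the learner through `den` offers. -/
theorem MeasurableMem.den {σ : Y → Mem ℝ} (hσ : MeasurableMem σ) (n : ℕ) (q : Prog) :
    MeasurableMem fun y => q.den n (σ y) := by
  classical
  induction q generalizing σ with
  | skip => exact hσ
  | setNat a i j e =>
    refine ⟨fun a' i' j' => ?_, hσ.2⟩
    refine Measurable.ite ?_ (hσ.nexp e) (hσ.1 a' i' j')
    exact (MeasurableSet.const _).inter
      ((measurableSet_eq_nat (hσ.nexp i) i').inter (measurableSet_eq_nat (hσ.nexp j) j'))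
  | setNum a i j e =>
    refine ⟨hσ.1, fun a' i' j' => ?_⟩
    refine Measurable.ite ?_ (hσ.rexp e) (hσ.2 a' i' j')
    exact (MeasurableSet.const _).inter
      ((measurableSet_eq_nat (hσ.nexp i) i').inter (measurableSet_eq_nat (hσ.nexp j) j'))
  | seq q q' h1 h2 => exact h2 (h1 hσ)
  | ite b q q' h1 h2 => exact (h1 hσ).ite (h2 hσ) (hσ.test b)
  | loop b q h1 =>
    have : ∀ m, MeasurableMem fun y =>
        (fun s => if b.eval s then q.den n s else s)^[m] (σ y) := by
      intro m
      induction m with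
      | zero => exact hσ
      | succ m ih =>
        simp only [Function.iterate_succ_apply']
        exact (h1 ih).ite ih (ih.test b)
    exact this n

end Measurability

/-! ### Rational runs as real runs -/

section Cast

/-- A memory of rational numbers as a memory of real numbers. -/
noncomputable def Mem.toReal (s : Mem ℚ) : Mem ℝ := ⟨s.nat, fun a i j => (s.num a i j : ℝ)⟩

theorem NExp.eval_toReal (s : Mem ℚ) (e : NExp) : e.eval s.toReal = e.eval s := by
  induction e with
  | const n => rfl
  | read a i j hi hj => simp only [NExp.eval, hi, hj]; rfl
  | add e f he hf => simp [NExp.eval, he, hf]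
  | sub e f he hf => simp [NExp.eval, he, hf]

theorem RExp.eval_toReal (s : Mem ℚ) (e : RExp) : e.eval s.toReal = ((e.eval s : ℚ) : ℝ) := by
  induction e with
  | zero => simp [RExp.eval]
  | one => simp [RExp.eval]
  | read a i j => simp only [RExp.eval, NExp.eval_toReal]; rfl
  | add e f he hf => simp [RExp.eval, he, hf]
  | sub e f he hf => simp [RExp.eval, he, hf]
  | mul e f he hf => simp [RExp.eval, he, hf]
  | div e f he hf => simp [RExp.eval, he, hf]

theorem Test.eval_toReal (s : Mem ℚ) (b : Test) : b.eval s.toReal ↔ b.eval s := by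
  induction b with
  | nle e f => simp [Test.eval, NExp.eval_toReal]
  | rle e f => simp [Test.eval, RExp.eval_toReal]
  | neg b hb => simp [Test.eval, hb]
  | conj b c hb hc => simp [Test.eval, hb, hc]

theorem Mem.toReal_writeNum (s : Mem ℚ) (a i j : ℕ) (v : ℚ) :
    (s.writeNum a i j v).toReal = s.toReal.writeNum a i j (v : ℝ) := by
  simp only [Mem.toReal, Mem.writeNum, Mem.mk.injEq, true_and]
  funext a' i' j'
  split_ifs <;> rfl

/-- The embedding of `ℚ` into `ℝ` respects comparisons and all field operations, including division
by zero, so each branch is taken in the same way. Only the time may differ. -/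
theorem Exec.toReal {c : CostModel ℚ} {q : Prog} {s s' : Mem ℚ} {t : ℕ} (he : Exec c q s s' t)
    (c' : CostModel ℝ) : ∃ t', Exec c' q s.toReal s'.toReal t' := by
  induction he with
  | skip s => exact ⟨_, .skip _⟩
  | setNat a i j e s =>
    have := Exec.setNat (c := c') a i j e s.toReal
    simp only [NExp.eval_toReal] at this
    exact ⟨_, this⟩
  | setNum a i j e s =>
    have := Exec.setNum (c := c') a i j e s.toReal
    simp only [NExp.eval_toReal, RExp.eval_toReal, ← Mem.toReal_writeNum] at this
    exact ⟨_, this⟩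
  | seq _ _ h1 h2 =>
    obtain ⟨t1, h1⟩ := h1
    obtain ⟨t2, h2⟩ := h2
    exact ⟨_, .seq h1 h2⟩
  | iteTrue hb _ h1 => exact h1.elim fun t h1 => ⟨_, .iteTrue ((Test.eval_toReal _ _).2 hb) h1⟩
  | iteFalse hb _ h1 =>
    exact h1.elim fun t h1 => ⟨_, .iteFalse (mt (Test.eval_toReal _ _).1 hb) h1⟩
  | loopDone hb => exact ⟨_, .loopDone (mt (Test.eval_toReal _ _).1 hb)⟩
  | loopStep hb _ _ h1 h2 =>
    obtain ⟨t1, h1⟩ := h1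
    obtain ⟨t2, h2⟩ := h2
    exact ⟨_, .loopStep ((Test.eval_toReal _ _).2 hb) h1 h2⟩

end Cast

/-! ### Unit cost and bit cost -/

section CostModels

theorem tame_unitCost (K : Type) [Field K] [LinearOrder K] :
    Tame (unitCost K) (fun _ => 0) (fun _ => 0) := by
  constructor <;> simp [unitCost]

/-- The size of the sum of the absolute values of numerator and denominator. -/
def ratHeight (q : ℚ) : ℕ := Nat.size (q.num.natAbs + q.den)

theorem Nat.size_mul_le (m n : ℕ) : Nat.size (m * n) ≤ Nat.size m + Nat.size n := by
  rw [Nat.size_le, pow_add]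
  exact Nat.mul_lt_mul'' (Nat.lt_size_self m) (Nat.lt_size_self n)

theorem Nat.size_le_self (n : ℕ) : Nat.size n ≤ n := Nat.size_le.2 Nat.lt_two_pow_self

theorem Nat.size_add_le (m n : ℕ) : Nat.size (m + n) ≤ Nat.size m + Nat.size n := by
  rcases Nat.eq_zero_or_pos m with rfl | hm
  · simp
  rcases Nat.eq_zero_or_pos n with rfl | hn
  · simp
  rw [Nat.size_le, pow_add]
  have h1 := Nat.lt_size_self m
  have h2 := Nat.lt_size_self n
  nlinarith

/-- Passing to lowest terms divides numerator and denominator, so every representation as a fraction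
bounds the height. -/
theorem ratHeight_le_of_divInt {q : ℚ} {a : ℤ} {b : ℕ} {n : ℕ} (hb : b ≠ 0)
    (hq : q = a / b) (hn : a.natAbs + b ≤ n) : ratHeight q ≤ Nat.size n := by
  refine Nat.size_le_size ?_
  have hb' : ((b : ℤ)) ≠ 0 := by exact_mod_cast hb
  have hq' : q = Rat.divInt a b := by rw [hq, Rat.divInt_eq_div]; simp
  have h1 : q.num ∣ a := hq' ▸ Rat.num_dvd a hb'
  have h2 : (q.den : ℤ) ∣ b := hq' ▸ Rat.den_dvd a b
  have h2' : q.den ∣ b := by exact_mod_cast h2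
  have h3 := Nat.le_of_dvd (Nat.pos_of_ne_zero hb) h2'
  -- Divisibility of zero bounds nothing, so this case is separate; the fraction is then `0 / 1`,
  -- and `1 ≤ b`.
  by_cases ha : a = 0
  · subst ha
    have : q = 0 := by rw [hq]; simp
    subst this
    simp at *
    omega
  · have := Nat.le_of_dvd (by positivity) (Int.natAbs_dvd_natAbs.2 h1)
    omega

/-- The product `(|a| + b)(|c| + d)` dominates `|ad + cb| + bd`. The bit length `ratBits` is not
subadditive itself: `1/7 + 1/8 = 15/56` has ten bits, while the summands have four and five. -/
theorem ratHeight_add (p q : ℚ) : ratHeight (p + q) ≤ ratHeight p + ratHeight q := by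
  refine (ratHeight_le_of_divInt (a := p.num * q.den + q.num * p.den) (b := p.den * q.den)
    (mul_ne_zero p.den_ne_zero q.den_ne_zero) ?_ ?_).trans (Nat.size_mul_le _ _)
  · have hp : (p.den : ℚ) ≠ 0 := by exact_mod_cast p.den_ne_zero
    have hq : (q.den : ℚ) ≠ 0 := by exact_mod_cast q.den_ne_zero
    conv_lhs => rw [← Rat.num_div_den p, ← Rat.num_div_den q]
    push_cast
    field_simp
  · have h1 := Int.natAbs_add_le (p.num * q.den) (q.num * p.den)
    simp only [Int.natAbs_mul, Int.natAbs_natCast] at h1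
    nlinarith [Nat.zero_le (p.num.natAbs * q.num.natAbs)]

theorem ratHeight_neg (q : ℚ) : ratHeight (-q) = ratHeight q := by simp [ratHeight]

theorem ratHeight_mul (p q : ℚ) : ratHeight (p * q) ≤ ratHeight p + ratHeight q := by
  refine (ratHeight_le_of_divInt (a := p.num * q.num) (b := p.den * q.den)
    (mul_ne_zero p.den_ne_zero q.den_ne_zero) ?_ ?_).trans (Nat.size_mul_le _ _)
  · have hp : (p.den : ℚ) ≠ 0 := by exact_mod_cast p.den_ne_zero
    have hq : (q.den : ℚ) ≠ 0 := by exact_mod_cast q.den_ne_zero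
    conv_lhs => rw [← Rat.num_div_den p, ← Rat.num_div_den q]
    push_cast
    field_simp
  · simp only [Int.natAbs_mul]
    nlinarith [Nat.zero_le (p.num.natAbs * q.den), Nat.zero_le (p.den * q.num.natAbs)]

theorem ratHeight_inv (q : ℚ) : ratHeight q⁻¹ ≤ ratHeight q := by
  by_cases hq : q = 0
  · simp [hq]
  have h0 : q.num ≠ 0 := Rat.num_ne_zero.2 hq
  refine ratHeight_le_of_divInt (a := q.num.sign * q.den) (b := q.num.natAbs) (by simpa using h0)
    ?_ ?_
  · have h1 : ((q.num.natAbs : ℕ) : ℚ) = |(q.num : ℚ)| := by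
      rw [Nat.cast_natAbs]; push_cast; rfl
    have h2 : (q.num.sign : ℚ) * |(q.num : ℚ)| = q.num := by
      rw [← Int.cast_abs, ← Int.cast_mul, Int.sign_mul_abs]
    have h3 : (q.num : ℚ) ≠ 0 := by exact_mod_cast h0
    have h4 : (q.den : ℚ) ≠ 0 := by exact_mod_cast q.den_ne_zero
    rw [h1]
    conv_lhs => rw [← Rat.num_div_den q]
    have h5 : |(q.num : ℚ)| ≠ 0 := abs_ne_zero.2 h3
    push_cast
    rw [inv_div, div_eq_div_iff h3 h5]
    have h6 : |(q.num : ℚ)| = q.num.sign * q.num := by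
      rw [← Int.cast_abs, ← Int.cast_mul, Int.sign_mul_self_eq_abs]
    rw [h6]; ring
  · rw [Int.natAbs_mul, Int.natAbs_sign_of_ne_zero h0]
    simp
    omega

theorem ratBits_le (q : ℚ) : ratBits q ≤ 2 * ratHeight q := by
  have h1 : Nat.size q.num.natAbs ≤ ratHeight q := Nat.size_le_size (Nat.le_add_right _ _)
  have h2 : Nat.size q.den ≤ ratHeight q := Nat.size_le_size (Nat.le_add_left _ _)
  simp only [ratBits]; omega

theorem ratHeight_le (q : ℚ) : ratHeight q ≤ ratBits q := Nat.size_add_le _ _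

/-- Natural numbers serve as counters and addresses only, so they can be measured by their value
instead of their bit length. -/
theorem tame_bitCost : Tame bitCost (fun n => n) ratHeight where
  nat_le n := Nat.size_le_self n
  num_le := ratBits_le
  g_le n := le_rfl
  g_add m n := le_rfl
  g_sub m n := Nat.sub_le m n
  h_zero := (ratHeight_le 0).trans (by simp [ratBits])
  h_one := (ratHeight_le 1).trans (by simp [ratBits])
  h_add := ratHeight_add
  h_sub a b := by rw [sub_eq_add_neg, ← ratHeight_neg b]; exact ratHeight_add _ _
  h_mul := ratHeight_mul
  h_div a b := by
    rw [div_eq_mul_inv]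
    exact (ratHeight_mul _ _).trans (Nat.add_le_add_left (ratHeight_inv b) _)

end CostModels

/-! ## Separable piecewise linear concave functions -/

section OneGood

/-- The part of `t` before segment `k`, if there are `n` segments with left end points `p`. -/
noncomputable def segCut (n : ℕ) (p : ℕ → ℝ) (k : ℕ) (t : ℝ) : ℝ := if k < n then min t (p k) else t

/-- The piecewise linear function with slopes `a`. -/
noncomputable def segUtility (n : ℕ) (p a : ℕ → ℝ) (t : ℝ) : ℝ :=
  ∑ k ∈ Finset.range n, a k * (segCut n p (k + 1) t - segCut n p k t)

variable {n : ℕ} {p a : ℕ → ℝ}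

theorem sum_segCut (hn : 0 < n) (h0 : p 0 = 0) {t : ℝ} (ht : 0 ≤ t) :
    ∑ k ∈ Finset.range n, (segCut n p (k + 1) t - segCut n p k t) = t := by
  rw [Finset.sum_range_sub (fun k => segCut n p k t)]
  simp [segCut, hn, h0, ht]

theorem segCut_mono (hp : ∀ k k', k ≤ k' → k' < n → p k ≤ p k') {k : ℕ} {t s : ℝ} (h : t ≤ s) :
    segCut n p (k + 1) t - segCut n p k t ≤ segCut n p (k + 1) s - segCut n p k s := by
  have := hp k (k + 1) (Nat.le_succ k)
  simp only [segCut]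
  split_ifs with h1 h2 h2
  · have := this h1
    rcases le_total t (p k) with h3 | h3 <;> rcases le_total s (p k) with h4 | h4 <;>
    rcases le_total t (p (k + 1)) with h5 | h5 <;> rcases le_total s (p (k + 1)) with h6 | h6 <;>
    simp [h3, h4, h5, h6] <;> linarith
  · omega
  · rcases le_total t (p k) with h3 | h3 <;> rcases le_total s (p k) with h4 | h4 <;>
    simp [h3, h4] <;> linarith
  · simp

theorem segCut_of_le (hp : ∀ k k', k ≤ k' → k' < n → p k ≤ p k') {k : ℕ} (hk : k < n) {t : ℝ}
    (h : t ≤ p k) : segCut n p (k + 1) t - segCut n p k t = 0 := by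
  simp only [segCut, if_pos hk, min_eq_left h]
  split_ifs with h1
  · rw [min_eq_left (h.trans (hp k (k + 1) (Nat.le_succ k) h1)), sub_self]
  · exact sub_self t

theorem segCut_of_ge (hp : ∀ k k', k ≤ k' → k' < n → p k ≤ p k') {k : ℕ} (hk : k + 1 < n) {t : ℝ}
    (h : p (k + 1) ≤ t) :
    segCut n p (k + 1) t - segCut n p k t = p (k + 1) - p k := by
  have := hp k (k + 1) (Nat.le_succ k) hk
  simp [segCut, hk, (Nat.lt_succ_self k).trans hk, min_eq_right h, min_eq_right (this.trans h)]

/-- The amounts in the segments add up to `s` and `t`, so a linear function of slope `c` can be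
subtracted segment by segment. The two bounds that follow only look at the signs of the summands. -/
theorem segUtility_sub (hn : 0 < n) (h0 : p 0 = 0) {t s : ℝ} (ht : 0 ≤ t) (hs : 0 ≤ s) (c : ℝ) :
    segUtility n p a s - segUtility n p a t - c * (s - t) = ∑ k ∈ Finset.range n, (a k - c) *
      ((segCut n p (k + 1) s - segCut n p k s) - (segCut n p (k + 1) t - segCut n p k t)) := by
  have e : s - t = ∑ k ∈ Finset.range n,
      ((segCut n p (k + 1) s - segCut n p k s) - (segCut n p (k + 1) t - segCut n p k t)) := by
    rw [Finset.sum_sub_distrib, sum_segCut hn h0 hs, sum_segCut hn h0 ht]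
  rw [e, segUtility, segUtility, Finset.mul_sum, ← Finset.sum_sub_distrib, ← Finset.sum_sub_distrib]
  exact Finset.sum_congr rfl fun k _ => by ring

/-- Segments up to `l` have slope at least `a l`, and later ones begin at or after `s`. -/
theorem le_segUtility_sub (h0 : p 0 = 0) (hp : ∀ k k', k ≤ k' → k' < n → p k ≤ p k')
    (ha : ∀ k k', k ≤ k' → k' < n → a k' ≤ a k) {t s : ℝ} (ht : 0 ≤ t) (hts : t ≤ s) {l : ℕ}
    (hl : l < n) (hsl : ∀ k, l < k → k < n → s ≤ p k) :
    a l * (s - t) ≤ segUtility n p a s - segUtility n p a t := by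
  rw [← sub_nonneg, segUtility_sub (by omega) h0 ht (ht.trans hts)]
  refine Finset.sum_nonneg fun k hk => ?_
  rw [Finset.mem_range] at hk
  rcases le_or_gt k l with h | h
  · exact mul_nonneg (sub_nonneg.2 (ha k l h hl)) (sub_nonneg.2 (segCut_mono hp hts))
  · rw [segCut_of_le hp hk (hsl k h hk), segCut_of_le hp hk (hts.trans (hsl k h hk))]
    simp

/-- Segments from `l` on have slope at most `a l`, and earlier ones are already full at `t`. -/
theorem segUtility_sub_le (h0 : p 0 = 0) (hp : ∀ k k', k ≤ k' → k' < n → p k ≤ p k')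
    (ha : ∀ k k', k ≤ k' → k' < n → a k' ≤ a k) {t s : ℝ} (ht : 0 ≤ t) (hts : t ≤ s) {l : ℕ}
    (hl : l < n) (htl : p l ≤ t) :
    segUtility n p a s - segUtility n p a t ≤ a l * (s - t) := by
  rw [← sub_nonpos, segUtility_sub (by omega) h0 ht (ht.trans hts)]
  refine Finset.sum_nonpos fun k hk => ?_
  rw [Finset.mem_range] at hk
  rcases le_or_gt l k with h | h
  · exact mul_nonpos_of_nonpos_of_nonneg (sub_nonpos.2 (ha l k h hk))
      (sub_nonneg.2 (segCut_mono hp hts))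
  · have h1 := hp (k + 1) l h hl
    rw [segCut_of_ge hp (by omega) (h1.trans htl), segCut_of_ge hp (by omega)
      (h1.trans (htl.trans hts))]
    simp

theorem segUtility_continuous : Continuous (segUtility n p a) := by
  unfold segUtility segCut
  refine continuous_finsetSum _ fun k _ => continuous_const.mul (.sub ?_ ?_)
  · split_ifs <;> fun_prop
  · split_ifs <;> fun_prop

end OneGood

/-! ### Locating an amount among the segments -/

section Last

variable {K : Type} [Field K] [LinearOrder K]

/-- The last index below `n` at which `f` is less than `x`. -/
def lastLt (f : ℕ → K) (x : K) : ℕ → ℕ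
  | 0 => 0
  | n + 1 => if f n < x then n else lastLt f x n

/-- The last index below `n` at which `f` is at most `x`. -/
def lastLe (f : ℕ → K) (x : K) : ℕ → ℕ
  | 0 => 0
  | n + 1 => if f n ≤ x then n else lastLe f x n

theorem lastLt_spec {f : ℕ → K} {x : K} {n : ℕ} (hn : 0 < n) (h0 : f 0 < x) :
    lastLt f x n < n ∧ f (lastLt f x n) < x ∧ ∀ k, lastLt f x n < k → k < n → x ≤ f k := by
  induction n with
  | zero => omega
  | succ n ih =>
    simp only [lastLt]
    split_ifs with h
    · exact ⟨by omega, h, fun k _ _ => by omega⟩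
    · rcases Nat.eq_zero_or_pos n with rfl | hn'
      · exact absurd h0 h
      obtain ⟨h1, h2, h3⟩ := ih hn'
      refine ⟨by omega, h2, fun k hk hk' => ?_⟩
      rcases Nat.lt_succ_iff_lt_or_eq.1 hk' with hk' | rfl
      exacts [h3 k hk hk', not_lt.1 h]

theorem lastLe_spec {f : ℕ → K} {x : K} {n : ℕ} (hn : 0 < n) (h0 : f 0 ≤ x) :
    lastLe f x n < n ∧ f (lastLe f x n) ≤ x ∧ ∀ k, lastLe f x n < k → k < n → x < f k := by
  induction n with
  | zero => omega
  | succ n ih =>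
    simp only [lastLe]
    split_ifs with h
    · exact ⟨by omega, h, fun k _ _ => by omega⟩
    · rcases Nat.eq_zero_or_pos n with rfl | hn'
      · exact absurd h0 h
      obtain ⟨h1, h2, h3⟩ := ih hn'
      refine ⟨by omega, h2, fun k hk hk' => ?_⟩
      rcases Nat.lt_succ_iff_lt_or_eq.1 hk' with hk' | rfl
      exacts [h3 k hk hk', not_le.1 h]

/-- Thanks to the default `0`, nothing about `f 0` and `x` is needed; this matters for samples that
no buyer has produced. -/
theorem lastLt_lt {f : ℕ → K} {x : K} {n : ℕ} (hn : 0 < n) : lastLt f x n < n := by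
  induction n with
  | zero => omega
  | succ n ih =>
    simp only [lastLt]
    split_ifs
    · omega
    · rcases Nat.eq_zero_or_pos n with rfl | h
      · simp [lastLt]
      · exact (ih h).trans (Nat.lt_succ_self n)

theorem lastLe_lt {f : ℕ → K} {x : K} {n : ℕ} (hn : 0 < n) : lastLe f x n < n := by
  induction n with
  | zero => omega
  | succ n ih =>
    simp only [lastLe]
    split_ifs
    · omega
    · rcases Nat.eq_zero_or_pos n with rfl | h
      · simp [lastLe]
      · exact (ih h).trans (Nat.lt_succ_self n)

/-- The left end point of segment `k` of good `j`, with natural numbers as indices. -/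
def Segments.pre {d κ : ℕ} (L : Segments K d κ) (j : Fin d) (k : ℕ) : K :=
  ∑ g ∈ Finset.range k, padVec (L.len j) g

/-- The last segment of good `j` that begins before `t`. -/
def Segments.lo {d κ : ℕ} (L : Segments K d κ) (j : Fin d) (t : K) : ℕ :=
  lastLt (L.pre j) t (L.num j)

/-- The last segment of good `j` that does not begin after `t`. -/
def Segments.hi {d κ : ℕ} (L : Segments K d κ) (j : Fin d) (t : K) : ℕ :=
  lastLe (L.pre j) t (L.num j)

end Last

/-! ### One-sided slopes and first order conditions -/

section Splc

variable {d κ : ℕ} {L : Segments ℝ d κ} {A : Fin d → Fin κ → ℝ} {p x y : Fin d → ℝ} {B : ℝ}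

/-- The right end of the segment of good `j` to which a small addition to `t` belongs, within the
unit supply. -/
noncomputable def Segments.top (L : Segments ℝ d κ) (j : Fin d) (t : ℝ) : ℝ :=
  if L.hi j t + 1 < L.num j then min 1 (L.pre j (L.hi j t + 1)) else 1

theorem padVec_of_lt {R : Type} [Zero R] {n : ℕ} (v : Fin n → R) {i : ℕ} (h : i < n) :
    padVec v i = v ⟨i, h⟩ := dif_pos h

theorem Segments.start_eq_pre (L : Segments ℝ d κ) (j : Fin d) (k : Fin κ) :
    L.start j k = L.pre j k := by
  unfold Segments.start Segments.pre
  refine Finset.sum_nbij' (fun g => (g : ℕ)) (fun g => if h : g < κ then ⟨g, h⟩ else k) ?_ ?_ ?_ ?_ ?_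
  · intro g hg; simpa using hg
  · intro g hg
    have hg' : g < k := by simpa using hg
    have h2 : g < κ := hg'.trans k.2
    simpa [h2, ← Fin.val_fin_lt] using hg'
  · intro g hg; simp
  · intro g hg
    have hg' : g < k := by simpa using hg
    simp [hg'.trans k.2]
  · intro g hg; simp [padVec_of_lt _ g.2]

theorem Segments.pre_zero (L : Segments ℝ d κ) (j : Fin d) : L.pre j 0 = 0 := by
  simp [Segments.pre]

theorem Segments.Valid.num_pos (hL : L.Valid) (j : Fin d) : 0 < L.num j := (hL.1 j).1

theorem Segments.Valid.pre_lt (hL : L.Valid) {j : Fin d} {k k' : ℕ} (h : k < k')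
    (h' : k' < L.num j) : L.pre j k < L.pre j k' := by
  unfold Segments.pre
  refine Finset.sum_lt_sum_of_subset (i := k) (Finset.range_mono h.le) (by simpa using h) (by simp)
    ?_ fun g hg _ => ?_
  · have hk : k < κ := by have := (hL.1 j).2; omega
    rw [padVec_of_lt _ hk]
    exact hL.2 j ⟨k, hk⟩ (by simp; omega)
  · rw [Finset.mem_range] at hg
    have hk : g < κ := by have := (hL.1 j).2; omega
    rw [padVec_of_lt _ hk]
    exact (hL.2 j ⟨g, hk⟩ (by simp; omega)).le

theorem Segments.Valid.pre_le (hL : L.Valid) {j : Fin d} (k k' : ℕ) (h : k ≤ k')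
    (h' : k' < L.num j) : L.pre j k ≤ L.pre j k' := by
  rcases h.eq_or_lt with rfl | h
  exacts [le_rfl, (hL.pre_lt h h').le]

theorem IsSlopes.padVec_le (hL : L.Valid) (hA : IsSlopes L A) (j : Fin d) (k k' : ℕ) (h : k ≤ k')
    (h' : k' < L.num j) : padVec (A j) k' ≤ padVec (A j) k := by
  rcases h.eq_or_lt with rfl | h
  · exact le_rfl
  have := (hL.1 j).2
  rw [padVec_of_lt _ (show k < κ by omega), padVec_of_lt _ (show k' < κ by omega)]
  exact (hA.2 j ⟨k, _⟩ ⟨k', _⟩ (by simpa [Fin.lt_def] using h) (by simpa using h')).le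

theorem IsSlopes.padVec_nonneg (hA : IsSlopes L A) (j : Fin d) (k : ℕ) : 0 ≤ padVec (A j) k := by
  unfold padVec
  split_ifs
  exacts [hA.1 _ _, le_rfl]

theorem Segments.Valid.alloc_eq (hL : L.Valid) {j : Fin d} {k : Fin κ} (hk : (k : ℕ) < L.num j)
    (t : ℝ) :
    L.alloc j k t = segCut (L.num j) (L.pre j) (k + 1) t - segCut (L.num j) (L.pre j) k t := by
  unfold Segments.alloc segCut
  rw [L.start_eq_pre]
  simp only [hk, if_true]
  split_ifs with h1 h2
  · have h3 := hL.2 j k h1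
    have h4 : L.pre j (k + 1) = L.pre j k + L.len j k := by
      unfold Segments.pre
      rw [Finset.sum_range_succ, padVec_of_lt _ k.2]
    rw [h4]
    rcases le_total t (L.pre j k) with h5 | h5
    · rw [min_eq_left h5, min_eq_left (h5.trans (by linarith)), sub_self,
        max_eq_left ((min_le_left _ _).trans (by linarith))]
    · rw [min_eq_right h5]
      rcases le_total t (L.pre j k + L.len j k) with h6 | h6
      · rw [min_eq_left h6, min_eq_left (by linarith), max_eq_right (by linarith)]
      · rw [min_eq_right h6, min_eq_right (by linarith), max_eq_right (by linarith)]
        ring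
  · rcases le_total t (L.pre j k) with h5 | h5
    · rw [min_eq_left h5, max_eq_left (by linarith), sub_self]
    · rw [min_eq_right h5, max_eq_right (by linarith)]
  · omega

theorem splcUtility_eq (hL : L.Valid) (A : Fin d → Fin κ → ℝ) (x : Fin d → ℝ) :
    splcUtility L A x = ∑ j, segUtility (L.num j) (L.pre j) (padVec (A j)) (x j) := by
  unfold splcUtility segUtility
  refine Finset.sum_congr rfl fun j _ => ?_
  have h1 : ∑ k : Fin κ, A j k * L.alloc j k (x j) = ∑ k : Fin κ,
      (fun k : ℕ => if k < L.num j then padVec (A j) k * (segCut (L.num j) (L.pre j) (k + 1) (x j)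
        - segCut (L.num j) (L.pre j) k (x j)) else 0) k := by
    refine Finset.sum_congr rfl fun k _ => ?_
    simp only
    split_ifs with hk
    · rw [hL.alloc_eq hk, padVec_of_lt _ k.2]
    · unfold Segments.alloc
      rw [if_neg (by omega), if_neg (by omega), mul_zero]
  rw [h1, Fin.sum_univ_eq_sum_range (fun k : ℕ => if k < L.num j then padVec (A j) k *
    (segCut (L.num j) (L.pre j) (k + 1) (x j) - segCut (L.num j) (L.pre j) k (x j)) else 0),
    ← Finset.sum_filter]
  refine Finset.sum_congr ?_ fun _ _ => rfl
  have := (hL.1 j).2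
  ext k
  simp
  omega

theorem Segments.Valid.lo_spec (hL : L.Valid) (j : Fin d) {t : ℝ} (ht : 0 < t) :
    L.lo j t < L.num j ∧ L.pre j (L.lo j t) < t ∧
      ∀ k, L.lo j t < k → k < L.num j → t ≤ L.pre j k :=
  lastLt_spec (hL.num_pos j) (by rwa [L.pre_zero])

theorem Segments.Valid.hi_spec (hL : L.Valid) (j : Fin d) {t : ℝ} (ht : 0 ≤ t) :
    L.hi j t < L.num j ∧ L.pre j (L.hi j t) ≤ t ∧
      ∀ k, L.hi j t < k → k < L.num j → t < L.pre j k :=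
  lastLe_spec (hL.num_pos j) (by rwa [L.pre_zero])

theorem Segments.Valid.pre_nonneg (hL : L.Valid) {j : Fin d} {k : ℕ} (hk : k < L.num j) :
    0 ≤ L.pre j k := (L.pre_zero j).symm.le.trans (hL.pre_le 0 k (Nat.zero_le _) hk)

theorem Segments.Valid.lt_top (hL : L.Valid) (j : Fin d) {t : ℝ} (ht : 0 ≤ t) (h1 : t < 1) :
    t < L.top j t := by
  unfold Segments.top
  split_ifs with h
  · exact lt_min h1 ((hL.hi_spec j ht).2.2 _ (Nat.lt_succ_self _) h)
  · exact h1

theorem Segments.top_le_one (L : Segments ℝ d κ) (j : Fin d) (t : ℝ) : L.top j t ≤ 1 := by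
  unfold Segments.top
  split_ifs
  exacts [min_le_left _ _, le_rfl]

/-- By concavity, the left derivative at the right end point, carried by `lo`, bounds the increments
from below. In the same way the right derivative, carried by `hi`, bounds them from above in
`seg_up_le`; equality holds up to the nearest breakpoint (`seg_down_eq`, `seg_up_eq`). -/
theorem seg_down_ge (hL : L.Valid) (hA : IsSlopes L A) (j : Fin d) {t s : ℝ} (ht : 0 ≤ t)
    (hts : t < s) : padVec (A j) (L.lo j s) * (s - t) ≤
      segUtility (L.num j) (L.pre j) (padVec (A j)) s -
        segUtility (L.num j) (L.pre j) (padVec (A j)) t := by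
  obtain ⟨h1, -, h3⟩ := hL.lo_spec j (ht.trans_lt hts)
  exact le_segUtility_sub (L.pre_zero j) hL.pre_le (hA.padVec_le hL j) ht hts.le h1 h3

theorem seg_up_le (hL : L.Valid) (hA : IsSlopes L A) (j : Fin d) {t s : ℝ} (ht : 0 ≤ t)
    (hts : t ≤ s) : segUtility (L.num j) (L.pre j) (padVec (A j)) s -
        segUtility (L.num j) (L.pre j) (padVec (A j)) t ≤ padVec (A j) (L.hi j t) * (s - t) := by
  obtain ⟨h1, h2, -⟩ := hL.hi_spec j ht
  exact segUtility_sub_le (L.pre_zero j) hL.pre_le (hA.padVec_le hL j) ht hts h1 h2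

theorem seg_down_eq (hL : L.Valid) (hA : IsSlopes L A) (j : Fin d) {t s : ℝ}
    (hts : t < s) (hs : L.pre j (L.lo j s) ≤ t) (h0 : 0 < s) :
    segUtility (L.num j) (L.pre j) (padVec (A j)) s -
        segUtility (L.num j) (L.pre j) (padVec (A j)) t = padVec (A j) (L.lo j s) * (s - t) := by
  have ht : 0 ≤ t := (hL.pre_nonneg (hL.lo_spec j h0).1).trans hs
  refine le_antisymm ?_ (seg_down_ge hL hA j ht hts)
  exact segUtility_sub_le (L.pre_zero j) hL.pre_le (hA.padVec_le hL j) ht hts.le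
    (hL.lo_spec j h0).1 hs

theorem seg_up_eq (hL : L.Valid) (hA : IsSlopes L A) (j : Fin d) {t s : ℝ} (ht : 0 ≤ t)
    (hts : t ≤ s) (hs : s ≤ L.top j t) :
    segUtility (L.num j) (L.pre j) (padVec (A j)) s -
        segUtility (L.num j) (L.pre j) (padVec (A j)) t = padVec (A j) (L.hi j t) * (s - t) := by
  refine le_antisymm (seg_up_le hL hA j ht hts) ?_
  refine le_segUtility_sub (L.pre_zero j) hL.pre_le (hA.padVec_le hL j) ht hts
    (hL.hi_spec j ht).1 fun k hk hk' => ?_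
  unfold Segments.top at hs
  rw [if_pos (by omega)] at hs
  exact (hs.trans (min_le_right _ _)).trans (hL.pre_le _ _ hk hk')

/-- A separable function lies below every linear function that supports it at `x`. -/
theorem splcUtility_sub_le (hL : L.Valid) (hA : IsSlopes L A) (hx : ∀ j, 0 ≤ x j)
    (hy : ∀ j, 0 ≤ y j) {c : Fin d → ℝ} (h1 : ∀ j, y j < x j → c j ≤ padVec (A j) (L.lo j (x j)))
    (h2 : ∀ j, x j < y j → padVec (A j) (L.hi j (x j)) ≤ c j) :
    splcUtility L A y - splcUtility L A x ≤ c ⬝ᵥ y - c ⬝ᵥ x := by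
  rw [splcUtility_eq hL, splcUtility_eq hL, ← Finset.sum_sub_distrib, dotProduct, dotProduct,
    ← Finset.sum_sub_distrib]
  refine Finset.sum_le_sum fun j _ => ?_
  rcases lt_trichotomy (x j) (y j) with h | h | h
  · have := seg_up_le hL hA j (hx j) h.le
    nlinarith [h2 j h]
  · rw [h]; simp
  · have := seg_down_ge hL hA j (hy j) h
    nlinarith [h1 j h]

/-- The slack `δ` at a single decreasing good can be added to the supporting functional, which then
loses `δ` times the decrease. -/
theorem splcUtility_sub_lt (hL : L.Valid) (hA : IsSlopes L A) (hx : ∀ j, 0 ≤ x j)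
    (hy : ∀ j, 0 ≤ y j) {c : Fin d → ℝ} (h1 : ∀ j, y j < x j → c j < padVec (A j) (L.lo j (x j)))
    (h2 : ∀ j, x j < y j → padVec (A j) (L.hi j (x j)) ≤ c j) (h3 : ∃ j, y j < x j) :
    splcUtility L A y - splcUtility L A x < c ⬝ᵥ y - c ⬝ᵥ x := by
  obtain ⟨i, hi⟩ := h3
  classical
  set δ := padVec (A i) (L.lo i (x i)) - c i with hδ
  have hδ0 : 0 < δ := sub_pos.2 (h1 i hi)
  have := splcUtility_sub_le hL hA hx hy (c := c + Pi.single i δ) (fun j hj => by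
      by_cases hji : j = i
      · subst hji; simp [hδ]
      · simp [hji, (h1 j hj).le]) (fun j hj => by
      have hji : j ≠ i := by rintro rfl; exact absurd hi (not_lt.2 hj.le)
      simpa [hji] using h2 j hj)
  rw [add_dotProduct, add_dotProduct, single_dotProduct, single_dotProduct] at this
  nlinarith

/-- Bundles of type `x`, at prices `p` and budget `B`, are chosen for strict reasons by a buyer
with slopes `A`. -/
def Fits (L : Segments ℝ d κ) (A : Fin d → Fin κ → ℝ) (p : Fin d → ℝ) (B : ℝ) (x : Fin d → ℝ) :
    Prop :=
  x ∈ unitCube d ∧ p ⬝ᵥ x ≤ B ∧ (∀ j, p j = 0 → x j = 1) ∧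
    (∀ j, 0 < x j → 0 < padVec (A j) (L.lo j (x j))) ∧
    (p ⬝ᵥ x < B → ∀ j, x j < 1 → padVec (A j) (L.hi j (x j)) = 0) ∧
    ∀ j j', j ≠ j' → 0 < x j → x j' < 1 →
      padVec (A j') (L.hi j' (x j')) * p j < padVec (A j) (L.lo j (x j)) * p j'

/-- A multiplier `c`, the value of money, separates the rates of the goods that `y` reduces strictly
from the rates of those that `y` increases. Then `c • p` supports the utility at `x`, and a bundle
that costs no more is worse. -/
theorem Fits.lt_of_cost_le (hL : L.Valid) (hA : IsSlopes L A) (hp : ∀ j, 0 ≤ p j)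
    (hf : Fits L A p B x) (hy : y ∈ unitCube d) (hyx : y ≠ x) (hc : p ⬝ᵥ y ≤ p ⬝ᵥ x) :
    splcUtility L A y < splcUtility L A x := by
  obtain ⟨hx, -, h0, h1, -, h3⟩ := hf
  have hpos : ∀ j, x j < y j → 0 < p j := fun j hj => (hp j).lt_of_ne' fun h => by
    have := h0 j h; have := (hy j).2; linarith
  by_cases hD : ∃ j, y j < x j
  · obtain ⟨c, hc0, hc1, hc2⟩ : ∃ c : ℝ, 0 ≤ c ∧
        (∀ j, y j < x j → c * p j < padVec (A j) (L.lo j (x j))) ∧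
        ∀ j, x j < y j → padVec (A j) (L.hi j (x j)) ≤ c * p j := by
      by_cases hI : ∃ j, x j < y j
      · obtain ⟨i, hi, hmax⟩ := (Finset.univ.filter fun j => x j < y j).exists_max_image
          (fun j => padVec (A j) (L.hi j (x j)) / p j) (by simpa [Finset.Nonempty] using hI)
        simp only [Finset.mem_filter, Finset.mem_univ, true_and] at hi hmax
        -- The multiplier is the best rate among the goods that `y` increases; their prices are
        -- positive because free goods are already complete in `x`.
        refine ⟨padVec (A i) (L.hi i (x i)) / p i, div_nonneg (hA.padVec_nonneg _ _) (hp i),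
          fun j hj => ?_, fun j hj => ?_⟩
        · have := h3 j i (by rintro rfl; linarith) (by linarith [(hy j).1]) (by linarith [(hy i).2])
          rw [div_mul_eq_mul_div, div_lt_iff₀ (hpos i hi)]
          exact this
        · have := hmax j hj
          rwa [div_le_iff₀ (hpos j hj)] at this
      · push Not at hI
        refine ⟨0, le_rfl, fun j hj => ?_, fun j hj => absurd hj (not_lt.2 (hI j))⟩
        simpa using h1 j (by linarith [(hy j).1])
    have := splcUtility_sub_lt hL hA (fun j => (hx j).1) (fun j => (hy j).1) (c := c • p)
      (by simpa using hc1) (by simpa using hc2) hD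
    rw [smul_dotProduct, smul_dotProduct, smul_eq_mul, smul_eq_mul] at this
    nlinarith
  -- If nothing is reduced, then `y` buys more of goods with positive prices and costs strictly
  -- more.
  · push Not at hD
    exfalso
    obtain ⟨i, hi⟩ := Function.ne_iff.1 hyx
    have hi' : x i < y i := lt_of_le_of_ne (hD i) (Ne.symm hi)
    refine absurd hc (not_le.2 (Finset.sum_lt_sum (fun j _ => ?_) ⟨i, Finset.mem_univ _, ?_⟩))
    · exact mul_le_mul_of_nonneg_left (hD j) (hp j)
    · exact mul_lt_mul_of_pos_left hi' (hpos i hi')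

/-- Bundles that cost no more than `x` are worse by `Fits.lt_of_cost_le`. Dearer ones are not
better: if they are affordable then money is left at `x`, where nothing more is wanted. -/
theorem Fits.cheapestBundles_eq (hL : L.Valid) (hA : IsSlopes L A) (hp : ∀ j, 0 ≤ p j)
    (hf : Fits L A p B x) : cheapestBundles (splcUtility L A) p B = {x} := by
  have hopt : x ∈ optimalBundles (splcUtility L A) p B := by
    refine ⟨⟨hf.1, hf.2.1⟩, fun y hy => ?_⟩
    by_cases hyx : y = x
    · rw [hyx]
    rcases le_or_gt (p ⬝ᵥ y) (p ⬝ᵥ x) with h | h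
    · exact (hf.lt_of_cost_le hL hA hp hy.1 hyx h).le
    -- Money is left at `x`, so all right slopes vanish and the zero functional supports the
    -- utility.
    · have h' : p ⬝ᵥ x < B := h.trans_le hy.2
      have := splcUtility_sub_le hL hA (fun j => (hf.1 j).1) (fun j => (hy.1 j).1) (c := 0)
        (fun j _ => hA.padVec_nonneg _ _)
        (fun j hj => (hf.2.2.2.2.1 h' j (hj.trans_le (hy.1 j).2)).le)
      simp at this
      linarith
  have key : ∀ y ∈ optimalBundles (splcUtility L A) p B, y ≠ x → p ⬝ᵥ x < p ⬝ᵥ y := by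
    intro y hy hyx
    by_contra h
    have := hf.lt_of_cost_le hL hA hp hy.1.1 hyx (not_lt.1 h)
    have := hy.2 x hopt.1
    linarith
  ext y
  constructor
  · intro hy
    by_contra hyx
    have := key y hy.1 hyx
    have := hy.2 x hopt
    linarith
  · intro hy
    rw [Set.mem_singleton_iff.1 hy]
    refine ⟨hopt, fun y hy => ?_⟩
    by_cases hyx : y = x
    · rw [hyx]
    · exact (key y hy hyx).le

theorem splcUtility_continuous (hL : L.Valid) (A : Fin d → Fin κ → ℝ) :
    Continuous (splcUtility L A) := by
  have : splcUtility L A = fun x => ∑ j, segUtility (L.num j) (L.pre j) (padVec (A j)) (x j) :=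
    funext fun x => splcUtility_eq hL A x
  rw [this]
  exact continuous_finsetSum _ fun j _ => segUtility_continuous.comp (continuous_apply j)

/-- Compactness is used twice, for the utility on the budget set and then for the cost on the
optimal bundles. A demand rule promises something only if there is a cheapest optimal bundle. -/
theorem cheapestBundles_nonempty {U : (Fin d → ℝ) → ℝ} (hU : Continuous U) (p : Fin d → ℝ)
    {B : ℝ} (hB : 0 ≤ B) : (cheapestBundles U p B).Nonempty := by
  have hp : Continuous fun x : Fin d → ℝ => p ⬝ᵥ x := by unfold dotProduct; fun_prop
  have hcube : unitCube d = Set.Icc 0 1 := by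
    ext x; simp [unitCube, Pi.le_def, forall_and]
  have hc : IsCompact (budgetSet p B) := by
    have : budgetSet p B = Set.Icc 0 1 ∩ {x | p ⬝ᵥ x ≤ B} := by
      rw [← hcube]; rfl
    rw [this]
    exact isCompact_Icc.inter_right (isClosed_le hp continuous_const)
  have hne : (budgetSet p B).Nonempty := ⟨0, by rw [hcube]; simp, by simpa using hB⟩
  obtain ⟨x, hx, hmax⟩ := hc.exists_isMaxOn hne hU.continuousOn
  have hopt : optimalBundles U p B = budgetSet p B ∩ {y | U x ≤ U y} := by
    ext y
    refine ⟨fun hy => ⟨hy.1, hy.2 x hx⟩, fun hy => ⟨hy.1, fun z hz => (hmax hz).trans hy.2⟩⟩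
  have hc' : IsCompact (optimalBundles U p B) := by
    rw [hopt]; exact hc.inter_right (isClosed_le continuous_const hU)
  obtain ⟨y, hy, hmin⟩ := hc'.exists_isMinOn ⟨x, hx, fun z hz => hmax hz⟩ hp.continuousOn
  exact ⟨y, hy, fun z hz => hmin hz⟩

/-- Change of the utility if the amount of one good is changed. -/
theorem splcUtility_update (hL : L.Valid) (A : Fin d → Fin κ → ℝ) (x : Fin d → ℝ) (j : Fin d)
    (t : ℝ) : splcUtility L A (Function.update x j t) - splcUtility L A x =
      segUtility (L.num j) (L.pre j) (padVec (A j)) t -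
        segUtility (L.num j) (L.pre j) (padVec (A j)) (x j) := by
  rw [splcUtility_eq hL, splcUtility_eq hL, ← Finset.sum_sub_distrib]
  rw [Finset.sum_eq_single j]
  · simp
  · intro i _ hi; simp [hi]
  · simp

theorem dotProduct_update (p x : Fin d → ℝ) (j : Fin d) (t : ℝ) :
    p ⬝ᵥ Function.update x j t = p ⬝ᵥ x + p j * (t - x j) := by
  rw [← sub_eq_iff_eq_add', dotProduct, dotProduct, ← Finset.sum_sub_distrib]
  rw [Finset.sum_eq_single j]
  · simp; ring
  · intro i _ hi; simp [hi]
  · simp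

theorem update_mem_unitCube (hx : x ∈ unitCube d) (j : Fin d) {t : ℝ} (h0 : 0 ≤ t) (h1 : t ≤ 1) :
    Function.update x j t ∈ unitCube d := by
  intro i
  by_cases hi : i = j
  · subst hi; simp [h0, h1]
  · simpa [hi] using hx i

/-- Money is moved from the last segment bought of good `j` to the next segment of good `i`. -/
theorem swap_spec (hL : L.Valid) (hA : IsSlopes L A) (hx : x ∈ unitCube d) {j i : Fin d}
    (hji : j ≠ i) (hpj : 0 < p j) (hpi : 0 < p i) {t : ℝ} (ht : 0 < t) (hj : 0 < x j)
    (htj : t ≤ p j * (x j - L.pre j (L.lo j (x j)))) (hti : t ≤ p i * (L.top i (x i) - x i)) :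
    let y := Function.update (Function.update x j (x j - t / p j)) i (x i + t / p i)
    y ∈ unitCube d ∧ p ⬝ᵥ y = p ⬝ᵥ x ∧ splcUtility L A y = splcUtility L A x -
      t * (padVec (A j) (L.lo j (x j)) / p j - padVec (A i) (L.hi i (x i)) / p i) := by
  intro y
  have h1 : t / p j ≤ x j - L.pre j (L.lo j (x j)) := by rwa [div_le_iff₀' hpj]
  have h2 : t / p i ≤ L.top i (x i) - x i := by rwa [div_le_iff₀' hpi]
  have h3 : 0 < t / p j := div_pos ht hpj
  have h4 : 0 < t / p i := div_pos ht hpi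
  have h5 := hL.pre_nonneg (hL.lo_spec j hj).1
  have h6 := L.top_le_one i (x i)
  refine ⟨update_mem_unitCube (update_mem_unitCube hx j ?_ ?_) i ?_ ?_, ?_, ?_⟩
  · linarith
  · linarith [(hx j).2]
  · linarith [(hx i).1]
  · linarith
  · simp only [y, dotProduct_update, Function.update_of_ne hji.symm]
    field_simp
    ring
  · have e1 := splcUtility_update hL A (Function.update x j (x j - t / p j)) i (x i + t / p i)
    have e2 := splcUtility_update hL A x j (x j - t / p j)
    rw [Function.update_of_ne hji.symm] at e1
    have e3 := seg_down_eq hL hA j (t := x j - t / p j) (s := x j) (by linarith) (by linarith) hj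
    have e4 := seg_up_eq hL hA i (s := x i + t / p i) (hx i).1 (by linarith) (by linarith)
    have e5 : splcUtility L A y - splcUtility L A x = padVec (A i) (L.hi i (x i)) * (t / p i) -
        padVec (A j) (L.lo j (x j)) * (t / p j) := by
      have e6 : x i + t / p i - x i = t / p i := by ring
      have e7 : x j - (x j - t / p j) = t / p j := by ring
      rw [e6] at e4
      rw [e7] at e3
      linarith
    rw [sub_eq_iff_eq_add] at e5
    rw [e5]
    ring

/-- Each condition is tested by one move that would yield another cheapest optimal bundle, or a
better one, if the condition failed: taking more of a free good, giving back a worthless last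
segment, spending money that is left, and shifting money between two goods. -/
theorem fits_of_unique (hL : L.Valid) (hA : IsSlopes L A) (hp : ∀ j, 0 ≤ p j)
    (hx : x ∈ cheapestBundles (splcUtility L A) p B)
    (hu : (cheapestBundles (splcUtility L A) p B).Subsingleton) : Fits L A p B x := by
  obtain ⟨⟨⟨hx1, hx2⟩, hopt⟩, hch⟩ := hx
  -- Uniqueness in the form in which it is used: nothing else is as cheap and as good.
  have key : ∀ y, y ∈ unitCube d → p ⬝ᵥ y ≤ p ⬝ᵥ x → splcUtility L A x ≤ splcUtility L A y →
      y = x := by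
    intro y hy hc hU
    have hyo : y ∈ optimalBundles (splcUtility L A) p B :=
      ⟨⟨hy, hc.trans hx2⟩, fun z hz => (hopt z hz).trans hU⟩
    exact hu ⟨hyo, fun z hz => hc.trans (hch z hz)⟩ ⟨⟨⟨hx1, hx2⟩, hopt⟩, hch⟩
  have hzero : ∀ j, p j = 0 → x j = 1 := by
    intro j hj
    by_contra h1
    have h1' : x j < 1 := lt_of_le_of_ne (hx1 j).2 h1
    have h2 := hL.lt_top j (hx1 j).1 h1'
    have h3 := L.top_le_one j (x j)
    have e1 := splcUtility_update hL A x j (L.top j (x j))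
    rw [seg_up_eq hL hA j (hx1 j).1 h2.le le_rfl] at e1
    have e2 := key (Function.update x j (L.top j (x j)))
      (update_mem_unitCube hx1 j ((hx1 j).1.trans h2.le) h3) (by rw [dotProduct_update, hj]; simp)
      (by nlinarith [hA.padVec_nonneg j (L.hi j (x j))])
    have := congrFun e2 j
    simp at this
    linarith
  have hpos : ∀ j, 0 < x j → 0 < padVec (A j) (L.lo j (x j)) := by
    intro j hj
    refine (hA.padVec_nonneg _ _).lt_of_ne' fun h0 => ?_
    obtain ⟨h1, h2, -⟩ := hL.lo_spec j hj
    have h3 := hL.pre_nonneg h1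
    have e1 := splcUtility_update hL A x j (L.pre j (L.lo j (x j)))
    have e3 := seg_down_eq hL hA j h2 le_rfl hj
    rw [h0] at e3
    have e2 := key (Function.update x j (L.pre j (L.lo j (x j))))
      (update_mem_unitCube hx1 j h3 (h2.le.trans (hx1 j).2))
      (by rw [dotProduct_update]; nlinarith [hp j]) (by linarith)
    have := congrFun e2 j
    simp at this
    linarith
  refine ⟨hx1, hx2, hzero, hpos, ?_, ?_⟩
  · intro hlt j hj
    by_contra h0
    have h0' : 0 < padVec (A j) (L.hi j (x j)) := (hA.padVec_nonneg _ _).lt_of_ne' h0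
    have hpj : 0 < p j := (hp j).lt_of_ne' fun h => by linarith [hzero j h]
    have h2 := hL.lt_top j (hx1 j).1 hj
    have h3 := L.top_le_one j (x j)
    -- The amount is limited by the next breakpoint, up to which the slope is constant, and by the
    -- money that is left.
    set δ := min (L.top j (x j) - x j) ((B - p ⬝ᵥ x) / p j) with hδ
    have hδ0 : 0 < δ := lt_min (by linarith) (div_pos (by linarith) hpj)
    have hδ1 : δ ≤ L.top j (x j) - x j := min_le_left _ _
    have hδ2 : p j * δ ≤ B - p ⬝ᵥ x := by
      have : δ ≤ (B - p ⬝ᵥ x) / p j := min_le_right _ _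
      rwa [le_div_iff₀' hpj] at this
    have e1 := splcUtility_update hL A x j (x j + δ)
    rw [seg_up_eq hL hA j (hx1 j).1 (by linarith) (by linarith)] at e1
    have := hopt (Function.update x j (x j + δ))
      ⟨update_mem_unitCube hx1 j (by linarith [(hx1 j).1]) (by linarith),
        by rw [dotProduct_update]; linarith⟩
    nlinarith
  · intro j i hji hj hi
    have hpi : 0 < p i := (hp i).lt_of_ne' fun h => by linarith [hzero i h]
    rcases (hp j).eq_or_lt with hpj | hpj
    · rw [← hpj, mul_zero]; exact mul_pos (hpos j hj) hpi
    by_contra hle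
    push Not at hle
    set t := min (p j * (x j - L.pre j (L.lo j (x j)))) (p i * (L.top i (x i) - x i)) with ht
    have ht0 : 0 < t := lt_min (mul_pos hpj (by linarith [(hL.lo_spec j hj).2.1]))
      (mul_pos hpi (by linarith [hL.lt_top i (hx1 i).1 hi]))
    obtain ⟨h1, h2, h3⟩ := swap_spec hL hA hx1 hji hpj hpi ht0 hj (min_le_left _ _) (min_le_right _ _)
    have h4 : padVec (A j) (L.lo j (x j)) / p j ≤ padVec (A i) (L.hi i (x i)) / p i := by
      rwa [div_le_div_iff₀ hpj hpi]
    have := congrFun (key _ h1 h2.le (by rw [h3]; nlinarith)) i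
    rw [Function.update_self] at this
    have := div_pos ht0 hpi
    linarith

end Splc

/-! ## The linear class -/

section LinearClass

variable {d κ : ℕ} {L : Segments ℝ d κ} {A : Fin d → Fin κ → ℝ}

theorem Segments.alloc_nonneg (L : Segments ℝ d κ) (j : Fin d) (k : Fin κ) (t : ℝ) :
    0 ≤ L.alloc j k t := by
  unfold Segments.alloc
  split_ifs
  exacts [le_max_left _ _, le_max_left _ _, le_rfl]

open Classical in
/-- The allocation of affordable bundles; the other bundles get a negative score. -/
noncomputable def splcEncoding (L : Segments ℝ d κ) (z : (Fin d → ℝ) × ℝ) (x : Fin d → ℝ)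
    (r : Fin (κ * d)) : ℝ :=
  if x ∈ budgetSet z.1 z.2 then
    L.alloc (finProdFinEquiv.symm r).2 (finProdFinEquiv.symm r).1 (x (finProdFinEquiv.symm r).2)
  else -1

theorem sum_finProdFinEquiv (f : Fin κ → Fin d → ℝ) :
    ∑ r : Fin (κ * d), f (finProdFinEquiv.symm r).1 (finProdFinEquiv.symm r).2 =
      ∑ j, ∑ k, f k j := by
  rw [Equiv.sum_comp finProdFinEquiv.symm (fun q : Fin κ × Fin d => f q.1 q.2),
    Fintype.sum_prod_type, Finset.sum_comm]

theorem score_of_affordable {p x : Fin d → ℝ} {B : ℝ} (hx : x ∈ budgetSet p B) :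
    (fun r => A (finProdFinEquiv.symm r).2 (finProdFinEquiv.symm r).1) ⬝ᵥ
      splcEncoding L (p, B) x = splcUtility L A x := by
  simp only [dotProduct, splcEncoding, hx, if_true, splcUtility]
  exact sum_finProdFinEquiv fun k j => A j k * L.alloc j k (x j)

theorem score_of_not_affordable {p x : Fin d → ℝ} {B : ℝ} (hx : x ∉ budgetSet p B) :
    (fun r => A (finProdFinEquiv.symm r).2 (finProdFinEquiv.symm r).1) ⬝ᵥ
      splcEncoding L (p, B) x = - ∑ j, ∑ k, A j k := by
  simp only [dotProduct, splcEncoding, hx, if_false, mul_neg, mul_one, Finset.sum_neg_distrib]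
  rw [sum_finProdFinEquiv fun k j => A j k]

theorem IsSlopes.utility_nonneg (hA : IsSlopes L A) (x : Fin d → ℝ) : 0 ≤ splcUtility L A x :=
  Finset.sum_nonneg fun _ _ => Finset.sum_nonneg fun _ _ =>
    mul_nonneg (hA.1 _ _) (L.alloc_nonneg _ _ _)

/-- With the slopes as weights, affordable bundles score their utility, which is non-negative, and
all others score minus the sum of the slopes. That sum is positive unless the utility vanishes. -/
theorem splcClass_isLinearDemandClass (L : Segments ℝ d κ) :
    IsLinearDemandClass (κ * d) (splcClass L) := by
  refine ⟨splcEncoding L, ?_⟩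
  rintro U ⟨A, hA, rfl⟩
  refine ⟨fun r => A (finProdFinEquiv.symm r).2 (finProdFinEquiv.symm r).1, fun p B hp hB => ?_⟩
  have hsum : 0 ≤ ∑ j, ∑ k, A j k :=
    Finset.sum_nonneg fun _ _ => Finset.sum_nonneg fun _ _ => hA.1 _ _
  refine ⟨fun x hx => ⟨hx.1.1, fun y hy => ?_⟩, ?_⟩
  · rw [score_of_affordable hx.1]
    by_cases h : y ∈ budgetSet p B
    · rw [score_of_affordable h]; exact hx.2 y h
    · rw [score_of_not_affordable h]; linarith [hA.utility_nonneg x]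
  · rintro ⟨z, -, hz⟩ x ⟨hx, hmax⟩
    have hpos : 0 < ∑ j, ∑ k, A j k := by
      refine hsum.lt_of_ne' fun h0 => hz ?_
      have h1 := (Finset.sum_eq_zero_iff_of_nonneg fun j _ =>
        Finset.sum_nonneg fun k _ => hA.1 j k).1 h0
      refine Finset.sum_eq_zero fun j hj => Finset.sum_eq_zero fun k hk => ?_
      rw [(Finset.sum_eq_zero_iff_of_nonneg fun k _ => hA.1 j k).1 (h1 j hj) k hk, zero_mul]
    -- The empty bundle is affordable and has a non-negative score, so no bundle of negative score
    -- is maximal.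
    have h0 : (0 : Fin d → ℝ) ∈ budgetSet p B := ⟨fun j => by simp, by simpa using hB⟩
    have hxb : x ∈ budgetSet p B := by
      by_contra h
      have := hmax 0 h0.1
      rw [score_of_affordable h0, score_of_not_affordable h] at this
      linarith [hA.utility_nonneg 0]
    refine ⟨hxb, fun y hy => ?_⟩
    have := hmax y hy.1
    rwa [score_of_affordable hxb, score_of_affordable hy] at this

end LinearClass

/-! ## Second best bundles -/

section SecondBest

variable {d κ : ℕ}

/-- The money spent on the last segment bought. -/
noncomputable def downMoney (L : Segments ℝ d κ) (p x : Fin d → ℝ) (j : Fin d) : ℝ :=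
  p j * (x j - L.pre j (L.lo j (x j)))

/-- The money needed to reach the next breakpoint. -/
noncomputable def upMoney (L : Segments ℝ d κ) (p x : Fin d → ℝ) (j : Fin d) : ℝ :=
  p j * (L.top j (x j) - x j)

/-- The utility per unit of money of the last segment bought. -/
noncomputable def downRate (L : Segments ℝ d κ) (A : Fin d → Fin κ → ℝ) (p x : Fin d → ℝ)
    (j : Fin d) : ℝ :=
  padVec (A j) (L.lo j (x j)) / p j

/-- The utility per unit of money of the next segment to be bought. -/
noncomputable def upRate (L : Segments ℝ d κ) (A : Fin d → Fin κ → ℝ) (p x : Fin d → ℝ)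
    (j : Fin d) : ℝ :=
  padVec (A j) (L.hi j (x j)) / p j

/-- The money that can be moved from good `j` to good `i` until a breakpoint is reached. -/
noncomputable def swapMoney (L : Segments ℝ d κ) (p x : Fin d → ℝ) (j i : Fin d) : ℝ :=
  min (downMoney L p x j) (upMoney L p x i)

noncomputable def swapLoss (L : Segments ℝ d κ) (A : Fin d → Fin κ → ℝ) (p x : Fin d → ℝ)
    (j i : Fin d) : ℝ :=
  swapMoney L p x j i * (downRate L A p x j - upRate L A p x i)

noncomputable def swapBundle (L : Segments ℝ d κ) (p x : Fin d → ℝ) (j i : Fin d) : Fin d → ℝ :=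
  Function.update (Function.update x j (x j - swapMoney L p x j i / p j)) i
    (x i + swapMoney L p x j i / p i)

/-- Good `j` is bought up to an interior point of a segment. -/
def IsSplitGood (L : Segments ℝ d κ) (x : Fin d → ℝ) (j : Fin d) : Prop :=
  0 < x j ∧ x j < 1 ∧ L.lo j (x j) = L.hi j (x j)

/-- A good that is split in `x` has to take part in the swap; otherwise it could remain split next
to a newly split one. -/
def ValidSwap (L : Segments ℝ d κ) (x : Fin d → ℝ) (j i : Fin d) : Prop :=
  j ≠ i ∧ 0 < x j ∧ x i < 1 ∧ ∀ f, IsSplitGood L x f → f = j ∨ f = i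

variable {L : Segments ℝ d κ} {A : Fin d → Fin κ → ℝ} {p x z : Fin d → ℝ} {B : ℝ}

theorem isBreakpoint_iff (hL : L.Valid) (j : Fin d) (t : ℝ) :
    IsBreakpoint L j t ↔ t = 1 ∨ ∃ k < L.num j, t = L.pre j k := by
  refine or_congr Iff.rfl ⟨?_, ?_⟩
  · rintro ⟨k, hk, rfl⟩
    exact ⟨k, hk, L.start_eq_pre j k⟩
  · rintro ⟨k, hk, rfl⟩
    have := (hL.1 j).2
    exact ⟨⟨k, by omega⟩, hk, (L.start_eq_pre j ⟨k, _⟩).symm⟩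

theorem isSplitGood_iff (hL : L.Valid) (hx : x ∈ unitCube d) (j : Fin d) :
    IsSplitGood L x j ↔ ¬ IsBreakpoint L j (x j) := by
  rw [isBreakpoint_iff hL]
  constructor
  · rintro ⟨h0, h1, h2⟩ (h3 | ⟨k, hk, h3⟩)
    · linarith
    · obtain ⟨h4, h5, h6⟩ := hL.lo_spec j h0
      obtain ⟨h7, h8, h9⟩ := hL.hi_spec j h0.le
      have h10 : L.lo j (x j) < k := by
        by_contra h
        have := hL.pre_le k _ (not_lt.1 h) h4
        linarith
      have := h9 k (by omega) hk
      linarith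
  · intro h
    push Not at h
    obtain ⟨h1, h2⟩ := h
    have h0 : 0 < x j := (hx j).1.lt_of_ne' fun h => h2 0 (hL.num_pos j) (by rw [h, L.pre_zero])
    obtain ⟨h4, h5, h6⟩ := hL.lo_spec j h0
    obtain ⟨h7, h8, h9⟩ := hL.hi_spec j h0.le
    refine ⟨h0, lt_of_le_of_ne (hx j).2 h1, ?_⟩
    rcases lt_trichotomy (L.lo j (x j)) (L.hi j (x j)) with h | h | h
    · exact absurd (le_antisymm (h6 _ h h7) h8) (h2 _ h7)
    · exact h
    · have := h9 _ h h4; linarith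

theorem downMoney_pos (hL : L.Valid) (hp : ∀ j, 0 < p j) {j : Fin d} (hj : 0 < x j) :
    0 < downMoney L p x j := mul_pos (hp j) (sub_pos.2 (hL.lo_spec j hj).2.1)

theorem upMoney_pos (hL : L.Valid) (hp : ∀ j, 0 < p j) (hx : x ∈ unitCube d) {j : Fin d}
    (hj : x j < 1) : 0 < upMoney L p x j := mul_pos (hp j) (sub_pos.2 (hL.lt_top j (hx j).1 hj))

theorem swapMoney_pos (hL : L.Valid) (hp : ∀ j, 0 < p j) (hx : x ∈ unitCube d) {j i : Fin d}
    (hj : 0 < x j) (hi : x i < 1) : 0 < swapMoney L p x j i :=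
  lt_min (downMoney_pos hL hp hj) (upMoney_pos hL hp hx hi)

theorem swapBundle_spec (hL : L.Valid) (hA : IsSlopes L A) (hp : ∀ j, 0 < p j)
    (hx : x ∈ unitCube d) {j i : Fin d} (hji : j ≠ i) (hj : 0 < x j) (hi : x i < 1) :
    swapBundle L p x j i ∈ unitCube d ∧ p ⬝ᵥ swapBundle L p x j i = p ⬝ᵥ x ∧
      splcUtility L A (swapBundle L p x j i) = splcUtility L A x - swapLoss L A p x j i :=
  swap_spec hL hA hx hji (hp j) (hp i) (swapMoney_pos hL hp hx hj hi) hj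
    (min_le_left _ _) (min_le_right _ _)

theorem swapBundle_ne (hL : L.Valid) (hp : ∀ j, 0 < p j) (hx : x ∈ unitCube d) {j i : Fin d}
    (hj : 0 < x j) (hi : x i < 1) : swapBundle L p x j i ≠ x := by
  intro h
  have := congrFun h i
  simp only [swapBundle, Function.update_self] at this
  have := div_pos (swapMoney_pos hL hp hx hj hi) (hp i)
  linarith

/-- The swap stops as soon as one of the two goods reaches a breakpoint, so at most the other one is
split afterwards. -/
theorem swapBundle_isAdmissible (hL : L.Valid) (hA : IsSlopes L A) (hp : ∀ j, 0 < p j)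
    (hx : x ∈ unitCube d) (hB : B < ∑ j, p j) (hc : p ⬝ᵥ x = B) {j i : Fin d}
    (hv : ValidSwap L x j i) : IsAdmissible L p B (swapBundle L p x j i) := by
  obtain ⟨hji, hj, hi, hF⟩ := hv
  obtain ⟨h1, h2, -⟩ := swapBundle_spec hL hA hp hx hji hj hi
  refine Or.inr ⟨hB, h1, h2.trans hc, ?_⟩
  have hsub : ∀ f, ¬ IsBreakpoint L f (swapBundle L p x j i f) → f = j ∨ f = i := by
    intro f hf
    by_contra h
    push Not at h
    rw [swapBundle, Function.update_of_ne h.2, Function.update_of_ne h.1,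
      ← isSplitGood_iff hL hx] at hf
    rcases hF f hf with rfl | rfl
    exacts [h.1 rfl, h.2 rfl]
  rcases le_total (downMoney L p x j) (upMoney L p x i) with h | h
  · have hbr : IsBreakpoint L j (swapBundle L p x j i j) := by
      rw [isBreakpoint_iff hL]
      refine Or.inr ⟨_, (hL.lo_spec j hj).1, ?_⟩
      rw [swapBundle, Function.update_of_ne hji, Function.update_self, swapMoney, min_eq_left h,
        downMoney, mul_div_cancel_left₀ _ (hp j).ne']
      ring
    have : {f | ¬ IsBreakpoint L f (swapBundle L p x j i f)} ⊆ {i} := by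
      intro f hf
      rcases hsub f hf with rfl | h
      exacts [absurd hbr hf, h]
    exact (Set.ncard_le_ncard this).trans (Set.ncard_singleton _).le
  · have hbr : IsBreakpoint L i (swapBundle L p x j i i) := by
      rw [isBreakpoint_iff hL]
      rw [swapBundle, Function.update_self, swapMoney, min_eq_right h,
        upMoney, mul_div_cancel_left₀ _ (hp i).ne', add_sub_cancel]
      unfold Segments.top
      split_ifs with h3
      · rcases min_choice 1 (L.pre i (L.hi i (x i) + 1)) with h4 | h4
        · exact Or.inl h4
        · exact Or.inr ⟨_, h3, h4⟩
      · exact Or.inl rfl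
    have : {f | ¬ IsBreakpoint L f (swapBundle L p x j i f)} ⊆ {j} := by
      intro f hf
      rcases hsub f hf with h | rfl
      exacts [h, absurd hbr hf]
    exact (Set.ncard_le_ncard this).trans (Set.ncard_singleton _).le

theorem upRate_le_downRate (hL : L.Valid) (hA : IsSlopes L A) (hp : ∀ j, 0 < p j)
    (hx : x ∈ optimalBundles (splcUtility L A) p B) {j i : Fin d} (hji : j ≠ i) (hj : 0 < x j)
    (hi : x i < 1) : upRate L A p x i ≤ downRate L A p x j := by
  by_contra h
  push Not at h
  obtain ⟨h1, h2, h3⟩ := swapBundle_spec hL hA hp hx.1.1 hji hj hi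
  have := hx.2 _ ⟨h1, h2.le.trans hx.1.2⟩
  rw [h3, swapLoss] at this
  nlinarith [swapMoney_pos hL hp hx.1.1 hj hi]

theorem downMoney_le (hL : L.Valid) (hp : ∀ j, 0 < p j) (hx : x ∈ unitCube d) {j : Fin d} {t : ℝ}
    (ht : 0 ≤ t) (htx : t < x j) (hb : IsBreakpoint L j t) :
    downMoney L p x j ≤ p j * (x j - t) := by
  refine mul_le_mul_of_nonneg_left ?_ (hp j).le
  obtain ⟨h4, h5, h6⟩ := hL.lo_spec j (ht.trans_lt htx)
  rcases (isBreakpoint_iff hL j t).1 hb with rfl | ⟨k, hk, rfl⟩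
  · linarith [(hx j).2]
  · by_cases h : L.lo j (x j) < k
    · linarith [h6 k h hk]
    · linarith [hL.pre_le k _ (not_lt.1 h) h4]

theorem upMoney_le (hL : L.Valid) (hp : ∀ j, 0 < p j) (hx : x ∈ unitCube d) {j : Fin d} {t : ℝ}
    (htx : x j < t) (hb : IsBreakpoint L j t) : upMoney L p x j ≤ p j * (t - x j) := by
  refine mul_le_mul_of_nonneg_left ?_ (hp j).le
  obtain ⟨h4, h5, h6⟩ := hL.hi_spec j (hx j).1
  rcases (isBreakpoint_iff hL j t).1 hb with rfl | ⟨k, hk, rfl⟩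
  · linarith [L.top_le_one j (x j)]
  · have h : L.hi j (x j) < k := by
      by_contra h
      linarith [hL.pre_le k _ (not_lt.1 h) h4]
    unfold Segments.top
    rw [if_pos (by omega)]
    have := hL.pre_le _ k h hk
    linarith [min_le_right 1 (L.pre j (L.hi j (x j) + 1))]

/-- A lower bound for the loss of a bundle by the loss in a single good. -/
theorem loss_ge (hL : L.Valid) (hA : IsSlopes L A) (hp : ∀ j, 0 < p j) (hx : x ∈ unitCube d)
    (hz : z ∈ unitCube d) (hc : p ⬝ᵥ z = p ⬝ᵥ x) {c : ℝ}
    (hD : ∀ j, z j < x j → c ≤ downRate L A p x j) (hI : ∀ j, x j < z j → upRate L A p x j ≤ c)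
    (g : Fin d) :
    (z g < x g → (downRate L A p x g - c) * (p g * (x g - z g)) ≤
      splcUtility L A x - splcUtility L A z) ∧
    (x g < z g → (c - upRate L A p x g) * (p g * (z g - x g)) ≤
      splcUtility L A x - splcUtility L A z) := by
  classical
  set w : Fin d → ℝ := fun j => if z j < x j then downRate L A p x j else
    if x j < z j then upRate L A p x j else c with hw
  have h1 : splcUtility L A z - splcUtility L A x ≤ ∑ j, w j * p j * (z j - x j) := by
    have := splcUtility_sub_le hL hA (fun j => (hx j).1) (fun j => (hz j).1)
      (c := fun j => w j * p j) (fun j hj => by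
        have := (hp j).ne'
        simp only [hw, if_pos hj, downRate]; field_simp; exact le_rfl) (fun j hj => by
        have := (hp j).ne'
        simp only [hw, if_neg (not_lt.2 hj.le), if_pos hj, upRate]; field_simp; exact le_rfl)
    rw [dotProduct, dotProduct, ← Finset.sum_sub_distrib] at this
    simpa only [mul_sub] using this
  have h2 : ∑ j, p j * (z j - x j) = 0 := by
    simp only [mul_sub, Finset.sum_sub_distrib]
    exact sub_eq_zero.2 hc
  have h3 : ∑ j, (w j - c) * (p j * (x j - z j)) ≤ splcUtility L A x - splcUtility L A z := by
    have : ∑ j, (w j - c) * (p j * (x j - z j)) =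
        - ∑ j, w j * p j * (z j - x j) + c * ∑ j, p j * (z j - x j) := by
      rw [Finset.mul_sum, ← Finset.sum_neg_distrib, ← Finset.sum_add_distrib]
      exact Finset.sum_congr rfl fun j _ => by ring
    rw [this, h2]; linarith
  -- Because `c` separates the rates, all summands are non-negative, and each of them alone is a
  -- lower bound for the loss.
  have h4 : (w g - c) * (p g * (x g - z g)) ≤ ∑ j, (w j - c) * (p j * (x j - z j)) := by
    refine Finset.single_le_sum (f := fun j => (w j - c) * (p j * (x j - z j))) (fun j _ => ?_)
      (Finset.mem_univ g)
    rcases lt_trichotomy (x j) (z j) with h | h | h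
    · simp only [hw, if_neg (not_lt.2 h.le), if_pos h]
      exact mul_nonneg_of_nonpos_of_nonpos (sub_nonpos.2 (hI j h))
        (mul_nonpos_of_nonneg_of_nonpos (hp j).le (by linarith))
    · simp [h]
    · simp only [hw, if_pos h]
      exact mul_nonneg (sub_nonneg.2 (hD j h)) (mul_nonneg (hp j).le (by linarith))
  refine ⟨fun h => ?_, fun h => ?_⟩
  · simp only [hw, if_pos h] at h4
    linarith
  · simp only [hw, if_neg (not_lt.2 h.le), if_pos h] at h4
    linarith

theorem exists_ne_of_cost_eq (hp : ∀ j, 0 < p j) (hc : p ⬝ᵥ z = p ⬝ᵥ x) {f : Fin d}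
    (hf : z f ≠ x f) : ∃ g, g ≠ f ∧ z g ≠ x g := by
  by_contra h
  push Not at h
  have : ∑ j, p j * (z j - x j) = 0 := by
    simp only [mul_sub, Finset.sum_sub_distrib]
    exact sub_eq_zero.2 hc
  rw [Finset.sum_eq_single f (fun g _ hg => by rw [h g hg]; ring) (by simp)] at this
  rcases mul_eq_zero.1 this with h1 | h1
  · exact (hp f).ne' h1
  · exact hf (sub_eq_zero.1 h1)

theorem exists_lt_of_cost_eq (hp : ∀ j, 0 < p j) (hc : p ⬝ᵥ z = p ⬝ᵥ x) (hzx : z ≠ x) :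
    ∃ j, z j < x j := by
  by_contra h
  push Not at h
  obtain ⟨i, hi⟩ := Function.ne_iff.1 hzx
  refine absurd hc (ne_of_gt ?_)
  refine Finset.sum_lt_sum (fun j _ => mul_le_mul_of_nonneg_left (h j) (hp j).le)
    ⟨i, Finset.mem_univ _, mul_lt_mul_of_pos_left (lt_of_le_of_ne (h i) hi.symm) (hp i)⟩

/-- At most one amount in `z` is not a breakpoint, so some good between `x` and `z` moves at least
as much money as a suitable swap. By `loss_ge`, with the rate of the partner in the swap as
separating value `c`, this good alone accounts for the loss of the swap. If a good `f` is split in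
`x` then it is the partner. Otherwise the partner is the sold good with the worst rate or the bought
good with the best one. -/
theorem exists_validSwap (hL : L.Valid) (hA : IsSlopes L A) (hp : ∀ j, 0 < p j)
    (hx : x ∈ optimalBundles (splcUtility L A) p B) (hz : z ∈ unitCube d)
    (hc : p ⬝ᵥ z = p ⬝ᵥ x) (hzx : z ≠ x)
    (hxF : {j | ¬ IsBreakpoint L j (x j)}.ncard ≤ 1)
    (hzF : {j | ¬ IsBreakpoint L j (z j)}.ncard ≤ 1) :
    ∃ j i, ValidSwap L x j i ∧ swapLoss L A p x j i ≤ splcUtility L A x - splcUtility L A z := by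
  have hx1 := hx.1.1
  rw [Set.ncard_le_one] at hxF hzF
  have hxF' : ∀ f g, IsSplitGood L x f → IsSplitGood L x g → f = g := fun f g hf hg =>
    hxF f ((isSplitGood_iff hL hx1 f).1 hf) g ((isSplitGood_iff hL hx1 g).1 hg)
  by_cases hF : ∃ f, IsSplitGood L x f
  · obtain ⟨f, hf⟩ := hF
    -- Both one-sided rates of the split good coincide, so its rate separates all other down rates
    -- from all other up rates.
    have hrate : downRate L A p x f = upRate L A p x f := by
      rw [downRate, upRate, hf.2.2]
    have hloss := loss_ge hL hA hp hx1 hz hc (c := upRate L A p x f) (fun j hj => by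
      by_cases hjf : j = f
      · rw [hjf, hrate]
      · exact upRate_le_downRate hL hA hp hx hjf ((hz j).1.trans_lt hj) hf.2.1) (fun j hj => by
      by_cases hjf : j = f
      · rw [hjf]
      · rw [← hrate]
        exact upRate_le_downRate hL hA hp hx (Ne.symm hjf) hf.1 (hj.trans_le (hz j).2))
    have hdown : ∀ g, g ≠ f → z g < x g → swapMoney L p x g f ≤ p g * (x g - z g) →
        ∃ j i, ValidSwap L x j i ∧
          swapLoss L A p x j i ≤ splcUtility L A x - splcUtility L A z := by
      intro g hgf hg hm
      refine ⟨g, f, ⟨hgf, (hz g).1.trans_lt hg, hf.2.1, fun f' hf' => Or.inr (hxF' _ _ hf' hf)⟩,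
        ?_⟩
      have h1 := (hloss g).1 hg
      have h2 := upRate_le_downRate hL hA hp hx hgf ((hz g).1.trans_lt hg) hf.2.1
      have h3 := mul_le_mul_of_nonneg_right hm (sub_nonneg.2 h2)
      rw [swapLoss]; linarith
    have hup : ∀ g, g ≠ f → x g < z g → swapMoney L p x f g ≤ p g * (z g - x g) →
        ∃ j i, ValidSwap L x j i ∧
          swapLoss L A p x j i ≤ splcUtility L A x - splcUtility L A z := by
      intro g hgf hg hm
      refine ⟨f, g, ⟨hgf.symm, hf.1, hg.trans_le (hz g).2, fun f' hf' => Or.inl (hxF' _ _ hf' hf)⟩,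
        ?_⟩
      have h1 := (hloss g).2 hg
      have h2 := upRate_le_downRate hL hA hp hx hgf.symm hf.1 (hg.trans_le (hz g).2)
      have h3 := mul_le_mul_of_nonneg_right hm (sub_nonneg.2 h2)
      rw [swapLoss, hrate] at *; linarith
    have hfull : ∀ g, g ≠ f → z g ≠ x g → IsBreakpoint L g (z g) → ∃ j i, ValidSwap L x j i ∧
          swapLoss L A p x j i ≤ splcUtility L A x - splcUtility L A z := by
      intro g hgf hg hb
      rcases lt_or_gt_of_ne hg with h | h
      · exact hdown g hgf h ((min_le_left _ _).trans (downMoney_le hL hp hx1 (hz g).1 h hb))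
      · exact hup g hgf h ((min_le_right _ _).trans (upMoney_le hL hp hx1 h hb))
    obtain ⟨g, hgf, hg⟩ : ∃ g, g ≠ f ∧ z g ≠ x g := by
      obtain ⟨i, hi⟩ := Function.ne_iff.1 hzx
      by_cases hif : i = f
      · subst hif; exact exists_ne_of_cost_eq hp hc hi
      · exact ⟨i, hif, hi⟩
    by_cases hb : IsBreakpoint L g (z g)
    · exact hfull g hgf hg hb
    have hothers : ∀ g', g' ≠ g → IsBreakpoint L g' (z g') := by
      intro g' hg'
      by_contra h
      exact hg' (hzF g' h g hb)
    by_cases h2 : ∃ g', g' ≠ f ∧ g' ≠ g ∧ z g' ≠ x g'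
    · obtain ⟨g', h3, h4, h5⟩ := h2
      exact hfull g' h3 h5 (hothers g' h4)
    push Not at h2
    -- Only `f` and `g` change, so they exchange the same sum. As `g` is the split good of `z`, the
    -- good `f` ends at a breakpoint and takes the role of the limiting good.
    have hmoney : p g * (z g - x g) + p f * (z f - x f) = 0 := by
      have : ∑ j, p j * (z j - x j) = 0 := by
        simp only [mul_sub, Finset.sum_sub_distrib]
        exact sub_eq_zero.2 hc
      rw [← this, Finset.sum_eq_add_of_mem g f (Finset.mem_univ _) (Finset.mem_univ _) hgf]
      rintro j - ⟨h3, h4⟩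
      rw [h2 j h4 h3]; ring
    have hbf := hothers f (Ne.symm hgf)
    rcases lt_or_gt_of_ne hg with h | h
    · have h3 : 0 < p g * (x g - z g) := mul_pos (hp g) (by linarith)
      have h4 : x f < z f := by
        have : 0 < p f * (z f - x f) := by linarith
        have := (pos_iff_pos_of_mul_pos this).1 (hp f)
        linarith
      refine hdown g hgf h ((min_le_right _ _).trans ((upMoney_le hL hp hx1 h4 hbf).trans ?_))
      linarith
    · have h3 : 0 < p g * (z g - x g) := mul_pos (hp g) (by linarith)
      have h4 : z f < x f := by
        have : 0 < p f * (x f - z f) := by linarith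
        have := (pos_iff_pos_of_mul_pos this).1 (hp f)
        linarith
      refine hup g hgf h ((min_le_left _ _).trans ((downMoney_le hL hp hx1 (hz f).1 h4 hbf).trans ?_))
      linarith
  · have hval : ∀ j i, z j < x j → x i < z i → ValidSwap L x j i := fun j i hj hi =>
      ⟨by rintro rfl; linarith, (hz j).1.trans_lt hj, hi.trans_le (hz i).2,
        fun f hf => absurd ⟨f, hf⟩ hF⟩
    have hrates : ∀ j i, z j < x j → x i < z i → upRate L A p x i ≤ downRate L A p x j :=
      fun j i hj hi => upRate_le_downRate hL hA hp hx (hval j i hj hi).1 (hval j i hj hi).2.1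
        (hval j i hj hi).2.2.1
    obtain ⟨j0, hj0⟩ := exists_lt_of_cost_eq hp hc hzx
    obtain ⟨i0, hi0⟩ := exists_lt_of_cost_eq hp hc.symm hzx.symm
    -- Since `z` has at most one split good, all bought goods or all sold goods end at breakpoints.
    -- A good of that kind bounds the money of the swap, and the partner is taken from the other
    -- side by its rate.
    by_cases hb : ∀ i, x i < z i → IsBreakpoint L i (z i)
    · obtain ⟨j, hj, hmin⟩ := (Finset.univ.filter fun j => z j < x j).exists_min_image
          (downRate L A p x) ⟨j0, by simpa using hj0⟩
      simp only [Finset.mem_filter, Finset.mem_univ, true_and] at hj hmin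
      refine ⟨j, i0, hval _ _ hj hi0, ?_⟩
      have h1 := (loss_ge hL hA hp hx1 hz hc (c := downRate L A p x j) hmin
        (fun i hi => hrates j i hj hi) i0).2 hi0
      have h2 : swapMoney L p x j i0 ≤ p i0 * (z i0 - x i0) :=
        (min_le_right _ _).trans (upMoney_le hL hp hx1 hi0 (hb i0 hi0))
      have h3 := mul_le_mul_of_nonneg_right h2 (sub_nonneg.2 (hrates j i0 hj hi0))
      rw [swapLoss]; linarith
    · push Not at hb
      obtain ⟨i1, hi1, hbi1⟩ := hb
      have hb' : ∀ j, z j < x j → IsBreakpoint L j (z j) := by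
        intro j hj
        by_contra h
        have := hzF j h i1 hbi1
        subst this
        linarith
      obtain ⟨i, hi, hmax⟩ := (Finset.univ.filter fun j => x j < z j).exists_max_image
          (upRate L A p x) ⟨i0, by simpa using hi0⟩
      simp only [Finset.mem_filter, Finset.mem_univ, true_and] at hi hmax
      refine ⟨j0, i, hval _ _ hj0 hi, ?_⟩
      have h1 := (loss_ge hL hA hp hx1 hz hc (c := upRate L A p x i)
        (fun j hj => hrates j i hj hi) hmax j0).1 hj0
      have h2 : swapMoney L p x j0 i ≤ p j0 * (x j0 - z j0) :=
        (min_le_left _ _).trans (downMoney_le hL hp hx1 (hz j0).1 hj0 (hb' j0 hj0))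
      have h3 := mul_le_mul_of_nonneg_right h2 (sub_nonneg.2 (hrates j0 i hj0 hi))
      rw [swapLoss]; linarith

/-- The best swap is found among those that involve a fractional good, a good with the best next
segment or a good with the worst last segment. -/
theorem exists_validSwap_of_mem (hL : L.Valid) (hA : IsSlopes L A) (hp : ∀ j, 0 < p j)
    (hx : x ∈ optimalBundles (splcUtility L A) p B) {H : Set (Fin d)}
    (hf : ∀ f, IsSplitGood L x f → f ∈ H)
    (hup : ∀ i, x i < 1 → ∃ h ∈ H, x h < 1 ∧ ∀ i, x i < 1 → upRate L A p x i ≤ upRate L A p x h)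
    (hdown : ∀ j, 0 < x j → ∃ h ∈ H, 0 < x h ∧
      ∀ j, 0 < x j → downRate L A p x h ≤ downRate L A p x j)
    {j i : Fin d} (hv : ValidSwap L x j i) :
    ∃ j' i', ValidSwap L x j' i' ∧ (j' ∈ H ∨ i' ∈ H) ∧
      swapLoss L A p x j' i' ≤ swapLoss L A p x j i := by
  have hx1 := hx.1.1
  by_cases hH : j ∈ H ∨ i ∈ H
  · exact ⟨j, i, hv, hH, le_rfl⟩
  push Not at hH
  obtain ⟨hji, hj, hi, hF⟩ := hv
  have hF' : ∀ f, ¬ IsSplitGood L x f := by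
    intro f hf'
    rcases hF f hf' with rfl | rfl
    exacts [hH.1 (hf _ hf'), hH.2 (hf _ hf')]
  -- The good that limits the money is kept and its partner is replaced by the candidate with the
  -- best rate. Neither the money moved nor the difference of the rates increases.
  rcases le_total (downMoney L p x j) (upMoney L p x i) with h | h
  · obtain ⟨i', h1, h2, h3⟩ := hup i hi
    have hne : j ≠ i' := by rintro rfl; exact hH.1 h1
    refine ⟨j, i', ⟨hne, hj, h2, fun f hf => absurd hf (hF' f)⟩, Or.inr h1, ?_⟩
    have h4 := upRate_le_downRate hL hA hp hx hne hj h2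
    have h5 : swapMoney L p x j i' ≤ swapMoney L p x j i := by
      rw [swapMoney, swapMoney, min_eq_left h]; exact min_le_left _ _
    exact mul_le_mul h5 (by linarith [h3 i hi]) (by linarith) (swapMoney_pos hL hp hx1 hj hi).le
  · obtain ⟨j', h1, h2, h3⟩ := hdown j hj
    have hne : j' ≠ i := by rintro rfl; exact hH.2 h1
    refine ⟨j', i, ⟨hne, h2, hi, fun f hf => absurd hf (hF' f)⟩, Or.inl h1, ?_⟩
    have h4 := upRate_le_downRate hL hA hp hx hne h2 hi
    have h5 : swapMoney L p x j' i ≤ swapMoney L p x j i := by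
      rw [swapMoney, swapMoney, min_eq_right h]; exact min_le_right _ _
    exact mul_le_mul h5 (by linarith [h3 j hj]) (by linarith) (swapMoney_pos hL hp hx1 hj hi).le

/-- A swap that is best among those with a member of `H` yields a second best bundle. -/
theorem isSecondBest_of_minimal (hL : L.Valid) (hA : IsSlopes L A) (hp : ∀ j, 0 < p j)
    (hx : x ∈ optimalBundles (splcUtility L A) p B) (hB : B < ∑ j, p j) (hc : p ⬝ᵥ x = B)
    (hxF : {j | ¬ IsBreakpoint L j (x j)}.ncard ≤ 1) {H : Set (Fin d)}
    (hf : ∀ f, IsSplitGood L x f → f ∈ H)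
    (hup : ∀ i, x i < 1 → ∃ h ∈ H, x h < 1 ∧ ∀ i, x i < 1 → upRate L A p x i ≤ upRate L A p x h)
    (hdown : ∀ j, 0 < x j → ∃ h ∈ H, 0 < x h ∧
      ∀ j, 0 < x j → downRate L A p x h ≤ downRate L A p x j)
    {j i : Fin d} (hv : ValidSwap L x j i)
    (hmin : ∀ j' i', ValidSwap L x j' i' → (j' ∈ H ∨ i' ∈ H) →
      swapLoss L A p x j i ≤ swapLoss L A p x j' i') :
    IsSecondBest L A p B x (swapBundle L p x j i) := by
  refine ⟨swapBundle_isAdmissible hL hA hp hx.1.1 hB hc hv,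
    swapBundle_ne hL hp hx.1.1 hv.2.1 hv.2.2.1, fun z hz hzx => ?_⟩
  rcases hz with ⟨h, -⟩ | ⟨-, hz1, hz2, hz3⟩
  · linarith
  obtain ⟨j', i', h1, h2⟩ := exists_validSwap hL hA hp hx hz1 (hz2.trans hc.symm) hzx hxF hz3
  obtain ⟨j'', i'', h3, h4, h5⟩ := exists_validSwap_of_mem hL hA hp hx hf hup hdown h1
  have := hmin j'' i'' h3 h4
  rw [(swapBundle_spec hL hA hp hx.1.1 hv.1 hv.2.1 hv.2.2.1).2.2]
  linarith

end SecondBest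

/-! ## A program for second best bundles -/

section UnitTriple

variable {P Q R : Mem ℝ → Prop}

/-- Total correctness at unit cost. -/
abbrev UnitTriple (P : Mem ℝ → Prop) (q : Prog) (Q : Mem ℝ → Prop) (T : ℕ) : Prop :=
  Triple (unitCost ℝ) (fun _ => 0) (fun _ => 0) 0 P q Q T

theorem Prog.safe_zero (q : Prog) (s : Mem ℝ) (G : ℕ) :
    q.Safe (fun _ => 0) (fun _ => 0) G s := by
  induction q generalizing s with
  | skip => trivial
  | setNat => exact Nat.zero_le _
  | setNum => exact Nat.zero_le _
  | seq _ _ h1 h2 => exact ⟨h1 _, h2 _⟩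
  | ite _ _ _ h1 h2 => exact ⟨fun _ => h1 _, fun _ => h2 _⟩
  | loop => trivial

theorem UnitTriple.straight {q : Prog} (hq : q.Straight) (hP : ∀ s, P s → Q (q.res s)) :
    UnitTriple P q Q 1 :=
  Triple.straight (tame_unitCost ℝ) hq fun s _ hs => ⟨q.safe_zero s 0, hP s hs⟩

theorem UnitTriple.forLoop {a : ℕ} {n : NExp} {q : Prog} {T N : ℕ} (I : ℕ → Mem ℝ → Prop)
    (hstab : ∀ i v s, I i s → I i (s.writeNat a 0 0 v)) (hb : ∀ i s, I i s → n.eval s = N)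
    (hbody : ∀ i < N, UnitTriple (fun s => I i s ∧ s.nat a 0 0 = i) q
      (fun s => I (i + 1) s ∧ s.nat a 0 0 = i) T) :
    UnitTriple (I 0) (.forLoop a n q) (I N) (N * (T + 1) + 2) :=
  Triple.forLoop (tame_unitCost ℝ) I (fun _ _ => Nat.zero_le _) hstab hb hbody

end UnitTriple

section SecondBestProgram

/-- The `j`-th cell of the first row. -/
def NExp.row (a : ℕ) (j : NExp) : NExp := .read a (.const 0) j

/-- The `j`-th cell of row `i`. -/
def RExp.row (a i : ℕ) (j : NExp) : RExp := .read a (.const i) j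

def Test.lt (e f : RExp) : Test := .neg (.rle f e)

def Test.nlt (e f : NExp) : Test := .neg (.nle f e)

def Test.disj (b c : Test) : Test := .neg (.conj (.neg b) (.neg c))

namespace SecondBestProgram

/-- Memory of the program. Natural numbers: 10 and 11 are counters, 16 holds the next segments, row
0 of 12 the three candidates (the split good, the good with the best next segment, the good with the
worst last segment), 13 and 14 the goods of the best swap. Goods in 12 to 14 are stored plus one,
and zero means that there is none. Field elements: rows 0 to 3 of 7 hold down money, down rate, up
money and up rate, 8 the loss and the money of the best swap, 9 is scratch, 6 is the output. -/
def J : NExp := .cell 10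

def bought : NExp := .row 2 J

/-- The last segment bought. -/
def last : NExp := .sub bought (.const 1)

/-- The next segment to be bought. -/
def next : NExp := .row 16 J

def downRates : Prog :=
  .ite (.lt .zero (.row 3 0 J))
    (.seq (.setNum 7 (.const 0) J (.mul (.row 1 0 J) (.read 5 J last)))
      (.setNum 7 (.const 1) J (.div (.read 4 J last) (.row 1 0 J))))
    .skip

def pickDown : Prog :=
  .ite (.lt .zero (.row 3 0 J))
    (.ite (.disj (.nle (.row 12 (.const 2)) (.const 0))
        (.lt (.row 7 1 J) (.row 7 1 (.sub (.row 12 (.const 2)) (.const 1)))))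
      (.setNat 12 (.const 0) (.const 2) (.add J (.const 1))) .skip)
    .skip

/-- A further segment is begun if there is one and the last segment bought is full, or if nothing
has been bought. Otherwise the good, not being complete, is split. -/
def nextSegments : Prog :=
  .ite (.lt (.row 3 0 J) .one)
    (.ite (.conj (.nlt bought (.row 1 J)) (.disj (.nle bought (.const 0))
        (.rle (.read 0 J last) (.read 5 J last))))
      (.setNat 16 (.const 0) J bought)
      (.seq (.setNat 16 (.const 0) J last) (.setNat 12 (.const 0) (.const 0) (.add J (.const 1)))))
    .skip

def upRates : Prog :=
  .ite (.lt (.row 3 0 J) .one)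
    (.seq (.setNum 7 (.const 3) J (.div (.read 4 J next) (.row 1 0 J)))
      (.ite (.conj (.nlt (.add next (.const 1)) (.row 1 J))
          (.lt (.sub (.read 0 J next) (.read 5 J next)) (.sub .one (.row 3 0 J))))
        (.setNum 7 (.const 2) J (.mul (.row 1 0 J) (.sub (.read 0 J next) (.read 5 J next))))
        (.setNum 7 (.const 2) J (.mul (.row 1 0 J) (.sub .one (.row 3 0 J))))))
    .skip

def pickUp : Prog :=
  .ite (.lt (.row 3 0 J) .one)
    (.ite (.disj (.nle (.row 12 (.const 1)) (.const 0))
        (.lt (.row 7 3 (.sub (.row 12 (.const 1)) (.const 1))) (.row 7 3 J)))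
      (.setNat 12 (.const 0) (.const 1) (.add J (.const 1))) .skip)
    .skip

def nequal (e f : NExp) : Test := .disj (.nlt e f) (.nlt f e)

def equal (e f : NExp) : Test := .conj (.nle e f) (.nle f e)

/-- Compare the swap from good `j` to good `i` to the best one that has been found. -/
def trySwap (j i : NExp) : Prog :=
  .ite (.conj (nequal j i) (.conj (.lt .zero (.row 3 0 j)) (.conj (.lt (.row 3 0 i) .one)
      (.disj (.nle (.row 12 (.const 0)) (.const 0))
        (.disj (equal (.row 12 (.const 0)) (.add j (.const 1)))
          (equal (.row 12 (.const 0)) (.add i (.const 1))))))))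
    (.seq
      (.ite (.rle (.row 7 0 j) (.row 7 2 i))
        (.setNum 9 (.const 0) (.const 0) (.row 7 0 j))
        (.setNum 9 (.const 0) (.const 0) (.row 7 2 i)))
      (.seq
        (.setNum 9 (.const 0) (.const 1)
          (.mul (.row 9 0 (.const 0)) (.sub (.row 7 1 j) (.row 7 3 i))))
        (.ite (.disj (.nle (.cell 13) (.const 0))
            (.lt (.row 9 0 (.const 1)) (.row 8 0 (.const 0))))
          (.seq (.setNat 13 (.const 0) (.const 0) (.add j (.const 1)))
            (.seq (.setNat 14 (.const 0) (.const 0) (.add i (.const 1)))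
              (.seq (.setNum 8 (.const 0) (.const 0) (.row 9 0 (.const 1)))
                (.setNum 8 (.const 0) (.const 1) (.row 9 0 (.const 0))))))
          .skip)))
    .skip

def candidate : NExp := .row 12 (.cell 11)

/-- Each good is paired, in both directions, with three candidates only. This makes the number of
swaps linear in `d`. -/
def trySwaps : Prog :=
  .ite (.nlt (.const 0) candidate)
    (.seq (trySwap J (.sub candidate (.const 1))) (trySwap (.sub candidate (.const 1)) J))
    .skip

def bestDown : NExp := .sub (.cell 13) (.const 1)

def bestUp : NExp := .sub (.cell 14) (.const 1)

def output : Prog :=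
  .seq (.setNum 6 (.const 0) bestDown
      (.sub (.row 6 0 bestDown) (.div (.row 8 0 (.const 1)) (.row 1 0 bestDown))))
    (.setNum 6 (.const 0) bestUp
      (.add (.row 6 0 bestUp) (.div (.row 8 0 (.const 1)) (.row 1 0 bestUp))))

def forGoods (q : Prog) : Prog := .forLoop 10 (.cell 0) q

def prog : Prog :=
  .seq (forGoods downRates) (.seq (forGoods pickDown) (.seq (forGoods nextSegments)
    (.seq (forGoods upRates) (.seq (forGoods pickUp)
      (.seq (forGoods (.forLoop 11 (.const 3) trySwaps))
        (.seq (forGoods (.setNum 6 (.const 0) J (.row 3 0 J))) output))))))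

variable {d κ : ℕ}

/-- The input is still in the memory. -/
structure Input (L : Segments ℝ d κ) (A : Fin d → Fin κ → ℝ) (p x : Fin d → ℝ) (s : Mem ℝ) :
    Prop where
  dim : s.nat 0 0 0 = d
  num : ∀ j : Fin d, s.nat 1 0 j = L.num j
  bought : ∀ j : Fin d, s.nat 2 0 j = L.bought x j
  len : ∀ (j : Fin d) (k : Fin κ), s.num 0 j k = L.len j k
  price : ∀ j : Fin d, s.num 1 0 j = p j
  bundle : ∀ j : Fin d, s.num 3 0 j = x j
  slope : ∀ (j : Fin d) (k : ℕ), s.num 4 j k = padVec (A j) k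
  alloc : ∀ (j : Fin d) (k : Fin κ), s.num 5 j k = L.alloc j k (x j)

variable {L : Segments ℝ d κ} {A : Fin d → Fin κ → ℝ} {p x : Fin d → ℝ} {s : Mem ℝ}

theorem input_secondBestInput (L : Segments ℝ d κ) (A : Fin d → Fin κ → ℝ) (p : Fin d → ℝ) (B : ℝ)
    (x : Fin d → ℝ) : Input L A p x (secondBestInput L A p B x) := by
  constructor <;> intros <;> simp [secondBestInput, padMat, padVec]

theorem Input.writeNat (h : Input L A p x s) {a : ℕ} (i j v : ℕ) (ha : 3 ≤ a) :
    Input L A p x (s.writeNat a i j v) := by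
  have h0 : a ≠ 0 := by omega
  have h1 : a ≠ 1 := by omega
  have h2 : a ≠ 2 := by omega
  constructor <;> intros <;>
    simp [Mem.writeNat, h0.symm, h1.symm, h2.symm, h.dim, h.num, h.bought, h.len, h.price,
      h.bundle, h.slope, h.alloc]

theorem Input.writeNum (h : Input L A p x s) {a : ℕ} (i j : ℕ) (v : ℝ) (ha : 6 ≤ a) :
    Input L A p x (s.writeNum a i j v) := by
  have h0 : a ≠ 0 := by omega
  have h1 : a ≠ 1 := by omega
  have h3 : a ≠ 3 := by omega
  have h4 : a ≠ 4 := by omega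
  have h5 : a ≠ 5 := by omega
  constructor <;> intros <;>
    simp [Mem.writeNum, h0.symm, h1.symm, h3.symm, h4.symm, h5.symm, h.dim, h.num, h.bought, h.len,
      h.price, h.bundle, h.slope, h.alloc]

theorem alloc_of_mem (hL : L.Valid) {j : Fin d} {k : Fin κ} (hk : (k : ℕ) < L.num j) {t : ℝ}
    (h1 : L.pre j k ≤ t) (h2 : (k : ℕ) + 1 < L.num j → t ≤ L.pre j (k + 1)) :
    L.alloc j k t = t - L.pre j k := by
  rw [hL.alloc_eq hk]
  simp only [segCut, hk, if_true, min_eq_right h1]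
  split_ifs with h
  · rw [min_eq_left (h2 h)]
  · rfl

theorem pre_succ (L : Segments ℝ d κ) (j : Fin d) (k : Fin κ) :
    L.pre j (k + 1) = L.pre j k + L.len j k := by
  unfold Segments.pre
  rw [Finset.sum_range_succ, padVec_of_lt _ k.2]

theorem bought_eq (hL : L.Valid) {j : Fin d} (hj : 0 < x j) : L.bought x j = L.lo j (x j) + 1 := by
  obtain ⟨h4, h5, h6⟩ := hL.lo_spec j hj
  have hκ := (hL.1 j).2
  have : {k : Fin κ | (k : ℕ) < L.num j ∧ L.start j k < x j} =
      ((Finset.univ.filter fun k : Fin κ => (k : ℕ) < L.lo j (x j) + 1 : Finset (Fin κ)) :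
        Set (Fin κ)) := by
    ext k
    simp only [Set.mem_ofPred_eq, L.start_eq_pre, Finset.coe_filter, Finset.mem_univ, true_and]
    constructor
    · rintro ⟨h1, h2⟩
      by_contra h
      have := h6 k (by omega) h1
      linarith
    · intro h
      exact ⟨by omega, (hL.pre_le _ _ (by omega) h4).trans_lt h5⟩
  rw [Segments.bought, this, Set.ncard_coe_finset, Fin.card_filter_val_lt]
  omega

theorem bought_eq_zero (hL : L.Valid) {j : Fin d} (hj : x j = 0) : L.bought x j = 0 := by
  have : {k : Fin κ | (k : ℕ) < L.num j ∧ L.start j k < x j} = ∅ := by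
    ext k
    simp only [Set.mem_ofPred_eq, L.start_eq_pre, hj, Set.mem_empty_iff_false, iff_false, not_and,
      not_lt]
    exact fun h => hL.pre_nonneg h
  rw [Segments.bought, this, Set.ncard_empty]

theorem lo_le_hi (hL : L.Valid) {j : Fin d} {t : ℝ} (ht : 0 < t) : L.lo j t ≤ L.hi j t := by
  obtain ⟨h4, h5, h6⟩ := hL.lo_spec j ht
  obtain ⟨h7, h8, h9⟩ := hL.hi_spec j ht.le
  by_contra h
  have := h9 _ (not_le.1 h) h4
  linarith

theorem hi_le (hL : L.Valid) {j : Fin d} {t : ℝ} (ht : 0 < t) : L.hi j t ≤ L.lo j t + 1 := by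
  obtain ⟨h4, h5, h6⟩ := hL.lo_spec j ht
  obtain ⟨h7, h8, h9⟩ := hL.hi_spec j ht.le
  by_contra h
  push Not at h
  have h1 := h6 (L.lo j t + 1) (by omega) (by omega)
  have h2 := hL.pre_lt h h7
  linarith

theorem alloc_lo (hL : L.Valid) {j : Fin d} {t : ℝ} (ht : 0 < t) (h : L.lo j t < κ) :
    L.alloc j ⟨L.lo j t, h⟩ t = t - L.pre j (L.lo j t) := by
  obtain ⟨h4, h5, h6⟩ := hL.lo_spec j ht
  exact alloc_of_mem hL h4 h5.le fun h => h6 _ (Nat.lt_succ_self _) h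

theorem alloc_hi (hL : L.Valid) {j : Fin d} {t : ℝ} (ht : 0 ≤ t) (h : L.hi j t < κ) :
    L.alloc j ⟨L.hi j t, h⟩ t = t - L.pre j (L.hi j t) := by
  obtain ⟨h4, h5, h6⟩ := hL.hi_spec j ht
  exact alloc_of_mem hL h4 h5 fun h => (h6 _ (Nat.lt_succ_self _) h).le

/-- The condition by which the program finds the next segment. -/
theorem hi_eq_bought_iff (hL : L.Valid) (hx : x ∈ unitCube d) (j : Fin d) :
    (L.hi j (x j) = L.bought x j ↔ L.bought x j < L.num j ∧ (L.bought x j = 0 ∨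
      ∃ h : L.bought x j - 1 < κ, L.len j ⟨_, h⟩ ≤ L.alloc j ⟨_, h⟩ (x j))) ∧
    (L.hi j (x j) ≠ L.bought x j → 0 < x j ∧ L.hi j (x j) = L.lo j (x j)) := by
  obtain ⟨h7, h8, h9⟩ := hL.hi_spec j (hx j).1
  have hκ := (hL.1 j).2
  rcases (hx j).1.eq_or_lt with h0 | h0
  · have hb := bought_eq_zero hL h0.symm
    have : L.hi j (x j) = 0 := by
      by_contra h
      have := hL.pre_lt (Nat.pos_of_ne_zero h) h7
      rw [L.pre_zero] at this
      linarith
    simp [hb, this, hL.num_pos j]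
  · obtain ⟨h4, h5, h6⟩ := hL.lo_spec j h0
    have hb := bought_eq hL h0
    have h1 := lo_le_hi hL (j := j) h0
    have h2 := hi_le hL (j := j) h0
    rw [hb]
    have hlo : L.lo j (x j) < κ := by omega
    refine ⟨⟨fun h => ⟨by omega, Or.inr ⟨by omega, ?_⟩⟩, ?_⟩, fun h => ⟨h0, by omega⟩⟩
    · simp only [Nat.add_sub_cancel, alloc_lo hL h0 hlo]
      have h3 := pre_succ L j ⟨_, hlo⟩
      simp only at h3
      rw [h] at h8
      linarith
    · rintro ⟨h3, h | ⟨h, h'⟩⟩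
      · omega
      · simp only [Nat.add_sub_cancel, alloc_lo hL h0 hlo] at h'
        have h10 := pre_succ L j ⟨_, hlo⟩
        simp only at h10
        by_contra hne
        have := h9 (L.lo j (x j) + 1) (by omega) h3
        linarith

/-- The end points of segments are sums that cannot be recomputed in constant time. The allocation
to the current segment, which is part of the input, replaces them, so that the time does not depend
on `κ`. -/
theorem upMoney_eq (hL : L.Valid) (hx : x ∈ unitCube d) (j : Fin d) (h : L.hi j (x j) < κ) :
    upMoney L p x j = if L.hi j (x j) + 1 < L.num j ∧
      L.len j ⟨_, h⟩ - L.alloc j ⟨_, h⟩ (x j) < 1 - x j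
      then p j * (L.len j ⟨_, h⟩ - L.alloc j ⟨_, h⟩ (x j)) else p j * (1 - x j) := by
  rw [upMoney, alloc_hi hL (hx j).1]
  have h3 := pre_succ L j ⟨_, h⟩
  simp only at h3
  unfold Segments.top
  rw [h3]
  split_ifs with h1 h2 h2
  · rw [min_eq_right (by linarith [h2.2])]
    ring
  · rw [min_eq_left]
    have : ¬ _ := fun h => h2 ⟨h1, h⟩
    linarith
  · exact absurd h2.1 h1
  · rfl

def DownRates (L : Segments ℝ d κ) (A : Fin d → Fin κ → ℝ) (p x : Fin d → ℝ) (n : ℕ)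
    (s : Mem ℝ) : Prop :=
  ∀ j : Fin d, (j : ℕ) < n → 0 < x j → s.num 7 0 j = downMoney L p x j ∧
    s.num 7 1 j = downRate L A p x j

def UpRates (L : Segments ℝ d κ) (A : Fin d → Fin κ → ℝ) (p x : Fin d → ℝ) (n : ℕ)
    (s : Mem ℝ) : Prop :=
  ∀ j : Fin d, (j : ℕ) < n → x j < 1 → s.num 7 2 j = upMoney L p x j ∧
    s.num 7 3 j = upRate L A p x j

def PickDown (L : Segments ℝ d κ) (A : Fin d → Fin κ → ℝ) (p x : Fin d → ℝ) (n : ℕ)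
    (s : Mem ℝ) : Prop :=
  (s.nat 12 0 2 = 0 ∧ ∀ j : Fin d, (j : ℕ) < n → ¬ 0 < x j) ∨
    ∃ h : Fin d, s.nat 12 0 2 = h + 1 ∧ 0 < x h ∧
      ∀ j : Fin d, (j : ℕ) < n → 0 < x j → downRate L A p x h ≤ downRate L A p x j

def PickUp (L : Segments ℝ d κ) (A : Fin d → Fin κ → ℝ) (p x : Fin d → ℝ) (n : ℕ)
    (s : Mem ℝ) : Prop :=
  (s.nat 12 0 1 = 0 ∧ ∀ j : Fin d, (j : ℕ) < n → ¬ x j < 1) ∨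
    ∃ h : Fin d, s.nat 12 0 1 = h + 1 ∧ x h < 1 ∧
      ∀ j : Fin d, (j : ℕ) < n → x j < 1 → upRate L A p x j ≤ upRate L A p x h

def Split (L : Segments ℝ d κ) (x : Fin d → ℝ) (n : ℕ) (s : Mem ℝ) : Prop :=
  (s.nat 12 0 0 = 0 ∧ ∀ j : Fin d, (j : ℕ) < n → ¬ IsSplitGood L x j) ∨
    ∃ h : Fin d, s.nat 12 0 0 = h + 1 ∧ IsSplitGood L x h

def NextSegments (L : Segments ℝ d κ) (x : Fin d → ℝ) (n : ℕ) (s : Mem ℝ) : Prop :=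
  ∀ j : Fin d, (j : ℕ) < n → x j < 1 → s.nat 16 0 j = L.hi j (x j)

theorem eval_J (h : s.nat 10 0 0 = n) : J.eval s = n := h

theorem res_ite {b : Test} {q q' : Prog} (hb : b.eval s) : (Prog.ite b q q').res s = q.res s := by
  simp [Prog.res, hb]

theorem res_ite' {b : Test} {q q' : Prog} (hb : ¬ b.eval s) :
    (Prog.ite b q q').res s = q'.res s := by
  simp [Prog.res, hb]

theorem forGoods_spec {q : Prog} (hq : q.Straight) (I : ℕ → Mem ℝ → Prop)
    (hI : ∀ i s, I i s → Input L A p x s) (hstab : ∀ i v s, I i s → I i (s.writeNat 10 0 0 v))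
    (hbody : ∀ (j : Fin d) s, I j s → s.nat 10 0 0 = j →
      I (j + 1) (q.res s) ∧ (q.res s).nat 10 0 0 = j) :
    UnitTriple (I 0) (forGoods q) (I d) (d * 2 + 2) :=
  UnitTriple.forLoop (n := .cell 0) (T := 1) I hstab (fun i s h => (hI i s h).dim) fun i hi =>
    UnitTriple.straight hq fun s hs => hbody ⟨i, hi⟩ s hs.1 hs.2

theorem forall_lt_succ {n : Fin d} {P : Fin d → Prop} (h : ∀ j : Fin d, (j : ℕ) < n → P j)
    (hn : P n) (j : Fin d) (hj : (j : ℕ) < n + 1) : P j := by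
  rcases Nat.lt_succ_iff_lt_or_eq.1 hj with h' | h'
  · exact h j h'
  · obtain rfl : j = n := Fin.ext h'
    exact hn

theorem eval_lt_bundle (hI : Input L A p x s) {e : NExp} {j : Fin d} (he : e.eval s = j) :
    ((Test.lt .zero (.row 3 0 e)).eval s ↔ 0 < x j) ∧
      ((Test.lt (.row 3 0 e) .one).eval s ↔ x j < 1) := by
  constructor <;>
    simp [Test.lt, Test.eval, RExp.eval, RExp.row, NExp.eval, he, hI.bundle]

theorem downRates_spec (hL : L.Valid) :
    UnitTriple (Input L A p x) (forGoods downRates)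
      (fun s => Input L A p x s ∧ DownRates L A p x d s) (d * 2 + 2) := by
  refine (forGoods_spec (by simp [downRates, Prog.Straight])
    (fun n s => Input L A p x s ∧ DownRates L A p x n s) (fun i s h => h.1)
    (fun i v s h => ⟨h.1.writeNat _ _ _ (by norm_num), h.2⟩) ?_).mono
    (fun s h => ⟨h, fun j hj => absurd hj (Nat.not_lt_zero _)⟩) (fun s h => h) le_rfl
  rintro j s ⟨hI, hR⟩ hc
  have htest := (eval_lt_bundle hI (eval_J hc)).1
  by_cases hx : 0 < x j
  · rw [downRates, res_ite (htest.2 hx)]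
    have hbo := hI.bought j
    rw [bought_eq hL hx] at hbo
    have hlo := (hL.lo_spec j hx).1
    have hκ := (hL.1 j).2
    have hal := hI.alloc j ⟨L.lo j (x j), by omega⟩
    rw [alloc_lo hL hx] at hal
    have e : Prog.res ((Prog.setNum 7 (.const 0) J (.mul (.row 1 0 J) (.read 5 J last))).seq
        (.setNum 7 (.const 1) J (.div (.read 4 J last) (.row 1 0 J)))) s =
        (s.writeNum 7 0 j (downMoney L p x j)).writeNum 7 1 j (downRate L A p x j) := by
      simp [Prog.res, RExp.eval, RExp.row, NExp.eval, NExp.row, J, NExp.cell, last, bought, hc, hbo,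
        Mem.writeNum, hI.price, hal, hI.slope, downMoney, downRate]
    rw [e]
    refine ⟨⟨(hI.writeNum _ _ _ (by norm_num)).writeNum _ _ _ (by norm_num), ?_⟩, hc⟩
    refine forall_lt_succ (fun i hi hxi => ?_) fun _ => by simp [Mem.writeNum]
    have := hR i hi hxi
    simpa [Mem.writeNum, hi.ne] using this
  · rw [downRates, res_ite' (mt htest.1 hx)]
    exact ⟨⟨hI, forall_lt_succ hR fun h => absurd h hx⟩, hc⟩

theorem pickDown_spec :
    UnitTriple (fun s => Input L A p x s ∧ DownRates L A p x d s ∧ s.nat 12 0 2 = 0 ∧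
        s.nat 12 0 0 = 0 ∧ s.nat 12 0 1 = 0)
      (forGoods pickDown)
      (fun s => Input L A p x s ∧ DownRates L A p x d s ∧ PickDown L A p x d s ∧
        s.nat 12 0 0 = 0 ∧ s.nat 12 0 1 = 0)
      (d * 2 + 2) := by
  refine (forGoods_spec (by simp [pickDown, Prog.Straight])
    (fun n s => Input L A p x s ∧ DownRates L A p x d s ∧ PickDown L A p x n s ∧
        s.nat 12 0 0 = 0 ∧ s.nat 12 0 1 = 0)
    (fun i s h => h.1)
    (fun i v s h => ⟨h.1.writeNat _ _ _ (by norm_num), h.2⟩) ?_).mono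
    (fun s h => ⟨h.1, h.2.1, Or.inl ⟨h.2.2.1, fun j hj => absurd hj (Nat.not_lt_zero _)⟩,
      h.2.2.2⟩)
    (fun s h => h) le_rfl
  rintro j s ⟨hI, hR, hP, h00, h01⟩ hc
  have htest := (eval_lt_bundle hI (eval_J hc)).1
  by_cases hx : 0 < x j
  · rw [pickDown, res_ite (htest.2 hx)]
    have htest2 : (Test.disj (.nle (.row 12 (.const 2)) (.const 0))
        (.lt (.row 7 1 J) (.row 7 1 (.sub (.row 12 (.const 2)) (.const 1))))).eval s ↔
        s.nat 12 0 2 = 0 ∨ downRate L A p x j < s.num 7 1 (s.nat 12 0 2 - 1) := by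
      simp [Test.disj, Test.lt, Test.eval, RExp.eval, RExp.row, NExp.row, NExp.eval, eval_J hc,
        (hR j j.2 hx).2, imp_iff_not_or]
    by_cases h2 : s.nat 12 0 2 = 0 ∨ downRate L A p x j < s.num 7 1 (s.nat 12 0 2 - 1)
    · rw [res_ite (htest2.2 h2)]
      have e : (Prog.setNat 12 (.const 0) (.const 2) (.add J (.const 1))).res s =
          s.writeNat 12 0 2 (j + 1) := by
        simp [Prog.res, NExp.eval, eval_J hc]
      rw [e]
      refine ⟨⟨hI.writeNat _ _ _ (by norm_num), hR, Or.inr ⟨j, by simp [Mem.writeNat], hx, ?_⟩,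
        by simpa [Mem.writeNat] using h00, by simpa [Mem.writeNat] using h01⟩,
        by simpa [Mem.writeNat] using hc⟩
      refine forall_lt_succ (fun i hi hxi => ?_) fun _ => le_rfl
      rcases hP with ⟨h3, h4⟩ | ⟨h, h3, h4, h5⟩
      · exact absurd hxi (h4 i hi)
      · rcases h2 with h2 | h2
        · omega
        · rw [h3, Nat.add_sub_cancel, (hR h h.2 h4).2] at h2
          exact h2.le.trans (h5 i hi hxi)
    · rw [res_ite' (mt htest2.1 h2)]
      push Not at h2
      refine ⟨⟨hI, hR, ?_, h00, h01⟩, hc⟩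
      rcases hP with ⟨h3, h4⟩ | ⟨h, h3, h4, h5⟩
      · exact absurd h3 h2.1
      · refine Or.inr ⟨h, h3, h4, forall_lt_succ h5 fun _ => ?_⟩
        have := h2.2
        rwa [h3, Nat.add_sub_cancel, (hR h h.2 h4).2] at this
  · rw [pickDown, res_ite' (mt htest.1 hx)]
    refine ⟨⟨hI, hR, ?_, h00, h01⟩, hc⟩
    rcases hP with ⟨h3, h4⟩ | ⟨h, h3, h4, h5⟩
    · exact Or.inl ⟨h3, forall_lt_succ h4 hx⟩
    · exact Or.inr ⟨h, h3, h4, forall_lt_succ h5 fun h => absurd h hx⟩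

theorem pickUp_spec :
    UnitTriple (fun s => Input L A p x s ∧ UpRates L A p x d s ∧ s.nat 12 0 1 = 0 ∧
        DownRates L A p x d s ∧ PickDown L A p x d s ∧ Split L x d s)
      (forGoods pickUp)
      (fun s => Input L A p x s ∧ UpRates L A p x d s ∧ PickUp L A p x d s ∧
        DownRates L A p x d s ∧ PickDown L A p x d s ∧ Split L x d s)
      (d * 2 + 2) := by
  refine (forGoods_spec (by simp [pickUp, Prog.Straight])
    (fun n s => Input L A p x s ∧ UpRates L A p x d s ∧ PickUp L A p x n s ∧
        DownRates L A p x d s ∧ PickDown L A p x d s ∧ Split L x d s)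
    (fun i s h => h.1)
    (fun i v s h => ⟨h.1.writeNat _ _ _ (by norm_num), h.2⟩) ?_).mono
    (fun s h => ⟨h.1, h.2.1, Or.inl ⟨h.2.2.1, fun j hj => absurd hj (Nat.not_lt_zero _)⟩, h.2.2.2⟩)
    (fun s h => h) le_rfl
  rintro j s ⟨hI, hR, hP, hD, hPD, hS⟩ hc
  have htest := (eval_lt_bundle hI (eval_J hc)).2
  by_cases hx : x j < 1
  · rw [pickUp, res_ite (htest.2 hx)]
    have htest2 : (Test.disj (.nle (.row 12 (.const 1)) (.const 0))
        (.lt (.row 7 3 (.sub (.row 12 (.const 1)) (.const 1))) (.row 7 3 J))).eval s ↔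
        s.nat 12 0 1 = 0 ∨ s.num 7 3 (s.nat 12 0 1 - 1) < upRate L A p x j := by
      simp [Test.disj, Test.lt, Test.eval, RExp.eval, RExp.row, NExp.row, NExp.eval, eval_J hc,
        (hR j j.2 hx).2, imp_iff_not_or]
    by_cases h2 : s.nat 12 0 1 = 0 ∨ s.num 7 3 (s.nat 12 0 1 - 1) < upRate L A p x j
    · rw [res_ite (htest2.2 h2)]
      have e : (Prog.setNat 12 (.const 0) (.const 1) (.add J (.const 1))).res s =
          s.writeNat 12 0 1 (j + 1) := by
        simp [Prog.res, NExp.eval, eval_J hc]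
      rw [e]
      refine ⟨⟨hI.writeNat _ _ _ (by norm_num), hR, Or.inr ⟨j, by simp [Mem.writeNat], hx, ?_⟩,
        hD, by simpa [PickDown, Mem.writeNat] using hPD, by simpa [Split, Mem.writeNat] using hS⟩,
        by simpa [Mem.writeNat] using hc⟩
      refine forall_lt_succ (fun i hi hxi => ?_) fun _ => le_rfl
      rcases hP with ⟨h3, h4⟩ | ⟨h, h3, h4, h5⟩
      · exact absurd hxi (h4 i hi)
      · rcases h2 with h2 | h2
        · omega
        · rw [h3, Nat.add_sub_cancel, (hR h h.2 h4).2] at h2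
          exact (h5 i hi hxi).trans h2.le
    · rw [res_ite' (mt htest2.1 h2)]
      push Not at h2
      refine ⟨⟨hI, hR, ?_, hD, hPD, hS⟩, hc⟩
      rcases hP with ⟨h3, h4⟩ | ⟨h, h3, h4, h5⟩
      · exact absurd h3 h2.1
      · refine Or.inr ⟨h, h3, h4, forall_lt_succ h5 fun _ => ?_⟩
        have := h2.2
        rwa [h3, Nat.add_sub_cancel, (hR h h.2 h4).2] at this
  · rw [pickUp, res_ite' (mt htest.1 hx)]
    refine ⟨⟨hI, hR, ?_, hD, hPD, hS⟩, hc⟩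
    rcases hP with ⟨h3, h4⟩ | ⟨h, h3, h4, h5⟩
    · exact Or.inl ⟨h3, forall_lt_succ h4 hx⟩
    · exact Or.inr ⟨h, h3, h4, forall_lt_succ h5 fun h => absurd h hx⟩

theorem nextSegments_spec (hL : L.Valid) (hx : x ∈ unitCube d) :
    UnitTriple (fun s => Input L A p x s ∧ DownRates L A p x d s ∧ PickDown L A p x d s ∧
        s.nat 12 0 0 = 0 ∧ s.nat 12 0 1 = 0)
      (forGoods nextSegments)
      (fun s => Input L A p x s ∧ DownRates L A p x d s ∧ PickDown L A p x d s ∧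
        s.nat 12 0 1 = 0 ∧ Split L x d s ∧ NextSegments L x d s)
      (d * 2 + 2) := by
  refine (forGoods_spec (by simp [nextSegments, Prog.Straight])
    (fun n s => Input L A p x s ∧ DownRates L A p x d s ∧ PickDown L A p x d s ∧
        s.nat 12 0 1 = 0 ∧ Split L x n s ∧ NextSegments L x n s)
    (fun i s h => h.1)
    (fun i v s h => ⟨h.1.writeNat _ _ _ (by norm_num), h.2⟩) ?_).mono
    (fun s h => ⟨h.1, h.2.1, h.2.2.1, h.2.2.2.2,
      Or.inl ⟨h.2.2.2.1, fun j hj => absurd hj (Nat.not_lt_zero _)⟩,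
      fun j hj => absurd hj (Nat.not_lt_zero _)⟩)
    (fun s h => h) le_rfl
  rintro j s ⟨hI, hR, hP, h1, hS, hN⟩ hc
  have htest := (eval_lt_bundle hI (eval_J hc)).2
  obtain ⟨hiff, hne⟩ := hi_eq_bought_iff hL hx j
  have hκ := (hL.1 j).2
  by_cases hx1 : x j < 1
  · rw [nextSegments, res_ite (htest.2 hx1)]
    have hlast : last.eval s = L.bought x j - 1 := by
      simp [last, SecondBestProgram.bought, NExp.eval, NExp.row, eval_J hc, hI.bought]
    have htest2 : (Test.conj (.nlt bought (.row 1 J)) (.disj (.nle bought (.const 0))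
        (.rle (.read 0 J last) (.read 5 J last)))).eval s ↔ L.hi j (x j) = L.bought x j := by
      rw [hiff]
      simp only [Test.disj, Test.nlt, Test.eval, RExp.eval, NExp.row, NExp.eval, eval_J hc,
        SecondBestProgram.bought, hI.bought, hI.num, not_and_or, not_not, not_le,
        nonpos_iff_eq_zero]
      refine and_congr_right fun h3 => or_congr_right ?_
      rw [hlast]
      have h : L.bought x j - 1 < κ := by omega
      have e1 := hI.len j ⟨_, h⟩
      have e2 := hI.alloc j ⟨_, h⟩
      simp only at e1 e2
      rw [e1, e2]
      exact ⟨fun h' => ⟨h, not_lt.1 h'⟩, fun h' => not_lt.2 h'.2⟩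
    have hsplit : L.hi j (x j) = L.bought x j → ¬ IsSplitGood L x j := by
      rintro h ⟨h2, h3, h4⟩
      rw [bought_eq hL h2] at h
      omega
    by_cases h2 : L.hi j (x j) = L.bought x j
    · rw [res_ite (htest2.2 h2)]
      have e : (Prog.setNat 16 (.const 0) J bought).res s =
          s.writeNat 16 0 j (L.hi j (x j)) := by
        simp [Prog.res, NExp.eval, eval_J hc, h2, SecondBestProgram.bought, NExp.row, hI.bought]
      rw [e]
      refine ⟨⟨hI.writeNat _ _ _ (by norm_num), hR, by simpa [PickDown, Mem.writeNat] using hP,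
        by simpa [Mem.writeNat] using h1, ?_, ?_⟩, by simpa [Mem.writeNat] using hc⟩
      · rcases hS with ⟨h3, h4⟩ | h3
        · exact Or.inl ⟨by simpa [Mem.writeNat] using h3, forall_lt_succ h4 (hsplit h2)⟩
        · exact Or.inr (by simpa [Mem.writeNat] using h3)
      · refine forall_lt_succ (fun i hi hxi => ?_) fun _ => by simp [Mem.writeNat]
        simpa [Mem.writeNat, hi.ne] using hN i hi hxi
    · rw [res_ite' (mt htest2.1 h2)]
      obtain ⟨h3, h4⟩ := hne h2
      have e : Prog.res (.seq (.setNat 16 (.const 0) J last)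
          (.setNat 12 (.const 0) (.const 0) (.add J (.const 1)))) s =
          (s.writeNat 16 0 j (L.hi j (x j))).writeNat 12 0 0 (j + 1) := by
        have : L.bought x j - 1 = L.hi j (x j) := by rw [bought_eq hL h3, h4]; rfl
        simp only [Prog.res, NExp.eval, eval_J hc, hlast, this]
        have : J.eval (s.writeNat 16 0 j (L.hi j (x j))) = j := by
          simpa [J, NExp.cell, NExp.eval, Mem.writeNat] using hc
        rw [this]
      rw [e]
      refine ⟨⟨(hI.writeNat _ _ _ (by norm_num)).writeNat _ _ _ (by norm_num), hR,
        by simpa [PickDown, Mem.writeNat] using hP,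
        by simpa [Mem.writeNat] using h1, ?_, ?_⟩, by simpa [Mem.writeNat] using hc⟩
      · exact Or.inr ⟨j, by simp [Mem.writeNat], h3, hx1, h4.symm⟩
      · refine forall_lt_succ (fun i hi hxi => ?_) fun _ => by simp [Mem.writeNat]
        simpa [Mem.writeNat, hi.ne] using hN i hi hxi
  · rw [nextSegments, res_ite' (mt htest.1 hx1)]
    refine ⟨⟨hI, hR, hP, h1, ?_, forall_lt_succ hN fun h => absurd h hx1⟩, hc⟩
    rcases hS with ⟨h3, h4⟩ | h3
    · exact Or.inl ⟨h3, forall_lt_succ h4 fun h => hx1 h.2.1⟩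
    · exact Or.inr h3

theorem upRates_spec (hL : L.Valid) (hx : x ∈ unitCube d) :
    UnitTriple (fun s => Input L A p x s ∧ DownRates L A p x d s ∧ PickDown L A p x d s ∧
        s.nat 12 0 1 = 0 ∧ Split L x d s ∧ NextSegments L x d s)
      (forGoods upRates)
      (fun s => Input L A p x s ∧ DownRates L A p x d s ∧ PickDown L A p x d s ∧
        s.nat 12 0 1 = 0 ∧ Split L x d s ∧ NextSegments L x d s ∧ UpRates L A p x d s)
      (d * 2 + 2) := by
  refine (forGoods_spec (by simp [upRates, Prog.Straight])
    (fun n s => Input L A p x s ∧ DownRates L A p x d s ∧ PickDown L A p x d s ∧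
        s.nat 12 0 1 = 0 ∧ Split L x d s ∧ NextSegments L x d s ∧ UpRates L A p x n s)
    (fun i s h => h.1)
    (fun i v s h => ⟨h.1.writeNat _ _ _ (by norm_num), h.2⟩) ?_).mono
    (fun s h => ⟨h.1, h.2.1, h.2.2.1, h.2.2.2.1, h.2.2.2.2.1, h.2.2.2.2.2,
      fun j hj => absurd hj (Nat.not_lt_zero _)⟩)
    (fun s h => h) le_rfl
  rintro j s ⟨hI, hD, hP, h1, hS, hN, hU⟩ hc
  have htest := (eval_lt_bundle hI (eval_J hc)).2
  have hκ := (hL.1 j).2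
  have hhi := (hL.hi_spec j (hx j).1).1
  have hhκ : L.hi j (x j) < κ := by omega
  by_cases hx1 : x j < 1
  · rw [upRates, res_ite (htest.2 hx1)]
    have hlen := hI.len j ⟨_, hhκ⟩
    have hal := hI.alloc j ⟨_, hhκ⟩
    simp only at hlen hal
    have hnx := hN j j.2 hx1
    have e : Prog.res (.seq (.setNum 7 (.const 3) J (.div (.read 4 J next) (.row 1 0 J)))
      (.ite (.conj (.nlt (.add next (.const 1)) (.row 1 J))
          (.lt (.sub (.read 0 J next) (.read 5 J next)) (.sub .one (.row 3 0 J))))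
        (.setNum 7 (.const 2) J (.mul (.row 1 0 J) (.sub (.read 0 J next) (.read 5 J next))))
        (.setNum 7 (.const 2) J (.mul (.row 1 0 J) (.sub .one (.row 3 0 J)))))) s =
        (s.writeNum 7 3 j (upRate L A p x j)).writeNum 7 2 j (upMoney L p x j) := by
      rw [upMoney_eq hL hx j hhκ]
      have e1 : Prog.res (.setNum 7 (.const 3) J (.div (.read 4 J next) (.row 1 0 J))) s =
          s.writeNum 7 3 j (upRate L A p x j) := by
        simp [Prog.res, RExp.eval, NExp.eval, J, NExp.cell, next, NExp.row, RExp.row, hc, hnx,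
          hI.slope, hI.price, upRate]
      have hI' : Input L A p x (s.writeNum 7 3 j (upRate L A p x j)) :=
        hI.writeNum _ _ _ (by norm_num)
      have hc' : (s.writeNum 7 3 j (upRate L A p x j)).nat 10 0 0 = j := hc
      have hnx' : (s.writeNum 7 3 j (upRate L A p x j)).nat 16 0 j = L.hi j (x j) := hnx
      rw [Prog.res, e1]
      generalize s.writeNum 7 3 j (upRate L A p x j) = s1 at *
      have hlen := hI'.len j ⟨_, hhκ⟩
      have hal := hI'.alloc j ⟨_, hhκ⟩
      simp only at hlen hal
      simp only [Prog.res, Test.eval, Test.nlt, Test.lt, RExp.eval, NExp.eval, J, NExp.cell, next,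
        NExp.row, RExp.row, hc', hnx', hI'.price, hI'.bundle, hI'.num, hlen, hal, not_le]
      split_ifs <;> rfl
    rw [e]
    refine ⟨⟨(hI.writeNum _ _ _ (by norm_num)).writeNum _ _ _ (by norm_num), ?_, hP, h1, hS, hN,
      ?_⟩, hc⟩
    · simpa [DownRates, Mem.writeNum] using hD
    · refine forall_lt_succ (fun i hi hxi => ?_) fun _ => by simp [Mem.writeNum]
      simpa [Mem.writeNum, hi.ne] using hU i hi hxi
  · rw [upRates, res_ite' (mt htest.1 hx1)]
    exact ⟨⟨hI, hD, hP, h1, hS, hN, forall_lt_succ hU fun h => absurd h hx1⟩, hc⟩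

/-- All tables that are needed for the comparison of the swaps. -/
structure Ready (L : Segments ℝ d κ) (A : Fin d → Fin κ → ℝ) (p x : Fin d → ℝ) (s : Mem ℝ) :
    Prop where
  input : Input L A p x s
  down : DownRates L A p x d s
  up : UpRates L A p x d s
  pickDown : PickDown L A p x d s
  pickUp : PickUp L A p x d s
  split : Split L x d s

theorem Ready.congr {s' : Mem ℝ} (h : Ready L A p x s) (hin : Input L A p x s')
    (h7 : s'.num 7 = s.num 7) (h12 : s'.nat 12 = s.nat 12) : Ready L A p x s' := by
  refine ⟨hin, ?_, ?_, ?_, ?_, ?_⟩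
  · simpa [DownRates, h7] using h.down
  · simpa [UpRates, h7] using h.up
  · simpa [PickDown, h12] using h.pickDown
  · simpa [PickUp, h12] using h.pickUp
  · simpa [Split, h12] using h.split

/-- The best swap among those in `T` is stored. -/
def Found (L : Segments ℝ d κ) (A : Fin d → Fin κ → ℝ) (p x : Fin d → ℝ)
    (T : Fin d → Fin d → Prop) (s : Mem ℝ) : Prop :=
  (s.nat 13 0 0 = 0 ∧ ∀ j i, T j i → ¬ ValidSwap L x j i) ∨
    ∃ j i : Fin d, ValidSwap L x j i ∧ s.nat 13 0 0 = j + 1 ∧ s.nat 14 0 0 = i + 1 ∧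
      s.num 8 0 0 = swapLoss L A p x j i ∧ s.num 8 0 1 = swapMoney L p x j i ∧
      ∀ j' i', T j' i' → ValidSwap L x j' i' → swapLoss L A p x j i ≤ swapLoss L A p x j' i'

theorem Found.mono {T T' : Fin d → Fin d → Prop} (h : Found L A p x T s)
    (hT : ∀ j i, T' j i → T j i) : Found L A p x T' s := by
  rcases h with ⟨h1, h2⟩ | ⟨j, i, h1, h2, h3, h4, h5, h6⟩
  · exact Or.inl ⟨h1, fun j i h => h2 j i (hT j i h)⟩
  · exact Or.inr ⟨j, i, h1, h2, h3, h4, h5, fun j' i' h => h6 j' i' (hT j' i' h)⟩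

/-- There is at most one split good, so the good recorded in column 0 decides the last clause of
`ValidSwap`. -/
theorem Ready.validSwap_iff (h : Ready L A p x s)
    (hF : ∀ f g, IsSplitGood L x f → IsSplitGood L x g → f = g) (j i : Fin d) :
    ValidSwap L x j i ↔ j ≠ i ∧ 0 < x j ∧ x i < 1 ∧
      (s.nat 12 0 0 = 0 ∨ s.nat 12 0 0 = j + 1 ∨ s.nat 12 0 0 = i + 1) := by
  refine and_congr_right fun _ => and_congr_right fun _ => and_congr_right fun _ => ?_
  rcases h.split with ⟨h1, h2⟩ | ⟨f, h1, h2⟩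
  · simp only [h1, true_or, iff_true]
    exact fun f hf => absurd hf (h2 f f.2)
  · rw [h1]
    simp only [Nat.add_right_cancel_iff, Nat.succ_ne_zero, false_or, ← Fin.ext_iff]
    refine ⟨fun h => h f h2, fun h g hg => ?_⟩
    rwa [hF g f hg h2]

/-- The expressions for the two goods are evaluated again after writes. They may depend on the
arrays 10 to 12 only, which the comparison leaves alone. -/
theorem trySwap_spec (h : Ready L A p x s)
    (hF : ∀ f g, IsSplitGood L x f → IsSplitGood L x g → f = g) {ej ei : NExp} {j i : Fin d}
    (hj : ∀ s' : Mem ℝ, s'.nat 10 = s.nat 10 → s'.nat 11 = s.nat 11 → s'.nat 12 = s.nat 12 →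
      ej.eval s' = j)
    (hi : ∀ s' : Mem ℝ, s'.nat 10 = s.nat 10 → s'.nat 11 = s.nat 11 → s'.nat 12 = s.nat 12 →
      ei.eval s' = i) {T : Fin d → Fin d → Prop} (hT : Found L A p x T s) :
    Ready L A p x ((trySwap ej ei).res s) ∧
      Found L A p x (fun j' i' => T j' i' ∨ j' = j ∧ i' = i) ((trySwap ej ei).res s) ∧
      ((trySwap ej ei).res s).nat 10 = s.nat 10 ∧ ((trySwap ej ei).res s).nat 11 = s.nat 11 ∧
      ((trySwap ej ei).res s).nat 12 = s.nat 12 := by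
  have hj0 := hj s rfl rfl rfl
  have hi0 := hi s rfl rfl rfl
  have hguard : (Test.conj (nequal ej ei) (.conj (.lt .zero (.row 3 0 ej))
      (.conj (.lt (.row 3 0 ei) .one) (.disj (.nle (.row 12 (.const 0)) (.const 0))
        (.disj (equal (.row 12 (.const 0)) (.add ej (.const 1)))
          (equal (.row 12 (.const 0)) (.add ei (.const 1)))))))).eval s ↔ ValidSwap L x j i := by
    rw [h.validSwap_iff hF]
    simp only [Test.eval]
    rw [(eval_lt_bundle h.input hj0).1, (eval_lt_bundle h.input hi0).2]
    refine and_congr ?_ (and_congr_right fun _ => and_congr_right fun _ => ?_)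
    · simp only [nequal, Test.disj, Test.nlt, Test.eval, hj0, hi0, ne_eq, Fin.ext_iff]
      omega
    · simp only [equal, Test.disj, Test.eval, NExp.eval, NExp.row, hj0, hi0]
      omega
  by_cases hv : ValidSwap L x j i
  · rw [trySwap, res_ite (hguard.2 hv)]
    obtain ⟨hd1, hd2⟩ := h.down j j.2 hv.2.1
    obtain ⟨hu1, hu2⟩ := h.up i i.2 hv.2.2.1
    set s2 := (s.writeNum 9 0 0 (swapMoney L p x j i)).writeNum 9 0 1 (swapLoss L A p x j i)
      with hs2
    have e1 : Prog.res (Prog.ite (.rle (.row 7 0 ej) (.row 7 2 ei))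
        (.setNum 9 (.const 0) (.const 0) (.row 7 0 ej))
        (.setNum 9 (.const 0) (.const 0) (.row 7 2 ei))) s =
        s.writeNum 9 0 0 (swapMoney L p x j i) := by
      simp only [Prog.res, Test.eval, RExp.eval, RExp.row, NExp.eval, hj0, hi0, hd1, hu1]
      split_ifs with hle
      · rw [swapMoney, min_eq_left hle]
      · rw [swapMoney, min_eq_right (le_of_not_ge hle)]
    have e2 : Prog.res (Prog.setNum 9 (.const 0) (.const 1)
          (.mul (.row 9 0 (.const 0)) (.sub (.row 7 1 ej) (.row 7 3 ei))))
          (s.writeNum 9 0 0 (swapMoney L p x j i)) = s2 := by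
      have hj1 := hj (s.writeNum 9 0 0 (swapMoney L p x j i)) rfl rfl rfl
      have hi1 := hi (s.writeNum 9 0 0 (swapMoney L p x j i)) rfl rfl rfl
      simp only [Prog.res, RExp.eval, RExp.row, NExp.eval, hj1, hi1, hs2]
      congr 1
      simp [Mem.writeNum, hd2, hu2, swapLoss]
    rw [Prog.res, e1, Prog.res, e2]
    have hI2 : Input L A p x s2 :=
      (h.input.writeNum _ _ _ (by norm_num)).writeNum _ _ _ (by norm_num)
    have hR2 : Ready L A p x s2 := h.congr hI2 (by simp [s2, Mem.writeNum]) rfl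
    have hT2 : Found L A p x T s2 := by simpa [Found, s2, Mem.writeNum] using hT
    have htest : (Test.disj (.nle (.cell 13) (.const 0))
        (.lt (.row 9 0 (.const 1)) (.row 8 0 (.const 0)))).eval s2 ↔
        s2.nat 13 0 0 = 0 ∨ swapLoss L A p x j i < s2.num 8 0 0 := by
      have : s2.num 9 0 1 = swapLoss L A p x j i := by simp [s2, Mem.writeNum]
      simp [Test.disj, Test.lt, Test.eval, NExp.cell, RExp.eval, RExp.row, NExp.eval, this,
        imp_iff_not_or]
    by_cases h2 : s2.nat 13 0 0 = 0 ∨ swapLoss L A p x j i < s2.num 8 0 0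
    · rw [res_ite (htest.2 h2)]
      have e3 : Prog.res (.seq (.setNat 13 (.const 0) (.const 0) (.add ej (.const 1)))
            (.seq (.setNat 14 (.const 0) (.const 0) (.add ei (.const 1)))
              (.seq (.setNum 8 (.const 0) (.const 0) (.row 9 0 (.const 1)))
                (.setNum 8 (.const 0) (.const 1) (.row 9 0 (.const 0)))))) s2 =
          (((s2.writeNat 13 0 0 (j + 1)).writeNat 14 0 0 (i + 1)).writeNum 8 0 0
            (swapLoss L A p x j i)).writeNum 8 0 1 (swapMoney L p x j i) := by
        have hj1 := hj s2 rfl rfl rfl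
        have hi1 := hi (s2.writeNat 13 0 0 (j + 1)) (by simp [s2, Mem.writeNat, Mem.writeNum])
          (by simp [s2, Mem.writeNat, Mem.writeNum]) (by simp [s2, Mem.writeNat, Mem.writeNum])
        simp only [Prog.res, NExp.eval, hj1, hi1, RExp.eval, RExp.row]
        simp [s2, Mem.writeNum, Mem.writeNat]
      rw [e3]
      refine ⟨hR2.congr ?_ ?_ ?_, Or.inr ⟨j, i, hv, ?_, ?_, ?_, ?_, ?_⟩, ?_, ?_, ?_⟩
      · exact ((((hI2.writeNat _ _ _ (by norm_num)).writeNat _ _ _ (by norm_num)).writeNum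
          _ _ _ (by norm_num)).writeNum _ _ _ (by norm_num))
      · simp [Mem.writeNum, Mem.writeNat]
      · simp [Mem.writeNum, Mem.writeNat]
      · simp [Mem.writeNum, Mem.writeNat]
      · simp [Mem.writeNum, Mem.writeNat]
      · simp [Mem.writeNum, Mem.writeNat]
      · simp [Mem.writeNum, Mem.writeNat]
      · rintro j' i' (h' | ⟨rfl, rfl⟩) hv'
        · rcases hT2 with ⟨-, h4⟩ | ⟨j'', i'', -, h4, -, h5, -, h6⟩
          · exact absurd hv' (h4 j' i' h')
          · rcases h2 with h2 | h2
            · omega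
            · rw [h5] at h2
              exact h2.le.trans (h6 j' i' h' hv')
        · exact le_rfl
      · simp [Mem.writeNum, Mem.writeNat, s2]
      · simp [Mem.writeNum, Mem.writeNat, s2]
      · simp [Mem.writeNum, Mem.writeNat, s2]
    · rw [res_ite' (mt htest.1 h2)]
      push Not at h2
      refine ⟨hR2, ?_, rfl, rfl, rfl⟩
      rcases hT2 with ⟨h3, -⟩ | ⟨j', i', h3, h4, h5, h6, h7, h8⟩
      · exact absurd h3 h2.1
      · refine Or.inr ⟨j', i', h3, h4, h5, h6, h7, ?_⟩
        rintro j'' i'' (h' | ⟨rfl, rfl⟩) hv'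
        · exact h8 _ _ h' hv'
        · rw [← h6]; exact h2.2
  · rw [trySwap, res_ite' (mt hguard.1 hv)]
    refine ⟨h, ?_, rfl, rfl, rfl⟩
    rcases hT with ⟨h3, h2⟩ | ⟨j', i', h3, h4, h5, h6, h7, h8⟩
    · refine Or.inl ⟨h3, ?_⟩
      rintro j'' i'' (h' | ⟨rfl, rfl⟩)
      exacts [h2 _ _ h', hv]
    · refine Or.inr ⟨j', i', h3, h4, h5, h6, h7, ?_⟩
      rintro j'' i'' (h' | ⟨rfl, rfl⟩) hv'
      exacts [h8 _ _ h' hv', absurd hv' hv]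

/-- The table of candidates is frozen as `N`, so that the pairs already compared can be described
independently of the memory. -/
theorem trySwaps_spec (hF : ∀ f g, IsSplitGood L x f → IsSplitGood L x g → f = g)
    (N : ℕ → ℕ → ℕ) :
    UnitTriple (fun s => Ready L A p x s ∧ s.nat 12 = N ∧ s.nat 13 0 0 = 0)
      (forGoods (.forLoop 11 (.const 3) trySwaps))
      (fun s => Ready L A p x s ∧ Found L A p x
        (fun j i => (∃ c < 3, N 0 c = j + 1) ∨ ∃ c < 3, N 0 c = i + 1) s)
      (d * (3 * 2 + 2 + 1) + 2) := by
  set T : ℕ → Fin d → Fin d → Prop := fun n j i =>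
    ((j : ℕ) < n ∧ ∃ c < 3, N 0 c = i + 1) ∨ ((i : ℕ) < n ∧ ∃ c < 3, N 0 c = j + 1) with hTdef
  have hstab : ∀ {T : Fin d → Fin d → Prop} {a v s}, a = 10 ∨ a = 11 → Ready L A p x s →
      s.nat 12 = N → Found L A p x T s → Ready L A p x (s.writeNat a 0 0 v) ∧
      (s.writeNat a 0 0 v).nat 12 = N ∧ Found L A p x T (s.writeNat a 0 0 v) := by
    rintro T a v s (rfl | rfl) h1 h2 h3
    · exact ⟨h1.congr (h1.input.writeNat _ _ _ (by norm_num)) rfl (by simp [Mem.writeNat]),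
        by simpa [Mem.writeNat] using h2, by simpa [Found, Mem.writeNat] using h3⟩
    · exact ⟨h1.congr (h1.input.writeNat _ _ _ (by norm_num)) rfl (by simp [Mem.writeNat]),
        by simpa [Mem.writeNat] using h2, by simpa [Found, Mem.writeNat] using h3⟩
  refine (UnitTriple.forLoop (n := .cell 0) (N := d) (T := 3 * 2 + 2)
    (fun n s => Ready L A p x s ∧ s.nat 12 = N ∧ Found L A p x (T n) s)
    (fun i v s h => hstab (Or.inl rfl) h.1 h.2.1 h.2.2) (fun i s h => h.1.input.dim) ?_).mono
    (fun s h => ⟨h.1, h.2.1, Or.inl ⟨h.2.2, by simp [T]⟩⟩) (fun s h => ⟨h.1, h.2.2.mono ?_⟩) le_rfl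
  · intro n hn
    refine (UnitTriple.forLoop (n := .const 3) (N := 3) (T := 1)
      (fun c s => (Ready L A p x s ∧ s.nat 12 = N ∧ Found L A p x (fun j i => T n j i ∨
        ((j : ℕ) = n ∧ ∃ c' < c, N 0 c' = i + 1) ∨ ((i : ℕ) = n ∧ ∃ c' < c, N 0 c' = j + 1)) s) ∧
        s.nat 10 0 0 = n)
      (fun i v s h => ⟨hstab (Or.inr rfl) h.1.1 h.1.2.1 h.1.2.2,
        by simpa [Mem.writeNat] using h.2⟩) (fun i s h => rfl) ?_).mono
      (fun s h => ⟨⟨h.1.1, h.1.2.1, h.1.2.2.mono ?_⟩, h.2⟩)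
      (fun s h => ⟨⟨h.1.1, h.1.2.1, h.1.2.2.mono ?_⟩, h.2⟩) le_rfl
    · intro c hc
      refine UnitTriple.straight (by simp [trySwaps, trySwap, Prog.Straight]) ?_
      rintro s ⟨⟨⟨hR, hN, hT⟩, h10⟩, h11⟩
      have hcand : ∀ s' : Mem ℝ, s'.nat 11 = s.nat 11 → s'.nat 12 = s.nat 12 →
          candidate.eval s' = N 0 c := by
        intro s' h1 h2
        simp only [candidate, NExp.row, NExp.cell, NExp.eval, h1, h2, h11, hN]
      have htest : (Test.nlt (.const 0) candidate).eval s ↔ N 0 c ≠ 0 := by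
        simp [Test.nlt, Test.eval, NExp.eval, hcand s rfl rfl]
      by_cases h0 : N 0 c = 0
      · rw [trySwaps, res_ite' (by rw [htest]; simpa using h0)]
        refine ⟨⟨⟨hR, hN, hT.mono ?_⟩, h10⟩, h11⟩
        have hlift : ∀ k : Fin d, (∃ c' < c + 1, N 0 c' = k + 1) → ∃ c' < c, N 0 c' = k + 1 := by
          rintro k ⟨c', h1, h2⟩
          refine ⟨c', lt_of_le_of_ne (by omega) ?_, h2⟩
          rintro rfl
          omega
        rintro j i (h | ⟨h1, h2⟩ | ⟨h1, h2⟩)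
        exacts [Or.inl h, Or.inr (Or.inl ⟨h1, hlift _ h2⟩), Or.inr (Or.inr ⟨h1, hlift _ h2⟩)]
      · obtain ⟨h, hh⟩ : ∃ h : Fin d, N 0 c = h + 1 := by
          rw [← hN]
          rw [← hN] at h0
          interval_cases c
          · rcases hR.split with h1 | ⟨h, h1, -⟩
            exacts [absurd h1.1 h0, ⟨h, h1⟩]
          · rcases hR.pickUp with h1 | ⟨h, h1, -⟩
            exacts [absurd h1.1 h0, ⟨h, h1⟩]
          · rcases hR.pickDown with h1 | ⟨h, h1, -⟩
            exacts [absurd h1.1 h0, ⟨h, h1⟩]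
        rw [trySwaps, res_ite (htest.2 h0), Prog.res]
        have hJ : ∀ s' : Mem ℝ, s'.nat 10 = s.nat 10 → J.eval s' = ((⟨n, hn⟩ : Fin d) : ℕ) := by
          intro s' h1
          simp only [J, NExp.cell, NExp.eval, h1, h10]
        have hC : ∀ s' : Mem ℝ, s'.nat 11 = s.nat 11 → s'.nat 12 = s.nat 12 →
            (NExp.sub candidate (.const 1)).eval s' = h := by
          intro s' h1 h2
          rw [NExp.eval, hcand s' h1 h2, hh]
          rfl
        obtain ⟨a1, a2, a3, a4, a5⟩ := trySwap_spec hR hF (fun s' h1 _ _ => hJ s' h1)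
          (fun s' _ h1 h2 => hC s' h1 h2) hT
        obtain ⟨b1, b2, b3, b4, b5⟩ := trySwap_spec a1 hF
          (fun s' _ h1 h2 => hC s' (h1.trans a4) (h2.trans a5))
          (fun s' h1 _ _ => hJ s' (h1.trans a3)) a2
        refine ⟨⟨⟨b1, by rw [b5, a5, hN], b2.mono ?_⟩, by rw [b3, a3, h10]⟩, by rw [b4, a4, h11]⟩
        have hlift : ∀ k : Fin d, (∃ c' < c + 1, N 0 c' = k + 1) →
            (∃ c' < c, N 0 c' = k + 1) ∨ k = h := by
          rintro k ⟨c', h1, h2⟩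
          rcases Nat.lt_succ_iff_lt_or_eq.1 h1 with h3 | rfl
          · exact Or.inl ⟨c', h3, h2⟩
          · right; apply Fin.ext; omega
        rintro j i (h1 | ⟨h1, h2⟩ | ⟨h1, h2⟩)
        · exact Or.inl (Or.inl (Or.inl h1))
        · rcases hlift _ h2 with h3 | h3
          · exact Or.inl (Or.inl (Or.inr (Or.inl ⟨h1, h3⟩)))
          · exact Or.inl (Or.inr ⟨Fin.ext h1, h3⟩)
        · rcases hlift _ h2 with h3 | h3
          · exact Or.inl (Or.inl (Or.inr (Or.inr ⟨h1, h3⟩)))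
          · exact Or.inr ⟨h3, Fin.ext h1⟩
    · rintro j i (h | ⟨-, c', h, -⟩ | ⟨-, c', h, -⟩)
      exacts [h, absurd h (Nat.not_lt_zero _), absurd h (Nat.not_lt_zero _)]
    · rintro j i (⟨h1, h2⟩ | ⟨h1, h2⟩)
      · rcases Nat.lt_succ_iff_lt_or_eq.1 h1 with h3 | h3
        exacts [Or.inl (Or.inl ⟨h3, h2⟩), Or.inr (Or.inl ⟨h3, h2⟩)]
      · rcases Nat.lt_succ_iff_lt_or_eq.1 h1 with h3 | h3
        exacts [Or.inl (Or.inr ⟨h3, h2⟩), Or.inr (Or.inr ⟨h3, h2⟩)]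
  · rintro j i (h | h)
    exacts [Or.inr ⟨i.2, h⟩, Or.inl ⟨j.2, h⟩]

theorem copy_spec {T : Fin d → Fin d → Prop} :
    UnitTriple (fun s => Input L A p x s ∧ Found L A p x T s)
      (forGoods (.setNum 6 (.const 0) J (.row 3 0 J)))
      (fun s => Input L A p x s ∧ Found L A p x T s ∧ ∀ j : Fin d, s.num 6 0 j = x j)
      (d * 2 + 2) := by
  refine (forGoods_spec (by simp [Prog.Straight])
    (fun n s => Input L A p x s ∧ Found L A p x T s ∧ ∀ j : Fin d, (j : ℕ) < n → s.num 6 0 j = x j)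
    (fun i s h => h.1)
    (fun i v s h => ⟨h.1.writeNat _ _ _ (by norm_num),
      by simpa [Found, Mem.writeNat] using h.2.1, h.2.2⟩) ?_).mono
    (fun s h => ⟨h.1, h.2, fun j hj => absurd hj (Nat.not_lt_zero _)⟩)
    (fun s h => ⟨h.1, h.2.1, fun j => h.2.2 j j.2⟩) le_rfl
  rintro j s ⟨hI, hT, hx⟩ hc
  have e : (Prog.setNum 6 (.const 0) J (.row 3 0 J)).res s = s.writeNum 6 0 j (x j) := by
    simp [Prog.res, RExp.eval, RExp.row, NExp.eval, eval_J hc, hI.bundle]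
  rw [e]
  refine ⟨⟨hI.writeNum _ _ _ (by norm_num), by simpa [Found, Mem.writeNum] using hT, ?_⟩, hc⟩
  refine forall_lt_succ (fun i hi => ?_) (by simp [Mem.writeNum])
  simpa [Mem.writeNum, hi.ne] using hx i hi

theorem output_spec {T : Fin d → Fin d → Prop} (hT : ∃ j i, T j i ∧ ValidSwap L x j i) :
    UnitTriple (fun s => Input L A p x s ∧ Found L A p x T s ∧ ∀ j : Fin d, s.num 6 0 j = x j)
      output
      (fun s => ∃ j i, ValidSwap L x j i ∧ (∀ j' i', T j' i' → ValidSwap L x j' i' →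
        swapLoss L A p x j i ≤ swapLoss L A p x j' i') ∧
        secondBestOutput d s = swapBundle L p x j i) 1 := by
  refine UnitTriple.straight (by simp [output, Prog.Straight]) ?_
  rintro s ⟨hI, (⟨-, h2⟩ | ⟨j, i, h1, h2, h3, h4, h5, h6⟩), hx⟩
  · obtain ⟨j, i, h3, h4⟩ := hT
    exact absurd h4 (h2 j i h3)
  · refine ⟨j, i, h1, h6, ?_⟩
    have hij : (i : ℕ) ≠ j := fun h => h1.1 (Fin.ext h.symm)
    funext g
    simp only [secondBestOutput, output, Prog.res, bestDown, bestUp, NExp.cell, NExp.eval, RExp.eval,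
      RExp.row, Mem.writeNum, h2, h3, Nat.add_sub_cancel, h5, hI.price, hx]
    simp only [swapBundle, Function.update_apply, Fin.ext_iff]
    by_cases hg : (g : ℕ) = i
    · simp [hg, hij]
    · by_cases hg' : (g : ℕ) = j
      · simp [hg', hij.symm]
      · simp [hg, hg']

theorem prog_spec (hL : L.Valid) (hA : IsSlopes L A) {B : ℝ} (hp : ∀ j, 0 < p j)
    (hx : x ∈ optimalBundles (splcUtility L A) p B) (hadm : IsAdmissible L p B x)
    (hy : ∃ y, IsAdmissible L p B y ∧ y ≠ x) :
    ∃ (s : Mem ℝ) (t : ℕ), Exec (unitCost ℝ) prog (secondBestInput L A p B x) s t ∧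
      t ≤ ((21 * d + 22) * prog.wt) ∧ IsSecondBest L A p B x (secondBestOutput d s) := by
  obtain ⟨y, hy, hyx⟩ := hy
  -- If everything is affordable then no second admissible bundle exists.
  rcases hadm with ⟨h1, rfl⟩ | ⟨hB, hx1, hc, hF⟩
  · rcases hy with ⟨-, rfl⟩ | ⟨h2, -⟩
    · exact absurd rfl hyx
    · linarith
  rcases hy with ⟨h1, -⟩ | ⟨-, hy1, hy2, hy3⟩
  · linarith
  have hF' : ∀ f g, IsSplitGood L x f → IsSplitGood L x g → f = g := by
    intro f g hf hg
    rw [isSplitGood_iff hL hx1] at hf hg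
    exact (Set.ncard_le_one).1 hF f hf g hg
  obtain ⟨j0, i0, hv0, -⟩ := exists_validSwap hL hA hp hx hy1 (hy2.trans hc.symm) hyx hF hy3
  have key : ∀ N : ℕ → ℕ → ℕ, UnitTriple
      (fun s => Ready L A p x s ∧ s.nat 12 = N ∧ s.nat 13 0 0 = 0)
      (.seq (forGoods (.forLoop 11 (.const 3) trySwaps))
        (.seq (forGoods (.setNum 6 (.const 0) J (.row 3 0 J))) output))
      (fun s => IsSecondBest L A p B x (secondBestOutput d s))
      ((d * (3 * 2 + 2 + 1) + 2) + ((d * 2 + 2) + 1 + 1) + 1) := by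
    intro N s hs hR
    set H : Set (Fin d) := {h | ∃ c < 3, N 0 c = h + 1} with hH
    have hf : ∀ f, IsSplitGood L x f → f ∈ H := by
      intro f hf
      rcases hR.1.split with ⟨-, h⟩ | ⟨h, h1, h2⟩
      · exact absurd hf (h f f.2)
      · exact ⟨0, by norm_num, by rw [← hR.2.1, h1, hF' h f h2 hf]⟩
    have hup : ∀ i, x i < 1 → ∃ h ∈ H, x h < 1 ∧
        ∀ i, x i < 1 → upRate L A p x i ≤ upRate L A p x h := by
      intro i hi
      rcases hR.1.pickUp with ⟨-, h⟩ | ⟨h, h1, h2, h3⟩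
      · exact absurd hi (h i i.2)
      · exact ⟨h, ⟨1, by norm_num, by rw [← hR.2.1, h1]⟩, h2, fun i hi => h3 i i.2 hi⟩
    have hdown : ∀ j, 0 < x j → ∃ h ∈ H, 0 < x h ∧
        ∀ j, 0 < x j → downRate L A p x h ≤ downRate L A p x j := by
      intro i hi
      rcases hR.1.pickDown with ⟨-, h⟩ | ⟨h, h1, h2, h3⟩
      · exact absurd hi (h i i.2)
      · exact ⟨h, ⟨2, by norm_num, by rw [← hR.2.1, h1]⟩, h2, fun i hi => h3 i i.2 hi⟩
    obtain ⟨j1, i1, hv1, hm1, -⟩ := exists_validSwap_of_mem hL hA hp hx hf hup hdown hv0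
    refine ((trySwaps_spec hF' N).seq (((copy_spec (T := fun j i => (∃ c < 3, N 0 c = j + 1) ∨
      ∃ c < 3, N 0 c = i + 1)).mono (fun s h => ⟨h.1.input, h.2⟩) (fun s h => h) le_rfl).seq
      (output_spec ⟨j1, i1, hm1, hv1⟩))).mono (fun s h => h) ?_ le_rfl s hs hR
    rintro s ⟨j, i, hv, hmin, he⟩
    rw [he]
    exact isSecondBest_of_minimal hL hA hp hx hB hc hF hf hup hdown hv fun j' i' h1 h2 =>
      hmin j' i' h2 h1
  have T1 := ((downRates_spec (A := A) (p := p) (x := x) hL).frameNat (a := 12)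
    (by simp [forGoods, downRates, Prog.forLoop, Prog.KeepsNat]) (fun N => N = 0)).frameNat
    (a := 13) (by simp [forGoods, downRates, Prog.forLoop, Prog.KeepsNat]) (fun N => N 0 0 = 0)
  have T2 := (pickDown_spec (L := L) (A := A) (p := p) (x := x)).frameNat
    (a := 13) (by simp [forGoods, pickDown, Prog.forLoop, Prog.KeepsNat]) (fun N => N 0 0 = 0)
  have T3 := (nextSegments_spec (A := A) (p := p) hL hx1).frameNat
    (a := 13) (by simp [forGoods, nextSegments, Prog.forLoop, Prog.KeepsNat]) (fun N => N 0 0 = 0)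
  have T4 := (upRates_spec (A := A) (p := p) hL hx1).frameNat
    (a := 13) (by simp [forGoods, upRates, Prog.forLoop, Prog.KeepsNat]) (fun N => N 0 0 = 0)
  have T5 := (pickUp_spec (L := L) (A := A) (p := p) (x := x)).frameNat
    (a := 13) (by simp [forGoods, pickUp, Prog.forLoop, Prog.KeepsNat]) (fun N => N 0 0 = 0)
  -- The candidates are known at run time only, so `key` is applied to the table that is found in
  -- the memory.
  have T6 : UnitTriple (fun s => Ready L A p x s ∧ s.nat 13 0 0 = 0) _ _ _ :=
    fun s hs hR => key (s.nat 12) s hs ⟨hR.1, rfl, hR.2⟩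
  have T := (T1.mono (P' := fun s => Input L A p x s ∧ s.nat 12 = 0 ∧ s.nat 13 0 0 = 0)
    (fun s h => ⟨⟨h.1, h.2.1⟩, h.2.2⟩) (fun s h => ⟨⟨h.1.1.1, h.1.1.2, by rw [h.1.2]; rfl,
      by rw [h.1.2]; rfl, by rw [h.1.2]; rfl⟩, h.2⟩) le_rfl).seq
    ((T2.mono (fun s h => h) (fun s h => ⟨⟨h.1.1, h.1.2.1, h.1.2.2.1, h.1.2.2.2⟩, h.2⟩) le_rfl).seq
    (T3.seq ((T4.mono (fun s h => h) (fun s h => ⟨⟨h.1.1, h.1.2.2.2.2.2.2, h.1.2.2.2.1, h.1.2.1,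
      h.1.2.2.1, h.1.2.2.2.2.1⟩, h.2⟩) le_rfl).seq
    ((T5.mono (fun s h => h) (fun s h => ⟨⟨h.1.1, h.1.2.2.2.1, h.1.2.1, h.1.2.2.2.2.1, h.1.2.2.1,
      h.1.2.2.2.2.2⟩, h.2⟩) le_rfl).seq T6))))
  obtain ⟨s, t, h1, -, h2, h3⟩ := T (secondBestInput L A p B x)
    ⟨fun _ _ _ => Nat.zero_le _, fun _ _ _ => Nat.zero_le _⟩
    ⟨input_secondBestInput L A p B x, rfl, rfl⟩
  refine ⟨s, t, h1, h3.trans ?_, h2⟩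
  simp only [zero_add, mul_one]
  exact Nat.mul_le_mul_right _ (by ring_nf; omega)

end SecondBestProgram

end SecondBestProgram

theorem secondBestInLinearTime : SecondBestInLinearTime := by
  refine ⟨SecondBestProgram.prog, 64 * SecondBestProgram.prog.wt, ?_⟩
  intro d κ L hL A hA p B hp _ x hx hadm hy
  obtain ⟨s, t, h1, h2, h3⟩ := SecondBestProgram.prog_spec hL hA hp hx hadm hy
  refine ⟨s, t, h1, h2.trans ?_, h3⟩
  -- Two different bundles need at least one good; this absorbs the additive constant into the bound
  -- `c * d`.
  have hd : 0 < d := by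
    rcases Nat.eq_zero_or_pos d with rfl | h
    · obtain ⟨y, -, hy⟩ := hy
      exact absurd (Subsingleton.elim y x) hy
    · exact h
  have : 21 * d + 22 ≤ 64 * d := by omega
  calc (21 * d + 22) * SecondBestProgram.prog.wt ≤ (64 * d) * SecondBestProgram.prog.wt :=
        Nat.mul_le_mul_right _ this
    _ = 64 * SecondBestProgram.prog.wt * d := by ring

/-! ## Least solutions of systems of inequalities between pairs of slopes -/

section LeastSolutions

/-- The inequality that the value at `src` is more than `wt` times the value at `dst`. -/
structure Edge (K : Type) where
  src : ℕ × ℕ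
  dst : ℕ × ℕ
  wt : K

variable {K : Type} [Field K] [LinearOrder K] [IsStrictOrderedRing K]

/-- The least value at `src`; the second component counts strict inequalities. -/
def Edge.act (e : Edge K) (a : K ×ₗ K) : K ×ₗ K := toLex (e.wt * (ofLex a).1, (ofLex a).2 + 1)

theorem lex_le_iff {a b : K ×ₗ K} :
    a ≤ b ↔ (ofLex a).1 < (ofLex b).1 ∨ (ofLex a).1 = (ofLex b).1 ∧ (ofLex a).2 ≤ (ofLex b).2 :=
  Prod.Lex.le_iff

theorem fst_le_of_lex_le {a b : K ×ₗ K} (h : a ≤ b) : (ofLex a).1 ≤ (ofLex b).1 := by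
  rcases lex_le_iff.1 h with h | h
  exacts [h.le, h.1.le]

theorem Edge.act_mono {e : Edge K} (he : 0 < e.wt) : Monotone e.act := by
  intro a b hab
  rw [lex_le_iff] at hab ⊢
  rcases hab with h | ⟨h1, h2⟩
  · exact Or.inl (mul_lt_mul_of_pos_left h he)
  · exact Or.inr ⟨by simp [Edge.act, h1], by simpa [Edge.act] using h2⟩

/-- One improvement of a lower bound for the least solution above `u₀`. -/
def improve (ed : ℕ → Edge K) (m : ℕ) (u₀ u : ℕ × ℕ → K ×ₗ K) (f : ℕ × ℕ) : K ×ₗ K :=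
  (Finset.range (m + 1)).sup' ⟨0, by simp⟩
    fun e => if e < m ∧ (ed e).src = f then (ed e).act (u (ed e).dst) else u₀ f

/-- The bounds after `r` rounds. -/
def rounds (ed : ℕ → Edge K) (m : ℕ) (u₀ : ℕ × ℕ → K ×ₗ K) : ℕ → ℕ × ℕ → K ×ₗ K
  | 0 => u₀
  | r + 1 => improve ed m (rounds ed m u₀ r) (rounds ed m u₀ r)

variable {ed : ℕ → Edge K} {m : ℕ} {u₀ u : ℕ × ℕ → K ×ₗ K}

theorem le_improve (f : ℕ × ℕ) : u₀ f ≤ improve ed m u₀ u f := by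
  have := Finset.le_sup' (fun e => if e < m ∧ (ed e).src = f then (ed e).act (u (ed e).dst) else u₀ f)
    (Finset.self_mem_range_succ m)
  simpa [improve] using this

theorem act_le_improve {e : ℕ} (he : e < m) :
    (ed e).act (u (ed e).dst) ≤ improve ed m u₀ u (ed e).src := by
  have := Finset.le_sup' (fun e' => if e' < m ∧ (ed e').src = (ed e).src then
    (ed e').act (u (ed e').dst) else u₀ (ed e).src) (Finset.mem_range.2 (he.trans (Nat.lt_succ_self m)))
  simpa [improve, he] using this

theorem improve_eq (f : ℕ × ℕ) : improve ed m u₀ u f = u₀ f ∨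
    ∃ e < m, (ed e).src = f ∧ improve ed m u₀ u f = (ed e).act (u (ed e).dst) := by
  obtain ⟨e, -, he⟩ := Finset.exists_mem_eq_sup' (s := Finset.range (m + 1)) ⟨0, by simp⟩
    (fun e => if e < m ∧ (ed e).src = f then (ed e).act (u (ed e).dst) else u₀ f)
  change improve ed m u₀ u f = _ at he
  split_ifs at he with h
  · exact Or.inr ⟨e, h.1, h.2, he⟩
  · exact Or.inl he

theorem improve_le {f : ℕ × ℕ} {a : K ×ₗ K} (h0 : u₀ f ≤ a)
    (h : ∀ e < m, (ed e).src = f → (ed e).act (u (ed e).dst) ≤ a) : improve ed m u₀ u f ≤ a := by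
  rcases improve_eq (ed := ed) (m := m) (u₀ := u₀) (u := u) f with h1 | ⟨e, h1, h2, h3⟩
  · rwa [h1]
  · rw [h3]; exact h e h1 h2

theorem rounds_mono {r r' : ℕ} (h : r ≤ r') (f : ℕ × ℕ) :
    rounds ed m u₀ r f ≤ rounds ed m u₀ r' f := by
  induction h with
  | refl => exact le_rfl
  | step _ ih => exact ih.trans (le_improve f)

/-- If the inequalities have a strict solution, then as many rounds suffice as there are
inequalities. -/
theorem act_rounds_le (hw : ∀ e < m, 0 < (ed e).wt) (h0 : ∀ e < m, 0 < (ofLex (u₀ (ed e).src)).1)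
    {a : ℕ × ℕ → K} (ha : ∀ e < m, 0 < a (ed e).src)
    (hae : ∀ e < m, (ed e).wt * a (ed e).dst < a (ed e).src) {e : ℕ} (he : e < m) :
    (ed e).act (rounds ed m u₀ (m + 1) (ed e).dst) ≤ rounds ed m u₀ (m + 1) (ed e).src := by
  by_contra hlt
  rw [not_le] at hlt
  set J := rounds ed m u₀ with hJ
  -- Inequality `e` is responsible for a strict improvement between the rounds `r` and `r + 1`.
  set P : ℕ → ℕ → Prop := fun r e => e < m ∧ J r (ed e).src < J (r + 1) (ed e).src ∧
    J (r + 1) (ed e).src = (ed e).act (J r (ed e).dst) with hP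
  have hfind : ∀ r f, J r f < J (r + 1) f → ∃ e, P r e ∧ (ed e).src = f := by
    intro r f hf
    rcases improve_eq (ed := ed) (m := m) (u₀ := J r) (u := J r) f with h1 | ⟨e, h1, rfl, h3⟩
    · exact absurd h1 (ne_of_gt hf)
    · exact ⟨e, ⟨h1, hf, h3⟩, rfl⟩
  -- If the value at `dst` had not just improved, the value at `src` would already have been that
  -- large one round before.
  have hstep : ∀ r e, P (r + 1) e → ∃ e', P r e' ∧ (ed e').src = (ed e).dst := by
    rintro r e ⟨h1, h2, h3⟩
    refine hfind r _ (not_le.1 fun h => ?_)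
    have := Edge.act_mono (hw e h1) h
    rw [← h3] at this
    exact absurd (h2.trans_le this) (not_lt.2 (act_le_improve h1))
  have hseq : ∀ r e, P r e → ∃ q : ℕ → ℕ, q r = e ∧ (∀ i ≤ r, P i (q i)) ∧
      ∀ i < r, (ed (q i)).src = (ed (q (i + 1))).dst := by
    intro r
    induction r with
    | zero =>
      intro e h
      refine ⟨fun _ => e, rfl, fun i hi => ?_, fun i hi => absurd hi (Nat.not_lt_zero _)⟩
      obtain rfl : i = 0 := by omega
      exact h
    | succ r ih =>
      intro e h
      obtain ⟨e', h1, h2⟩ := hstep r e h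
      obtain ⟨q, h3, h4, h5⟩ := ih e' h1
      refine ⟨Function.update q (r + 1) e, by simp, fun i hi => ?_, fun i hi => ?_⟩
      · rcases Nat.le_succ_iff.1 hi with hi | rfl
        · rw [Function.update_of_ne (by omega)]; exact h4 i hi
        · simpa using h
      · rw [Function.update_of_ne (by omega)]
        rcases Nat.lt_succ_iff_lt_or_eq.1 hi with hi | rfl
        · rw [Function.update_of_ne (by omega)]; exact h5 i hi
        · rw [Function.update_self, h3, h2]
  obtain ⟨e₀, hPe, -⟩ := hfind (m + 1) (ed e).src (hlt.trans_le (act_le_improve he))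
  obtain ⟨q, -, hq1, hq2⟩ := hseq (m + 1) e₀ hPe
  -- Relative to the strict solution `a`, the values drop along the chain of improvements, as each
  -- inequality holds strictly for `a`.
  set ρ : ℕ → K := fun r => (ofLex (J (r + 1) (ed (q r)).src)).1 / a (ed (q r)).src with hρ
  have hdec : ∀ r < m + 1, ρ (r + 1) < ρ r := by
    intro r hr
    obtain ⟨h1, -, h3⟩ := hq1 (r + 1) hr
    obtain ⟨h1', -, -⟩ := hq1 r hr.le
    have hpos : 0 < (ofLex (J (r + 1) (ed (q r)).src)).1 :=
      (h0 _ h1').trans_le (fst_le_of_lex_le (rounds_mono (Nat.zero_le (r + 1)) _))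
    simp only [hρ, h3, Edge.act, ofLex_toLex, ← hq2 r hr]
    rw [div_lt_div_iff₀ (ha _ h1) (ha _ h1')]
    have := hae _ h1
    rw [← hq2 r hr] at this
    nlinarith
  have hanti : ∀ r r', r < r' → r' ≤ m + 1 → ρ r' < ρ r := by
    intro r r' h
    induction h with
    | refl => exact fun h => hdec r h
    | step _ ih => exact fun h => (hdec _ h).trans (ih (Nat.le_of_succ_le h))
  -- The chain has `m + 2` members, so one of the `m` inequalities repeats. The value at its source
  -- would have decreased from one round to a later one, but rounds never decrease.
  obtain ⟨r, hr, r', hr', hne, heq⟩ := Finset.exists_ne_map_eq_of_card_lt_of_maps_to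
    (s := Finset.range (m + 2)) (t := Finset.range m) (by simp) (f := q)
    (fun i hi => by simpa using (hq1 i (by simpa [Nat.lt_succ_iff] using hi)).1)
  have key : ∀ r r', r < r' → r' ≤ m + 1 → q r = q r' → False := by
    intro r r' h h' heq
    have h1 := hanti r r' h h'
    simp only [hρ, ← heq] at h1
    rw [div_lt_div_iff_of_pos_right (ha _ (hq1 r (by omega)).1)] at h1
    exact absurd (fst_le_of_lex_le (rounds_mono (u₀ := u₀) (show r + 1 ≤ r' + 1 by omega) _)) (not_le.2 h1)
  simp only [Finset.mem_range] at hr hr'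
  rcases lt_or_gt_of_ne hne with h | h
  · exact key r r' h (by omega) heq
  · exact key r' r h (by omega) heq.symm

end LeastSolutions

/-! ## The learner -/

section Learner

variable {K : Type} [Field K] [LinearOrder K] {d κ : ℕ}

def chainEdges (L : Segments K d κ) : Set (Edge K) :=
  {e | ∃ (j : Fin d) (k : ℕ), k + 1 < L.num j ∧ e = ⟨(j, k), (j, k + 1), 1⟩}

/-- The inequality for the segments of the goods `j` and `j'` that an observation implies. -/
def obsEdge (L : Segments K d κ) (o : Obs K d) (j j' : Fin d) : Edge K :=
  ⟨(j, L.lo j (o.bundle j)), (j', L.hi j' (o.bundle j')), o.price j / o.price j'⟩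

/-- Free goods contribute no inequality: if `j` is free then only positivity of its slope is at
stake, which start value one ensures, and a free `j'` is bought completely in every realizable
observation. -/
def HasObsEdge (o : Obs K d) (j j' : Fin d) : Prop :=
  j ≠ j' ∧ 0 < o.bundle j ∧ o.bundle j' < 1 ∧ 0 < o.price j ∧ 0 < o.price j'

def obsEdges (L : Segments K d κ) (o : Obs K d) : Set (Edge K) :=
  {e | ∃ j j', HasObsEdge o j j' ∧ e = obsEdge L o j j'}

/-- The segments that are not bought although there is money left. -/
def obsZeros (L : Segments K d κ) (o : Obs K d) : Set (ℕ × ℕ) :=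
  {f | o.price ⬝ᵥ o.bundle < o.budget ∧
    ∃ j, o.bundle j < 1 ∧ f = ((j : ℕ), L.hi j (o.bundle j))}

variable {ι : Type*}

def edgeSet (L : Segments K d κ) (S : ι → Obs K d) : Set (Edge K) :=
  chainEdges L ∪ ⋃ i, obsEdges L (S i)

def zeroSet (L : Segments K d κ) (S : ι → Obs K d) : Set (ℕ × ℕ) := ⋃ i, obsZeros L (S i)

-- The inequalities are homogeneous, so the scale is arbitrary. Starting at one makes every slope
-- positive that is not known to be zero.
open Classical in
noncomputable def startValue (L : Segments K d κ) (S : ι → Obs K d) (f : ℕ × ℕ) : K ×ₗ K :=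
  toLex (if f.1 < d ∧ f.2 < κ ∧ f ∉ zeroSet L S then 1 else 0, 0)

/-- A solution of the inequalities in which every value is forced. -/
structure IsTightSolution (E : Set (Edge K)) (u₀ u : ℕ × ℕ → K ×ₗ K) : Prop where
  start_le : u₀ ≤ u
  closed : ∀ e ∈ E, e.act (u e.dst) ≤ u e.src
  tight : ∀ f, u f = u₀ f ∨ ∃ e ∈ E, e.src = f ∧ u f = e.act (u e.dst)
  nonneg : ∀ f, 0 ≤ (ofLex (u f)).2

/-- The bounds for the unit of strictness. -/
def slacks (E : Set (Edge K)) (u : ℕ × ℕ → K ×ₗ K) : Set K :=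
  {t | ∃ e ∈ E, e.wt * (ofLex (u e.dst)).1 < (ofLex (u e.src)).1 ∧
    t = ((ofLex (u e.src)).1 - e.wt * (ofLex (u e.dst)).1) /
      (1 + e.wt * (ofLex (u e.dst)).1 * (ofLex (u e.dst)).2)}

/-- The slope of a segment, if `η` is the unit of strictness. -/
def slopeOf (u : ℕ × ℕ → K ×ₗ K) (η : K) (f : ℕ × ℕ) : K :=
  (ofLex (u f)).1 * (1 + η * (ofLex (u f)).2)

/-- The matrix `a` of slopes is obtained from the least solution of the inequalities. -/
def IsFit (L : Segments K d κ) (S : ι → Obs K d) (a : Fin d → Fin κ → K) : Prop :=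
  ∃ u η, IsTightSolution (edgeSet L S) (startValue L S) u ∧
    IsLeast (insert 1 (slacks (edgeSet L S) u)) η ∧
    ∀ j k, a j k = if (k : ℕ) < L.num j then slopeOf u η (j, k) else 0

variable [IsStrictOrderedRing K]

theorem chainEdges_pos {L : Segments K d κ} {e : Edge K} (he : e ∈ chainEdges L) : 0 < e.wt := by
  obtain ⟨j, k, -, rfl⟩ := he
  exact one_pos

theorem edgeSet_pos {L : Segments K d κ} {S : ι → Obs K d} {e : Edge K} (he : e ∈ edgeSet L S) :
    0 < e.wt := by
  rcases he with he | he
  · exact chainEdges_pos he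
  · obtain ⟨i, j, j', h, rfl⟩ := Set.mem_iUnion.1 he
    exact div_pos h.2.2.2.1 h.2.2.2.2

/-- A value that is not a start value is forced by an inequality whose `dst` has a count smaller by
one. Counts are non-negative, so the forcing leads back to start values, and induction on the count
bounds `u` by every solution. -/
theorem IsTightSolution.le {E : Set (Edge K)} {u₀ u w : ℕ × ℕ → K ×ₗ K}
    (hu : IsTightSolution E u₀ u) (hE : ∀ e ∈ E, 0 < e.wt) [Archimedean K] (h0 : u₀ ≤ w)
    (hw : ∀ e ∈ E, e.act (w e.dst) ≤ w e.src) : u ≤ w := by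
  have key : ∀ n : ℕ, ∀ f, (ofLex (u f)).2 < n → u f ≤ w f := by
    intro n
    induction n with
    | zero =>
      intro f hf
      have := hu.nonneg f
      exact absurd hf (not_lt.2 (by simpa using this))
    | succ n ih =>
      intro f hf
      rcases hu.tight f with h | ⟨e, he, rfl, h⟩
      · rw [h]; exact h0 f
      · have h1 : u e.dst ≤ w e.dst := by
          refine ih _ ?_
          have : (ofLex (u e.src)).2 = (ofLex (u e.dst)).2 + 1 := by rw [h]; rfl
          rw [this] at hf
          push_cast at hf
          linarith
        rw [h]
        exact (Edge.act_mono (hE e he) h1).trans (hw e he)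
  intro f
  obtain ⟨n, hn⟩ := exists_nat_gt (ofLex (u f)).2
  exact key n f hn

/-- Two tight solutions lie below each other. Uniqueness identifies the slopes learned from a
subsample with those learned from the whole sample. -/
theorem IsFit.unique [Archimedean K] {L : Segments K d κ} {S : ι → Obs K d}
    {a a' : Fin d → Fin κ → K} (h : IsFit L S a) (h' : IsFit L S a') : a = a' := by
  obtain ⟨u, η, hu, hη, ha⟩ := h
  obtain ⟨u', η', hu', hη', ha'⟩ := h'
  obtain rfl : u = u' := le_antisymm
    (hu.le (fun _ he => edgeSet_pos he) hu'.start_le hu'.closed)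
    (hu'.le (fun _ he => edgeSet_pos he) hu.start_le hu.closed)
  obtain rfl : η = η' := hη.unique hη'
  funext j k
  rw [ha, ha']

/-- A value that nothing forces could be lowered. -/
theorem isTightSolution_of_isLeast {ed : ℕ → Edge K} {m : ℕ} {u₀ u : ℕ × ℕ → K ×ₗ K}
    (hw : ∀ e < m, 0 < (ed e).wt) (h0 : u₀ ≤ u)
    (hc : ∀ e < m, (ed e).act (u (ed e).dst) ≤ u (ed e).src)
    (hmin : ∀ w, u₀ ≤ w → (∀ e < m, (ed e).act (w (ed e).dst) ≤ w (ed e).src) → u ≤ w)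
    (hn : ∀ f, 0 ≤ (ofLex (u f)).2) {E : Set (Edge K)} (hE : ∀ e, e ∈ E ↔ ∃ i < m, e = ed i) :
    IsTightSolution E u₀ u := by
  refine ⟨h0, ?_, fun f => ?_, hn⟩
  · intro e he
    obtain ⟨i, hi, rfl⟩ := (hE e).1 he
    exact hc i hi
  · have hle : improve ed m u₀ u f ≤ u f := improve_le (h0 f) fun e he h => h ▸ hc e he
    have : u f ≤ improve ed m u₀ u f := by
      -- Lowering the value at `f` to what is forced by `u` leaves a solution, since the right-hand
      -- sides decrease too; by minimality nothing has been lowered.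
      have hle' : Function.update u f (improve ed m u₀ u f) ≤ u := by
        intro g
        by_cases hg : g = f
        · subst hg; simpa using hle
        · simp [hg]
      have := hmin (Function.update u f (improve ed m u₀ u f)) (fun g => ?_) (fun e he => ?_) f
      · simpa using this
      · by_cases hg : g = f
        · subst hg; simpa using le_improve g
        · simpa [hg] using h0 g
      · have h1 := Edge.act_mono (hw e he) (hle' (ed e).dst)
        by_cases hg : (ed e).src = f
        · subst hg
          rw [Function.update_self]
          exact h1.trans (act_le_improve he)
        · rw [Function.update_of_ne hg]
          exact h1.trans (hc e he)
    have heq := le_antisymm this hle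
    rcases improve_eq (ed := ed) (m := m) (u₀ := u₀) (u := u) f with h | ⟨e, h1, h2, h3⟩
    · exact Or.inl (heq.trans h)
    · exact Or.inr ⟨ed e, (hE _).2 ⟨e, h1, rfl⟩, h2, heq.trans h3⟩

end Learner

/-! ### Fitted slopes explain the sample and can be compressed -/

section Fitting

variable {d κ : ℕ} {ι : Type*} {L : Segments ℝ d κ} {S : ι → Obs ℝ d} {A a : Fin d → Fin κ → ℝ}

/-- The observations are bundles bought for strict reasons by a buyer with slopes `A`. -/
def Realizes (L : Segments ℝ d κ) (A : Fin d → Fin κ → ℝ) (S : ι → Obs ℝ d) : Prop :=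
  ∀ i, (∀ j, 0 ≤ (S i).price j) ∧ Fits L A (S i).price (S i).budget (S i).bundle

theorem padMat_of_lt {R : Type} [Zero R] {m n : ℕ} (M : Fin m → Fin n → R) (i : Fin m) (k : ℕ) :
    padMat M i k = padVec (M i) k := by
  simp [padMat]

theorem Realizes.zero (h : Realizes L A S) {f : ℕ × ℕ} (hf : f ∈ zeroSet L S) :
    padMat A f.1 f.2 = 0 := by
  obtain ⟨i, h1, j, h2, rfl⟩ := Set.mem_iUnion.1 hf
  rw [padMat_of_lt]
  exact (h i).2.2.2.2.2.1 h1 j h2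

theorem Realizes.edge (hL : L.Valid) (hA : IsSlopes L A) (h : Realizes L A S) {e : Edge ℝ}
    (he : e ∈ edgeSet L S) :
    0 < padMat A e.src.1 e.src.2 ∧ e.wt * padMat A e.dst.1 e.dst.2 < padMat A e.src.1 e.src.2 ∧
      e.src.1 < d ∧ e.src.2 < κ := by
  rcases he with ⟨j, k, hk, rfl⟩ | he
  · have hκ := (hL.1 j).2
    simp only [padMat_of_lt, one_mul]
    have h1 : k < κ := by omega
    have h2 : padVec (A j) (k + 1) < padVec (A j) k := by
      rw [padVec_of_lt _ h1, padVec_of_lt _ (show k + 1 < κ by omega)]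
      exact hA.2 j ⟨k, _⟩ ⟨k + 1, _⟩ (by simp [Fin.lt_def]) hk
    exact ⟨(hA.padVec_nonneg _ _).trans_lt h2, h2, j.2, h1⟩
  · obtain ⟨i, j, j', ⟨h1, h2, h3, h4, h5⟩, rfl⟩ := Set.mem_iUnion.1 he
    obtain ⟨-, -, -, h6, -, h7⟩ := (h i).2
    have hκ := (hL.1 j).2
    have := (hL.lo_spec j h2).1
    simp only [obsEdge, padMat_of_lt]
    refine ⟨h6 j h2, ?_, j.2, by omega⟩
    rw [div_mul_eq_mul_div, div_lt_iff₀ h5, mul_comm]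
    exact h7 j j' h1 h2 h3

/-- The source of an inequality has a positive true slope, so it is never among the worthless
segments. Hence zeros and inequalities do not conflict. -/
theorem Realizes.src_notMem (hL : L.Valid) (hA : IsSlopes L A) (h : Realizes L A S) {e : Edge ℝ}
    (he : e ∈ edgeSet L S) : e.src ∉ zeroSet L S := fun h0 => by
  have := (h.edge hL hA he).1
  rw [h.zero h0] at this
  exact lt_irrefl _ this

theorem Realizes.startValue_src (hL : L.Valid) (hA : IsSlopes L A) (h : Realizes L A S)
    {e : Edge ℝ} (he : e ∈ edgeSet L S) : (ofLex (startValue L S e.src)).1 = 1 := by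
  have h1 := h.edge hL hA he
  simp [startValue, h1.2.2.1, h1.2.2.2, h.src_notMem hL hA he]

section Solution

variable {u : ℕ × ℕ → ℝ ×ₗ ℝ} {η : ℝ}

theorem startValue_nonneg (L : Segments ℝ d κ) (S : ι → Obs ℝ d) (f : ℕ × ℕ) :
    0 ≤ (ofLex (startValue L S f)).1 := by
  simp only [startValue, ofLex_toLex]
  split_ifs
  exacts [zero_le_one, le_rfl]

theorem IsTightSolution.fst_nonneg (hu : IsTightSolution (edgeSet L S) (startValue L S) u)
    (f : ℕ × ℕ) : 0 ≤ (ofLex (u f)).1 :=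
  (startValue_nonneg L S f).trans (fst_le_of_lex_le (hu.start_le f))

theorem strictness_pos (hu : IsTightSolution (edgeSet L S) (startValue L S) u)
    (hη : IsLeast (insert 1 (slacks (edgeSet L S) u)) η) : 0 < η := by
  rcases hη.1 with rfl | ⟨e, he, h, rfl⟩
  · exact one_pos
  · refine div_pos (sub_pos.2 h) ?_
    have := mul_nonneg (mul_nonneg (edgeSet_pos he).le (hu.fst_nonneg e.dst)) (hu.nonneg e.dst)
    linarith

theorem slopeOf_nonneg (hu : IsTightSolution (edgeSet L S) (startValue L S) u)
    (hη : IsLeast (insert 1 (slacks (edgeSet L S) u)) η) (f : ℕ × ℕ) : 0 ≤ slopeOf u η f :=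
  mul_nonneg (hu.fst_nonneg f)
    (add_nonneg zero_le_one (mul_nonneg (strictness_pos hu hη).le (hu.nonneg f)))

/-- Write `X` for the weight times the value at `dst`, and `c` for its count. If `X` is less than
the value `v` at `src`, then `η * (1 + X * c) ≤ v - X` gives `X * (1 + η * c) ≤ v - η < v`. If both
are equal, then the count at `src` is larger by at least one. -/
theorem slopeOf_edge (hL : L.Valid) (hA : IsSlopes L A) (h : Realizes L A S)
    (hu : IsTightSolution (edgeSet L S) (startValue L S) u)
    (hη : IsLeast (insert 1 (slacks (edgeSet L S) u)) η) {e : Edge ℝ} (he : e ∈ edgeSet L S) :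
    e.wt * slopeOf u η e.dst < slopeOf u η e.src := by
  have hη0 := strictness_pos hu hη
  have hv : 1 ≤ (ofLex (u e.src)).1 := by
    rw [← h.startValue_src hL hA he]
    exact fst_le_of_lex_le (hu.start_le _)
  have hX := mul_nonneg (edgeSet_pos he).le (hu.fst_nonneg e.dst)
  have hcf := hu.nonneg e.src
  have hcg := hu.nonneg e.dst
  have hmin : e.wt * (ofLex (u e.dst)).1 < (ofLex (u e.src)).1 → η ≤
    ((ofLex (u e.src)).1 - e.wt * (ofLex (u e.dst)).1) /
      (1 + e.wt * (ofLex (u e.dst)).1 * (ofLex (u e.dst)).2) :=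
    fun hlt => hη.2 (Or.inr ⟨e, he, hlt, rfl⟩)
  have hcl := lex_le_iff.1 (hu.closed e he)
  simp only [Edge.act, ofLex_toLex] at hcl
  simp only [slopeOf, ← mul_assoc]
  generalize e.wt * (ofLex (u e.dst)).1 = X at *
  generalize (ofLex (u e.dst)).2 = cg at *
  generalize (ofLex (u e.src)).2 = cf at *
  generalize (ofLex (u e.src)).1 = v at *
  rcases hcl with hlt | ⟨rfl, h2⟩
  · have := hmin hlt
    rw [le_div_iff₀ (by nlinarith)] at this
    nlinarith [mul_nonneg (mul_nonneg hη0.le hcf) (by linarith : (0:ℝ) ≤ v)]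
  · have : η * cg < η * cf := mul_lt_mul_of_pos_left (by linarith) hη0
    nlinarith

end Solution

theorem IsFit.isSlopes (hL : L.Valid) (hA : IsSlopes L A) (h : Realizes L A S) (hf : IsFit L S a) :
    IsSlopes L a := by
  obtain ⟨u, η, hu, hη, ha⟩ := hf
  refine ⟨fun j k => ?_, fun j k k' hk hk' => ?_⟩
  · rw [ha]
    split_ifs
    exacts [slopeOf_nonneg hu hη _, le_rfl]
  · have key : ∀ n m : ℕ, n < m → m < L.num j → slopeOf u η (j, m) < slopeOf u η (j, n) := by
      intro n m hnm
      have hstep : ∀ k, k + 1 < L.num j → slopeOf u η (j, k + 1) < slopeOf u η (j, k) := by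
        intro k hk
        have := slopeOf_edge hL hA h hu hη (e := ⟨(j, k), (j, k + 1), 1⟩) (Or.inl ⟨j, k, hk, rfl⟩)
        simpa using this
      induction hnm with
      | refl => exact hstep n
      | step _ ih => exact fun h => (hstep _ h).trans (ih (Nat.lt_of_succ_lt h))
    have hkk : (k : ℕ) < k' := hk
    rw [ha, ha, if_pos hk', if_pos (hkk.trans hk')]
    exact key k k' hkk hk'

/-- The learned slopes satisfy the same strict conditions as the true ones, so they predict the
observed bundles, and do so without ties. -/
theorem IsFit.realizes (hL : L.Valid) (hA : IsSlopes L A) (h : Realizes L A S) (hf : IsFit L S a) :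
    Realizes L a S := by
  obtain ⟨u, η, hu, hη, ha⟩ := hf
  have hpad : ∀ (j : Fin d) (k : ℕ), k < L.num j → padVec (a j) k = slopeOf u η (j, k) := by
    intro j k hk
    have := (hL.1 j).2
    rw [padVec_of_lt _ (show k < κ by omega), ha, if_pos hk]
  intro i
  obtain ⟨hp, hx, hB, h0, h1, h2, h3⟩ := h i
  refine ⟨hp, hx, hB, h0, fun j hj => ?_, fun hlt j hj => ?_, fun j j' hjj hj hj' => ?_⟩
  · have hlo := (hL.lo_spec j hj).1
    have hκ := (hL.1 j).2
    rw [hpad j _ hlo]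
    have hz : ((j : ℕ), L.lo j ((S i).bundle j)) ∉ zeroSet L S := by
      intro hz
      have := h.zero hz
      rw [padMat_of_lt] at this
      exact (h1 j hj).ne' this
    have hv : 1 ≤ (ofLex (u ((j : ℕ), L.lo j ((S i).bundle j)))).1 := by
      have := fst_le_of_lex_le (hu.start_le ((j : ℕ), L.lo j ((S i).bundle j)))
      simpa [startValue, hz, hlo.trans_le hκ] using this
    refine mul_pos (by linarith) ?_
    have := mul_nonneg (strictness_pos hu hη).le (hu.nonneg ((j : ℕ), L.lo j ((S i).bundle j)))
    linarith
  · have hhi := (hL.hi_spec j (hx j).1).1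
    rw [hpad j _ hhi]
    have hz : ((j : ℕ), L.hi j ((S i).bundle j)) ∈ zeroSet L S :=
      Set.mem_iUnion.2 ⟨i, hlt, j, hj, rfl⟩
    -- A worthless segment starts at zero and is never the source of an inequality, so tightness
    -- keeps it there.
    rcases hu.tight ((j : ℕ), L.hi j ((S i).bundle j)) with h4 | ⟨e, he, h4, -⟩
    · rw [slopeOf, h4]
      simp [startValue, hz]
    · exact absurd (h4 ▸ hz) (h.src_notMem hL hA he)
  · have hlo := (hL.lo_spec j hj).1
    have hhi := (hL.hi_spec j' (hx j').1).1
    have hpj' : 0 < (S i).price j' := (hp j').lt_of_ne' fun h => by linarith [h0 j' h]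
    have ha1 : 0 < padVec (a j) (L.lo j ((S i).bundle j)) := by
      have hκ := (hL.1 j).2
      rw [hpad j _ hlo]
      have hz : ((j : ℕ), L.lo j ((S i).bundle j)) ∉ zeroSet L S := by
        intro hz
        have := h.zero hz
        rw [padMat_of_lt] at this
        exact (h1 j hj).ne' this
      have hv : 1 ≤ (ofLex (u ((j : ℕ), L.lo j ((S i).bundle j)))).1 := by
        have := fst_le_of_lex_le (hu.start_le ((j : ℕ), L.lo j ((S i).bundle j)))
        simpa [startValue, hz, hlo.trans_le hκ] using this
      refine mul_pos (by linarith) ?_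
      have := mul_nonneg (strictness_pos hu hη).le (hu.nonneg ((j : ℕ), L.lo j ((S i).bundle j)))
      linarith
    -- A free good `j` has no inequality in the system; positivity of its slope is all that is
    -- needed.
    rcases (hp j).eq_or_lt with hpj | hpj
    · rw [← hpj, mul_zero]; exact mul_pos ha1 hpj'
    · have := slopeOf_edge hL hA h hu hη (e := obsEdge L (S i) j j')
        (Or.inr (Set.mem_iUnion.2 ⟨i, j, j', ⟨hjj, hj, hj', hpj, hpj'⟩, rfl⟩))
      simp only [obsEdge] at this
      rw [hpad j _ hlo, hpad j' _ hhi]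
      rw [div_mul_eq_mul_div, div_lt_iff₀ hpj'] at this
      linarith

/-- The learner's output depends only on a small part of the sample. -/
theorem IsFit.exists_compression {n : ℕ} {S : Fin n → Obs ℝ d} (hL : L.Valid)
    (hf : IsFit L S a) : ∃ T : Finset (Fin n), T.card ≤ 2 * (κ * d) + 1 ∧
      ∀ (k : ℕ) (σ : Fin k → Fin n), (∀ i ∈ T, ∃ i', σ i' = i) → IsFit L (S ∘ σ) a := by
  classical
  obtain ⟨u, η, hu, hη, ha⟩ := hf
  -- For each segment, one observation which shows that it is worthless, if there is any.
  have hZ : ∀ f : Fin d × Fin κ, ∃ T : Finset (Fin n), T.card ≤ 1 ∧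
      (((f.1 : ℕ), (f.2 : ℕ)) ∈ zeroSet L S → ∃ i ∈ T, ((f.1 : ℕ), (f.2 : ℕ)) ∈ obsZeros L (S i)) := by
    intro f
    by_cases h : ((f.1 : ℕ), (f.2 : ℕ)) ∈ zeroSet L S
    · obtain ⟨i, hi⟩ := Set.mem_iUnion.1 h
      exact ⟨{i}, by simp, fun _ => ⟨i, by simp, hi⟩⟩
    · exact ⟨∅, by simp, fun h' => absurd h' h⟩
  have hE : ∀ e ∈ edgeSet L S, ∃ T : Finset (Fin n), T.card ≤ 1 ∧
      ∀ (k : ℕ) (σ : Fin k → Fin n), (∀ i ∈ T, ∃ i', σ i' = i) → e ∈ edgeSet L (S ∘ σ) := by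
    rintro e (he | he)
    · exact ⟨∅, by simp, fun _ _ _ => Or.inl he⟩
    · obtain ⟨i, hi⟩ := Set.mem_iUnion.1 he
      refine ⟨{i}, by simp, fun k σ h => Or.inr ?_⟩
      obtain ⟨i', hi'⟩ := h i (by simp)
      exact Set.mem_iUnion.2 ⟨i', by simpa [hi'] using hi⟩
  -- For each segment, one observation that forces its value; none is needed for start values and
  -- for the inequalities within a good.
  have hT : ∀ f : Fin d × Fin κ, ∃ T : Finset (Fin n), T.card ≤ 1 ∧
      (u ((f.1 : ℕ), (f.2 : ℕ)) = startValue L S ((f.1 : ℕ), (f.2 : ℕ)) ∨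
      ∀ (k : ℕ) (σ : Fin k → Fin n), (∀ i ∈ T, ∃ i', σ i' = i) → ∃ e ∈ edgeSet L (S ∘ σ),
        e.src = ((f.1 : ℕ), (f.2 : ℕ)) ∧ u ((f.1 : ℕ), (f.2 : ℕ)) = e.act (u e.dst)) := by
    intro f
    rcases hu.tight ((f.1 : ℕ), (f.2 : ℕ)) with h | ⟨e, he, h1, h2⟩
    · exact ⟨∅, by simp, Or.inl h⟩
    · obtain ⟨T, h3, h4⟩ := hE e he
      exact ⟨T, h3, Or.inr fun k σ h => ⟨e, h4 k σ h, h1, h2⟩⟩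
  choose TZ hTZ1 hTZ2 using hZ
  choose TT hTT1 hTT2 using hT
  -- One more observation for the inequality that determines the unit of strictness.
  obtain ⟨Tη, hη1, hη2⟩ : ∃ T : Finset (Fin n), T.card ≤ 1 ∧
      ∀ (k : ℕ) (σ : Fin k → Fin n), (∀ i ∈ T, ∃ i', σ i' = i) →
        η ∈ insert 1 (slacks (edgeSet L (S ∘ σ)) u) := by
    rcases hη.1 with h | ⟨e, he, h1, h2⟩
    · exact ⟨∅, by simp, fun _ _ _ => Or.inl h⟩
    · obtain ⟨T, h3, h4⟩ := hE e he
      exact ⟨T, h3, fun k σ h => Or.inr ⟨e, h4 k σ h, h1, h2⟩⟩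
  have hcard : ∀ F : Fin d × Fin κ → Finset (Fin n), (∀ f, (F f).card ≤ 1) →
      (Finset.univ.biUnion F).card ≤ κ * d := by
    intro F hF
    refine Finset.card_biUnion_le.trans ((Finset.sum_le_sum fun f _ => hF f).trans ?_)
    simp [mul_comm]
  refine ⟨Finset.univ.biUnion TZ ∪ Finset.univ.biUnion TT ∪ Tη, ?_, fun k σ hσ => ?_⟩
  · refine (Finset.card_union_le _ _).trans ?_
    have := Finset.card_union_le (Finset.univ.biUnion TZ) (Finset.univ.biUnion TT)
    have := hcard TZ hTZ1
    have := hcard TT hTT1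
    omega
  · have hsub : edgeSet L (S ∘ σ) ⊆ edgeSet L S := by
      rintro e (he | he)
      · exact Or.inl he
      · obtain ⟨i, hi⟩ := Set.mem_iUnion.1 he
        exact Or.inr (Set.mem_iUnion.2 ⟨σ i, hi⟩)
    -- With the same zeros, the start values are the same. The inequalities become fewer, so `u`
    -- still solves them and `η` is still a lower bound; the chosen observations preserve that `u`
    -- is tight and that `η` is attained.
    have hzero : zeroSet L (S ∘ σ) = zeroSet L S := by
      refine Set.Subset.antisymm ?_ ?_
      · intro f hf
        obtain ⟨i, hi⟩ := Set.mem_iUnion.1 hf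
        exact Set.mem_iUnion.2 ⟨σ i, hi⟩
      · intro f hf
        obtain ⟨i, h1, j, h2, h3⟩ := Set.mem_iUnion.1 hf
        have hκ := (hL.1 j).2
        have hlt : L.hi j ((S i).bundle j) < L.num j := lastLe_lt (hL.num_pos j)
        obtain ⟨i', hi', hz⟩ := hTZ2 (j, ⟨L.hi j ((S i).bundle j), by omega⟩) (by
          rw [h3] at hf; exact hf)
        obtain ⟨i'', rfl⟩ := hσ i' (by
          simp only [Finset.mem_union, Finset.mem_biUnion, Finset.mem_univ, true_and]
          exact Or.inl (Or.inl ⟨_, hi'⟩))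
        rw [h3]
        exact Set.mem_iUnion.2 ⟨i'', hz⟩
    have hstart : startValue L (S ∘ σ) = startValue L S := by
      funext f
      simp only [startValue, hzero]
    refine ⟨u, η, ⟨hstart ▸ hu.start_le, fun e he => hu.closed e (hsub he), fun f => ?_, hu.nonneg⟩,
      ⟨hη2 k σ fun i hi => hσ i (Finset.mem_union_right _ hi), fun t ht => hη.2 ?_⟩, ha⟩
    · rw [hstart]
      rcases hu.tight f with h | ⟨e, he, h1, h2⟩
      · exact Or.inl h
      · have hf : f.1 < d ∧ f.2 < κ := by
          rcases he with ⟨j, k, hk, rfl⟩ | he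
          · have := (hL.1 j).2
            subst h1
            exact ⟨j.2, by simp only; omega⟩
          · obtain ⟨i, j, j', -, rfl⟩ := Set.mem_iUnion.1 he
            have := (hL.1 j).2
            have hlt : L.lo j ((S i).bundle j) < L.num j := lastLt_lt (hL.num_pos j)
            subst h1
            exact ⟨j.2, by simp only [obsEdge]; omega⟩
        refine (hTT2 (⟨f.1, hf.1⟩, ⟨f.2, hf.2⟩)).imp id fun h => h k σ fun i hi => hσ i ?_
        simp only [Finset.mem_union, Finset.mem_biUnion, Finset.mem_univ, true_and]
        exact Or.inl (Or.inr ⟨_, hi⟩)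
    · rcases ht with ht | ⟨e, he, h1, h2⟩
      exacts [Or.inl ht, Or.inr ⟨e, hsub he, h1, h2⟩]

end Fitting

/-! ## Further rules for programs -/

section Frames

variable {K : Type} [Field K] [LinearOrder K]

instance Prog.decidableKeepsNat (a : ℕ) : (q : Prog) → Decidable (q.KeepsNat a)
  | .skip => .isTrue trivial
  | .setNat b _ _ _ => inferInstanceAs (Decidable (a ≠ b))
  | .setNum _ _ _ _ => .isTrue trivial
  | .seq c c' =>
    have := decidableKeepsNat a c
    have := decidableKeepsNat a c'
    inferInstanceAs (Decidable (c.KeepsNat a ∧ c'.KeepsNat a))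
  | .ite _ c c' =>
    have := decidableKeepsNat a c
    have := decidableKeepsNat a c'
    inferInstanceAs (Decidable (c.KeepsNat a ∧ c'.KeepsNat a))
  | .loop _ c => decidableKeepsNat a c

instance Prog.decidableKeepsNum (a : ℕ) : (q : Prog) → Decidable (q.KeepsNum a)
  | .skip => .isTrue trivial
  | .setNat _ _ _ _ => .isTrue trivial
  | .setNum b _ _ _ => inferInstanceAs (Decidable (a ≠ b))
  | .seq c c' =>
    have := decidableKeepsNum a c
    have := decidableKeepsNum a c'
    inferInstanceAs (Decidable (c.KeepsNum a ∧ c'.KeepsNum a))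
  | .ite _ c c' =>
    have := decidableKeepsNum a c
    have := decidableKeepsNum a c'
    inferInstanceAs (Decidable (c.KeepsNum a ∧ c'.KeepsNum a))
  | .loop _ c => decidableKeepsNum a c

/-- The property `C` of memories depends only on the arrays `A` of natural numbers and the arrays
`B` of field elements. -/
def LocalTo (A B : List ℕ) (C : Mem K → Prop) : Prop :=
  ∀ s s' : Mem K, (∀ a ∈ A, s'.nat a = s.nat a) → (∀ a ∈ B, s'.num a = s.num a) → C s → C s'

/-- The program writes neither to the arrays `A` nor to the arrays `B`. -/
def Prog.Keeps (A B : List ℕ) (q : Prog) : Prop :=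
  (∀ a ∈ A, q.KeepsNat a) ∧ ∀ a ∈ B, q.KeepsNum a

instance (A B : List ℕ) (q : Prog) : Decidable (q.Keeps A B) :=
  inferInstanceAs (Decidable ((∀ a ∈ A, q.KeepsNat a) ∧ ∀ a ∈ B, q.KeepsNum a))

variable {c : CostModel K} {g : ℕ → ℕ} {h : K → ℕ} {G : ℕ} {P Q C F : Mem K → Prop} {A B : List ℕ}
  {q : Prog} {T : ℕ}

theorem LocalTo.counter (hC : LocalTo A B C) (a j : ℕ) :
    LocalTo (a :: A) B fun s => C s ∧ s.nat a 0 0 = j := by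
  rintro s s' h1 h2 ⟨h3, h4⟩
  exact ⟨hC s s' (fun x hx => h1 x (List.mem_cons_of_mem _ hx)) h2 h3, by
    rw [h1 a List.mem_cons_self, h4]⟩

theorem LocalTo.and {A' B' : List ℕ} {D : Mem K → Prop} (hC : LocalTo A B C)
    (hD : LocalTo A' B' D) : LocalTo (A ++ A') (B ++ B') fun s => C s ∧ D s := by
  rintro s s' h1 h2 ⟨h3, h4⟩
  simp only [List.mem_append, or_imp, forall_and] at h1 h2
  exact ⟨hC s s' h1.1 h2.1 h3, hD s s' h1.2 h2.2 h4⟩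

theorem Triple.frame (ht : Triple c g h G P q Q T) (hF : LocalTo A B F) (hq : q.Keeps A B) :
    Triple c g h G (fun s => F s ∧ P s) q (fun s => F s ∧ Q s) T := by
  rintro s hs ⟨hf, hp⟩
  obtain ⟨s', t, h1, h2, h3, h4⟩ := ht s hs hp
  exact ⟨s', t, h1, h2, ⟨hF s s' (fun a ha => h1.nat_eq (hq.1 a ha))
    (fun a ha => h1.num_eq (hq.2 a ha)) hf, h3⟩, h4⟩

theorem Triple.keep (hC : LocalTo A B C) (hq : q.Keeps A B)
    (ht : Triple c g h G (fun s => C s ∧ P s) q Q T) :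
    Triple c g h G (fun s => C s ∧ P s) q (fun s => C s ∧ Q s) T :=
  (ht.frame hC hq).mono (fun _ h => ⟨h.1, h⟩) (fun _ h => h) le_rfl

/-- A loop in the context `C`. -/
theorem Triple.forLoopIn (hc : Tame c g h) (hC : LocalTo A B C) {a : ℕ} {n : NExp} {N : ℕ}
    (hq : q.Keeps (a :: A) B) (ha : a ∉ A) (hN : N ≤ G) (I : ℕ → Mem K → Prop)
    (hI : ∀ i v s, I i s → I i (s.writeNat a 0 0 v)) (hn : ∀ s, C s → n.eval s = N)
    (hbody : ∀ i < N, Triple c g h G (fun s => (C s ∧ s.nat a 0 0 = i) ∧ I i s) q (I (i + 1)) T) :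
    Triple c g h G (fun s => C s ∧ I 0 s) (.forLoop a n q) (fun s => C s ∧ I N s)
      (N * (T + 1) + 2) := by
  refine Triple.forLoop hc (fun i s => C s ∧ I i s) (fun i hi => (hc.g_le i).trans (hi.trans hN))
    (fun i v s h => ⟨hC s _ (fun x hx => ?_) (fun _ _ => rfl) h.1, hI i v s h.2⟩)
    (fun i s h => hn s h.1) (fun i hi => ?_)
  · have : x ≠ a := fun h => ha (h ▸ hx)
    simp [Mem.writeNat, this]
  · exact ((hbody i hi).keep (hC.counter a i) hq).mono (fun s h => ⟨⟨h.1.1, h.2⟩, h.1.2⟩)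
      (fun s h => ⟨⟨h.1.1, h.2⟩, h.1.2⟩) le_rfl

/-- A loop in the context `C` whose iterations enlarge a set. -/
theorem Triple.forUnion (hc : Tame c g h) (hC : LocalTo A B C) {a : ℕ} {n : NExp} {N : ℕ}
    (hq : q.Keeps (a :: A) B) (ha : a ∉ A) (hN : N ≤ G) {α : Type*}
    (W : Set α → ℕ → Mem K → Prop) (D : ℕ → Set α) (w : ℕ)
    (hW : ∀ X m v s, W X m s → W X m (s.writeNat a 0 0 v)) (hn : ∀ s, C s → n.eval s = N)
    {M : ℕ} (hbody : ∀ i < N, ∀ X m, m + w ≤ M → Triple c g h G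
      (fun s => (C s ∧ s.nat a 0 0 = i) ∧ W X m s) q (W (X ∪ D i) (m + w)) T)
    (X : Set α) (m : ℕ) (hm : m + N * w ≤ M) :
    Triple c g h G (fun s => C s ∧ W X m s) (.forLoop a n q)
      (fun s => C s ∧ W (X ∪ {x | ∃ i < N, x ∈ D i}) (m + N * w) s) (N * (T + 1) + 2) := by
  have := Triple.forLoopIn hc hC hq ha hN
    (fun i => W (X ∪ {x | ∃ i' < i, x ∈ D i'}) (m + i * w)) (fun i v s => hW _ _ v s) hn
    (T := T) (fun i hi => ?_)
  · simpa using this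
  · have e : X ∪ {x | ∃ i' < i + 1, x ∈ D i'} = (X ∪ {x | ∃ i' < i, x ∈ D i'}) ∪ D i := by
      ext x
      simp only [Set.mem_union, Set.mem_ofPred_eq, Nat.lt_succ_iff_lt_or_eq]
      constructor
      · rintro (h | ⟨i', h | rfl, h'⟩)
        exacts [.inl (.inl h), .inl (.inr ⟨i', h, h'⟩), .inr h']
      · rintro ((h | ⟨i', h, h'⟩) | h)
        exacts [.inl h, .inr ⟨i', .inl h, h'⟩, .inr ⟨i, .inr rfl, h⟩]
    have e' : m + (i + 1) * w = m + i * w + w := by ring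
    simp only [e, e']
    refine hbody i hi _ _ (le_trans ?_ hm)
    nlinarith

end Frames

/-! ## The program of the learner -/

namespace LearnerProgram

open SecondBestProgram (equal nequal)

/-- Memory of the program. Natural numbers: 10 to 15 are counters, cell 20 counts the inequalities,
21 to 24 hold their sources and targets, 25 and 26 the segments `lo` and `hi` of the observed
amounts. Field elements: 5 holds the left end points of segments, 6 and 7 the two components of the
current bounds, 8 the costs of bundles, 9 the weights of the inequalities, 10 the unit of
strictness, 11 is scratch, 4 is the output. -/
def J : NExp := .cell 10

def Seg : NExp := .cell 11

def I : NExp := .cell 12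

def J' : NExp := .cell 13

def goods : NExp := .row 0 (.const 0)

def maxSegs : NExp := .row 0 (.const 1)

def sampleSize : NExp := .row 0 (.const 2)

/-- The left end points of the segments. -/
def starts : Prog :=
  .forLoop 10 goods (.seq (.setNum 5 J (.const 0) .zero)
    (.forLoop 11 maxSegs (.setNum 5 J (.add Seg (.const 1)) (.add (.read 5 J Seg) (.read 0 J Seg)))))

/-- The segments that contain the bundles of the sample. -/
def locate : Prog :=
  .forLoop 12 sampleSize (.forLoop 10 goods
    (.seq (.seq (.setNat 25 I J (.const 0)) (.setNat 26 I J (.const 0)))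
      (.forLoop 11 (.row 1 J) (.seq
        (.ite (.lt (.read 5 J Seg) (.read 3 I J)) (.setNat 25 I J Seg) .skip)
        (.ite (.rle (.read 5 J Seg) (.read 3 I J)) (.setNat 26 I J Seg) .skip)))))

/-- The costs of the bundles of the sample. -/
def costs : Prog :=
  .forLoop 12 sampleSize (.seq (.setNum 8 (.const 0) I .zero)
    (.forLoop 10 goods
      (.setNum 8 (.const 0) I (.add (.row 8 0 I) (.mul (.read 1 I J) (.read 3 I J))))))

def ones : Prog := .forLoop 10 goods (.forLoop 11 maxSegs (.setNum 6 J Seg .one))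

def zeros : Prog :=
  .forLoop 12 sampleSize (.forLoop 10 goods
    (.ite (.conj (.lt (.row 8 0 I) (.read 2 I (.const 0))) (.lt (.read 3 I J) .one))
      (.setNum 6 J (.read 26 I J) .zero) .skip))

variable {K : Type} [Field K] [LinearOrder K] {d κ n : ℕ}

structure IsInput (L : Segments K d κ) (S : Fin n → Obs K d) (s : Mem K) : Prop where
  goods : s.nat 0 0 0 = d
  maxSegs : s.nat 0 0 1 = κ
  sampleSize : s.nat 0 0 2 = n
  num : ∀ j : Fin d, s.nat 1 0 j = L.num j
  len : ∀ (j : Fin d) (k : ℕ), s.num 0 j k = padVec (L.len j) k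
  price : ∀ (i : Fin n) (j : Fin d), s.num 1 i j = (S i).price j
  budget : ∀ i : Fin n, s.num 2 i 0 = (S i).budget
  bundle : ∀ (i : Fin n) (j : Fin d), s.num 3 i j = (S i).bundle j

/-- All numbers in the input have size at most `b`. -/
structure InputBound (h : K → ℕ) (L : Segments K d κ) (S : Fin n → Obs K d) (b : ℕ) : Prop where
  two_le : 2 ≤ b
  goods : d ≤ b
  maxSegs : κ ≤ b
  sampleSize : n ≤ b
  len : ∀ j k, h (L.len j k) ≤ b
  price : ∀ i j, h ((S i).price j) ≤ b
  budget : ∀ i, h (S i).budget ≤ b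
  bundle : ∀ i j, h ((S i).bundle j) ≤ b

variable {c : CostModel K} {g : ℕ → ℕ} {h : K → ℕ} {G b : ℕ} {L : Segments K d κ}
  {S : Fin n → Obs K d}

theorem localTo_isInput : LocalTo [0, 1] [0, 1, 2, 3] (IsInput L S) := by
  intro s s' h1 h2 h3
  simp only [List.forall_mem_cons] at h1 h2
  obtain ⟨h10, h11, -⟩ := h1
  obtain ⟨h20, h21, h22, h23, -⟩ := h2
  constructor
  · rw [h10, h3.goods]
  · rw [h10, h3.maxSegs]
  · rw [h10, h3.sampleSize]
  · rw [h11]; exact h3.num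
  · rw [h20]; exact h3.len
  · rw [h21]; exact h3.price
  · rw [h22]; exact h3.budget
  · rw [h23]; exact h3.bundle

theorem isInput_learnInput : IsInput L S (learnInput L S) := by
  constructor <;> intros <;> simp [learnInput, padMat, padVec]

theorem size_sum_le (hc : Tame c g h) {f : ℕ → K} {a k : ℕ} (hf : ∀ i < k, h (f i) ≤ a) :
    h (∑ i ∈ Finset.range k, f i) ≤ 2 + k * a := by
  induction k with
  | zero => simpa using hc.h_zero
  | succ k ih =>
    rw [Finset.sum_range_succ]
    have h1 := ih fun i hi => hf i (by omega)
    have h2 := hf k (by omega)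
    have h3 := hc.h_add (∑ i ∈ Finset.range k, f i) (f k)
    have e : (k + 1) * a = k * a + a := by ring
    omega

theorem InputBound.padVec_len (hc : Tame c g h) (hb : InputBound h L S b) (j : Fin d) (k : ℕ) :
    h (padVec (L.len j) k) ≤ b := by
  unfold padVec
  split_ifs
  exacts [hb.len _ _, hc.h_zero.trans hb.two_le]

theorem InputBound.pre (hc : Tame c g h) (hb : InputBound h L S b) (j : Fin d) {k : ℕ}
    (hk : k ≤ κ) : h (L.pre j k) ≤ 2 + b * b :=
  (size_sum_le hc fun i _ => hb.padVec_len hc j i).trans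
    (Nat.add_le_add_left (Nat.mul_le_mul_right _ (hk.trans hb.maxSegs)) _)

def HasStarts (L : Segments K d κ) (s : Mem K) : Prop :=
  ∀ (j : Fin d) (k : ℕ), k ≤ κ → s.num 5 j k = L.pre j k

theorem starts_triple (hc : Tame c g h) (hb : InputBound h L S b) (hG : 2 + b * b ≤ G) :
    Triple c g h G (IsInput L S) starts (fun s => IsInput L S s ∧ HasStarts L s)
      (d * (1 + (κ * (1 + 1) + 2) + 1 + 1) + 2) := by
  have hb2 := hb.two_le
  have hbG : b ≤ G := by nlinarith
  have hin := localTo_isInput (L := L) (S := S)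
  have key := Triple.forUnion hc hin (a := 10) (n := goods) (N := d) (G := G)
    (q := .seq (.setNum 5 J (.const 0) .zero)
    (.forLoop 11 maxSegs (.setNum 5 J (.add Seg (.const 1)) (.add (.read 5 J Seg) (.read 0 J Seg)))))
    (T := 1 + (κ * (1 + 1) + 2) + 1)
    (by decide) (by decide) (hb.goods.trans hbG)
    (fun X _ s => ∀ j : Fin d, (j : ℕ) ∈ X → ∀ k, k ≤ κ → s.num 5 j k = L.pre j k)
    (fun j => {j}) 0 (fun _ _ _ _ h => h) (fun s hs => hs.goods) ?_ ∅ 0 le_rfl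
  · refine key.mono (fun s hs => ⟨hs, by simp⟩) (fun s hs => ⟨hs.1, fun j => hs.2 j ?_⟩) le_rfl
    simp
  intro i hi X _ _
  obtain ⟨j, rfl⟩ : ∃ j : Fin d, (j : ℕ) = i := ⟨⟨i, hi⟩, rfl⟩
  refine Triple.seq (Q := fun s => (IsInput L S s ∧ s.nat 10 0 0 = j) ∧
    ((∀ j' : Fin d, (j' : ℕ) ∈ X → j' ≠ j → ∀ k ≤ κ, s.num 5 j' k = L.pre j' k) ∧
      ∀ k ≤ 0, s.num 5 j k = L.pre j k)) ?_ ?_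
  · refine Triple.keep (hin.counter 10 j) (by decide) (Triple.straight hc trivial ?_)
    rintro s - ⟨⟨h1, h2⟩, h3⟩
    refine ⟨hc.h_zero.trans (by omega), fun j' hj' hne k hk => ?_, fun k hk => ?_⟩
    · have : (j' : ℕ) ≠ j := fun h => hne (Fin.ext h)
      simp [Prog.res, NExp.eval, J, NExp.cell, h2, Mem.writeNum, this, h3 j' hj' k hk]
    · obtain rfl : k = 0 := by omega
      simp [Prog.res, NExp.eval, RExp.eval, J, NExp.cell, h2, Mem.writeNum, Segments.pre]
  · refine (Triple.forLoopIn hc (hin.counter 10 j) (a := 11) (n := maxSegs) (N := κ) (T := 1)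
      (by decide) (by decide) (hb.maxSegs.trans hbG) (fun k s =>
      (∀ j' : Fin d, (j' : ℕ) ∈ X → j' ≠ j → ∀ k ≤ κ, s.num 5 j' k = L.pre j' k) ∧
      ∀ k' ≤ k, s.num 5 j k' = L.pre j k') (fun _ _ _ h => h) (fun s hs => hs.1.maxSegs) ?_).mono
      (fun _ h => h) (fun s hs j' hj' => ?_) le_rfl
    · intro k hk
      refine Triple.straight hc trivial ?_
      rintro s - ⟨⟨⟨h1, h2⟩, h3⟩, h4, h5⟩
      have e : (Prog.setNum 5 J (.add Seg (.const 1)) (.add (.read 5 J Seg) (.read 0 J Seg))).res s =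
          s.writeNum 5 j (k + 1) (L.pre j (k + 1)) := by
        simp [Prog.res, NExp.eval, RExp.eval, J, Seg, NExp.cell, h2, h3, h5, h1.len, Segments.pre,
          Finset.sum_range_succ]
      refine ⟨?_, ?_⟩
      · have := hb.pre hc j (k := k + 1) hk
        simp only [Segments.pre, Finset.sum_range_succ] at this
        simp [Prog.Safe, NExp.eval, RExp.eval, J, Seg, NExp.cell, h2, h3, h5, h1.len]
        exact this.trans hG
      · rw [e]
        refine ⟨fun j' hj' hne k' hk' => ?_, fun k' hk' => ?_⟩
        · have : (j' : ℕ) ≠ j := fun h => hne (Fin.ext h)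
          simp [Mem.writeNum, this, h4 j' hj' hne k' hk']
        · by_cases hkk : k' = k + 1
          · simp [Mem.writeNum, hkk]
          · simp [Mem.writeNum, hkk, h5 k' (by omega)]
    · by_cases hne : j' = j
      · subst hne; exact hs.2.2
      · refine hs.2.1 j' ?_ hne
        simpa [Fin.val_inj, hne] using hj'

def IsLocated (L : Segments K d κ) (S : Fin n → Obs K d) (s : Mem K) : Prop :=
  ∀ (i : Fin n) (j : Fin d), s.nat 25 i j = L.lo j ((S i).bundle j) ∧
    s.nat 26 i j = L.hi j ((S i).bundle j)

theorem localTo_hasStarts : LocalTo [] [5] (HasStarts L) := by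
  intro s s' _ h2 h3
  simp only [List.forall_mem_cons] at h2
  simpa only [HasStarts, h2.1] using h3

/-- The scan runs upwards and overwrites earlier hits, so after `k` segments the cells hold `lastLt`
and `lastLe` for `k`; the loop follows their recursion. -/
theorem locate_triple (hc : Tame c g h) (hL : L.Valid) (hb : InputBound h L S b) (hG : b ≤ G) :
    Triple c g h G (fun s => IsInput L S s ∧ HasStarts L s) locate
      (fun s => (IsInput L S s ∧ HasStarts L s) ∧ IsLocated L S s)
      (n * ((d * ((1 + (κ * (1 + 1) + 2) + 1) + 1) + 2) + 1) + 2) := by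
  have hb2 := hb.two_le
  have hin := (localTo_isInput (L := L) (S := S)).and (localTo_hasStarts (L := L))
  have hg0 : ∀ m ≤ b, g m ≤ G := fun m hm => (hc.g_le m).trans (hm.trans hG)
  set W : Set (ℕ × ℕ) → ℕ → Mem K → Prop := fun X _ s => ∀ (i : Fin n) (j : Fin d),
    ((i : ℕ), (j : ℕ)) ∈ X → s.nat 25 i j = L.lo j ((S i).bundle j) ∧
    s.nat 26 i j = L.hi j ((S i).bundle j) with hWdef
  have key := Triple.forUnion hc hin (a := 12) (n := sampleSize) (N := n) (G := G)
    (q := .forLoop 10 goods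
    (.seq (.seq (.setNat 25 I J (.const 0)) (.setNat 26 I J (.const 0)))
      (.forLoop 11 (.row 1 J) (.seq
        (.ite (.lt (.read 5 J Seg) (.read 3 I J)) (.setNat 25 I J Seg) .skip)
        (.ite (.rle (.read 5 J Seg) (.read 3 I J)) (.setNat 26 I J Seg) .skip)))))
    (T := d * ((1 + (κ * (1 + 1) + 2) + 1) + 1) + 2)
    (by decide) (by decide) (hb.sampleSize.trans hG) W
    (fun i => {x | ∃ j < d, x ∈ ({(i, j)} : Set (ℕ × ℕ))}) 0 (fun _ _ _ _ h => h)
    (fun s hs => hs.1.sampleSize) (fun i hi X m hm => ?_) ∅ 0 le_rfl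
  · refine key.mono (fun s hs => ⟨hs, by simp [hWdef]⟩)
      (fun s hs => ⟨hs.1, fun i j => hs.2 i j ?_⟩) le_rfl
    simp
  obtain ⟨i, rfl⟩ : ∃ i' : Fin n, (i' : ℕ) = i := ⟨⟨i, hi⟩, rfl⟩
  refine (Triple.forUnion hc (hin.counter 12 i) (a := 10) (n := goods) (N := d)
    (by decide) (by decide) (hb.goods.trans hG) W (fun j => {((i : ℕ), j)}) 0 (fun _ _ _ _ h => h)
    (fun s hs => hs.1.1.goods) (fun j hj X m _ => ?_) X m (M := m) (by simp)).mono (fun s hs => hs) (fun s hs => hs.2) le_rfl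
  obtain ⟨j, rfl⟩ : ∃ j' : Fin d, (j' : ℕ) = j := ⟨⟨j, hj⟩, rfl⟩
  have hne : ∀ {i' : Fin n} {j' : Fin d}, (i', j') ≠ (i, j) → ¬ ((i' : ℕ) = i ∧ (j' : ℕ) = j) := by
    rintro i' j' hne ⟨h1, h2⟩
    exact hne (Prod.ext (Fin.ext h1) (Fin.ext h2))
  have hctx := (hin.counter 12 i).counter 10 j
  set W' : ℕ → Mem K → Prop := fun k s => (∀ (i' : Fin n) (j' : Fin d), ((i' : ℕ), (j' : ℕ)) ∈ X →
      (i', j') ≠ (i, j) → s.nat 25 i' j' = L.lo j' ((S i').bundle j') ∧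
      s.nat 26 i' j' = L.hi j' ((S i').bundle j')) ∧
      s.nat 25 i j = lastLt (L.pre j) ((S i).bundle j) k ∧
      s.nat 26 i j = lastLe (L.pre j) ((S i).bundle j) k with hW'
  refine Triple.seq (Q := fun s => (((IsInput L S s ∧ HasStarts L s) ∧ s.nat 12 0 0 = i) ∧
    s.nat 10 0 0 = j) ∧ W' 0 s) ?_ ?_
  · refine Triple.keep hctx (by decide) (Triple.straight hc ⟨trivial, trivial⟩ ?_)
    rintro s - ⟨⟨⟨⟨h1, h2⟩, h3⟩, h4⟩, h5⟩
    refine ⟨⟨hg0 0 (Nat.zero_le _), hg0 0 (Nat.zero_le _)⟩, fun i' j' hij hij' => ?_, ?_, ?_⟩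
    · simp [Prog.res, NExp.eval, J, I, NExp.cell, h3, h4, Mem.writeNat, hne hij', h5 i' j' hij]
    · simp [Prog.res, NExp.eval, J, I, NExp.cell, h3, h4, Mem.writeNat, lastLt]
    · simp [Prog.res, NExp.eval, J, I, NExp.cell, h3, h4, Mem.writeNat, lastLe]
  · refine (Triple.forLoopIn hc hctx (a := 11) (n := .row 1 J) (N := L.num j) (T := 1)
      (by decide) (by decide) (((hL.1 j).2.trans hb.maxSegs).trans hG) W' (fun _ _ _ h => h)
      (fun s hs => ?_) ?_).mono
      (fun _ h => h) (fun s hs i' j' hij => ?_) ?_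
    · simp [NExp.row, NExp.eval, J, NExp.cell, hs.2, hs.1.1.1.num]
    · intro k hk
      refine Triple.straight hc ⟨⟨trivial, trivial⟩, ⟨trivial, trivial⟩⟩ ?_
      rintro s - ⟨⟨⟨⟨⟨h1, h2⟩, h3⟩, h4⟩, h5⟩, h6, h7, h8⟩
      have hk' : k ≤ κ := hk.le.trans (hL.1 j).2
      have hgk := hg0 k (hk'.trans hb.maxSegs)
      refine ⟨?_, ?_⟩
      · by_cases hx : L.pre j k < (S i).bundle j
        · simp [Prog.Safe, Prog.res, NExp.eval, RExp.eval, Test.eval, Test.lt, J, I, Seg, NExp.cell,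
            h3, h4, h5, hgk, hx, h2 j k hk', h1.bundle, Mem.writeNat]
        · simp [Prog.Safe, Prog.res, NExp.eval, RExp.eval, Test.eval, Test.lt, J, I, Seg, NExp.cell,
            h3, h4, h5, hgk, hx, h2 j k hk', h1.bundle]
      · by_cases hx : L.pre j k < (S i).bundle j
        · refine ⟨fun i' j' hij hij' => ?_, ?_, ?_⟩
          · simp [Prog.res, NExp.eval, RExp.eval, Test.eval, Test.lt, J, I, Seg, NExp.cell, h3, h4,
              h5, hx, hx.le, h2 j k hk', h1.bundle, Mem.writeNat, hne hij', h6 i' j' hij hij']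
          · simp [Prog.res, NExp.eval, RExp.eval, Test.eval, Test.lt, J, I, Seg, NExp.cell, h3, h4,
              h5, hx, hx.le, h2 j k hk', h1.bundle, Mem.writeNat, lastLt]
          · simp [Prog.res, NExp.eval, RExp.eval, Test.eval, Test.lt, J, I, Seg, NExp.cell, h3, h4,
              h5, hx, hx.le, h2 j k hk', h1.bundle, Mem.writeNat, lastLe]
        · by_cases hx' : L.pre j k ≤ (S i).bundle j
          · refine ⟨fun i' j' hij hij' => ?_, ?_, ?_⟩
            · simp [Prog.res, NExp.eval, RExp.eval, Test.eval, Test.lt, J, I, Seg, NExp.cell, h3, h4,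
                h5, hx, hx', h2 j k hk', h1.bundle, Mem.writeNat, hne hij', h6 i' j' hij hij']
            · simp [Prog.res, NExp.eval, RExp.eval, Test.eval, Test.lt, J, I, Seg, NExp.cell, h3, h4,
                h5, hx, hx', h2 j k hk', h1.bundle, Mem.writeNat, lastLt, h7]
            · simp [Prog.res, NExp.eval, RExp.eval, Test.eval, Test.lt, J, I, Seg, NExp.cell, h3, h4,
                h5, hx, hx', h2 j k hk', h1.bundle, Mem.writeNat, lastLe]
          · refine ⟨fun i' j' hij hij' => ?_, ?_, ?_⟩
            · simp [Prog.res, NExp.eval, RExp.eval, Test.eval, Test.lt, J, I, Seg, NExp.cell, h3, h4,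
                h5, hx, hx', h2 j k hk', h1.bundle, h6 i' j' hij hij']
            · simp [Prog.res, NExp.eval, RExp.eval, Test.eval, Test.lt, J, I, Seg, NExp.cell, h3, h4,
                h5, hx, hx', h2 j k hk', h1.bundle, lastLt, h7]
            · simp [Prog.res, NExp.eval, RExp.eval, Test.eval, Test.lt, J, I, Seg, NExp.cell, h3, h4,
                h5, hx, hx', h2 j k hk', h1.bundle, lastLe, h8]
    · by_cases heq : (i', j') = (i, j)
      · obtain ⟨rfl, rfl⟩ := Prod.ext_iff.1 heq
        exact hs.2.2
      · refine hs.2.1 i' j' ?_ heq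
        simpa [hne heq] using hij
    · have := (hL.1 j).2
      nlinarith

theorem localTo_isLocated : LocalTo [25, 26] [] (IsLocated L S) := by
  intro s s' h1 _ h3
  simp only [List.forall_mem_cons] at h1
  simpa only [IsLocated, h1.1, h1.2.1] using h3

def HasCosts (S : Fin n → Obs K d) (s : Mem K) : Prop :=
  ∀ i : Fin n, s.num 8 0 i = (S i).price ⬝ᵥ (S i).bundle

theorem localTo_hasCosts : LocalTo [] [8] (HasCosts S) := by
  intro s s' _ h2 h3
  simp only [List.forall_mem_cons] at h2
  simpa only [HasCosts, h2.1] using h3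

theorem sum_range_padVec (v : Fin d → K) : ∑ j ∈ Finset.range d, padVec v j = ∑ j, v j := by
  rw [Finset.sum_range]
  exact Finset.sum_congr rfl fun j _ => by simp [padVec]

theorem InputBound.cost (hc : Tame c g h) (hb : InputBound h L S b) (i : Fin n) {j : ℕ}
    (hj : j ≤ d) : h (∑ j' ∈ Finset.range j, padVec (fun j' => (S i).price j' * (S i).bundle j') j')
      ≤ 2 + b * (2 * b) := by
  refine (size_sum_le (a := 2 * b) hc fun j' hj' => ?_).trans
    (Nat.add_le_add_left (Nat.mul_le_mul_right _ (hj.trans hb.goods)) _)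
  rw [padVec_of_lt _ (hj'.trans_le hj)]
  have := hc.h_mul ((S i).price ⟨j', hj'.trans_le hj⟩) ((S i).bundle ⟨j', hj'.trans_le hj⟩)
  have := hb.price i ⟨j', hj'.trans_le hj⟩
  have := hb.bundle i ⟨j', hj'.trans_le hj⟩
  omega

theorem costs_triple (hc : Tame c g h) (hb : InputBound h L S b) (hG : 2 + b * (2 * b) ≤ G) :
    Triple c g h G (IsInput L S) costs (fun s => IsInput L S s ∧ HasCosts S s)
      (n * (1 + (d * (1 + 1) + 2) + 1 + 1) + 2) := by
  have hb2 := hb.two_le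
  have hbG : b ≤ G := by nlinarith
  have hin := localTo_isInput (L := L) (S := S)
  have key := Triple.forUnion hc hin (a := 12) (n := sampleSize) (N := n) (G := G)
    (q := .seq (.setNum 8 (.const 0) I .zero)
    (.forLoop 10 goods
      (.setNum 8 (.const 0) I (.add (.row 8 0 I) (.mul (.read 1 I J) (.read 3 I J))))))
    (T := 1 + (d * (1 + 1) + 2) + 1)
    (by decide) (by decide) (hb.sampleSize.trans hbG)
    (fun X _ s => ∀ i : Fin n, (i : ℕ) ∈ X → s.num 8 0 i = (S i).price ⬝ᵥ (S i).bundle)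
    (fun i => {i}) 0 (fun _ _ _ _ h => h) (fun s hs => hs.sampleSize) ?_ ∅ 0 le_rfl
  · refine key.mono (fun s hs => ⟨hs, by simp⟩) (fun s hs => ⟨hs.1, fun i => hs.2 i ?_⟩) le_rfl
    simp
  intro i hi X _ _
  obtain ⟨i, rfl⟩ : ∃ i' : Fin n, (i' : ℕ) = i := ⟨⟨i, hi⟩, rfl⟩
  set W' : ℕ → Mem K → Prop := fun j s =>
    (∀ i' : Fin n, (i' : ℕ) ∈ X → i' ≠ i → s.num 8 0 i' = (S i').price ⬝ᵥ (S i').bundle) ∧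
      s.num 8 0 i = ∑ j' ∈ Finset.range j, padVec (fun j' => (S i).price j' * (S i).bundle j') j'
    with hW'
  refine Triple.seq (Q := fun s => (IsInput L S s ∧ s.nat 12 0 0 = i) ∧ W' 0 s) ?_ ?_
  · refine Triple.keep (hin.counter 12 i) (by decide) (Triple.straight hc trivial ?_)
    rintro s - ⟨⟨h1, h2⟩, h3⟩
    refine ⟨hc.h_zero.trans (by omega), fun i' hi' hne => ?_, ?_⟩
    · have : (i' : ℕ) ≠ i := fun h => hne (Fin.ext h)
      simp [Prog.res, NExp.eval, I, NExp.cell, h2, Mem.writeNum, this, h3 i' hi']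
    · simp [Prog.res, NExp.eval, RExp.eval, I, NExp.cell, h2, Mem.writeNum]
  · refine (Triple.forLoopIn hc (hin.counter 12 i) (a := 10) (n := goods) (N := d) (T := 1)
      (by decide) (by decide) (hb.goods.trans hbG) W' (fun _ _ _ h => h)
      (fun s hs => hs.1.goods) ?_).mono (fun _ h => h) (fun s hs i' hi' => ?_) le_rfl
    · intro j hj
      refine Triple.straight hc trivial ?_
      rintro s - ⟨⟨⟨h1, h2⟩, h3⟩, h4, h5⟩
      obtain ⟨j, rfl⟩ : ∃ j' : Fin d, (j' : ℕ) = j := ⟨⟨j, hj⟩, rfl⟩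
      have e : (RExp.add (.row 8 0 I) (.mul (.read 1 I J) (.read 3 I J))).eval s =
          ∑ j' ∈ Finset.range (j + 1), padVec (fun j' => (S i).price j' * (S i).bundle j') j' := by
        simp [NExp.eval, RExp.eval, RExp.row, J, I, NExp.cell, h2, h3, h5, h1.price, h1.bundle,
          Finset.sum_range_succ, padVec]
      refine ⟨?_, fun i' hi' hne => ?_, ?_⟩
      · rw [Prog.Safe, e]
        exact (hb.cost hc i j.2).trans hG
      · have : (i' : ℕ) ≠ i := fun h => hne (Fin.ext h)
        simp [Prog.res, NExp.eval, I, NExp.cell, h2, Mem.writeNum, this, h4 i' hi' hne]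
      · simp only [Prog.res, e]
        simp [NExp.eval, I, NExp.cell, h2, Mem.writeNum]
    · by_cases hne : i' = i
      · subst hne
        rw [hs.2.2, sum_range_padVec]
        rfl
      · refine hs.2.1 i' ?_ hne
        simpa [Fin.val_inj, hne] using hi'

end LearnerProgram

/-! ### Storing the start values and the inequalities -/

namespace LearnerProgram

open SecondBestProgram (equal nequal)

/-- The number of inequalities. -/
def edges : NExp := .cell 20

def append (a b a' b' : NExp) (w : RExp) : Prog :=
  .seq (.seq (.seq (.setNat 21 (.const 0) edges a) (.setNat 22 (.const 0) edges b))
    (.seq (.setNat 23 (.const 0) edges a') (.setNat 24 (.const 0) edges b')))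
    (.seq (.setNum 9 (.const 0) edges w)
      (.setNat 20 (.const 0) (.const 0) (.add edges (.const 1))))

def chains : Prog :=
  .forLoop 10 goods (.forLoop 11 (.sub (.row 1 J) (.const 1))
    (append J Seg J (.add Seg (.const 1)) .one))

def observations : Prog :=
  .forLoop 12 sampleSize (.forLoop 10 goods (.forLoop 13 goods
    (.ite (.conj (.conj (nequal J J') (.conj (.lt .zero (.read 3 I J)) (.lt (.read 3 I J') .one)))
        (.conj (.lt .zero (.read 1 I J)) (.lt .zero (.read 1 I J'))))
      (append J (.read 25 I J) J' (.read 26 I J') (.div (.read 1 I J) (.read 1 I J')))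
      .skip)))

variable {K : Type} [Field K] [LinearOrder K] {d κ n : ℕ} {c : CostModel K} {g : ℕ → ℕ}
  {h : K → ℕ} {G b : ℕ} {L : Segments K d κ} {S : Fin n → Obs K d}

theorem ite_eq_ite_of_iff {p q : Prop} {_ : Decidable p} {_ : Decidable q} {α : Type*} {a b : α}
    (hpq : p ↔ q) : ite p a b = ite q a b :=
  if_congr hpq rfl rfl

open Classical in
theorem ones_triple (hc : Tame c g h) (hb : InputBound h L S b) (hG : b ≤ G) :
    Triple c g h G (fun s => IsInput L S s ∧ ∀ f : ℕ × ℕ, s.num 6 f.1 f.2 = 0) ones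
      (fun s => IsInput L S s ∧ ∀ f : ℕ × ℕ, s.num 6 f.1 f.2 = if f.1 < d ∧ f.2 < κ then 1 else 0)
      (d * ((κ * (1 + 1) + 2) + 1) + 2) := by
  have hb2 := hb.two_le
  have hin := localTo_isInput (L := L) (S := S)
  set W : Set (ℕ × ℕ) → ℕ → Mem K → Prop := fun X _ s => ∀ f : ℕ × ℕ,
    s.num 6 f.1 f.2 = if f ∈ X then 1 else 0 with hWdef
  have key := Triple.forUnion hc hin (a := 10) (n := goods) (N := d) (G := G)
    (q := .forLoop 11 maxSegs (.setNum 6 J Seg .one)) (T := κ * (1 + 1) + 2)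
    (by decide) (by decide) (hb.goods.trans hG) W
    (fun j => {x | ∃ k < κ, x ∈ ({(j, k)} : Set (ℕ × ℕ))}) 0 (fun _ _ _ _ h => h)
    (fun s hs => hs.goods) (fun j hj X m hm => ?_) ∅ 0 le_rfl
  · refine key.mono (fun s hs => ⟨hs.1, by simpa [hWdef] using hs.2⟩)
      (fun s hs => ⟨hs.1, fun f => ?_⟩) le_rfl
    refine (hs.2 f).trans (ite_eq_ite_of_iff ?_)
    obtain ⟨j, k⟩ := f
    simp only [Set.empty_union, Set.mem_ofPred_eq, Set.mem_singleton_iff, Prod.mk.injEq]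
    exact ⟨fun ⟨j', h1, k', h2, h3, h4⟩ => ⟨h3 ▸ h1, h4 ▸ h2⟩, fun ⟨h1, h2⟩ => ⟨j, h1, k, h2, rfl, rfl⟩⟩
  refine (Triple.forUnion hc (hin.counter 10 j) (a := 11) (n := maxSegs) (N := κ)
    (by decide) (by decide) (hb.maxSegs.trans hG) W (fun k => {(j, k)}) 0 (fun _ _ _ _ h => h)
    (fun s hs => hs.1.maxSegs) (fun k hk X m _ => ?_) X m (M := m) (by simp)).mono (fun s hs => hs)
      (fun s hs => hs.2) le_rfl
  refine Triple.straight hc trivial ?_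
  rintro s - ⟨⟨⟨h1, h2⟩, h3⟩, h4⟩
  refine ⟨hc.h_one.trans (hb2.trans hG), fun f => ?_⟩
  obtain ⟨j', k'⟩ := f
  have := h4 (j', k')
  simp only at this
  by_cases h5 : j' = j ∧ k' = k
  · simp [Prog.res, NExp.eval, RExp.eval, J, Seg, NExp.cell, h2, h3, Mem.writeNum, h5]
  · simp [Prog.res, NExp.eval, RExp.eval, J, Seg, NExp.cell, h2, h3, Mem.writeNum, h5, this]

/-- Everything that is known about the sample after it has been scanned. -/
def IsScanned (L : Segments K d κ) (S : Fin n → Obs K d) (s : Mem K) : Prop :=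
  IsInput L S s ∧ IsLocated L S s ∧ HasCosts S s

theorem localTo_isScanned :
    LocalTo [0, 1, 25, 26] [0, 1, 2, 3, 8] (IsScanned L S) :=
  localTo_isInput.and (localTo_isLocated.and localTo_hasCosts)

open Classical in
theorem zeros_triple (hc : Tame c g h) (hb : InputBound h L S b) (hG : b ≤ G) :
    Triple c g h G (fun s => IsScanned L S s ∧ ∀ f : ℕ × ℕ, s.num 6 f.1 f.2 =
        if f.1 < d ∧ f.2 < κ then 1 else 0) zeros
      (fun s => IsScanned L S s ∧ ∀ f : ℕ × ℕ, s.num 6 f.1 f.2 = (ofLex (startValue L S f)).1)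
      (n * ((d * (1 + 1) + 2) + 1) + 2) := by
  have hb2 := hb.two_le
  have hin := localTo_isScanned (L := L) (S := S)
  set W : Set (ℕ × ℕ) → ℕ → Mem K → Prop := fun X _ s => ∀ f : ℕ × ℕ,
    s.num 6 f.1 f.2 = if f.1 < d ∧ f.2 < κ ∧ f ∉ X then 1 else 0 with hWdef
  set D : ℕ → ℕ → Set (ℕ × ℕ) := fun i j => {f | ∃ (i' : Fin n) (j' : Fin d), (i' : ℕ) = i ∧
    (j' : ℕ) = j ∧ (S i').price ⬝ᵥ (S i').bundle < (S i').budget ∧ (S i').bundle j' < 1 ∧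
    f = ((j' : ℕ), L.hi j' ((S i').bundle j'))} with hD
  have key := Triple.forUnion hc hin (a := 12) (n := sampleSize) (N := n) (G := G)
    (q := .forLoop 10 goods
    (.ite (.conj (.lt (.row 8 0 I) (.read 2 I (.const 0))) (.lt (.read 3 I J) .one))
      (.setNum 6 J (.read 26 I J) .zero) .skip)) (T := d * (1 + 1) + 2)
    (by decide) (by decide) (hb.sampleSize.trans hG) W
    (fun i => {x | ∃ j < d, x ∈ D i j}) 0 (fun _ _ _ _ h => h)
    (fun s hs => hs.1.sampleSize) (fun i hi X m hm => ?_) ∅ 0 le_rfl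
  · refine key.mono (fun s hs => ⟨hs.1, by simpa [hWdef] using hs.2⟩)
      (fun s hs => ⟨hs.1, fun f => ?_⟩) le_rfl
    refine (hs.2 f).trans (ite_eq_ite_of_iff ?_)
    refine and_congr_right fun _ => and_congr_right fun _ => not_congr ?_
    simp only [hD, zeroSet, obsZeros, Set.empty_union, Set.mem_iUnion, Set.mem_ofPred_eq]
    constructor
    · rintro ⟨i, -, j, -, i', j', -, -, h1, h2, h3⟩
      exact ⟨i', h1, j', h2, h3⟩
    · rintro ⟨i', h1, j', h2, h3⟩
      exact ⟨i', i'.2, j', j'.2, i', j', rfl, rfl, h1, h2, h3⟩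
  obtain ⟨i, rfl⟩ : ∃ i' : Fin n, (i' : ℕ) = i := ⟨⟨i, hi⟩, rfl⟩
  refine (Triple.forUnion hc (hin.counter 12 i) (a := 10) (n := goods) (N := d)
    (by decide) (by decide) (hb.goods.trans hG) W (D i) 0 (fun _ _ _ _ h => h)
    (fun s hs => hs.1.1.goods) (fun j hj X m _ => ?_) X m (M := m) (by simp)).mono (fun s hs => hs)
      (fun s hs => hs.2) le_rfl
  obtain ⟨j, rfl⟩ : ∃ j' : Fin d, (j' : ℕ) = j := ⟨⟨j, hj⟩, rfl⟩
  refine Triple.straight hc ⟨trivial, trivial⟩ ?_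
  rintro s - ⟨⟨⟨⟨h1, h2, h3⟩, h4⟩, h5⟩, h6⟩
  refine ⟨⟨fun _ => hc.h_zero.trans (hb2.trans hG), fun _ => trivial⟩, fun f => ?_⟩
  obtain ⟨j', k'⟩ := f
  have h7 := h6 (j', k')
  simp only at h7
  have h8 : (j', k') ∈ D i j ↔ ((S i).price ⬝ᵥ (S i).bundle < (S i).budget ∧
      (S i).bundle j < 1) ∧ j' = j ∧ k' = L.hi j ((S i).bundle j) := by
    simp only [hD, Set.mem_ofPred_eq, Fin.val_inj, Prod.mk.injEq]
    constructor
    · rintro ⟨_, _, rfl, rfl, h1, h2, h3⟩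
      exact ⟨⟨h1, h2⟩, h3⟩
    · rintro ⟨⟨h1, h2⟩, h3⟩
      exact ⟨i, j, rfl, rfl, h1, h2, h3⟩
  simp only [Set.mem_union, h8]
  by_cases hx : (S i).price ⬝ᵥ (S i).bundle < (S i).budget ∧ (S i).bundle j < 1
  · by_cases hf : j' = j ∧ k' = L.hi j ((S i).bundle j)
    · simp [Prog.res, NExp.eval, RExp.eval, RExp.row, Test.eval, Test.lt, J, I, NExp.cell, h3 i, h4,
        h5, h1.bundle, h1.budget, hx, h2 i j, Mem.writeNum, hf]
    · simp [Prog.res, NExp.eval, RExp.eval, RExp.row, Test.eval, Test.lt, J, I, NExp.cell, h3 i, h4,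
        h5, h1.bundle, h1.budget, hx, h2 i j, Mem.writeNum, hf, h7]
  · have : ¬ (Test.conj (.lt (.row 8 0 I) (.read 2 I (.const 0))) (.lt (.read 3 I J) .one)).eval s := by
      simpa [NExp.eval, RExp.eval, RExp.row, Test.eval, Test.lt, J, I, NExp.cell, h3 i, h4,
        h5, h1.bundle, h1.budget] using hx
    simp [Prog.res, this, hx, h7]

def edgeAt (s : Mem K) (t : ℕ) : Edge K :=
  ⟨(s.nat 21 0 t, s.nat 22 0 t), (s.nat 23 0 t, s.nat 24 0 t), s.num 9 0 t⟩

/-- The set `X` of inequalities is stored, with at most `m` entries. -/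
def HasEdges (X : Set (Edge K)) (m : ℕ) (s : Mem K) : Prop :=
  s.nat 20 0 0 ≤ m ∧ {e | ∃ t < s.nat 20 0 0, e = edgeAt s t} = X

def Mem.push (s : Mem K) (e : Edge K) : Mem K :=
  (((((s.writeNat 21 0 (s.nat 20 0 0) e.src.1).writeNat 22 0 (s.nat 20 0 0) e.src.2).writeNat
    23 0 (s.nat 20 0 0) e.dst.1).writeNat 24 0 (s.nat 20 0 0) e.dst.2).writeNum
    9 0 (s.nat 20 0 0) e.wt).writeNat 20 0 0 (s.nat 20 0 0 + 1)

theorem HasEdges.push {X : Set (Edge K)} {m : ℕ} {s : Mem K} (hs : HasEdges X m s) (e : Edge K) :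
    HasEdges (X ∪ {e}) (m + 1) (Mem.push s e) := by
  obtain ⟨h1, h2⟩ := hs
  have h3 : (Mem.push s e).nat 20 0 0 = s.nat 20 0 0 + 1 := by simp [Mem.push, Mem.writeNat]
  have h4 : edgeAt (Mem.push s e) (s.nat 20 0 0) = e := by
    simp [edgeAt, Mem.push, Mem.writeNat, Mem.writeNum]
  have h5 : ∀ t < s.nat 20 0 0, edgeAt (Mem.push s e) t = edgeAt s t := by
    intro t ht
    simp [edgeAt, Mem.push, Mem.writeNat, Mem.writeNum, ht.ne]
  refine ⟨by omega, ?_⟩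
  rw [h3, ← h2]
  ext e'
  simp only [Set.mem_ofPred_eq, Set.mem_union, Set.mem_singleton_iff, Nat.lt_succ_iff_lt_or_eq]
  constructor
  · rintro ⟨t, ht | rfl, rfl⟩
    exacts [.inl ⟨t, ht, h5 t ht⟩, .inr h4]
  · rintro (⟨t, ht, rfl⟩ | rfl)
    exacts [⟨t, .inl ht, (h5 t ht).symm⟩, ⟨_, .inr rfl, h4.symm⟩]

theorem chains_triple (hc : Tame c g h) (hL : L.Valid) (hb : InputBound h L S b) (hG : b ≤ G)
    (hG' : d * κ ≤ G) :
    Triple c g h G (fun s => IsInput L S s ∧ HasEdges ∅ 0 s) chains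
      (fun s => IsInput L S s ∧ HasEdges (chainEdges L) (d * κ) s)
      (d * ((κ * (1 + 1) + 2) + 1) + 2) := by
  have hb2 := hb.two_le
  have hin := localTo_isInput (L := L) (S := S)
  have hg0 : ∀ m ≤ b, g m ≤ G := fun m hm => (hc.g_le m).trans (hm.trans hG)
  set D : ℕ → Set (Edge K) := fun j => {e | ∃ (j' : Fin d) (k : ℕ), (j' : ℕ) = j ∧
    k + 1 < L.num j' ∧ e = ⟨(j', k), (j', k + 1), 1⟩} with hD
  have hW : ∀ a, a = 10 ∨ a = 11 → ∀ X m v (s : Mem K), HasEdges X m s →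
      HasEdges X m (s.writeNat a 0 0 v) := by
    rintro a (rfl | rfl) X m v s hs <;> simpa [HasEdges, edgeAt, Mem.writeNat] using hs
  have key := Triple.forUnion hc hin (a := 10) (n := goods) (N := d) (G := G)
    (q := .forLoop 11 (.sub (.row 1 J) (.const 1)) (append J Seg J (.add Seg (.const 1)) .one))
    (T := κ * (1 + 1) + 2)
    (by decide) (by decide) (hb.goods.trans hG) HasEdges D κ (hW _ (.inl rfl))
    (fun s hs => hs.goods) (fun j hj X m hm => ?_) ∅ 0 le_rfl
  · refine key.mono (fun s hs => hs) (fun s hs => ⟨hs.1, ?_⟩) le_rfl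
    convert hs.2 using 1
    · ext e
      simp only [Set.empty_union, Set.mem_ofPred_eq, hD, chainEdges]
      exact ⟨fun ⟨j, k, h1, h2⟩ => ⟨j, j.2, j, k, rfl, h1, h2⟩,
        fun ⟨_, _, j, k, _, h1, h2⟩ => ⟨j, k, h1, h2⟩⟩
    · simp
  obtain ⟨j, rfl⟩ : ∃ j' : Fin d, (j' : ℕ) = j := ⟨⟨j, hj⟩, rfl⟩
  have hj1 := hL.1 j
  have hκ := hb.maxSegs
  refine (Triple.forUnion hc (hin.counter 10 j) (a := 11) (N := L.num j - 1) (T := 1)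
    (by decide) (by decide) (by omega) HasEdges (fun k => {⟨(j, k), (j, k + 1), 1⟩}) 1
    (hW _ (.inr rfl)) (fun s hs => ?_) (fun k hk X m hm' => ?_) X m (M := d * κ)
    (by omega)).mono (fun s hs => hs) (fun s hs => ⟨hs.2.1.trans (by omega), ?_⟩) ?_
  · simp [NExp.row, NExp.eval, J, NExp.cell, hs.2, hs.1.num]
  · refine Triple.straight hc ⟨⟨⟨trivial, trivial⟩, ⟨trivial, trivial⟩⟩, ⟨trivial, trivial⟩⟩ ?_
    rintro s - ⟨⟨⟨h1, h2⟩, h3⟩, h4⟩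
    have hjb : g j ≤ G := hg0 _ (j.2.le.trans hb.goods)
    have hkb : g k ≤ G := hg0 _ (by omega)
    have hkb' : g (k + 1) ≤ G := hg0 _ (by omega)
    have hmb : g (s.nat 20 0 0 + 1) ≤ G := (hc.g_le _).trans (by have := h4.1; omega)
    refine ⟨?_, ?_⟩
    · simp [append, Prog.Safe, Prog.res, NExp.eval, RExp.eval, J, Seg, edges, NExp.cell, h2, h3,
        Mem.writeNat, Mem.writeNum, hjb, hkb, hkb', hmb, hc.h_one.trans (hb2.trans hG)]
    · convert h4.push ⟨(j, k), (j, k + 1), 1⟩ using 1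
      simp [append, Prog.res, NExp.eval, RExp.eval, J, Seg, edges, NExp.cell, h2, h3,
        Mem.writeNat, Mem.writeNum, Mem.push]
  · rw [hs.2.2]
    congr 1
    ext e
    simp only [hD, Set.mem_ofPred_eq, Set.mem_singleton_iff, Fin.val_inj]
    constructor
    · rintro ⟨k, h1, rfl⟩
      exact ⟨j, k, rfl, by omega, rfl⟩
    · rintro ⟨_, k, rfl, h1, rfl⟩
      exact ⟨k, by omega, rfl⟩
  · have : (L.num j - 1) * (1 + 1) ≤ κ * (1 + 1) := Nat.mul_le_mul_right _ (by omega)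
    omega

theorem observations_triple (hc : Tame c g h) (hL : L.Valid) (hb : InputBound h L S b)
    (hG : 2 * b ≤ G) (hG' : d * κ + n * (d * d) ≤ G) :
    Triple c g h G (fun s => IsScanned L S s ∧ HasEdges (chainEdges L) (d * κ) s) observations
      (fun s => IsScanned L S s ∧ HasEdges (edgeSet L S) (d * κ + n * (d * d)) s)
      (n * ((d * ((d * (1 + 1) + 2) + 1) + 2) + 1) + 2) := by
  have hb2 := hb.two_le
  have hbG : b ≤ G := by omega
  have hin := localTo_isScanned (L := L) (S := S)
  have hg0 : ∀ m ≤ b, g m ≤ G := fun m hm => (hc.g_le m).trans (hm.trans hbG)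
  set D : ℕ → ℕ → ℕ → Set (Edge K) := fun i j j' => {e | ∃ (i₀ : Fin n) (j₀ j₀' : Fin d),
    (i₀ : ℕ) = i ∧ (j₀ : ℕ) = j ∧ (j₀' : ℕ) = j' ∧ HasObsEdge (S i₀) j₀ j₀' ∧
    e = obsEdge L (S i₀) j₀ j₀'} with hD
  have hW : ∀ a, a = 10 ∨ a = 12 ∨ a = 13 → ∀ X m v (s : Mem K), HasEdges X m s →
      HasEdges X m (s.writeNat a 0 0 v) := by
    rintro a (rfl | rfl | rfl) X m v s hs <;> simpa [HasEdges, edgeAt, Mem.writeNat] using hs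
  have key := Triple.forUnion hc hin (a := 12) (n := sampleSize) (N := n) (G := G)
    (q := .forLoop 10 goods (.forLoop 13 goods
    (.ite (.conj (.conj (nequal J J') (.conj (.lt .zero (.read 3 I J)) (.lt (.read 3 I J') .one)))
        (.conj (.lt .zero (.read 1 I J)) (.lt .zero (.read 1 I J'))))
      (append J (.read 25 I J) J' (.read 26 I J') (.div (.read 1 I J) (.read 1 I J')))
      .skip)))
    (T := d * ((d * (1 + 1) + 2) + 1) + 2)
    (by decide) (by decide) (hb.sampleSize.trans hbG) HasEdges
    (fun i => {e | ∃ j < d, e ∈ {e | ∃ j' < d, e ∈ D i j j'}}) (d * d) (hW _ (.inr (.inl rfl)))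
    (fun s hs => hs.1.sampleSize) (fun i hi X m hm => ?_) (chainEdges L) (d * κ) le_rfl
  · refine key.mono (fun s hs => hs) (fun s hs => ⟨hs.1, ?_⟩) le_rfl
    convert hs.2 using 1
    rw [edgeSet]
    congr 1
    ext e
    simp only [Set.mem_ofPred_eq, hD, obsEdges, Set.mem_iUnion]
    exact ⟨fun ⟨i, j, j', h1, h2⟩ => ⟨i, i.2, j, j.2, j', j'.2, i, j, j', rfl, rfl, rfl, h1, h2⟩,
      fun ⟨_, _, _, _, _, _, i, j, j', _, _, _, h1, h2⟩ => ⟨i, j, j', h1, h2⟩⟩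
  obtain ⟨i, rfl⟩ : ∃ i' : Fin n, (i' : ℕ) = i := ⟨⟨i, hi⟩, rfl⟩
  refine (Triple.forUnion hc (hin.counter 12 i) (a := 10) (n := goods) (N := d)
    (T := d * (1 + 1) + 2) (by decide) (by decide) (hb.goods.trans hbG) HasEdges
    (fun j => {e | ∃ j' < d, e ∈ D i j j'}) d (hW _ (.inl rfl))
    (fun s hs => hs.1.1.goods) (fun j hj X m hm => ?_) X m hm).mono (fun s hs => hs)
      (fun s hs => hs.2) le_rfl
  obtain ⟨j, rfl⟩ : ∃ j' : Fin d, (j' : ℕ) = j := ⟨⟨j, hj⟩, rfl⟩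
  refine (Triple.forUnion hc ((hin.counter 12 i).counter 10 j) (a := 13) (n := goods) (N := d)
    (T := 1) (by decide) (by decide) (hb.goods.trans hbG) HasEdges (D i j) 1 (hW _ (.inr (.inr rfl)))
    (fun s hs => hs.1.1.1.goods) (fun j' hj' X m hm => ?_) X m (by simpa using hm)).mono
      (fun s hs => hs) (fun s hs => by simpa using hs.2) le_rfl
  obtain ⟨j', rfl⟩ : ∃ j₀ : Fin d, (j₀ : ℕ) = j' := ⟨⟨j', hj'⟩, rfl⟩
  refine Triple.straight hc ⟨⟨⟨⟨trivial, trivial⟩, ⟨trivial, trivial⟩⟩, ⟨trivial, trivial⟩⟩,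
    trivial⟩ ?_
  rintro s - ⟨⟨⟨⟨⟨h1, h2, -⟩, h3⟩, h4⟩, h5⟩, h6⟩
  have hDe : D i j j' = {e | HasObsEdge (S i) j j' ∧ e = obsEdge L (S i) j j'} := by
    ext e
    simp only [hD, Set.mem_ofPred_eq, Fin.val_inj]
    exact ⟨fun ⟨_, _, _, h1, h2, h3, h4⟩ => h1 ▸ h2 ▸ h3 ▸ h4, fun h => ⟨i, j, j', rfl, rfl, rfl, h⟩⟩
  have htest : (Test.conj (.conj (nequal J J') (.conj (.lt .zero (.read 3 I J)) (.lt (.read 3 I J')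
      .one))) (.conj (.lt .zero (.read 1 I J)) (.lt .zero (.read 1 I J')))).eval s ↔
      HasObsEdge (S i) j j' := by
    simp [Test.eval, Test.lt, Test.nlt, Test.disj, nequal, RExp.eval, NExp.eval, I, J, J', NExp.cell,
      h3, h4, h5, h1.bundle, h1.price, HasObsEdge, Fin.ext_iff]
    grind
  have hlo : g (L.lo j ((S i).bundle j)) ≤ G :=
    hg0 _ ((lastLt_lt (hL.1 j).1).le.trans ((hL.1 j).2.trans hb.maxSegs))
  have hhi : g (L.hi j' ((S i).bundle j')) ≤ G :=
    hg0 _ ((lastLe_lt (hL.1 j').1).le.trans ((hL.1 j').2.trans hb.maxSegs))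
  have hjb : g j ≤ G := hg0 _ (j.2.le.trans hb.goods)
  have hjb' : g j' ≤ G := hg0 _ (j'.2.le.trans hb.goods)
  have hmb : g (s.nat 20 0 0 + 1) ≤ G := (hc.g_le _).trans (by have := h6.1; omega)
  have hw : h ((S i).price j / (S i).price j') ≤ G :=
    (hc.h_div _ _).trans (by have := hb.price i j; have := hb.price i j'; omega)
  have e : (append J (.read 25 I J) J' (.read 26 I J') (.div (.read 1 I J) (.read 1 I J'))).res s =
      Mem.push s (obsEdge L (S i) j j') := by
    simp [append, Prog.res, NExp.eval, RExp.eval, I, J, J', edges, NExp.cell, h3, h4, h5, h2 i j,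
      h2 i j', h1.price, Mem.writeNat, Mem.writeNum, Mem.push, obsEdge]
  refine ⟨⟨fun _ => ?_, fun _ => trivial⟩, ?_⟩
  · simp [append, Prog.Safe, Prog.res, NExp.eval, RExp.eval, I, J, J', edges, NExp.cell, h3, h4, h5,
      h2 i j, h2 i j', h1.price, Mem.writeNat, Mem.writeNum, hjb, hjb', hlo, hhi, hmb, hw]
  · by_cases hx : HasObsEdge (S i) j j'
    · simp only [Prog.res, if_pos (htest.2 hx), e, hDe, hx, true_and]
      exact h6.push _
    · simp only [Prog.res, if_neg (mt htest.1 hx), hDe, hx, false_and]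
      exact ⟨h6.1.trans (Nat.le_succ _), by simpa using h6.2⟩

end LearnerProgram

/-! ### Relaxation of the inequalities -/

namespace LearnerProgram

def E : NExp := .cell 15

def srcVal : RExp := .read 6 (.row 21 E) (.row 22 E)

def srcCount : RExp := .read 7 (.row 21 E) (.row 22 E)

def dstVal : RExp := .read 6 (.row 23 E) (.row 24 E)

def dstCount : RExp := .read 7 (.row 23 E) (.row 24 E)

def tmp (i : ℕ) : RExp := .row 11 0 (.const i)

def relax : Prog :=
  .seq (.seq (.setNum 11 (.const 0) (.const 0) (.mul (.row 9 0 E) dstVal))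
    (.setNum 11 (.const 0) (.const 1) (.add dstCount .one)))
  (.ite (.neg (.conj (.rle (tmp 0) srcVal) (.neg (.conj (.rle srcVal (tmp 0))
      (.neg (.rle (tmp 1) srcCount))))))
    (.seq (.setNum 6 (.row 21 E) (.row 22 E) (tmp 0)) (.setNum 7 (.row 21 E) (.row 22 E) (tmp 1)))
    .skip)

/-- Relax all inequalities, as many times as there are inequalities and once more. -/
def solve : Prog := .forLoop 14 (.add edges (.const 1)) (.forLoop 15 edges relax)

variable {K : Type} [Field K] [LinearOrder K] [IsStrictOrderedRing K] {d κ n : ℕ} {c : CostModel K}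
  {g : ℕ → ℕ} {h : K → ℕ} {G b : ℕ} {L : Segments K d κ} {S : Fin n → Obs K d}

def values (s : Mem K) (f : ℕ × ℕ) : K ×ₗ K := toLex (s.num 6 f.1 f.2, s.num 7 f.1 f.2)

def IsList (ed : ℕ → Edge K) (m : ℕ) (s : Mem K) : Prop :=
  s.nat 20 0 0 = m ∧ ∀ t < m, edgeAt s t = ed t

theorem localTo_isList (ed : ℕ → Edge K) (m : ℕ) :
    LocalTo [20, 21, 22, 23, 24] [9] (IsList ed m) := by
  intro s s' h1 h2 h3
  simp only [List.forall_mem_cons] at h1 h2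
  obtain ⟨h10, h11, h12, h13, h14, -⟩ := h1
  simpa only [IsList, edgeAt, h10, h11, h12, h13, h14, h2.1] using h3

/-- The state after `r` full rounds and `e` inequalities of the next one. Values are updated in
place, so the table may run ahead of `rounds`; it stays between `rounds` and every solution, which
is all that is needed. Every relaxation adds at most `2 * b` to the largest size, which keeps the
bit lengths polynomial. -/
structure IsRelaxed (h : K → ℕ) (b : ℕ) (ed : ℕ → Edge K) (m : ℕ) (u₀ : ℕ × ℕ → K ×ₗ K) (r e : ℕ)
    (u : ℕ × ℕ → K ×ₗ K) : Prop where
  rounds_le : ∀ f, rounds ed m u₀ r f ≤ u f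
  act_le : ∀ t < e, (ed t).act (rounds ed m u₀ r (ed t).dst) ≤ u (ed t).src
  le : ∀ w, u₀ ≤ w → (∀ t < m, (ed t).act (w (ed t).dst) ≤ w (ed t).src) → ∀ f, u f ≤ w f
  nonneg : ∀ f, 0 ≤ (ofLex (u f)).2
  size_fst : ∀ f, h (ofLex (u f)).1 ≤ b + (r * m + e) * (2 * b)
  size_snd : ∀ f, h (ofLex (u f)).2 ≤ b + (r * m + e) * (2 * b)

variable {ed : ℕ → Edge K} {m r e : ℕ} {u₀ u : ℕ × ℕ → K ×ₗ K}

theorem IsRelaxed.relax (hc : Tame c g h) (hb : 2 ≤ b) (hw : ∀ t < m, 0 < (ed t).wt)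
    (hs : ∀ t < m, h (ed t).wt ≤ 2 * b) (he : e < m) (hu : IsRelaxed h b ed m u₀ r e u)
    {u' : ℕ × ℕ → K ×ₗ K} (hu' : u' = Function.update u (ed e).src
      (max (u (ed e).src) ((ed e).act (u (ed e).dst)))) :
    IsRelaxed h b ed m u₀ r (e + 1) u' := by
  have hle : ∀ f, u f ≤ u' f := by
    intro f
    rw [hu']
    by_cases hf : f = (ed e).src
    · subst hf; simp
    · simp [hf]
  have hcase : ∀ f, u' f = u f ∨ f = (ed e).src ∧ u' f = (ed e).act (u (ed e).dst) := by
    intro f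
    rw [hu']
    by_cases hf : f = (ed e).src
    · subst hf
      rcases max_choice (u (ed e).src) ((ed e).act (u (ed e).dst)) with h1 | h1 <;> simp [h1]
    · simp [hf]
  refine ⟨fun f => (hu.rounds_le f).trans (hle f), fun t ht => ?_, fun w h1 h2 f => ?_, fun f => ?_,
    fun f => ?_, fun f => ?_⟩
  · rcases Nat.lt_succ_iff_lt_or_eq.1 ht with ht | rfl
    · exact (hu.act_le t ht).trans (hle _)
    · rw [hu', Function.update_self]
      exact ((ed t).act_mono (hw t he) (hu.rounds_le _)).trans (le_max_right _ _)
  · rcases hcase f with h3 | ⟨rfl, h3⟩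
    · rw [h3]; exact hu.le w h1 h2 f
    · rw [h3]
      exact ((ed e).act_mono (hw e he) (hu.le w h1 h2 _)).trans (h2 e he)
  · rcases hcase f with h3 | ⟨rfl, h3⟩
    · rw [h3]; exact hu.nonneg f
    · rw [h3]
      exact add_nonneg (hu.nonneg _) zero_le_one
  · rcases hcase f with h3 | ⟨rfl, h3⟩
    · rw [h3]
      exact (hu.size_fst f).trans (by nlinarith)
    · rw [h3]
      have := hc.h_mul (ed e).wt (ofLex (u (ed e).dst)).1
      have := hs e he
      have := hu.size_fst (ed e).dst
      simp only [Edge.act, ofLex_toLex]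
      nlinarith
  · rcases hcase f with h3 | ⟨rfl, h3⟩
    · rw [h3]
      exact (hu.size_snd f).trans (by nlinarith)
    · rw [h3]
      have := hc.h_add (ofLex (u (ed e).dst)).2 1
      have := hc.h_one
      have := hu.size_snd (ed e).dst
      simp only [Edge.act, ofLex_toLex]
      nlinarith

theorem IsRelaxed.next (hu : IsRelaxed h b ed m u₀ r m u) : IsRelaxed h b ed m u₀ (r + 1) 0 u := by
  refine ⟨fun f => improve_le (hu.rounds_le f) ?_,
    fun t ht => absurd ht (Nat.not_lt_zero t), hu.le, hu.nonneg, fun f => ?_, fun f => ?_⟩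
  · rintro t ht rfl
    exact hu.act_le t ht
  · have := hu.size_fst f
    rwa [add_zero, Nat.succ_mul]
  · have := hu.size_snd f
    rwa [add_zero, Nat.succ_mul]

theorem relax_triple (hc : Tame c g h) (hb : 2 ≤ b) (hw : ∀ t < m, 0 < (ed t).wt)
    (hs : ∀ t < m, h (ed t).wt ≤ 2 * b) (hr : r < m + 1) (he : e < m)
    (hG : b + (m + 1) * m * (2 * b) ≤ G) :
    Triple c g h G (fun s => ((IsList ed m s ∧ s.nat 14 0 0 = r) ∧ s.nat 15 0 0 = e) ∧
      IsRelaxed h b ed m u₀ r e (values s)) relax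
      (fun s => IsRelaxed h b ed m u₀ r (e + 1) (values s)) 1 := by
  refine Triple.straight hc ⟨⟨trivial, trivial⟩, ⟨trivial, trivial⟩, trivial⟩ ?_
  rintro s - ⟨⟨⟨⟨h1, h2⟩, h3⟩, h4⟩, h5⟩
  have he' := h2 e he
  have hE : (s.nat 21 0 e = (ed e).src.1 ∧ s.nat 22 0 e = (ed e).src.2) ∧
      (s.nat 23 0 e = (ed e).dst.1 ∧ s.nat 24 0 e = (ed e).dst.2) ∧ s.num 9 0 e = (ed e).wt := by
    rw [← he']; simp [edgeAt]
  obtain ⟨⟨hE1, hE2⟩, ⟨hE3, hE4⟩, hE5⟩ := hE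
  have hnew := h5.relax hc hb hw hs he rfl
  set a := (ed e).act (values s (ed e).dst) with ha
  set s1 := (s.writeNum 11 0 0 (ofLex a).1).writeNum 11 0 1 (ofLex a).2 with hs1
  have e1 : (Prog.seq (.setNum 11 (.const 0) (.const 0) (.mul (.row 9 0 E) dstVal))
      (.setNum 11 (.const 0) (.const 1) (.add dstCount .one))).res s = s1 := by
    simp [Prog.res, NExp.eval, RExp.eval, NExp.row, RExp.row, E, NExp.cell, dstVal, dstCount, h4,
      hE3, hE4, hE5, hs1, ha, Edge.act, values, Mem.writeNum]
  have e2 : (Test.neg (.conj (.rle (tmp 0) srcVal) (.neg (.conj (.rle srcVal (tmp 0))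
      (.neg (.rle (tmp 1) srcCount)))))).eval s1 ↔ ¬ a ≤ values s (ed e).src := by
    rw [lex_le_iff]
    simp only [Test.eval, tmp, srcVal, srcCount, NExp.eval, RExp.eval, NExp.row, RExp.row, E,
      NExp.cell, hs1, Mem.writeNum, h4, hE1, hE2, values, ofLex_toLex]
    simp
    grind
  have hsz : h (ofLex a).1 ≤ G ∧ h (ofLex a).2 ≤ G := by
    -- At most `(m + 1) * m` relaxations take place altogether.
    have h6 : b + (r * m + e + 1) * (2 * b) ≤ G := le_trans (by gcongr; nlinarith) hG
    have := hc.h_mul (ed e).wt (ofLex (values s (ed e).dst)).1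
    have := hs e he
    have := h5.size_fst (ed e).dst
    have := hc.h_add (ofLex (values s (ed e).dst)).2 1
    have := hc.h_one
    have := h5.size_snd (ed e).dst
    simp only [ha, Edge.act, ofLex_toLex]
    constructor <;> nlinarith
  have e0 : relax.res s = if ¬ a ≤ values s (ed e).src then
      (s1.writeNum 6 (ed e).src.1 (ed e).src.2 (ofLex a).1).writeNum 7 (ed e).src.1 (ed e).src.2
        (ofLex a).2 else s1 := by
    have : relax.res s = (Prog.ite _ _ _).res (Prog.res _ s) := rfl
    rw [this, e1]
    by_cases hx : a ≤ values s (ed e).src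
    · simp only [Prog.res, if_neg (mt e2.1 (not_not.2 hx)), hx, not_true, if_false]
    · simp only [Prog.res, if_pos (e2.2 hx), hx, not_false_eq_true, if_true]
      simp [tmp, NExp.eval, RExp.eval, NExp.row, RExp.row, E, NExp.cell, h4, hE1, hE2, hs1,
        Mem.writeNum]
  refine ⟨⟨?_, ?_, ?_⟩, ?_⟩
  · refine ⟨?_, ?_⟩
    · simpa [Prog.Safe, NExp.eval, RExp.eval, NExp.row, RExp.row, E, NExp.cell, dstVal, h4,
        hE3, hE4, hE5, ha, Edge.act, values] using hsz.1
    · simpa [Prog.Safe, Prog.res, NExp.eval, RExp.eval, NExp.row, E, NExp.cell, dstCount,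
        h4, hE3, hE4, ha, Edge.act, values, Mem.writeNum] using hsz.2
  · rw [e1]
    intro _
    refine ⟨?_, ?_⟩
    · simpa [Prog.Safe, tmp, NExp.eval, RExp.eval, RExp.row, hs1, Mem.writeNum] using hsz.1
    · simpa [Prog.Safe, Prog.res, tmp, NExp.eval, RExp.eval, RExp.row, hs1, Mem.writeNum] using hsz.2
  · exact fun _ => trivial
  · convert hnew using 1
    by_cases hx : a ≤ values s (ed e).src
    · rw [max_eq_left hx, Function.update_eq_self, e0, if_neg (not_not.2 hx)]
      funext f
      simp [values, hs1, Mem.writeNum]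
    · rw [max_eq_right (not_le.1 hx).le, e0, if_pos hx]
      funext f
      by_cases hf : f = (ed e).src
      · subst hf
        simp [values, Mem.writeNum]
      · have : ¬ (f.1 = (ed e).src.1 ∧ f.2 = (ed e).src.2) := fun h => hf (Prod.ext h.1 h.2)
        simp [values, hs1, Mem.writeNum, hf, this]

theorem solve_triple (hc : Tame c g h) (hb : 2 ≤ b) (hw : ∀ t < m, 0 < (ed t).wt)
    (hs : ∀ t < m, h (ed t).wt ≤ 2 * b) (hG : b + (m + 1) * m * (2 * b) ≤ G) (hG' : m + 1 ≤ G) :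
    Triple c g h G (fun s => IsList ed m s ∧ IsRelaxed h b ed m u₀ 0 0 (values s)) solve
      (fun s => IsList ed m s ∧ IsRelaxed h b ed m u₀ (m + 1) 0 (values s))
      ((m + 1) * ((m * (1 + 1) + 2) + 1) + 2) := by
  have hin := localTo_isList ed m
  refine Triple.forLoopIn hc hin (by decide) (by decide) hG'
    (fun r s => IsRelaxed h b ed m u₀ r 0 (values s)) (fun _ _ _ h => h)
    (fun s hs => by simp [NExp.eval, edges, NExp.cell, hs.1]) (fun r hr => ?_)
  refine (Triple.forLoopIn hc (hin.counter 14 r) (by decide) (by decide)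
    ((Nat.le_succ m).trans hG') (fun e s => IsRelaxed h b ed m u₀ r e (values s)) (fun _ _ _ h => h)
    (fun s hs => by simp [NExp.eval, edges, NExp.cell, hs.1.1]) (fun e he => ?_)).mono
    (fun s hs => hs) (fun s hs => hs.2.next) le_rfl
  exact relax_triple hc hb hw hs hr he hG

end LearnerProgram

/-! ### From the least solution to the slopes -/

namespace LearnerProgram

def strictness : RExp := .row 10 0 (.const 0)

/-- The unit of strictness. -/
def measureSlack : Prog :=
  .seq (.setNum 10 (.const 0) (.const 0) .one) (.forLoop 15 edges
    (.seq (.setNum 11 (.const 0) (.const 0) (.mul (.row 9 0 E) dstVal))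
      (.ite (.lt (tmp 0) srcVal)
        (.seq (.setNum 11 (.const 0) (.const 1)
            (.div (.sub srcVal (tmp 0)) (.add .one (.mul (tmp 0) dstCount))))
          (.ite (.lt (tmp 1) strictness) (.setNum 10 (.const 0) (.const 0) (tmp 1)) .skip))
        .skip)))

def output : Prog :=
  .forLoop 10 goods (.forLoop 11 (.row 1 J)
    (.setNum 4 J Seg (.mul (.read 6 J Seg) (.add .one (.mul strictness (.read 7 J Seg))))))

/-- Make the slopes strictly decreasing. -/
def repair : Prog :=
  .forLoop 10 goods (.forLoop 11 (.sub (.row 1 J) (.const 1))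
    (.ite (.rle (.read 4 J (.sub (.row 1 J) (.add Seg (.const 2))))
        (.read 4 J (.sub (.row 1 J) (.add Seg (.const 1)))))
      (.setNum 4 J (.sub (.row 1 J) (.add Seg (.const 2)))
        (.add (.read 4 J (.sub (.row 1 J) (.add Seg (.const 1)))) .one))
      .skip))

variable {K : Type} [Field K] [LinearOrder K] [IsStrictOrderedRing K] {d κ n : ℕ} {c : CostModel K}
  {g : ℕ → ℕ} {h : K → ℕ} {G b V : ℕ} {L : Segments K d κ} {S : Fin n → Obs K d}
  {ed : ℕ → Edge K} {m : ℕ} {u : ℕ × ℕ → K ×ₗ K}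

def HasValues (ed : ℕ → Edge K) (m : ℕ) (u : ℕ × ℕ → K ×ₗ K) (s : Mem K) : Prop :=
  IsList ed m s ∧ values s = u

theorem localTo_values (u : ℕ × ℕ → K ×ₗ K) : LocalTo [] [6, 7] fun s => values s = u := by
  intro s s' _ h2 h3
  simp only [List.forall_mem_cons] at h2
  rw [← h3]
  funext f
  simp only [values, h2.1, h2.2.1]

theorem localTo_hasValues : LocalTo [20, 21, 22, 23, 24] [9, 6, 7] (HasValues ed m u) :=
  (localTo_isList ed m).and (localTo_values u)

theorem measureSlack_triple (hc : Tame c g h) (hb : 2 ≤ b) (hs : ∀ t < m, h (ed t).wt ≤ 2 * b)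
    (hu : ∀ f, h (ofLex (u f)).1 ≤ V ∧ h (ofLex (u f)).2 ≤ V)
    (hG : 4 * V + 5 * b ≤ G) (hG' : m ≤ G) :
    Triple c g h G (HasValues ed m u) measureSlack (fun s => HasValues ed m u s ∧
      IsLeast (insert 1 (slacks {e | ∃ t < m, e = ed t} u)) (s.num 10 0 0) ∧
      h (s.num 10 0 0) ≤ 4 * V + 5 * b) (1 + (m * (1 + 1) + 2) + 1) := by
  have hin := localTo_hasValues (ed := ed) (m := m) (u := u)
  set W : Set K → ℕ → Mem K → Prop := fun X _ s => IsLeast X (s.num 10 0 0) ∧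
    h (s.num 10 0 0) ≤ 4 * V + 5 * b with hWdef
  set D : ℕ → Set K := fun t => {x | (ed t).wt * (ofLex (u (ed t).dst)).1 <
    (ofLex (u (ed t).src)).1 ∧ x = ((ofLex (u (ed t).src)).1 - (ed t).wt * (ofLex (u (ed t).dst)).1) /
      (1 + (ed t).wt * (ofLex (u (ed t).dst)).1 * (ofLex (u (ed t).dst)).2)} with hD
  refine Triple.seq (Q := fun s => HasValues ed m u s ∧ W {1} 0 s) ?_ ?_
  · refine ((Triple.straight (P := fun _ => True)
      (q := .setNum 10 (.const 0) (.const 0) .one) (Q := W {1} 0) hc trivial ?_).frame hin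
      (by decide)).mono (fun s hs => ⟨hs, trivial⟩) (fun s hs => hs) le_rfl
    rintro s - -
    have := hc.h_one
    refine ⟨this.trans (by omega), ?_⟩
    simp only [hWdef, Prog.res, NExp.eval, RExp.eval, Mem.writeNum, and_self, if_true]
    exact ⟨isLeast_singleton, by omega⟩
  refine (Triple.forUnion hc hin (a := 15) (n := edges) (N := m) (T := 1)
    (by decide) (by decide) hG' W D 0 (fun _ _ _ _ h => h)
    (fun s hs => by simp [NExp.eval, edges, NExp.cell, hs.1.1]) (fun e he X _ _ => ?_) {1} 0
    le_rfl).mono (fun s hs => hs) (fun s hs => ⟨hs.1, ?_⟩) le_rfl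
  · refine Triple.straight hc ⟨trivial, ⟨trivial, trivial, trivial⟩, trivial⟩ ?_
    rintro s - ⟨⟨⟨⟨h1, h2⟩, h3⟩, h4⟩, h5⟩
    have he' := h2 e he
    have hE : (s.nat 21 0 e = (ed e).src.1 ∧ s.nat 22 0 e = (ed e).src.2) ∧
        (s.nat 23 0 e = (ed e).dst.1 ∧ s.nat 24 0 e = (ed e).dst.2) ∧ s.num 9 0 e = (ed e).wt := by
      rw [← he']; simp [edgeAt]
    obtain ⟨⟨hE1, hE2⟩, ⟨hE3, hE4⟩, hE5⟩ := hE
    have hv : ∀ f : ℕ × ℕ, s.num 6 f.1 f.2 = (ofLex (u f)).1 ∧ s.num 7 f.1 f.2 = (ofLex (u f)).2 := by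
      intro f
      rw [← h3]
      exact ⟨rfl, rfl⟩
    set t0 := (ed e).wt * (ofLex (u (ed e).dst)).1 with ht0
    set t1 := ((ofLex (u (ed e).src)).1 - t0) / (1 + t0 * (ofLex (u (ed e).dst)).2) with ht1
    have hD' : D e = {x | t0 < (ofLex (u (ed e).src)).1 ∧ x = t1} := rfl
    -- The numerator has size at most `V + (2b + V)` and the denominator at most `2 + (2b + V) + V`,
    -- where `2 ≤ b`.
    obtain ⟨hs1, hs2⟩ : h t0 ≤ G ∧ h t1 ≤ 4 * V + 5 * b := by
      have : h t0 ≤ _ := hc.h_mul (ed e).wt (ofLex (u (ed e).dst)).1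
      have := hs e he
      have := hu (ed e).dst
      have := hu (ed e).src
      have := hc.h_mul t0 (ofLex (u (ed e).dst)).2
      have := hc.h_add 1 (t0 * (ofLex (u (ed e).dst)).2)
      have := hc.h_one
      have := hc.h_sub (ofLex (u (ed e).src)).1 t0
      have : h t1 ≤ _ := hc.h_div ((ofLex (u (ed e).src)).1 - t0) (1 + t0 * (ofLex (u (ed e).dst)).2)
      omega
    set s1 := s.writeNum 11 0 0 t0 with hs1'
    have e1 : (Prog.setNum 11 (.const 0) (.const 0) (.mul (.row 9 0 E) dstVal)).res s = s1 := by
      simp [Prog.res, NExp.eval, RExp.eval, NExp.row, RExp.row, E, NExp.cell, dstVal, h4, hE3, hE4,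
        hE5, hv, hs1', ht0]
    have e2 : (Test.lt (tmp 0) srcVal).eval s1 ↔ t0 < (ofLex (u (ed e).src)).1 := by
      simp [Test.eval, Test.lt, tmp, srcVal, NExp.eval, RExp.eval, NExp.row, RExp.row, E, NExp.cell,
        hs1', Mem.writeNum, h4, hE1, hE2, hv]
    set s2 := s1.writeNum 11 0 1 t1 with hs2'
    have e3 : (RExp.div (.sub srcVal (tmp 0)) (.add .one (.mul (tmp 0) dstCount))).eval s1 = t1 := by
      simp [NExp.eval, RExp.eval, NExp.row, RExp.row, E, NExp.cell, dstCount, srcVal, tmp, hs1',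
        Mem.writeNum, h4, hE1, hE2, hE3, hE4, hv, ht1]
    have e4 : (Prog.setNum 11 (.const 0) (.const 1) (.div (.sub srcVal (tmp 0))
        (.add .one (.mul (tmp 0) dstCount)))).res s1 = s2 := by
      simp only [Prog.res, e3, NExp.eval, hs2']
    have e5 : (Test.lt (tmp 1) strictness).eval s2 ↔ t1 < s.num 10 0 0 := by
      simp [Test.eval, Test.lt, tmp, strictness, NExp.eval, RExp.eval, RExp.row, hs1', hs2',
        Mem.writeNum]
    have e6 : (tmp 1).eval s2 = t1 := by
      simp [tmp, NExp.eval, RExp.eval, RExp.row, hs2', Mem.writeNum]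
    refine ⟨⟨?_, ?_⟩, ?_⟩
    · have : (RExp.mul (.row 9 0 E) dstVal).eval s = t0 := by
        simp [NExp.eval, RExp.eval, NExp.row, RExp.row, E, NExp.cell, dstVal, h4, hE3, hE4,
          hE5, hv, ht0]
      simpa only [Prog.Safe, this] using hs1
    · rw [e1]
      refine ⟨fun _ => ⟨?_, ?_⟩, fun _ => trivial⟩
      · simp only [Prog.Safe, e3]; exact hs2.trans hG
      · rw [e4]
        refine ⟨fun _ => ?_, fun _ => trivial⟩
        simp only [Prog.Safe, e6]; exact hs2.trans hG
    · rw [Prog.res, e1, Prog.res]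
      by_cases hx : t0 < (ofLex (u (ed e).src)).1
      · rw [if_pos (e2.2 hx), Prog.res, e4, Prog.res, hD']
        simp only [hx, true_and]
        by_cases hy : t1 < s.num 10 0 0
        · simp only [if_pos (e5.2 hy), Prog.res, e6, NExp.eval, hWdef, Mem.writeNum, and_self,
            if_true]
          refine ⟨⟨Or.inr rfl, ?_⟩, hs2⟩
          rintro x (hx | rfl)
          exacts [hy.le.trans (h5.1.2 hx), le_rfl]
        · simp only [if_neg (mt e5.1 hy), Prog.res, hWdef, hs1', hs2', Mem.writeNum]
          refine ⟨⟨Or.inl (by simpa using h5.1.1), ?_⟩, by simpa using h5.2⟩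
          rintro x (hx | rfl)
          exacts [by simpa using h5.1.2 hx, by simpa using hy]
      · rw [if_neg (mt e2.1 hx), Prog.res, hD']
        simpa [hx, hWdef, hs1', Mem.writeNum] using h5
  · have e : insert 1 (slacks {e | ∃ t < m, e = ed t} u) = {1} ∪ {x | ∃ t < m, x ∈ D t} := ?_
    · rw [e]; exact hs.2
    ext x
    simp only [slacks, hD, Set.mem_ofPred_eq, Set.mem_union, Set.mem_insert_iff,
      Set.mem_singleton_iff]
    exact or_congr Iff.rfl ⟨fun ⟨_, ⟨t, ht, rfl⟩, h⟩ => ⟨t, ht, h⟩, fun ⟨t, ht, h⟩ => ⟨_, ⟨t, ht, rfl⟩, h⟩⟩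

open Classical in
theorem output_triple (hc : Tame c g h) (hL : L.Valid) (hb : InputBound h L S b) (hbG : b ≤ G)
    {η : K} (hη : h η ≤ 4 * V + 5 * b) (hu : ∀ f, h (ofLex (u f)).1 ≤ V ∧ h (ofLex (u f)).2 ≤ V)
    (hG : 6 * V + 6 * b ≤ G) :
    Triple c g h G (fun s => (IsInput L S s ∧ values s = u ∧ s.num 10 0 0 = η) ∧
        ∀ f : ℕ × ℕ, s.num 4 f.1 f.2 = 0) output
      (fun s => (IsInput L S s ∧ values s = u ∧ s.num 10 0 0 = η) ∧ ∀ f : ℕ × ℕ, s.num 4 f.1 f.2 =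
        if ∃ j : Fin d, (j : ℕ) = f.1 ∧ f.2 < L.num j then slopeOf u η f else 0)
      (d * ((κ * (1 + 1) + 2) + 1) + 2) := by
  have hb2 := hb.two_le
  have hη' : LocalTo [] [10] fun s : Mem K => s.num 10 0 0 = η := by
    intro s s' _ h2 h3
    simp only [List.forall_mem_cons] at h2
    simpa only [h2.1] using h3
  have hin := (localTo_isInput (L := L) (S := S)).and ((localTo_values u).and hη')
  set W : Set (ℕ × ℕ) → ℕ → Mem K → Prop := fun X _ s => ∀ f : ℕ × ℕ,
    s.num 4 f.1 f.2 = if f ∈ X then slopeOf u η f else 0 with hWdef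
  have key := Triple.forUnion hc hin (a := 10) (n := goods) (N := d) (G := G)
    (q := .forLoop 11 (.row 1 J)
      (.setNum 4 J Seg (.mul (.read 6 J Seg) (.add .one (.mul strictness (.read 7 J Seg))))))
    (T := κ * (1 + 1) + 2) (by decide) (by decide) (hb.goods.trans hbG) W
    (fun j => {f | ∃ j' : Fin d, (j' : ℕ) = j ∧ ∃ k < L.num j', f ∈ ({(j, k)} : Set (ℕ × ℕ))}) 0
    (fun _ _ _ _ h => h)
    (fun s hs => hs.1.goods) (fun j hj X m hm => ?_) ∅ 0 le_rfl
  · refine key.mono (fun s hs => ⟨hs.1, by simpa [hWdef] using hs.2⟩)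
      (fun s hs => ⟨hs.1, fun f => ?_⟩) le_rfl
    refine (hs.2 f).trans (ite_eq_ite_of_iff ?_)
    obtain ⟨j, k⟩ := f
    simp only [Set.empty_union, Set.mem_ofPred_eq, Set.mem_singleton_iff, Prod.mk.injEq]
    constructor
    · rintro ⟨i, -, j', rfl, k', h1, rfl, rfl⟩
      exact ⟨j', rfl, h1⟩
    · rintro ⟨j', rfl, h1⟩
      exact ⟨j', j'.2, j', rfl, k, h1, rfl, rfl⟩
  obtain ⟨j, rfl⟩ : ∃ j' : Fin d, (j' : ℕ) = j := ⟨⟨j, hj⟩, rfl⟩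
  refine (Triple.forUnion hc (hin.counter 10 j) (a := 11) (n := .row 1 J) (N := L.num j) (T := 1)
    (by decide) (by decide) (((hL.1 j).2.trans hb.maxSegs).trans hbG) W (fun k => {((j : ℕ), k)}) 0
    (fun _ _ _ _ h => h) (fun s hs => ?_) (fun k hk X m _ => ?_) X m (M := m) (by simp)).mono
    (fun s hs => hs) (fun s hs f => (hs.2 f).trans (ite_eq_ite_of_iff ?_)) ?_
  · simp [NExp.row, NExp.eval, J, NExp.cell, hs.2, hs.1.1.num]
  · refine Triple.straight hc trivial ?_
    rintro s - ⟨⟨⟨⟨h1, h2, h3⟩, h4⟩, h5⟩, h6⟩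
    have e : (RExp.mul (.read 6 J Seg) (.add .one (.mul strictness (.read 7 J Seg)))).eval s =
        slopeOf u η (j, k) := by
      simp [strictness, NExp.eval, RExp.eval, RExp.row, J, Seg, NExp.cell, h4, h5, h3, slopeOf, ← h2,
        values]
    refine ⟨?_, fun f => ?_⟩
    · simp only [Prog.Safe, e, slopeOf]
      have := hc.h_mul η (ofLex (u (j, k))).2
      have := hc.h_add 1 (η * (ofLex (u (j, k))).2)
      have := hc.h_one
      have := hc.h_mul (ofLex (u (j, k))).1 (1 + η * (ofLex (u (j, k))).2)
      have := hu (j, k)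
      omega
    · obtain ⟨j', k'⟩ := f
      have := h6 (j', k')
      simp only at this
      simp only [Prog.res, e]
      by_cases h7 : j' = j ∧ k' = k
      · simp [NExp.eval, J, Seg, NExp.cell, h4, h5, Mem.writeNum, h7]
      · simp [NExp.eval, J, Seg, NExp.cell, h4, h5, Mem.writeNum, h7, this]
  · simp [Fin.val_inj]
  · have := (hL.1 j).2
    nlinarith

/-- The slopes of every good are strictly decreasing. -/
def IsDecreasing (L : Segments K d κ) (a : ℕ × ℕ → K) : Prop :=
  ∀ (j : Fin d) (k : ℕ), k + 1 < L.num j → a (j, k + 1) < a (j, k)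

/-- A sample that no buyer has produced may lead to slopes that do not decrease, while the learner
has to stay in the class. From the last segment backwards, an offending slope is replaced by the
next one plus one. Tables that decrease already are not touched. -/
theorem repair_triple (hc : Tame c g h) (hL : L.Valid) (hb : InputBound h L S b) (hbG : b ≤ G)
    {a : ℕ × ℕ → K} (ha : ∀ f, 0 ≤ a f) (has : ∀ f, h (a f) ≤ V) (hG : V + 2 * b ≤ G) :
    Triple c g h G (fun s => IsInput L S s ∧ ∀ f : ℕ × ℕ, s.num 4 f.1 f.2 = a f) repair
      (fun s => IsInput L S s ∧ IsDecreasing L (fun f => s.num 4 f.1 f.2) ∧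
        (∀ f : ℕ × ℕ, 0 ≤ s.num 4 f.1 f.2) ∧
        (IsDecreasing L a → ∀ f : ℕ × ℕ, s.num 4 f.1 f.2 = a f))
      (d * ((κ * (1 + 1) + 2) + 1) + 2) := by
  have hb2 := hb.two_le
  have hin := localTo_isInput (L := L) (S := S)
  set W : ℕ → Mem K → Prop := fun j s =>
    (∀ j' : Fin d, (j' : ℕ) < j → ∀ k, k + 1 < L.num j' → s.num 4 j' (k + 1) < s.num 4 j' k) ∧
    (∀ f : ℕ × ℕ, 0 ≤ s.num 4 f.1 f.2) ∧ (∀ j' k, j ≤ j' → h (s.num 4 j' k) ≤ V) ∧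
    (IsDecreasing L a → ∀ f : ℕ × ℕ, s.num 4 f.1 f.2 = a f) with hW
  have key := Triple.forLoopIn hc hin (a := 10) (n := goods) (N := d) (G := G)
    (q := .forLoop 11 (.sub (.row 1 J) (.const 1))
    (.ite (.rle (.read 4 J (.sub (.row 1 J) (.add Seg (.const 2))))
        (.read 4 J (.sub (.row 1 J) (.add Seg (.const 1)))))
      (.setNum 4 J (.sub (.row 1 J) (.add Seg (.const 2)))
        (.add (.read 4 J (.sub (.row 1 J) (.add Seg (.const 1)))) .one))
      .skip)) (T := κ * (1 + 1) + 2) (by decide) (by decide) (hb.goods.trans hbG) W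
    (fun _ _ _ h => h) (fun s hs => hs.goods) (fun j hj => ?_)
  · refine key.mono (fun s hs => ⟨hs.1, fun j' hj' => absurd hj' (Nat.not_lt_zero _), fun f => ?_,
      fun j' k _ => ?_, fun _ => hs.2⟩)
      (fun s hs => ⟨hs.1, fun j => hs.2.1 j j.2, hs.2.2.1, hs.2.2.2.2⟩) le_rfl
    · rw [hs.2]; exact ha f
    · have := hs.2 (j', k)
      simp only at this
      rw [this]; exact has _
  obtain ⟨j, rfl⟩ : ∃ j' : Fin d, (j' : ℕ) = j := ⟨⟨j, hj⟩, rfl⟩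
  have hj1 := hL.1 j
  have hκ := hb.maxSegs
  -- Pass `c` compares the segments `num - c - 2` and `num - c - 1`, so before it the slopes
  -- decrease from segment `num - c - 1` on. Each pass adds at most two to the sizes.
  set W' : ℕ → Mem K → Prop := fun c s =>
    (∀ j' : Fin d, (j' : ℕ) < j → ∀ k, k + 1 < L.num j' → s.num 4 j' (k + 1) < s.num 4 j' k) ∧
    (∀ k, L.num j ≤ k + (c + 1) → k + 1 < L.num j → s.num 4 j (k + 1) < s.num 4 j k) ∧
    (∀ f : ℕ × ℕ, 0 ≤ s.num 4 f.1 f.2) ∧ (∀ j' k, (j : ℕ) + 1 ≤ j' → h (s.num 4 j' k) ≤ V) ∧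
    (∀ k, h (s.num 4 j k) ≤ V + 2 * c) ∧
    (IsDecreasing L a → ∀ f : ℕ × ℕ, s.num 4 f.1 f.2 = a f) with hW'
  refine (Triple.forLoopIn hc (hin.counter 10 j) (a := 11) (N := L.num j - 1) (T := 1)
    (by decide) (by decide) (by omega) W' (fun _ _ _ h => h) (fun s hs => ?_) (fun c hc' => ?_)).mono
    (fun s hs => ⟨hs.1, hs.2.1, fun k h1 h2 => by omega, hs.2.2.1,
      fun j' k hj' => hs.2.2.2.1 j' k (by omega), fun k => hs.2.2.2.1 j k le_rfl, hs.2.2.2.2⟩)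
    (fun s hs => ⟨fun j' hj' k hk => ?_, hs.2.2.2.1, hs.2.2.2.2.1, hs.2.2.2.2.2.2⟩) ?_
  · simp [NExp.row, NExp.eval, J, NExp.cell, hs.2, hs.1.num]
  · refine Triple.straight hc ⟨trivial, trivial⟩ ?_
    rintro s - ⟨⟨⟨h1, h2⟩, h3⟩, h4, h5, h6, h7, h8, h9⟩
    obtain ⟨k, hk⟩ : ∃ k, k + (c + 2) = L.num j := ⟨L.num j - (c + 2), by omega⟩
    have ek : L.num j - (c + 2) = k := by omega
    have ek' : L.num j - (c + 1) = k + 1 := by omega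
    have e1 : (Test.rle (.read 4 J (.sub (.row 1 J) (.add Seg (.const 2))))
        (.read 4 J (.sub (.row 1 J) (.add Seg (.const 1))))).eval s ↔
        s.num 4 j k ≤ s.num 4 j (k + 1) := by
      simp [Test.eval, NExp.eval, RExp.eval, NExp.row, J, Seg, NExp.cell, h2, h3, h1.num, ek, ek']
    have e2 : (RExp.add (.read 4 J (.sub (.row 1 J) (.add Seg (.const 1)))) .one).eval s =
        s.num 4 j (k + 1) + 1 := by
      simp [NExp.eval, RExp.eval, NExp.row, J, Seg, NExp.cell, h2, h3, h1.num, ek']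
    have e3 : (Prog.setNum 4 J (.sub (.row 1 J) (.add Seg (.const 2)))
        (.add (.read 4 J (.sub (.row 1 J) (.add Seg (.const 1)))) .one)).res s =
        s.writeNum 4 j k (s.num 4 j (k + 1) + 1) := by
      rw [Prog.res, e2]
      simp [NExp.eval, NExp.row, J, Seg, NExp.cell, h2, h3, h1.num, ek]
    have hsz : h (s.num 4 j (k + 1) + 1) ≤ V + 2 * (c + 1) := by
      have := hc.h_add (s.num 4 j (k + 1)) 1
      have := hc.h_one
      have := h8 (k + 1)
      omega
    refine ⟨⟨fun _ => ?_, fun _ => trivial⟩, ?_⟩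
    · rw [Prog.Safe, e2]
      exact hsz.trans (by omega)
    · by_cases hx : s.num 4 j k ≤ s.num 4 j (k + 1)
      · simp only [Prog.res.eq_5, if_pos (e1.2 hx), e3]
        refine ⟨fun j' hj' k' hk' => ?_, fun k' hk' hk'' => ?_, fun f => ?_, fun j' k' hj' => ?_,
          fun k' => ?_, fun hdec => ?_⟩
        · have : (j' : ℕ) ≠ j := by omega
          simpa [Mem.writeNum, this] using h4 j' hj' k' hk'
        · by_cases hkk : k' = k
          · subst hkk
            simp [Mem.writeNum]
          · have : k' + 1 ≠ k := by omega
            simpa [Mem.writeNum, this, hkk] using h5 k' (by omega) hk''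
        · simp only [Mem.writeNum]
          split_ifs
          exacts [add_nonneg (h6 (j, k + 1)) zero_le_one, h6 f]
        · have : j' ≠ j := by omega
          simpa [Mem.writeNum, this] using h7 j' k' hj'
        · simp only [Mem.writeNum]
          split_ifs
          exacts [hsz, (h8 k').trans (by omega)]
        · have h10 := hdec j k (by omega)
          have h11 := h9 hdec (j, k)
          have h12 := h9 hdec (j, k + 1)
          simp only at h11 h12
          rw [← h11, ← h12] at h10
          exact absurd hx (not_le.2 h10)
      · simp only [Prog.res, if_neg (mt e1.1 hx)]
        refine ⟨h4, fun k' hk' hk'' => ?_, h6, h7, fun k' => (h8 k').trans (by omega), h9⟩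
        by_cases hkk : k' = k
        · subst hkk; exact not_le.1 hx
        · exact h5 k' (by omega) hk''
  · rcases Nat.lt_succ_iff_lt_or_eq.1 hj' with h1 | h1
    · exact hs.2.1 j' h1 k hk
    · obtain rfl : j' = j := Fin.ext h1
      exact hs.2.2.1 k (by omega) hk
  · have : (L.num j - 1) * (1 + 1) ≤ κ * (1 + 1) := Nat.mul_le_mul_right _ (by omega)
    omega

end LearnerProgram

theorem localTo_nat {K : Type} [Field K] [LinearOrder K] (a : ℕ) (p : (ℕ → ℕ → ℕ) → Prop) :
    LocalTo [a] [] fun s : Mem K => p (s.nat a) := by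
  intro s s' h1 _ h3
  simp only [List.forall_mem_cons] at h1
  rwa [h1.1]

theorem localTo_num {K : Type} [Field K] [LinearOrder K] (a : ℕ) (p : (ℕ → ℕ → K) → Prop) :
    LocalTo [] [a] fun s : Mem K => p (s.num a) := by
  intro s s' _ h2 h3
  simp only [List.forall_mem_cons] at h2
  rwa [h2.1]

/-- This admits specifications that refer to objects computed at run time, like the least solution.
-/
theorem Triple.exists {K : Type} [Field K] [LinearOrder K] {c : CostModel K} {g : ℕ → ℕ}
    {h : K → ℕ} {G T : ℕ} {q : Prog} {Q : Mem K → Prop} {α : Sort*} {P : α → Mem K → Prop}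
    (ht : ∀ x, Triple c g h G (P x) q Q T) : Triple c g h G (fun s => ∃ x, P x s) q Q T :=
  fun s hs ⟨x, hx⟩ => ht x s hs hx

/-! ### The whole program of the learner -/

namespace LearnerProgram

/-- Store the inequalities that a sample implies. -/
def prepare : Prog :=
  .seq starts (.seq locate (.seq costs (.seq ones (.seq zeros (.seq chains observations)))))

/-- Choose slopes that satisfy the inequalities. -/
def fit : Prog := .seq solve (.seq measureSlack (.seq output repair))

/-- All dimensions are replaced by the common bound `b`, so that the time is a polynomial in a
single variable. -/
def prepareTime (b : ℕ) : ℕ :=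
  (b * (1 + (b * (1 + 1) + 2) + 1 + 1) + 2) +
  ((b * ((b * ((1 + (b * (1 + 1) + 2) + 1) + 1) + 2) + 1) + 2) +
  ((b * (1 + (b * (1 + 1) + 2) + 1 + 1) + 2) +
  ((b * ((b * (1 + 1) + 2) + 1) + 2) + ((b * ((b * (1 + 1) + 2) + 1) + 2) +
  ((b * ((b * (1 + 1) + 2) + 1) + 2) +
  (b * ((b * ((b * (1 + 1) + 2) + 1) + 2) + 1) + 2) + 1) + 1) + 1) + 1) + 1) + 1

/-- A bound for the number of inequalities. -/
def edgeBound (b : ℕ) : ℕ := b * b + b * (b * b)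

/-- A bound for the sizes of the values of the least solution. -/
def valueBound (b : ℕ) : ℕ := b + (edgeBound b + 1) * edgeBound b * (2 * b)

def memoryBound (b : ℕ) : ℕ := 6 * valueBound b + 8 * b + b * (2 * b) + edgeBound b + 3

def fitTime (b : ℕ) : ℕ :=
  ((edgeBound b + 1) * ((edgeBound b * (1 + 1) + 2) + 1) + 2) +
  ((1 + (edgeBound b * (1 + 1) + 2) + 1) + ((b * ((b * (1 + 1) + 2) + 1) + 2) +
  (b * ((b * (1 + 1) + 2) + 1) + 2) + 1) + 1) + 1

variable {K : Type} [Field K] [LinearOrder K] {d κ n : ℕ} {c : CostModel K}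
  {g : ℕ → ℕ} {h : K → ℕ} {b : ℕ} {L : Segments K d κ} {S : Fin n → Obs K d}

theorem InputBound.edges_le (hb : InputBound h L S b) : d * κ + n * (d * d) ≤ edgeBound b := by
  have := hb.goods
  have := hb.maxSegs
  have := hb.sampleSize
  unfold edgeBound
  gcongr

def IsPrepared (L : Segments K d κ) (S : Fin n → Obs K d) (s : Mem K) : Prop :=
  (IsInput L S s ∧ ∀ f : ℕ × ℕ, s.num 4 f.1 f.2 = 0) ∧ values s = startValue L S ∧
    HasEdges (edgeSet L S) (d * κ + n * (d * d)) s

def IsBlank (s : Mem K) : Prop :=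
  (∀ f : ℕ × ℕ, s.num 4 f.1 f.2 = 0) ∧ ∀ f : ℕ × ℕ, s.num 7 f.1 f.2 = 0

theorem localTo_isBlank : LocalTo [] [4, 7] (IsBlank (K := K)) :=
  (localTo_num 4 fun a => ∀ f : ℕ × ℕ, a f.1 f.2 = 0).and
    (localTo_num 7 fun a => ∀ f : ℕ × ℕ, a f.1 f.2 = 0)

open Classical in
theorem prepare_triple (hc : Tame c g h) (hL : L.Valid) (hb : InputBound h L S b) :
    Triple c g h (memoryBound b) (fun s => IsInput L S s ∧ IsBlank s ∧ s.nat 20 0 0 = 0 ∧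
      ∀ f : ℕ × ℕ, s.num 6 f.1 f.2 = 0) prepare (IsPrepared L S) (prepareTime b) := by
  have hd := hb.goods
  have hκ := hb.maxSegs
  have hn := hb.sampleSize
  have hb2 := hb.two_le
  have hbb : b * (2 * b) = 2 * (b * b) := by ring
  have hM := hb.edges_le
  have hM' : d * κ ≤ edgeBound b := (Nat.le_add_right _ _).trans hM
  have hG : memoryBound b = 6 * valueBound b + 8 * b + b * (2 * b) + edgeBound b + 3 := rfl
  have hZ : LocalTo [20] [4, 7, 6] fun s : Mem K => IsBlank s ∧ s.nat 20 0 0 = 0 ∧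
      ∀ f : ℕ × ℕ, s.num 6 f.1 f.2 = 0 :=
    localTo_isBlank.and ((localTo_nat 20 fun a => a 0 0 = 0).and
      (localTo_num 6 fun a => ∀ f : ℕ × ℕ, a f.1 f.2 = 0))
  have hV : LocalTo [] [6] fun s : Mem K => ∀ f : ℕ × ℕ, s.num 6 f.1 f.2 =
      (ofLex (startValue L S f)).1 := localTo_num 6 fun a => ∀ f : ℕ × ℕ, a f.1 f.2 =
      (ofLex (startValue L S f)).1
  have hN : LocalTo [20] [] fun s : Mem K => s.nat 20 0 0 = 0 := localTo_nat 20 fun a => a 0 0 = 0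
  refine Triple.seq (Q := fun s => (IsBlank s ∧ s.nat 20 0 0 = 0 ∧
    ∀ f : ℕ × ℕ, s.num 6 f.1 f.2 = 0) ∧ IsInput L S s ∧ HasStarts L s) ?_
    (Triple.seq (Q := fun s => (IsBlank s ∧ s.nat 20 0 0 = 0 ∧ ∀ f : ℕ × ℕ, s.num 6 f.1 f.2 = 0) ∧
      IsInput L S s ∧ IsLocated L S s) ?_
    (Triple.seq (Q := fun s => (IsBlank s ∧ s.nat 20 0 0 = 0 ∧ ∀ f : ℕ × ℕ, s.num 6 f.1 f.2 = 0) ∧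
      IsScanned L S s) ?_
    (Triple.seq (Q := fun s => (IsBlank s ∧ s.nat 20 0 0 = 0) ∧ IsScanned L S s ∧
      ∀ f : ℕ × ℕ, s.num 6 f.1 f.2 = if f.1 < d ∧ f.2 < κ then 1 else 0) ?_
    (Triple.seq (Q := fun s => (IsBlank s ∧ s.nat 20 0 0 = 0) ∧ IsScanned L S s ∧
      ∀ f : ℕ × ℕ, s.num 6 f.1 f.2 = (ofLex (startValue L S f)).1) ?_
    (Triple.seq (Q := fun s => (IsBlank s ∧ ∀ f : ℕ × ℕ, s.num 6 f.1 f.2 =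
      (ofLex (startValue L S f)).1) ∧ IsScanned L S s ∧ HasEdges (chainEdges L) (d * κ) s)
      ?_ ?_)))))
  · refine ((starts_triple hc hb (by omega)).frame hZ (by decide)).mono
      (fun s hs => ⟨hs.2, hs.1⟩) (fun s hs => hs) ?_
    gcongr
  · refine ((locate_triple hc hL hb (by omega)).frame hZ (by decide)).mono
      (fun s hs => hs) (fun s hs => ⟨hs.1, hs.2.1.1, hs.2.2⟩) ?_
    gcongr
  · refine ((costs_triple hc hb (by omega)).frame (hZ.and (localTo_isLocated (L := L) (S := S)))
      (by decide)).mono (fun s hs => ⟨⟨hs.1, hs.2.2⟩, hs.2.1⟩)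
      (fun s hs => ⟨hs.1.1, hs.2.1, hs.1.2, hs.2.2⟩) ?_
    gcongr
  · refine ((ones_triple hc hb (by omega)).frame ((localTo_isBlank.and hN).and
      ((localTo_isLocated (L := L) (S := S)).and (localTo_hasCosts (S := S)))) (by decide)).mono
      (fun s hs => ⟨⟨⟨hs.1.1, hs.1.2.1⟩, hs.2.2⟩, hs.2.1, hs.1.2.2⟩)
      (fun s hs => ⟨hs.1.1, ⟨hs.2.1, hs.1.2⟩, hs.2.2⟩) ?_
    gcongr
  · refine ((zeros_triple hc hb (by omega)).frame (localTo_isBlank.and hN) (by decide)).mono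
      (fun s hs => hs) (fun s hs => hs) ?_
    gcongr
  · refine ((chains_triple hc hL hb (by omega) (by omega)).frame ((localTo_isBlank.and hV).and
      ((localTo_isLocated (L := L) (S := S)).and (localTo_hasCosts (S := S)))) (by decide)).mono
      (fun s hs => ⟨⟨⟨hs.1.1, hs.2.2⟩, hs.2.1.2⟩, hs.2.1.1, ?_⟩)
      (fun s hs => ⟨hs.1.1, ⟨hs.2.1, hs.1.2⟩, hs.2.2⟩) ?_
    · have := hs.1.2
      exact ⟨this.le, by simp [this]⟩
    · gcongr
  · refine ((observations_triple hc hL hb (by omega) (by omega)).frame (localTo_isBlank.and hV)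
      (by decide)).mono (fun s hs => hs)
      (fun s hs => ⟨⟨hs.2.1.1, hs.1.1.1⟩, funext fun f => ?_, hs.2.2⟩) ?_
    · simp only [values, hs.1.1.2, hs.1.2]
      rfl
    · gcongr

variable [IsStrictOrderedRing K]

/-- The inequalities have a strict solution that respects the initial bounds. -/
def IsSolvable (E : Set (Edge K)) (u₀ : ℕ × ℕ → K ×ₗ K) : Prop :=
  ∃ a : ℕ × ℕ → K, ∀ e ∈ E, 0 < (ofLex (u₀ e.src)).1 ∧ 0 < a e.src ∧ e.wt * a e.dst < a e.src

open Classical in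
noncomputable def slopeTable (L : Segments K d κ) (u : ℕ × ℕ → K ×ₗ K) (η : K) (f : ℕ × ℕ) : K :=
  if ∃ j : Fin d, (j : ℕ) = f.1 ∧ f.2 < L.num j then slopeOf u η f else 0

/-- What the program achieves. -/
def IsResult (L : Segments K d κ) (S : Fin n → Obs K d) (a : ℕ × ℕ → K) : Prop :=
  (IsDecreasing L a ∧ ∀ f, 0 ≤ a f) ∧ ∃ u η,
    (IsSolvable (edgeSet L S) (startValue L S) → IsTightSolution (edgeSet L S) (startValue L S) u) ∧
    IsLeast (insert 1 (slacks (edgeSet L S) u)) η ∧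
    (IsDecreasing L (slopeTable L u η) → a = slopeTable L u η)

/-- If the system is solvable then `rounds` has become a solution after `m + 1` rounds. The table
lies between it and every solution, so both agree and are least. -/
theorem IsRelaxed.isTightSolution {ed : ℕ → Edge K} {m : ℕ} {u₀ u : ℕ × ℕ → K ×ₗ K} {E : Set (Edge K)}
    (hE : {e | ∃ t < m, e = ed t} = E) (hw : ∀ t < m, 0 < (ed t).wt)
    (hu : IsRelaxed h b ed m u₀ (m + 1) 0 u) (hs : IsSolvable E u₀) : IsTightSolution E u₀ u := by
  obtain ⟨a, ha⟩ := hs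
  have hmem : ∀ t < m, ed t ∈ E := fun t ht => hE ▸ ⟨t, ht, rfl⟩
  have h0 : ∀ f, u₀ f ≤ rounds ed m u₀ (m + 1) f := fun f => rounds_mono (Nat.zero_le _) f
  have hcl : ∀ t < m, (ed t).act (rounds ed m u₀ (m + 1) (ed t).dst) ≤
      rounds ed m u₀ (m + 1) (ed t).src := fun t ht =>
    act_rounds_le hw (fun t ht => (ha _ (hmem t ht)).1) (fun t ht => (ha _ (hmem t ht)).2.1)
      (fun t ht => (ha _ (hmem t ht)).2.2) ht
  have heq : u = rounds ed m u₀ (m + 1) := funext fun f =>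
    le_antisymm (hu.le _ h0 hcl f) (hu.rounds_le f)
  refine isTightSolution_of_isLeast hw (heq ▸ h0) (heq ▸ hcl) (fun w h1 h2 f => hu.le w h1 h2 f)
    hu.nonneg fun e => ?_
  rw [← hE]
  rfl

theorem fit_triple (hc : Tame c g h) (hL : L.Valid) (hb : InputBound h L S b) :
    Triple c g h (memoryBound b) (IsPrepared L S) fit
      (fun s => IsResult L S fun f => s.num 4 f.1 f.2) (fitTime b) := by
  have hd := hb.goods
  have hκ := hb.maxSegs
  have hn := hb.sampleSize
  have hb2 := hb.two_le
  have hM := hb.edges_le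
  have hG : memoryBound b = 6 * valueBound b + 8 * b + b * (2 * b) + edgeBound b + 3 := rfl
  have hin := localTo_isInput (L := L) (S := S)
  have h4 : LocalTo [] [4] fun s : Mem K => ∀ f : ℕ × ℕ, s.num 4 f.1 f.2 = 0 :=
    localTo_num 4 fun a => ∀ f : ℕ × ℕ, a f.1 f.2 = 0
  -- The order of the inequalities, possibly with repetitions, is read off from the memory; the
  -- result does not refer to it.
  suffices key : ∀ (ed : ℕ → Edge K) (m : ℕ), {e | ∃ t < m, e = ed t} = edgeSet L S →
      m ≤ edgeBound b → Triple c g h (memoryBound b) (fun s => (IsInput L S s ∧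
        ∀ f : ℕ × ℕ, s.num 4 f.1 f.2 = 0) ∧ IsList ed m s ∧ values s = startValue L S) fit
        (fun s => IsResult L S fun f => s.num 4 f.1 f.2) (fitTime b) by
    intro s hs hp
    exact key (edgeAt s) (s.nat 20 0 0) hp.2.2.2 (hp.2.2.1.trans hM) s hs
      ⟨hp.1, ⟨rfl, fun _ _ => rfl⟩, hp.2.1⟩
  intro ed m hE hm
  have hmem : ∀ t < m, ed t ∈ edgeSet L S := fun t ht => hE ▸ ⟨t, ht, rfl⟩
  have hw : ∀ t < m, 0 < (ed t).wt := fun t ht => edgeSet_pos (hmem t ht)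
  have hs : ∀ t < m, h (ed t).wt ≤ 2 * b := by
    intro t ht
    rcases hmem t ht with ⟨j, k, -, he⟩ | he
    · rw [he]; exact hc.h_one.trans (by omega)
    · obtain ⟨i, j, j', -, he⟩ := Set.mem_iUnion.1 he
      rw [he]
      have := hc.h_div ((S i).price j) ((S i).price j')
      have := hb.price i j
      have := hb.price i j'
      simp only [obsEdge]
      omega
  have hV : b + (m + 1) * m * (2 * b) ≤ valueBound b := by unfold valueBound; gcongr
  have hstart : ∀ f, (h (ofLex (startValue L S f)).1 ≤ b ∧ h (ofLex (startValue L S f)).2 ≤ b) ∧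
      0 ≤ (ofLex (startValue L S f)).1 ∧ 0 ≤ (ofLex (startValue L S f)).2 := by
    intro f
    have := hc.h_one
    have := hc.h_zero
    simp only [startValue, ofLex_toLex]
    split_ifs
    exacts [⟨⟨by omega, by omega⟩, zero_le_one, le_rfl⟩, ⟨⟨by omega, by omega⟩, le_rfl, le_rfl⟩]
  refine Triple.seq (Q := fun s => ∃ u : {u // IsRelaxed h b ed m (startValue L S) (m + 1) 0 u},
    (IsInput L S s ∧ ∀ f : ℕ × ℕ, s.num 4 f.1 f.2 = 0) ∧ HasValues ed m u.1 s) ?_ (Triple.exists ?_)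
  · refine ((solve_triple (u₀ := startValue L S) hc hb2 hw hs (by omega) (by omega)).frame
      (hin.and h4) (by decide)).mono (fun s hs => ⟨hs.1, hs.2.1, ?_⟩)
      (fun s hs => ⟨⟨values s, hs.2.2⟩, hs.1, hs.2.1, rfl⟩) ?_
    · rw [hs.2.2]
      refine ⟨fun f => le_rfl, fun t ht => absurd ht (Nat.not_lt_zero t), fun w h0 _ => h0,
        fun f => (hstart f).2.2, fun f => ?_, fun f => ?_⟩
      · exact (hstart f).1.1.trans (Nat.le_add_right _ _)
      · exact (hstart f).1.2.trans (Nat.le_add_right _ _)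
    · gcongr
  rintro ⟨u, hu⟩
  have huV : ∀ f, h (ofLex (u f)).1 ≤ valueBound b ∧ h (ofLex (u f)).2 ≤ valueBound b :=
    fun f => ⟨(hu.size_fst f).trans hV, (hu.size_snd f).trans hV⟩
  refine Triple.seq (Q := fun s => ∃ η : {η // IsLeast (insert 1 (slacks (edgeSet L S) u)) η ∧
    h η ≤ 4 * valueBound b + 5 * b}, (IsInput L S s ∧ values s = u ∧ s.num 10 0 0 = η.1) ∧
      ∀ f : ℕ × ℕ, s.num 4 f.1 f.2 = 0) ?_ (Triple.exists ?_)
  · refine ((measureSlack_triple hc hb2 hs huV (by omega) (by omega)).frame (hin.and h4)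
      (by decide)).mono (fun s hs => hs)
      (fun s hs => ⟨⟨_, hE ▸ hs.2.2.1, hs.2.2.2⟩, ⟨hs.1.1, hs.2.1.2, rfl⟩, hs.1.2⟩) ?_
    gcongr
  rintro ⟨η, hη, hηV⟩
  have hr : ∀ f, startValue L S f ≤ rounds ed m (startValue L S) (m + 1) f :=
    fun f => rounds_mono (ed := ed) (m := m) (u₀ := startValue L S) (Nat.zero_le (m + 1)) f
  have hu0 : ∀ f, 0 ≤ (ofLex (u f)).1 := fun f => (hstart f).2.1.trans
    (fst_le_of_lex_le ((hr f).trans (hu.rounds_le f)))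
  have hη0 : 0 ≤ η := by
    rcases hη.1 with rfl | ⟨e, he, h1, rfl⟩
    · exact zero_le_one
    · exact div_nonneg (sub_nonneg.2 h1.le) (add_nonneg zero_le_one
        (mul_nonneg (mul_nonneg (edgeSet_pos he).le (hu0 _)) (hu.nonneg _)))
  have htable : ∀ f, 0 ≤ slopeTable L u η f ∧
      h (slopeTable L u η f) ≤ 6 * valueBound b + 6 * b := by
    intro f
    unfold slopeTable
    split_ifs
    · refine ⟨mul_nonneg (hu0 f) (add_nonneg zero_le_one (mul_nonneg hη0 (hu.nonneg f))), ?_⟩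
      have := hc.h_mul η (ofLex (u f)).2
      have := hc.h_add 1 (η * (ofLex (u f)).2)
      have := hc.h_one
      have := hc.h_mul (ofLex (u f)).1 (1 + η * (ofLex (u f)).2)
      have := huV f
      unfold slopeOf
      omega
    · exact ⟨le_rfl, hc.h_zero.trans (by omega)⟩
  refine (Triple.seq ((output_triple hc hL hb (by omega) hηV huV (by omega)).mono
    (T' := b * ((b * (1 + 1) + 2) + 1) + 2) (fun s hs => hs) (fun s hs => ⟨hs.1.1, hs.2⟩) (by gcongr))
    ((repair_triple hc hL hb (by omega) (fun f => (htable f).1) (fun f => (htable f).2)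
      (by omega)).mono (T' := b * ((b * (1 + 1) + 2) + 1) + 2) (fun s hs => hs)
      (fun s hs => hs.2) (by gcongr))).mono (fun s hs => hs) (fun s hs => ?_) le_rfl
  refine ⟨⟨hs.1, hs.2.1⟩, u, η, fun h => hu.isTightSolution hE hw h, hη, fun h => ?_⟩
  exact funext (hs.2.2 h)

def learn : Prog := .seq prepare fit

def learnTime (b : ℕ) : ℕ := (prepareTime b + fitTime b + 1) * (learn.wt * (memoryBound b + 1))

theorem exec_learn (hc : Tame c g h) (hL : L.Valid) (hb : InputBound h L S b) :
    ∃ s t, Exec c learn (learnInput L S) s t ∧ t ≤ learnTime b ∧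
      IsResult L S fun f => s.num 4 f.1 f.2 := by
  have hb2 := hb.two_le
  have hG : memoryBound b = 6 * valueBound b + 8 * b + b * (2 * b) + edgeBound b + 3 := rfl
  have hbdd : Bdd g h (memoryBound b) (learnInput L S) := by
    have key : ∀ a i j, (learnInput L S).nat a i j ≤ b := by
      intro a i j
      simp only [learnInput]
      split
      · split_ifs
        exacts [hb.goods, hb.maxSegs, hb.sampleSize, Nat.zero_le _]
      · simp only [padVec]
        split_ifs
        exacts [((hL.1 _).2).trans hb.maxSegs, Nat.zero_le _]
      · exact Nat.zero_le _
    have key' : ∀ a i j, h ((learnInput L S).num a i j) ≤ b := by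
      intro a i j
      have h0 : h 0 ≤ b := hc.h_zero.trans hb2
      simp only [learnInput]
      split <;> (try simp only [padMat, padVec]) <;> (try split_ifs) <;>
        first | exact h0 | exact hb.len _ _ | exact hb.price _ _ | exact hb.budget _ |
          exact hb.bundle _ _
    exact ⟨fun a i j => (hc.g_le _).trans ((key a i j).trans (by omega)),
      fun a i j => (key' a i j).trans (by omega)⟩
  obtain ⟨s, t, h1, -, h3, h4⟩ := ((prepare_triple hc hL hb).seq (fit_triple hc hL hb)) _ hbdd
    ⟨isInput_learnInput, ⟨fun _ => rfl, fun _ => rfl⟩, rfl, fun _ => rfl⟩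
  exact ⟨s, t, h1, h4, h3⟩

end LearnerProgram

/-! ## The learner as a function -/

section Polynomials

def IsPolynomial (f : ℕ → ℕ) : Prop := ∃ q : Polynomial ℕ, ∀ x, q.eval x = f x

theorem IsPolynomial.const (a : ℕ) : IsPolynomial fun _ => a := ⟨.C a, by simp⟩

theorem IsPolynomial.id : IsPolynomial fun x => x := ⟨.X, by simp⟩

theorem IsPolynomial.add {f g : ℕ → ℕ} (hf : IsPolynomial f) (hg : IsPolynomial g) :
    IsPolynomial fun x => f x + g x := by
  obtain ⟨p, hp⟩ := hf
  obtain ⟨q, hq⟩ := hg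
  exact ⟨p + q, by simp [hp, hq]⟩

theorem IsPolynomial.mul {f g : ℕ → ℕ} (hf : IsPolynomial f) (hg : IsPolynomial g) :
    IsPolynomial fun x => f x * g x := by
  obtain ⟨p, hp⟩ := hf
  obtain ⟨q, hq⟩ := hg
  exact ⟨p * q, by simp [hp, hq]⟩

theorem IsPolynomial.comp {f g : ℕ → ℕ} (hf : IsPolynomial f) (hg : IsPolynomial g) :
    IsPolynomial fun x => f (g x) := by
  obtain ⟨p, hp⟩ := hf
  obtain ⟨q, hq⟩ := hg
  exact ⟨p.comp q, by simp [hp, hq]⟩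

end Polynomials

namespace LearnerProgram

theorem isPolynomial_learnTime : IsPolynomial learnTime := by
  have hE : IsPolynomial edgeBound := by
    unfold edgeBound
    repeat' with_reducible first
      | exact .const _ | exact .id | refine IsPolynomial.add ?_ ?_ | refine IsPolynomial.mul ?_ ?_
  have hV : IsPolynomial valueBound := by
    unfold valueBound
    repeat' with_reducible first
      | exact .const _ | exact .id | exact hE | refine IsPolynomial.add ?_ ?_
      | refine IsPolynomial.mul ?_ ?_
  have hM : IsPolynomial memoryBound := by
    unfold memoryBound
    repeat' with_reducible first
      | exact .const _ | exact .id | exact hE | exact hV | refine IsPolynomial.add ?_ ?_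
      | refine IsPolynomial.mul ?_ ?_
  unfold learnTime prepareTime fitTime
  generalize learn.wt = w
  repeat' with_reducible first
    | exact .const _ | exact .id | exact hE | exact hM | refine IsPolynomial.add ?_ ?_
    | refine IsPolynomial.mul ?_ ?_

end LearnerProgram

section LearnerFunction

open LearnerProgram

variable {d κ n : ℕ}

/-- The slopes that the program computes. -/
noncomputable def learner (d κ : ℕ) (L : Segments ℝ d κ) : Learner d κ := fun n S =>
  learnOutput d κ (learn.den (learnTime (d + κ + n + 2)) (learnInput L S))

theorem exec_learner {L : Segments ℝ d κ} (hL : L.Valid) (S : Fin n → Obs ℝ d) :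
    ∃ s t, Exec (unitCost ℝ) learn (learnInput L S) s t ∧ t ≤ learnTime (d + κ + n + 2) ∧
      learnOutput d κ s = learner d κ L n S ∧ IsResult L S fun f => s.num 4 f.1 f.2 := by
  -- At unit cost all sizes are zero, so only the dimensions and the requirement `2 ≤ b` matter.
  obtain ⟨s, t, h1, h2, h3⟩ := exec_learn (tame_unitCost ℝ) hL (S := S) (b := d + κ + n + 2)
    ⟨by omega, by omega, by omega, by omega, by simp, by simp, by simp, by simp⟩
  exact ⟨s, t, h1, h2, by rw [learner, h1.den_eq _ h2], h3⟩

theorem learnInput_toReal (L : Segments ℚ d κ) (S : Fin n → Obs ℚ d) :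
    (learnInput L S).toReal = learnInput L.toReal fun i => (S i).toReal := by
  simp only [learnInput, Mem.toReal, Mem.mk.injEq]
  refine ⟨rfl, ?_⟩
  funext a i j
  split <;> (try simp only [padMat, padVec, Segments.toReal, Obs.toReal]) <;> (try split_ifs) <;>
    simp

theorem ratHeight_le_learnInputBits (L : Segments ℚ d κ) (S : Fin n → Obs ℚ d) :
    InputBound ratHeight L S (learnInputBits L S + 2) := by
  have hobs : ∀ i, ∑ j, ratBits ((S i).price j) + ratBits ((S i).budget) +
      ∑ j, ratBits ((S i).bundle j) ≤ learnInputBits L S := fun i =>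
    (Finset.single_le_sum (f := fun i => ∑ j, ratBits ((S i).price j) + ratBits ((S i).budget) +
      ∑ j, ratBits ((S i).bundle j)) (fun _ _ => Nat.zero_le _) (Finset.mem_univ i)).trans
      (Nat.le_add_left _ _)
  have hsum : ∀ (f : Fin d → ℚ) (j : Fin d), ratHeight (f j) ≤ ∑ j, ratBits (f j) := fun f j =>
    (ratHeight_le _).trans (Finset.single_le_sum (f := fun j => ratBits (f j))
      (fun _ _ => Nat.zero_le _) (Finset.mem_univ j))
  refine ⟨by omega, ?_, ?_, ?_, fun j k => ?_, fun i j => ?_, fun i => ?_, fun i j => ?_⟩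
  · unfold learnInputBits; omega
  · unfold learnInputBits; omega
  · unfold learnInputBits; omega
  · have h1 := (ratHeight_le (L.len j k)).trans (Finset.single_le_sum
      (f := fun k => ratBits (L.len j k)) (fun _ _ => Nat.zero_le _) (Finset.mem_univ k))
    have h2 := Finset.single_le_sum (f := fun j => ∑ k, ratBits (L.len j k))
      (fun _ _ => Nat.zero_le _) (Finset.mem_univ j)
    unfold learnInputBits
    omega
  · have := hobs i
    have := hsum (S i).price j
    omega
  · have := hobs i
    have := ratHeight_le (S i).budget
    omega
  · have := hobs i
    have := hsum (S i).bundle j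
    omega

theorem isPolyTimeLearner_learner : IsPolyTimeLearner learner := by
  obtain ⟨q, hq⟩ := isPolynomial_learnTime.comp (IsPolynomial.id.add (.const 2))
  refine ⟨learn, q, fun d κ L hL n S => ?_, fun d κ L hL n S => ?_⟩
  · obtain ⟨s, t, h1, h2, h3, -⟩ := exec_learner hL S
    exact ⟨s, t, h1, by rwa [hq], h3⟩
  · obtain ⟨s, t, h1, h2, -⟩ := exec_learn tame_bitCost hL (ratHeight_le_learnInputBits L S)
    refine ⟨s, t, h1, by rwa [hq], fun j k => ?_⟩
    have hL' : L.toReal.Valid := ⟨hL.1, fun j k h => by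
      simpa [Segments.toReal] using hL.2 j k h⟩
    -- The rational run, read as a real run, starts from the same memory as the run that defines the
    -- learner. Runs are deterministic, so the outputs agree.
    obtain ⟨s', t', h3, -, h4, -⟩ := exec_learner hL' fun i => (S i).toReal
    obtain ⟨t'', h5⟩ := h1.toReal (unitCost ℝ)
    rw [learnInput_toReal] at h5
    rw [← h4, ← h5.unique h3]
    rfl

theorem LearnerProgram.IsDecreasing.isSlopes {L : Segments ℝ d κ} {a : ℕ × ℕ → ℝ} (ha : IsDecreasing L a)
    (h0 : ∀ f, 0 ≤ a f) : IsSlopes L fun j k => a (j, k) := by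
  refine ⟨fun _ _ => h0 _, fun j k k' hk hk' => ?_⟩
  have key : ∀ n m : ℕ, n < m → m < L.num j → a (j, m) < a (j, n) := by
    intro n m hnm
    induction hnm with
    | refl => exact ha j n
    | step _ ih => exact fun h => (ha j _ h).trans (ih (Nat.lt_of_succ_lt h))
  exact key k k' hk hk'

theorem isSlopes_learner {L : Segments ℝ d κ} (hL : L.Valid) (S : Fin n → Obs ℝ d) :
    IsSlopes L (learner d κ L n S) := by
  obtain ⟨s, t, -, -, h3, h4⟩ := exec_learner hL S
  rw [← h3]
  exact h4.1.1.isSlopes h4.1.2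

/-- The true slopes are a strict solution, so the relaxation ends with the least solution. Its
slopes already decrease, and the repair leaves them alone. -/
theorem isFit_learner {L : Segments ℝ d κ} (hL : L.Valid) {S : Fin n → Obs ℝ d}
    {A : Fin d → Fin κ → ℝ} (hA : IsSlopes L A) (hS : Realizes L A S) :
    IsFit L S (learner d κ L n S) := by
  obtain ⟨s, t, -, -, h3, h4, u, η, h5, h6, h7⟩ := exec_learner hL S
  have hsol : IsSolvable (edgeSet L S) (startValue L S) := by
    refine ⟨fun f => padMat A f.1 f.2, fun e he => ⟨?_, (hS.edge hL hA he).1,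
      (hS.edge hL hA he).2.1⟩⟩
    rw [hS.startValue_src hL hA he]
    exact one_pos
  have htab : ∀ (j : Fin d) (k : ℕ), slopeTable L u η ((j : ℕ), k) =
      if k < L.num j then slopeOf u η (j, k) else 0 := by
    intro j k
    unfold slopeTable
    refine ite_eq_ite_of_iff ⟨?_, fun h => ⟨j, rfl, h⟩⟩
    rintro ⟨j', h1, h2⟩
    rwa [← Fin.ext h1]
  have hfit : IsFit L S fun (j : Fin d) (k : Fin κ) => slopeTable L u η ((j : ℕ), (k : ℕ)) :=
    ⟨u, η, h5 hsol, h6, fun j k => htab j k⟩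
  have hsl := hfit.isSlopes hL hA hS
  have hdec : IsDecreasing L (slopeTable L u η) := by
    intro j k hk
    have hκ := (hL.1 j).2
    exact hsl.2 j ⟨k, by omega⟩ ⟨k + 1, by omega⟩ (by simp [Fin.lt_def]) hk
  have e : learner d κ L n S = fun (j : Fin d) (k : Fin κ) => slopeTable L u η ((j : ℕ), (k : ℕ)) := by
    rw [← h3, ← h7 hdec]
    rfl
  rwa [e]

theorem measurable_learner (L : Segments ℝ d κ) {Y : Type*} [MeasurableSpace Y]
    {S : Y → Fin n → Obs ℝ d} (hp : ∀ i j, Measurable fun y => (S y i).price j)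
    (hB : ∀ i, Measurable fun y => (S y i).budget)
    (hx : ∀ i j, Measurable fun y => (S y i).bundle j) :
    Measurable fun y => learner d κ L n (S y) := by
  have hσ : MeasurableMem fun y => learnInput L (S y) := by
    refine ⟨fun a i j => measurable_const, fun a i j => ?_⟩
    simp only [learnInput]
    split <;> (try simp only [padMat, padVec]) <;> (try split_ifs) <;>
      first | exact measurable_const | exact hp _ _ | exact hB _ | exact hx _ _
  have := hσ.den (learnTime (d + κ + n + 2)) learn
  exact measurable_pi_lambda _ fun j => measurable_pi_lambda _ fun k => this.2 4 j k

end LearnerFunction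

/-! ## Generalization -/

section MeasurableFits

variable {Y : Type*} [MeasurableSpace Y] {d κ : ℕ}

theorem measurable_lastLt (f : ℕ → ℝ) (n : ℕ) : Measurable fun t => lastLt f t n := by
  induction n with
  | zero => exact measurable_const
  | succ n ih => exact Measurable.ite measurableSet_Ioi measurable_const ih

theorem measurable_lastLe (f : ℕ → ℝ) (n : ℕ) : Measurable fun t => lastLe f t n := by
  induction n with
  | zero => exact measurable_const
  | succ n ih => exact Measurable.ite measurableSet_Ici measurable_const ih

theorem measurable_padVec {a : Y → Fin κ → ℝ} (ha : Measurable a) {k : Y → ℕ} (hk : Measurable k) :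
    Measurable fun y => padVec (a y) (k y) := by
  refine measurable_comp_nat_nat (f := fun y i _ => padVec (a y) i) (fun i _ => ?_) hk hk
  unfold padVec
  split_ifs
  exacts [(measurable_pi_apply _).comp ha, measurable_const]

theorem measurableSet_fits (L : Segments ℝ d κ) {A : Y → Fin d → Fin κ → ℝ} {p x : Y → Fin d → ℝ}
    {B : Y → ℝ} (hA : Measurable A) (hp : Measurable p) (hB : Measurable B) (hx : Measurable x) :
    MeasurableSet {y | Fits L (A y) (p y) (B y) (x y)} := by
  have hx' : ∀ j, Measurable fun y => x y j := fun j => (measurable_pi_apply j).comp hx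
  have hp' : ∀ j, Measurable fun y => p y j := fun j => (measurable_pi_apply j).comp hp
  have hc : Measurable fun y => p y ⬝ᵥ x y :=
    Finset.measurable_sum _ fun j _ => (hp' j).mul (hx' j)
  have hlo : ∀ j, Measurable fun y => padVec (A y j) (L.lo j (x y j)) := fun j =>
    measurable_padVec ((measurable_pi_apply j).comp hA) ((measurable_lastLt _ _).comp (hx' j))
  have hhi : ∀ j, Measurable fun y => padVec (A y j) (L.hi j (x y j)) := fun j =>
    measurable_padVec ((measurable_pi_apply j).comp hA) ((measurable_lastLe _ _).comp (hx' j))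
  have lt : ∀ {f g : Y → ℝ}, Measurable f → Measurable g → Measurable fun y => f y < g y :=
    fun hf hg => measurableSet_setOfPred.1 (measurableSet_lt hf hg)
  have le : ∀ {f g : Y → ℝ}, Measurable f → Measurable g → Measurable fun y => f y ≤ g y :=
    fun hf hg => measurableSet_setOfPred.1 (measurableSet_le hf hg)
  have eq : ∀ {f g : Y → ℝ}, Measurable f → Measurable g → Measurable fun y => f y = g y :=
    fun hf hg => measurableSet_setOfPred.1 (measurableSet_eq_fun hf hg)
  refine measurableSet_setOfPred.2 ?_
  refine Measurable.and (.forall fun j => (le measurable_const (hx' j)).and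
    (le (hx' j) measurable_const)) (Measurable.and (le hc hB) (Measurable.and
    (.forall fun j => (eq (hp' j) measurable_const).imp (eq (hx' j) measurable_const))
    (Measurable.and (.forall fun j => (lt measurable_const (hx' j)).imp (lt measurable_const (hlo j)))
    (Measurable.and ((lt hc hB).imp (.forall fun j => (lt (hx' j) measurable_const).imp
      (eq (hhi j) measurable_const))) (.forall fun j => .forall fun j' => ?_)))))
  exact measurable_const.imp ((lt measurable_const (hx' j)).imp ((lt (hx' j') measurable_const).imp
    (lt ((hhi j').mul (hp' j)) ((hlo j).mul (hp' j')))))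

/-- A measurable demand function. -/
theorem exists_measurable_demand {L : Segments ℝ d κ} (hL : L.Valid) {A : Fin d → Fin κ → ℝ}
    (hA : IsSlopes L A) : ∃ ξ : (Fin d → ℝ) × ℝ → Fin d → ℝ, Measurable ξ ∧
      ∀ z x, (∀ j, 0 ≤ z.1 j) → Fits L A z.1 z.2 x → ξ z = x := by
  set Γ : Set (((Fin d → ℝ) × ℝ) × (Fin d → ℝ)) :=
    {q | (∀ j, 0 ≤ q.1.1 j) ∧ Fits L A q.1.1 q.1.2 q.2} with hΓ
  have hm : MeasurableSet Γ := by
    refine MeasurableSet.inter ?_ (measurableSet_fits L measurable_const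
      (measurable_fst.comp measurable_fst) (measurable_snd.comp measurable_fst) measurable_snd)
    exact measurableSet_setOfPred.2 (.forall fun j => measurableSet_setOfPred.1
      (measurableSet_le measurable_const ((measurable_pi_apply j).comp
        (measurable_fst.comp measurable_fst))))
  have := hm.standardBorel
  -- Two fitting bundles at the same prices and budget are both the only cheapest optimal bundle.
  have hinj : Function.Injective fun q : Γ => q.1.1 := by
    rintro ⟨⟨z, x⟩, hz, hx⟩ ⟨⟨z', x'⟩, hz', hx'⟩ h
    simp only at h
    subst h
    have h1 := hx.cheapestBundles_eq hL hA hz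
    have h2 := hx'.cheapestBundles_eq hL hA hz
    simp only [Subtype.mk.injEq, Prod.mk.injEq, true_and]
    exact Set.singleton_injective (h1.symm.trans h2)
  -- By the theorem of Lusin and Souslin, an injective Borel map on a standard Borel space is an
  -- embedding. Thus the second coordinate of the graph becomes a measurable function of the first.
  have hemb : MeasurableEmbedding fun q : Γ => q.1.1 :=
    (measurable_fst.comp measurable_subtype_coe).measurableEmbedding hinj
  obtain ⟨ξ, hξ, h⟩ := hemb.exists_measurable_extend (g := fun q : Γ => q.1.2)
    (measurable_snd.comp measurable_subtype_coe) fun _ => ⟨0⟩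
  exact ⟨ξ, hξ, fun z x hz hx => congrFun h ⟨(z, x), hz, hx⟩⟩

end MeasurableFits

/-! ### Hypotheses determined by part of the sample -/

section Compression

open scoped ENNReal

variable {Ω : Type*} [MeasurableSpace Ω]

/-- A set of measure at least `ε` that is determined by some of the sample points is unlikely to
be missed by all others. -/
theorem pi_compression_le (P : Measure Ω) [IsProbabilityMeasure P] {n : ℕ} (T : Finset (Fin n))
    {N : ({i // i ∈ T} → Ω) → Set Ω} (hN : MeasurableSet {q : ({i // i ∈ T} → Ω) × Ω | q.2 ∈ N q.1})
    (ε : ℝ≥0∞) :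
    Measure.pi (fun _ : Fin n => P) {Z | ε ≤ P (N fun i => Z i) ∧
      ∀ i, i ∉ T → Z i ∉ N fun i => Z i} ≤ (1 - ε) ^ (n - T.card) := by
  set C : Set (({i // i ∈ T} → Ω) × ({i // ¬ i ∈ T} → Ω)) :=
    {q | ε ≤ P (N q.1) ∧ ∀ i, q.2 i ∉ N q.1} with hC
  have hNy : ∀ y, MeasurableSet (N y) := fun y => measurable_prodMk_left hN
  have hCm : MeasurableSet C := by
    refine MeasurableSet.inter ?_ ?_
    · exact measurableSet_le measurable_const
        ((measurable_measure_prodMk_left hN).comp measurable_fst)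
    · refine measurableSet_setOfPred.2 (.forall fun i => Measurable.not (measurableSet_setOfPred.1 ?_))
      have hm : Measurable fun q : ({i // i ∈ T} → Ω) × ({i // ¬ i ∈ T} → Ω) => (q.1, q.2 i) :=
        measurable_fst.prodMk ((measurable_pi_apply i).comp measurable_snd)
      exact hm hN
  have hpre := (measurePreserving_piEquivPiSubtypeProd (fun _ : Fin n => P)
    (fun i => i ∈ T)).measure_preimage hCm.nullMeasurableSet
  have hset : {Z : Fin n → Ω | ε ≤ P (N fun i => Z i) ∧ ∀ i, i ∉ T → Z i ∉ N fun i => Z i} =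
      (MeasurableEquiv.piEquivPiSubtypeProd (fun _ : Fin n => Ω) fun i => i ∈ T) ⁻¹' C := by
    ext Z
    simp only [hC, Set.mem_ofPred_eq, Set.mem_preimage]
    exact and_congr Iff.rfl ⟨fun h i => h i.1 i.2, fun h i hi => h ⟨i, hi⟩⟩
  rw [hset, hpre, Measure.prod_apply hCm]
  have hcard : Fintype.card {i // ¬ i ∈ T} = n - T.card := by
    rw [Fintype.card_subtype_compl]
    simp
  refine (lintegral_mono (g := fun _ => (1 - ε) ^ (n - T.card)) fun y => ?_).trans (by simp)
  by_cases hy : ε ≤ P (N y)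
  -- Once the coordinates in `T` are fixed, the others are independent, and each of them avoids `N
  -- y` with probability at most `1 - ε`.
  · have : Prod.mk y ⁻¹' C = Set.univ.pi fun _ => (N y)ᶜ := by
      ext w
      simp [hC, hy]
    rw [this, Measure.pi_pi, Finset.prod_const, Finset.card_univ, hcard]
    refine pow_le_pow_left' ?_ _
    rw [prob_compl_eq_one_sub (hNy y)]
    exact tsub_le_tsub_left hy 1
  · have : Prod.mk y ⁻¹' C = ∅ := by
      ext w
      simp [hC, hy]
    rw [this, measure_empty]
    exact zero_le

end Compression

/-! ### The union bound in numbers -/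

section Counting

/-- Writing `n ^ k / k!` as `(4 / ε) ^ k` times a term of the exponential series at `ε * n / 4`
avoids a factor `log n` in the exponent. It remains to see that `k * (log (4 / ε) + ε) + log (1 /
δ)` is at most `3 / 4 * ε * n`. The left-hand side is at most `12 * N * log (1 / ε) + log (1 / δ)`,
so the constant 16 suffices. -/
theorem choose_mul_pow_le {n k N : ℕ} {ε δ : ℝ} (hN : 1 ≤ N) (hk : k ≤ 3 * N) (hkn : k ≤ n)
    (hε : 0 < ε) (hε' : ε ≤ 1 / 2) (hδ : 0 < δ) (hδ' : δ < 1)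
    (hn : 16 * ((N * Real.log (1 / ε) + Real.log (1 / δ)) / ε) ≤ n) :
    (n.choose k : ℝ) * (1 - ε) ^ (n - k) ≤ δ := by
  have hlog2 := Real.log_two_gt_d9
  have hl : Real.log 2 ≤ Real.log (1 / ε) :=
    Real.log_le_log (by norm_num) (by rw [le_div_iff₀ hε]; linarith)
  have hld : 0 ≤ Real.log (1 / δ) := Real.log_nonneg (by rw [le_div_iff₀ hδ]; linarith)
  have hn' : 16 * (N * Real.log (1 / ε) + Real.log (1 / δ)) ≤ ε * n := by
    have := mul_le_mul_of_nonneg_left hn hε.le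
    have e : ε * (16 * ((N * Real.log (1 / ε) + Real.log (1 / δ)) / ε)) =
        16 * (N * Real.log (1 / ε) + Real.log (1 / δ)) := by field_simp
    linarith
  have h1 : (n.choose k : ℝ) ≤ (4 / ε) ^ k * Real.exp (ε / 4 * n) := by
    have h2 := Nat.choose_le_pow_div (α := ℝ) k n
    have h3 := Real.pow_div_factorial_le_exp (ε / 4 * n) (by positivity) k
    refine h2.trans ?_
    have e : (n : ℝ) ^ k / k.factorial = (4 / ε) ^ k * ((ε / 4 * n) ^ k / k.factorial) := by
      rw [← mul_div_assoc, ← mul_pow]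
      congr 2
      field_simp
    rw [e]
    gcongr
  have h2 : (4 / ε) ^ k = Real.exp (k * Real.log (4 / ε)) := by
    rw [← Real.log_pow, Real.exp_log (by positivity)]
  have h3 : (1 - ε) ^ (n - k) ≤ Real.exp (-ε * (n - k)) := by
    have := Real.one_sub_le_exp_neg ε
    calc (1 - ε) ^ (n - k) ≤ Real.exp (-ε) ^ (n - k) :=
          pow_le_pow_left₀ (by linarith) this _
      _ = Real.exp (-ε * (n - k)) := by
          rw [← Real.exp_nat_mul, Nat.cast_sub hkn]; ring_nf
  have hlog4 : Real.log (4 / ε) = 2 * Real.log 2 + Real.log (1 / ε) := by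
    rw [show (4 : ℝ) / ε = 2 ^ 2 * (1 / ε) by ring, Real.log_mul (by norm_num) (by positivity),
      Real.log_pow]
    norm_num
  have hk' : (k : ℝ) ≤ 3 * N := by exact_mod_cast hk
  have hk0 : (0 : ℝ) ≤ k := Nat.cast_nonneg k
  calc (n.choose k : ℝ) * (1 - ε) ^ (n - k)
      ≤ ((4 / ε) ^ k * Real.exp (ε / 4 * n)) * Real.exp (-ε * (n - k)) := by
        gcongr
        exact pow_nonneg (by linarith) _
    _ = Real.exp (k * Real.log (4 / ε) + ε / 4 * n + -ε * (n - k)) := by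
        rw [h2, Real.exp_add, Real.exp_add]
    _ ≤ Real.exp (Real.log δ) := by
        refine Real.exp_le_exp.2 ?_
        have e : Real.log (1 / δ) = - Real.log δ := by rw [one_div, Real.log_inv]
        -- As `ε ≤ 1 / 2 < log 2 ≤ log (1 / ε)`, each of `2 * log 2` and `ε` is absorbed by
        -- multiples of `log (1 / ε)`.
        have h4 : k * (Real.log (4 / ε) + ε) ≤ 3 * N * (4 * Real.log (1 / ε)) := by
          rw [hlog4]
          gcongr <;> linarith
        have h5 : (0 : ℝ) ≤ N * Real.log (1 / ε) := mul_nonneg (Nat.cast_nonneg _) (by linarith)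
        nlinarith
    _ = δ := Real.exp_log hδ

end Counting

/-! ### Sample complexity of the learner -/

section Learning

variable {d κ : ℕ} {L : Segments ℝ d κ}

/-- Where the slopes `a` fit the true bundle, it is the only cheapest optimal bundle for `a` as
well, so every demand rule predicts it. The set on the right-hand side is defined without the rule,
whose measurability is not assumed. -/
theorem predictionError_le {β : DemandRule d} {P : Measure ((Fin d → ℝ) × ℝ)}
    {U : (Fin d → ℝ) → ℝ} {ξ : (Fin d → ℝ) × ℝ → Fin d → ℝ} (hL : L.Valid)
    (hξ : ∀ᵐ z ∂P, (∀ j, 0 ≤ z.1 j) ∧ β.demand U z.1 z.2 = ξ z) {a : Fin d → Fin κ → ℝ}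
    (ha : IsSlopes L a) : predictionError β P U (splcUtility L a) ≤
      P {z | ¬ Fits L a z.1 z.2 (ξ z)} := by
  refine measure_mono_ae ?_
  filter_upwards [hξ] with z ⟨hp, hz⟩ hne hfit
  have h1 := hfit.cheapestBundles_eq hL ha hp
  have h2 := β.demand_mem (splcUtility L a) z.1 z.2 (h1 ▸ Set.singleton_nonempty _)
  rw [h1, Set.mem_singleton_iff] at h2
  exact hne (by rw [hz, h2])

/-- If the error is large, then some `k` positions of the sample yield slopes that fail on a set of
measure at least `ε` and still fit all other observations. This is unlikely for a fixed set of
positions, and there are `n.choose k` of them. -/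
theorem sampleSizeSuffices_learner (hL : L.Valid) (β : DemandRule d) {ε δ : ℝ} (hε : 0 < ε)
    (hε' : ε ≤ 1 / 2) (hδ : 0 < δ) (hδ' : δ < 1) {m : ℕ}
    (hm : 16 * (((κ : ℝ) * d * Real.log (1 / ε) + Real.log (1 / δ)) / ε) ≤ m) :
    SampleSizeSuffices L β (learner d κ L) ε δ m := by
  classical
  rintro n hmn P hP hpos _ ⟨A, hA, rfl⟩ huniq
  -- Without goods there is only one bundle and no error; the estimates need `1 ≤ κ * d`.
  rcases Nat.eq_zero_or_pos d with rfl | hd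
  · have : ∀ V, predictionError β P (splcUtility L A) V = 0 := fun V => by
      have e : ∀ z : (Fin 0 → ℝ) × ℝ, β.demand (splcUtility L A) z.1 z.2 = β.demand V z.1 z.2 :=
        fun z => Subsingleton.elim _ _
      simp [predictionError, e]
    simp [this]
  obtain ⟨ξ, hξ, hξ'⟩ := exists_measurable_demand hL hA
  set obs : (Fin d → ℝ) × ℝ → Obs ℝ d := fun z => ⟨z.1, z.2, ξ z⟩ with hobs
  have hgood : ∀ᵐ z ∂P, ((∀ j, 0 ≤ z.1 j) ∧ β.demand (splcUtility L A) z.1 z.2 = ξ z) ∧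
      Fits L A z.1 z.2 (ξ z) := by
    filter_upwards [hpos, huniq] with z ⟨hp, hB⟩ hu
    obtain ⟨x, hx⟩ := cheapestBundles_nonempty (splcUtility_continuous hL A) z.1 hB
    have hf := fits_of_unique hL hA hp hx hu
    rw [hξ' z x hp hf]
    exact ⟨⟨hp, hu (β.demand_mem _ _ _ ⟨x, hx⟩) hx⟩, hf⟩
  have hgoodn : ∀ᵐ Z ∂Measure.pi fun _ : Fin n => P, ∀ i, ((∀ j, 0 ≤ (Z i).1 j) ∧
      β.demand (splcUtility L A) (Z i).1 (Z i).2 = ξ (Z i)) ∧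
      Fits L A (Z i).1 (Z i).2 (ξ (Z i)) :=
    ae_all_iff.2 fun i => (measurePreserving_eval (fun _ : Fin n => P) i).quasiMeasurePreserving.ae
      hgood
  have hκ : 1 ≤ κ := (hL.1 ⟨0, hd⟩).1.trans (hL.1 ⟨0, hd⟩).2
  have hN : 1 ≤ κ * d := Nat.mul_pos hκ hd
  set k := 2 * (κ * d) + 1 with hk
  have hn : 16 * ((((κ * d : ℕ) : ℝ) * Real.log (1 / ε) + Real.log (1 / δ)) / ε) ≤ n := by
    push_cast
    exact hm.trans (by exact_mod_cast hmn)
  have hkn : k ≤ n := by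
    have hlog2 := Real.log_two_gt_d9
    have hl : Real.log 2 ≤ Real.log (1 / ε) :=
      Real.log_le_log (by norm_num) (by rw [le_div_iff₀ hε]; linarith)
    have hld : 0 ≤ Real.log (1 / δ) := Real.log_nonneg (by rw [le_div_iff₀ hδ]; linarith)
    have hN' : (1 : ℝ) ≤ ((κ * d : ℕ) : ℝ) := by exact_mod_cast hN
    have h1 : ((κ * d : ℕ) : ℝ) * (1 / 2) ≤
        ((κ * d : ℕ) : ℝ) * Real.log (1 / ε) + Real.log (1 / δ) := by nlinarith
    have h2 : ((κ * d : ℕ) : ℝ) * (1 / 2) ≤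
        (((κ * d : ℕ) : ℝ) * Real.log (1 / ε) + Real.log (1 / δ)) / ε := by
      rw [le_div_iff₀ hε]
      nlinarith
    have h3 : (k : ℝ) ≤ n := by
      rw [hk]; push_cast at *; linarith
    exact_mod_cast h3
  set σ : ∀ T : {T : Finset (Fin n) // T.card = k}, Fin k → {i // i ∈ T.1} :=
    fun T => T.1.orderIsoOfFin T.2 with hσ
  -- The set of prices and budgets at which the slopes learned from the positions in `T` fail to fit
  -- the true bundle.
  set N : ∀ T : {T : Finset (Fin n) // T.card = k}, ({i // i ∈ T.1} → (Fin d → ℝ) × ℝ) →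
      Set ((Fin d → ℝ) × ℝ) := fun T y =>
    {z | ¬ Fits L (learner d κ L k fun i => obs (y (σ T i))) z.1 z.2 (ξ z)} with hNdef
  have hNm : ∀ T, MeasurableSet {q : ({i // i ∈ T.1} → (Fin d → ℝ) × ℝ) × ((Fin d → ℝ) × ℝ) |
      q.2 ∈ N T q.1} := by
    intro T
    have hev : ∀ i, Measurable fun q : ({i // i ∈ T.1} → (Fin d → ℝ) × ℝ) × ((Fin d → ℝ) × ℝ) =>
      q.1 (σ T i) := fun i => (measurable_pi_apply _).comp measurable_fst
    refine MeasurableSet.compl (measurableSet_fits L (measurable_learner L (fun i j => ?_)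
      (fun i => ?_) (fun i j => ?_)) (measurable_fst.comp measurable_snd)
      (measurable_snd.comp measurable_snd) (hξ.comp measurable_snd))
    · exact (measurable_pi_apply j).comp (measurable_fst.comp (hev i))
    · exact measurable_snd.comp (hev i)
    · exact (measurable_pi_apply j).comp (hξ.comp (hev i))
  have hcover : ∀ᵐ Z ∂Measure.pi fun _ : Fin n => P,
      ENNReal.ofReal ε < predictionError β P (splcUtility L A)
        (splcUtility L (learner d κ L n fun i => observe β (splcUtility L A) (Z i))) →
      ∃ T, ENNReal.ofReal ε ≤ P (N T fun i => Z i) ∧ ∀ i, i ∉ T.1 → Z i ∉ N T fun i => Z i := by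
    filter_upwards [hgoodn] with Z hZ hlt
    have hS : (fun i => observe β (splcUtility L A) (Z i)) = fun i => obs (Z i) :=
      funext fun i => by simp only [observe, hobs, (hZ i).1.2]
    rw [hS] at hlt
    have hreal : Realizes L A fun i => obs (Z i) := fun i => ⟨(hZ i).1.1, (hZ i).2⟩
    have hfit := isFit_learner hL hA hreal
    have hfits := hfit.realizes hL hA hreal
    obtain ⟨T₀, hT₀, hcomp⟩ := hfit.exists_compression hL
    -- Further observations do no harm to the compression, so exactly `k` positions can be taken.
    obtain ⟨T, hT₀T, hT⟩ := Finset.exists_superset_card_eq hT₀ (by rwa [Fintype.card_fin])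
    have heq : learner d κ L n (fun i => obs (Z i)) =
        learner d κ L k fun i => obs (Z (σ ⟨T, hT⟩ i)) := by
      -- The slopes learned from the whole sample are a fit of the subsample too, and a fit is
      -- unique.
      refine (hcomp k (fun i => (σ ⟨T, hT⟩ i : Fin n)) fun i hi => ?_).unique
        (isFit_learner hL hA (S := fun i => obs (Z (σ ⟨T, hT⟩ i))) fun i => hreal _)
      obtain ⟨i', hi'⟩ := (T.orderIsoOfFin hT).surjective ⟨i, hT₀T hi⟩
      exact ⟨i', congrArg Subtype.val hi'⟩
    refine ⟨⟨T, hT⟩, ?_, fun i _ => ?_⟩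
    · refine hlt.le.trans ?_
      simp only [hNdef, ← heq]
      exact predictionError_le hL (hgood.mono fun z hz => hz.1) (isSlopes_learner hL _)
    · simp only [hNdef, ← heq]
      exact fun h => h (hfits i).2
  calc Measure.pi (fun _ : Fin n => P) _
      ≤ Measure.pi (fun _ : Fin n => P) (⋃ T, {Z | ENNReal.ofReal ε ≤ P (N T fun i => Z i) ∧
          ∀ i, i ∉ T.1 → Z i ∉ N T fun i => Z i}) := by
        refine measure_mono_ae ?_
        filter_upwards [hcover] with Z hZ hlt
        exact Set.mem_iUnion.2 (hZ hlt)
    _ ≤ ∑ T, Measure.pi (fun _ : Fin n => P) {Z | ENNReal.ofReal ε ≤ P (N T fun i => Z i) ∧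
          ∀ i, i ∉ T.1 → Z i ∉ N T fun i => Z i} := measure_iUnion_fintype_le _ _
    _ ≤ ∑ _T : {T : Finset (Fin n) // T.card = k}, (1 - ENNReal.ofReal ε) ^ (n - k) := by
        refine Finset.sum_le_sum fun T _ => ?_
        have := pi_compression_le P T.1 (hNm T) (ENNReal.ofReal ε)
        rwa [T.2] at this
    _ = ENNReal.ofReal ((n.choose k : ℝ) * (1 - ε) ^ (n - k)) := by
        rw [Finset.sum_const, Finset.card_univ, Fintype.card_finset_len, Fintype.card_fin,
          nsmul_eq_mul, ENNReal.ofReal_mul (Nat.cast_nonneg _), ENNReal.ofReal_natCast,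
          ENNReal.ofReal_pow (by linarith), ENNReal.ofReal_sub _ hε.le, ENNReal.ofReal_one]
    _ ≤ ENNReal.ofReal δ := ENNReal.ofReal_le_ofReal
        (choose_mul_pow_le hN (by omega) hkn hε hε' hδ hδ' hn)

end Learning

theorem mainTheorem8 :
    ∃ (C : ℝ) (𝒜 : (d κ : ℕ) → Segments ℝ d κ → Learner d κ), 0 < C ∧
      (∀ (d κ : ℕ) (L : Segments ℝ d κ), L.Valid →
        ∀ (n : ℕ) (S : Fin n → Obs ℝ d), IsSlopes L (𝒜 d κ L n S)) ∧
      (∀ (d κ : ℕ) (L : Segments ℝ d κ), L.Valid → ∀ (β : DemandRule d) (ε δ : ℝ),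
        0 < ε → ε ≤ 1 / 2 → 0 < δ → δ < 1 →
          sampleComplexity L β (𝒜 d κ L) ε δ ≤
            (⌈C * (((κ : ℝ) * d * Real.log (1 / ε) + Real.log (1 / δ)) / ε)⌉₊ : ℕ∞)) ∧
      IsPolyTimeLearner 𝒜 ∧
      (∀ (d κ : ℕ) (L : Segments ℝ d κ), L.Valid → IsLinearDemandClass (κ * d) (splcClass L)) ∧
      SecondBestInLinearTime := by
  refine ⟨16, learner, by norm_num, fun d κ L hL n S => isSlopes_learner hL S,
    fun d κ L hL β ε δ hε hε' hδ hδ' => ?_, isPolyTimeLearner_learner,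
    fun d κ L _ => splcClass_isLinearDemandClass L, secondBestInLinearTime⟩
  exact iInf₂_le _ (sampleSizeSuffices_learner hL β hε hε' hδ hδ' (Nat.le_ceil _))
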